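/- **Theorem 3 (finite sample analysis).** Fix $d$, $\lambda_1,\dots,\lambda_d>0$, $\Lambda=\mathrm{diag}(\lambda_1,\dots,\lambda_d)$, $\sigma>0$, $\alpha\in(0,1)$ and a test threshold $\epsilon>0$. Norms of matrices are spectral norms, and $n$ ranges over the integers $n\ge\max(1,d)$. *Model.* For every $n$ let $U=U^{(n)}\in\mathbb R^{n\times d}$ be deterministic with $U^\top U=I_d$. At time $k=0,1,2,\dots$ one observes $\Omega_k=\mathrm{diag}(v_{k,1},\dots,v_{k,n})$ and $y_k=\Omega_k(Uc_k+a_k)$, where * (A.1) the entries of $a_k\in\mathbb R^n$ are i.i.d. with mean $0$, variance $\sigma^2$ and finite moments of all orders; * (A.2) $c_k\in\mathbb R^d$ has mean $0$, covariance $\Lambda^2$ and finite moments of all orders; * (A.3) the $v_{k,i}$ are i.i.d. with $\mathbb P(v_{k,i}=1)=\alpha$ and $\mathbb P(v_{k,i}=0)=1-\alpha$. The $c_k,a_k,v_k$ ($k\ge0$) and the possibly random initial guess $X_0=X_0^{(n)}\in\mathbb R^{n\times d}$ are all independent, and the laws of $c_k$ and of $a_{k,i}$ depend neither on $k,i$ nor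 on $n$. * (A.4) There is $C$ independent of $n$ with $\sum_{i,j}U_{ij}^4\le C/n$ and, almost surely, $\sum_{i,j}(X_0)_{ij}^4\le C/n$. *Algorithms.* At step $k$ let $Z_k=X_k^\top\Omega_kX_k$. If $\lambda_{\min}(Z_k)\le\epsilon$, nothing changes at this step. Otherwise let $\hat w_k=\arg\min_w\|y_k-\Omega_kX_kw\|$ and update as follows. * Oja: $\hat y_k=y_k+(I-\Omega_k)X_k\hat w_k$, $\tilde X_k=X_k+\frac{\tau_k}{n}\hat y_k\hat w_k^\top$, $X_{k+1}=\tilde X_k(\tilde X_k^\top\tilde X_k)^{-1/2}$. * GROUSE: $p_k=X_k\hat w_k$, $r_k=y_k-\Omega_kp_k$, $\theta_k=\frac{\tau_k}{n}\|r_k\|\|p_k\|$, $X_{k+1}=X_k+\big[(\cos\theta_k-1)\frac{p_k}{\|p_k\|}+\sin\theta_k\frac{r_k}{\|r_k\|}\big]\frac{\hat w_k^\top}{\|\hat w_k\|}$ (with $0/\|0\|$ read as $0$). * PETRELS, with $R_0=\frac{\delta}{n}I_d$, $\delta>0$: $X_{k+1}=X_k+\Omega_k(y_k-X_k\hat w_k)\hat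 w_k^\top R_k$, $u_k=\gamma^{-1}R_k\hat w_k$, $\beta_k=1+\alpha\hat w_k^\top u_k$, $R_{k+1}=\gamma^{-1}R_k-\alpha u_ku_k^\top/\beta_k$. Let $Q_k^{(n)}=U^\top X_k(X_k^\top X_k)^{-1/2}$ and $Q^{(n)}(t)=Q^{(n)}_{\lfloor nt\rfloor}$. Assume that there are a matrix $Q(0)$ and a constant $C$ with $\mathbb E\|Q_0^{(n)}-Q(0)\|\le Cn^{-1/2}$ for all $n$. Let $T>0$. 1. *(Oja's method and GROUSE.)* Let $\epsilon<\alpha$, $X_0^\top X_0=I_d$ almost surely, and $\tau_k=\tau(k/n)$, where $\tau:[0,\infty)\to[0,\infty)$ is bounded and of locally bounded variation. Then the equation $Q'(t)=F(Q(t),\tau(t)I_d)$ with initial value $Q(0)$, in integrated form, where $$F(Q,G)=\big[\alpha\Lambda^2Q-\tfrac{\sigma^4}{2}QG-Q(I_d+\tfrac{\sigma^2}{2}G)Q^\top\alpha\Lambda^2Q\big]G,$$ has exactly one continuous solution on $[0,T]$, and there is a constant $C(T)$ such that, for either algorithm, $\mathbb E\|Q^{(n)}(t)-Q(t)\|\le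 C(T)/\sqrt n$ for all $t\in[0,T]$ and all $n$. 2. *(PETRELS.)* Let $\gamma=1-\mu/n$ with $\mu>0$, and let $W(0)$ be a symmetric matrix with $\epsilon<\alpha\lambda_{\min}(W(0))$ and $\mathbb E\|X_0^\top X_0-W(0)\|\le Cn^{-1/2}$ for all $n$, with $C$ independent of $n$. (If $X_0^\top X_0=I_d$, take $W(0)=I_d$; the condition is then $\epsilon<\alpha$.) Then the system $$\begin{aligned}A'&=W^{-1}(K^\top\alpha\Lambda^2K+\sigma^2W)W^{-1}-\mu A,\\ K'&=(\alpha\Lambda^2+\sigma^2I_d)KW^{-1}A^{-1}-KW^{-1}(K^\top\alpha\Lambda^2K+\sigma^2W)W^{-1}A^{-1},\\ W'&=\sigma^2A^{-1}W^{-1}(K^\top\alpha\Lambda^2K+\sigma^2W)W^{-1}A^{-1}\end{aligned}$$ with $A(0)=\delta^{-1}I_d$, $K(0)=Q(0)W(0)^{1/2}$ and initial value $W(0)$ has exactly one solution on $[0,T]$, $A(t)$ and $W(t)$ are positive definite, and with $Q(t)=K(t)W(t)^{-1/2}$ there is a constant $C(T)$ such that $\mathbb E\|Q^{(n)}(t)-Q(t)\|\le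 C(T)/\sqrt n$ for all $t\in[0,T]$ and all $n>\mu$. The constants $C(T)$ depend neither on $n$ nor on $t$. -/

import Mathlib

open MeasureTheory ProbabilityTheory Set
open scoped Matrix Matrix.Norms.L2Operator

/-! Streaming subspace estimation from incomplete data: the observation model, the algorithms
Oja (with imputation), GROUSE and simplified PETRELS, and their limiting ODEs.
The norm `‖·‖` on matrices is the spectral norm (Euclidean operator norm). -/

namespace SubspaceTracking

noncomputable section

variable {n d : ℕ}

/-! ### Linear algebra -/

/-- Euclidean norm of a plain vector. -/
def vnorm (x : Fin n → ℝ) : ℝ := √(x ⬝ᵥ x)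

/-- Principal square root of a positive semidefinite matrix, through its eigenvalues. -/
def matSqrt (A : Matrix (Fin d) (Fin d) ℝ) : Matrix (Fin d) (Fin d) ℝ := cfc Real.sqrt A

/-- `A ^ (-1/2)` for a positive definite matrix `A`, through its eigenvalues. -/
def invSqrt (A : Matrix (Fin d) (Fin d) ℝ) : Matrix (Fin d) (Fin d) ℝ :=
  cfc (fun x : ℝ => (√x)⁻¹) A

/-- The cosine similarity matrix `Uᵀ X (Xᵀ X) ^ (-1/2)`. -/
def cosSim (U X : Matrix (Fin n) (Fin d) ℝ) : Matrix (Fin d) (Fin d) ℝ :=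
  Uᵀ * X * invSqrt (Xᵀ * X)

/-- The entrywise fourth-moment sum that measures incoherence. -/
def fourthSum (X : Matrix (Fin n) (Fin d) ℝ) : ℝ := ∑ i, ∑ j, X i j ^ 4

/-! ### Observation model -/

/-- The law of one entry of the sampling mask: `true` (observed) with probability `α`. -/
def maskLaw (α : ℝ) : Measure Bool :=
  ENNReal.ofReal α • Measure.dirac true + ENNReal.ofReal (1 - α) • Measure.dirac false

/-- What is drawn at one time step: coefficients `c`, noise `a`, sampling pattern `v`. -/
abbrev Draw (n d : ℕ) : Type := (Fin d → ℝ) × (Fin n → ℝ) × (Fin n → Bool)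

/-- The law of one draw: `c`, `a`, `v` are independent, `c ∼ κ`, the entries of `a` are i.i.d.
with law `ν`, and the entries of `v` are i.i.d. Bernoulli with parameter `α`. -/
def drawLaw (n : ℕ) (κ : Measure (Fin d → ℝ)) (ν : Measure ℝ) (α : ℝ) : Measure (Draw n d) :=
  κ.prod ((Measure.pi fun _ => ν).prod (Measure.pi fun _ => maskLaw α))

/-- The noise entries have mean zero, variance `σ ^ 2` and finite moments of every order. -/
structure IsNoiseLaw (ν : Measure ℝ) (σ : ℝ) : Prop where
  isProb : IsProbabilityMeasure ν
  moments : ∀ p : ℕ, Integrable (fun x => |x| ^ p) ν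
  mean : ∫ x, x ∂ν = 0
  variance : ∫ x, x ^ 2 ∂ν = σ ^ 2

/-- The coefficient vector has mean zero, covariance `diag (lam i ^ 2)` and finite moments of
every order. -/
structure IsCoefLaw (κ : Measure (Fin d → ℝ)) (lam : Fin d → ℝ) : Prop where
  isProb : IsProbabilityMeasure κ
  moments : ∀ p : ℕ, Integrable (fun c => ‖c‖ ^ p) κ
  mean : ∀ i, ∫ c, c i ∂κ = 0
  cov : ∀ i j, ∫ c, c i * c j ∂κ = if i = j then lam i ^ 2 else 0

/-- The draws `ξ 0, ξ 1, …` are i.i.d. with law `drawLaw n κ ν α`, and the (possibly random)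
initial guess `X₀` is independent of them. -/
structure IsStream {Ω : Type*} [MeasurableSpace Ω] (P : Measure Ω)
    (κ : Measure (Fin d → ℝ)) (ν : Measure ℝ) (α : ℝ)
    (X₀ : Ω → Matrix (Fin n) (Fin d) ℝ) (ξ : ℕ → Ω → Draw n d) : Prop where
  measurable_init : Measurable fun ω i j => X₀ ω i j
  measurable_draw : ∀ k, Measurable (ξ k)
  law : ∀ k, P.map (ξ k) = drawLaw n κ ν α
  indep : iIndepFun ξ P
  indep_init : IndepFun (fun ω i j => X₀ ω i j) (fun ω k => ξ k ω) P

/-- The diagonal 0/1 matrix of a sampling pattern. -/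
def mask (v : Fin n → Bool) : Matrix (Fin n) (Fin n) ℝ :=
  Matrix.diagonal fun i => if v i then 1 else 0

/-- An observation: the incomplete vector `y` together with its sampling pattern. -/
abbrev Obs (n : ℕ) : Type := (Fin n → ℝ) × (Fin n → Bool)

/-- The observation `y = Ω (U c + a)` made from a draw `(c, a, v)`, where `Ω = mask v`. -/
def observe (U : Matrix (Fin n) (Fin d) ℝ) (ξ : Draw n d) : Obs n :=
  (mask ξ.2.2 *ᵥ (U *ᵥ ξ.1 + ξ.2.1), ξ.2.2)

/-! ### The algorithms -/

/-- `Xᵀ Ω X`. -/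
def maskedGram (X : Matrix (Fin n) (Fin d) ℝ) (v : Fin n → Bool) : Matrix (Fin d) (Fin d) ℝ :=
  Xᵀ * mask v * X

/-- The test `λ_min (Xᵀ Ω X) > ε`. -/
def Enough (ε : ℝ) (X : Matrix (Fin n) (Fin d) ℝ) (v : Fin n → Bool) : Prop :=
  (maskedGram X v - ε • (1 : Matrix (Fin d) (Fin d) ℝ)).PosDef

/-- The least-squares coefficients `ŵ = argmin_w ‖y - Ω X w‖`, `ŵ = (Xᵀ Ω X)⁻¹ Xᵀ Ω y`. -/
def coeff (X : Matrix (Fin n) (Fin d) ℝ) (o : Obs n) : Fin d → ℝ :=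
  (maskedGram X o.2)⁻¹ *ᵥ (Xᵀ *ᵥ (mask o.2 *ᵥ o.1))

open Classical in
/-- One step of Oja's method with imputation; `τ` is the current step-size parameter. -/
def ojaStep (ε τ : ℝ) (X : Matrix (Fin n) (Fin d) ℝ) (o : Obs n) : Matrix (Fin n) (Fin d) ℝ :=
  if Enough ε X o.2 then
    let w := coeff X o
    let yhat := o.1 + (1 - mask o.2) *ᵥ (X *ᵥ w)
    let Xt := X + (τ / n) • Matrix.vecMulVec yhat w
    Xt * invSqrt (Xtᵀ * Xt)
  else X

open Classical in
/-- One step of GROUSE (a normalized zero vector is read as the zero vector). -/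
def grouseStep (ε τ : ℝ) (X : Matrix (Fin n) (Fin d) ℝ) (o : Obs n) : Matrix (Fin n) (Fin d) ℝ :=
  if Enough ε X o.2 then
    let w := coeff X o
    let p := X *ᵥ w
    let r := o.1 - mask o.2 *ᵥ p
    let θ := τ / n * vnorm r * vnorm p
    X + Matrix.vecMulVec
      (((Real.cos θ - 1) / vnorm p) • p + (Real.sin θ / vnorm r) • r) ((vnorm w)⁻¹ • w)
  else X

open Classical in
/-- One step of simplified PETRELS on the state `(X, R)`, with discount factor `γ`. -/
def petrelsStep (ε α γ : ℝ) (S : Matrix (Fin n) (Fin d) ℝ × Matrix (Fin d) (Fin d) ℝ)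
    (o : Obs n) : Matrix (Fin n) (Fin d) ℝ × Matrix (Fin d) (Fin d) ℝ :=
  if Enough ε S.1 o.2 then
    let w := coeff S.1 o
    let u := γ⁻¹ • (S.2 *ᵥ w)
    let β := 1 + α * (w ⬝ᵥ u)
    (S.1 + Matrix.vecMulVec (mask o.2 *ᵥ (o.1 - S.1 *ᵥ w)) w * S.2,
      γ⁻¹ • S.2 - (α / β) • Matrix.vecMulVec u u)
  else S

/-- Iterates of Oja's method, step sizes `τ (k / n)`. -/
def ojaIter (ε : ℝ) (τ : ℝ → ℝ) (X₀ : Matrix (Fin n) (Fin d) ℝ) (o : ℕ → Obs n) :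
    ℕ → Matrix (Fin n) (Fin d) ℝ
  | 0 => X₀
  | k + 1 => ojaStep ε (τ ((k : ℝ) / n)) (ojaIter ε τ X₀ o k) (o k)

/-- Iterates of GROUSE, step sizes `τ (k / n)`. -/
def grouseIter (ε : ℝ) (τ : ℝ → ℝ) (X₀ : Matrix (Fin n) (Fin d) ℝ) (o : ℕ → Obs n) :
    ℕ → Matrix (Fin n) (Fin d) ℝ
  | 0 => X₀
  | k + 1 => grouseStep ε (τ ((k : ℝ) / n)) (grouseIter ε τ X₀ o k) (o k)

/-- Iterates `(X_k, R_k)` of simplified PETRELS, with `R_0 = (δ / n) I` and discount factor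
`γ = 1 - μ / n`. -/
def petrelsIter (ε α μ δ : ℝ) (X₀ : Matrix (Fin n) (Fin d) ℝ) (o : ℕ → Obs n) :
    ℕ → Matrix (Fin n) (Fin d) ℝ × Matrix (Fin d) (Fin d) ℝ
  | 0 => (X₀, (δ / n) • (1 : Matrix (Fin d) (Fin d) ℝ))
  | k + 1 => petrelsStep ε α (1 - μ / n) (petrelsIter ε α μ δ X₀ o k) (o k)

/-! ### The limiting ODEs -/

/-- `Λ² = diag (lam i ^ 2)`. -/
def lamSq (lam : Fin d → ℝ) : Matrix (Fin d) (Fin d) ℝ := Matrix.diagonal fun i => lam i ^ 2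

/-- `F(Q, G) = [α Λ² Q - (σ⁴/2) Q G - Q (I + (σ²/2) G) Qᵀ α Λ² Q] G`. -/
def drift (α σ : ℝ) (lam : Fin d → ℝ) (Q G : Matrix (Fin d) (Fin d) ℝ) :
    Matrix (Fin d) (Fin d) ℝ :=
  (α • lamSq lam * Q - (σ ^ 4 / 2) • (Q * G)
    - Q * (1 + (σ ^ 2 / 2) • G) * Qᵀ * (α • lamSq lam) * Q) * G

/-- `Q` solves `Q' = F(Q, τ I)`, `Q(0) = Q₀` on `[0, T]`. As `τ` may jump, the equation is read in
integrated form; wherever `τ` is continuous this gives `Q'(t) = F(Q(t), τ(t) I)`. -/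
structure IsOjaSolution (α σ : ℝ) (lam : Fin d → ℝ) (τ : ℝ → ℝ)
    (Q₀ : Matrix (Fin d) (Fin d) ℝ) (T : ℝ) (Q : ℝ → Matrix (Fin d) (Fin d) ℝ) : Prop where
  cont : ContinuousOn Q (Icc 0 T)
  eq : ∀ t ∈ Icc 0 T, Q t = Q₀ + ∫ s in (0 : ℝ)..t,
    drift α σ lam (Q s) (τ s • (1 : Matrix (Fin d) (Fin d) ℝ))

/-- `J₁ = W⁻¹ (Kᵀ α Λ² K + σ² W) W⁻¹ - μ A`. -/
def petrelsJ₁ (α σ μ : ℝ) (lam : Fin d → ℝ) (A K W : Matrix (Fin d) (Fin d) ℝ) :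
    Matrix (Fin d) (Fin d) ℝ :=
  W⁻¹ * (Kᵀ * (α • lamSq lam) * K + σ ^ 2 • W) * W⁻¹ - μ • A

/-- `J₂ = (α Λ² + σ² I) K W⁻¹ A⁻¹ - K W⁻¹ (Kᵀ α Λ² K + σ² W) W⁻¹ A⁻¹`. -/
def petrelsJ₂ (α σ : ℝ) (lam : Fin d → ℝ) (A K W : Matrix (Fin d) (Fin d) ℝ) :
    Matrix (Fin d) (Fin d) ℝ :=
  (α • lamSq lam + σ ^ 2 • (1 : Matrix (Fin d) (Fin d) ℝ)) * K * W⁻¹ * A⁻¹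
    - K * W⁻¹ * (Kᵀ * (α • lamSq lam) * K + σ ^ 2 • W) * W⁻¹ * A⁻¹

/-- `J₃ = σ² A⁻¹ W⁻¹ (Kᵀ α Λ² K + σ² W) W⁻¹ A⁻¹`. -/
def petrelsJ₃ (α σ : ℝ) (lam : Fin d → ℝ) (A K W : Matrix (Fin d) (Fin d) ℝ) :
    Matrix (Fin d) (Fin d) ℝ :=
  σ ^ 2 • (A⁻¹ * W⁻¹ * (Kᵀ * (α • lamSq lam) * K + σ ^ 2 • W) * W⁻¹ * A⁻¹)

/-- `(A, K, W)` solves the PETRELS system on `[0, T]` from `(A₀, K₀, W₀)`. -/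
structure IsPetrelsSolution (α σ μ : ℝ) (lam : Fin d → ℝ)
    (A₀ K₀ W₀ : Matrix (Fin d) (Fin d) ℝ) (T : ℝ)
    (A K W : ℝ → Matrix (Fin d) (Fin d) ℝ) : Prop where
  init_A : A 0 = A₀
  init_K : K 0 = K₀
  init_W : W 0 = W₀
  deriv_A : ∀ t ∈ Icc 0 T,
    HasDerivWithinAt A (petrelsJ₁ α σ μ lam (A t) (K t) (W t)) (Icc 0 T) t
  deriv_K : ∀ t ∈ Icc 0 T,
    HasDerivWithinAt K (petrelsJ₂ α σ lam (A t) (K t) (W t)) (Icc 0 T) t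
  deriv_W : ∀ t ∈ Icc 0 T,
    HasDerivWithinAt W (petrelsJ₃ α σ lam (A t) (K t) (W t)) (Icc 0 T) t

/-! ### The definitions above mean what they say -/

theorem mask_mul_mask (v : Fin n → Bool) : mask v * mask v = mask v := by
  simp [mask, Matrix.diagonal_mul_diagonal]

theorem mask_transpose (v : Fin n → Bool) : (mask v)ᵀ = mask v := by
  simp [mask]

theorem maskedGram_isHermitian (X : Matrix (Fin n) (Fin d) ℝ) (v : Fin n → Bool) :
    (maskedGram X v).IsHermitian := by
  simp [Matrix.IsHermitian, maskedGram, Matrix.conjTranspose_eq_transpose_of_trivial,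
    Matrix.transpose_mul, mask_transpose, Matrix.mul_assoc]

open scoped Pointwise in
/-- The test says that every eigenvalue of `Xᵀ Ω X` exceeds `ε`. -/
theorem enough_iff (ε : ℝ) (X : Matrix (Fin n) (Fin d) ℝ) (v : Fin n → Bool) :
    Enough ε X v ↔ ∀ x ∈ spectrum ℝ (maskedGram X v), ε < x := by
  have hH : (maskedGram X v - ε • (1 : Matrix (Fin d) (Fin d) ℝ)).IsHermitian :=
    (maskedGram_isHermitian X v).sub
      (by simp [Matrix.IsHermitian])
  have hs : spectrum ℝ (maskedGram X v - ε • (1 : Matrix (Fin d) (Fin d) ℝ)) =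
      spectrum ℝ (maskedGram X v) - ({ε} : Set ℝ) := by
    rw [spectrum.sub_singleton_eq, Algebra.algebraMap_eq_smul_one]
  rw [Enough, hH.posDef_iff_eigenvalues_pos]
  constructor
  · intro h x hx
    have hx' : x - ε ∈ spectrum ℝ (maskedGram X v - ε • (1 : Matrix (Fin d) (Fin d) ℝ)) := by
      rw [hs]; exact Set.sub_mem_sub hx rfl
    rw [hH.spectrum_real_eq_range_eigenvalues] at hx'
    obtain ⟨i, hi⟩ := hx'
    have := h i
    linarith
  · intro h i
    have hi := hH.eigenvalues_mem_spectrum_real i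
    rw [hs] at hi
    obtain ⟨x, hx, y, hy, hxy⟩ := hi
    rw [Set.mem_singleton_iff] at hy
    have := h x hx
    change x - y = _ at hxy
    linarith

/-- When the test is passed, `coeff` is the unique minimizer of `‖y - Ω X w‖`. -/
theorem coeff_isArgmin {ε : ℝ} (hε : 0 < ε) (X : Matrix (Fin n) (Fin d) ℝ) (o : Obs n)
    (h : Enough ε X o.2) (w : Fin d → ℝ) (hw : w ≠ coeff X o) :
    vnorm (o.1 - mask o.2 *ᵥ (X *ᵥ coeff X o)) < vnorm (o.1 - mask o.2 *ᵥ (X *ᵥ w)) := by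
  have hpd : (maskedGram X o.2).PosDef := by
    have h1 : (ε • (1 : Matrix (Fin d) (Fin d) ℝ)).PosDef := Matrix.PosDef.one.smul hε
    have h2 := Matrix.PosDef.add h h1
    rwa [sub_add_cancel] at h2
  set w₀ := coeff X o with hw₀
  set e := w - w₀ with he
  have he0 : e ≠ 0 := sub_ne_zero.mpr hw
  have hdet : IsUnit (maskedGram X o.2).det := (Matrix.isUnit_iff_isUnit_det _).mp hpd.isUnit
  have hnormal : maskedGram X o.2 *ᵥ w₀ = Xᵀ *ᵥ (mask o.2 *ᵥ o.1) := by
    rw [hw₀, coeff, Matrix.mulVec_mulVec, Matrix.mul_nonsing_inv _ hdet, Matrix.one_mulVec]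
  have hgram : ∀ a b : Fin d → ℝ, (mask o.2 *ᵥ (X *ᵥ a)) ⬝ᵥ (mask o.2 *ᵥ (X *ᵥ b)) =
      a ⬝ᵥ (maskedGram X o.2 *ᵥ b) := by
    intro a b
    rw [maskedGram, ← Matrix.vecMul_transpose, mask_transpose, ← Matrix.vecMul_transpose,
      ← Matrix.dotProduct_mulVec, ← Matrix.dotProduct_mulVec, Matrix.mulVec_mulVec,
      Matrix.mulVec_mulVec, Matrix.mulVec_mulVec, Matrix.mul_assoc Xᵀ, mask_mul_mask]
  have hcross : ∀ a : Fin d → ℝ, (mask o.2 *ᵥ (X *ᵥ a)) ⬝ᵥ o.1 =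
      a ⬝ᵥ (maskedGram X o.2 *ᵥ w₀) := by
    intro a
    rw [hnormal, ← Matrix.vecMul_transpose, mask_transpose, ← Matrix.vecMul_transpose,
      ← Matrix.dotProduct_mulVec, ← Matrix.dotProduct_mulVec]
  have hsplit : o.1 - mask o.2 *ᵥ (X *ᵥ w) =
      (o.1 - mask o.2 *ᵥ (X *ᵥ w₀)) - mask o.2 *ᵥ (X *ᵥ e) := by
    rw [he, Matrix.mulVec_sub, Matrix.mulVec_sub]; abel
  have horth : (mask o.2 *ᵥ (X *ᵥ e)) ⬝ᵥ (o.1 - mask o.2 *ᵥ (X *ᵥ w₀)) = 0 := by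
    rw [dotProduct_sub, hcross, hgram, sub_self]
  have hpos : 0 < e ⬝ᵥ (maskedGram X o.2 *ᵥ e) := by
    simpa using hpd.dotProduct_mulVec_pos he0
  unfold vnorm
  have hnn : ∀ z : Fin n → ℝ, 0 ≤ z ⬝ᵥ z := fun z =>
    Finset.sum_nonneg fun i _ => mul_self_nonneg _
  apply Real.sqrt_lt_sqrt (hnn _)
  have hexp : ∀ z y : Fin n → ℝ, (z - y) ⬝ᵥ (z - y) = z ⬝ᵥ z - 2 * (y ⬝ᵥ z) + y ⬝ᵥ y := by
    intro z y
    rw [sub_dotProduct, dotProduct_sub, dotProduct_sub, dotProduct_comm z y]; ring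
  rw [hsplit, hexp (o.1 - mask o.2 *ᵥ (X *ᵥ w₀)), horth, hgram]
  linarith

theorem matSqrt_mul_self {A : Matrix (Fin d) (Fin d) ℝ} (hA : A.PosSemidef) :
    matSqrt A * matSqrt A = A := by
  have hfin : (spectrum ℝ A).Finite := by
    rw [hA.isHermitian.spectrum_real_eq_range_eigenvalues]; exact Set.finite_range _
  rw [matSqrt, ← cfc_mul Real.sqrt Real.sqrt A (hfin.continuousOn _) (hfin.continuousOn _)]
  conv_rhs => rw [← cfc_id ℝ A hA.isHermitian]
  refine cfc_congr fun x hx => ?_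
  rw [hA.isHermitian.spectrum_real_eq_range_eigenvalues] at hx
  obtain ⟨i, rfl⟩ := hx
  exact Real.mul_self_sqrt (hA.eigenvalues_nonneg i)

theorem invSqrt_eq {A : Matrix (Fin d) (Fin d) ℝ} (hA : A.PosDef) :
    invSqrt A = (matSqrt A)⁻¹ := by
  have hfin : (spectrum ℝ A).Finite := by
    rw [hA.isHermitian.spectrum_real_eq_range_eigenvalues]; exact Set.finite_range _
  symm
  apply Matrix.inv_eq_right_inv
  rw [matSqrt, invSqrt, ← cfc_mul Real.sqrt _ A (hfin.continuousOn _) (hfin.continuousOn _),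
    ← cfc_one ℝ A hA.isHermitian]
  refine cfc_congr fun x hx => ?_
  rw [hA.isHermitian.spectrum_real_eq_range_eigenvalues] at hx
  obtain ⟨i, rfl⟩ := hx
  exact mul_inv_cancel₀ (Real.sqrt_pos.mpr (hA.isHermitian.posDef_iff_eigenvalues_pos.mp hA i)).ne'

end

end SubspaceTracking

open SubspaceTracking

namespace SubspaceTracking

open Matrix (vecMulVec mulVec_mulVec transpose_mul nonsing_inv_mul one_mulVec transpose_transpose smul_vecMulVec sub_mulVec smul_mulVec mul_nonsing_inv isUnit_iff_isUnit_det conjTranspose_eq_transpose_of_trivial transpose_sub vecMulVec_apply inv_eq_right_inv transpose_vecMulVec mulVec_sub mulVec_smul mulVec_add vecMulVec_smul mulVec_transpose transpose_add transpose_smul add_vecMulVec)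
open Finset (sum_nonneg sum_le_sum single_le_sum mem_univ sum_mul sum_congr sum_comm mul_sum sum_add_distrib mem_singleton_self sum_insert measurable_fun_sum sum_mul_sum sum_div)
open ENNReal (ofReal ofReal_le_ofReal ofReal_mul ofReal_add)
open Real (norm_eq_abs sq_sqrt sqrt_nonneg cos sin exp sqrt_pos exp_pos one_le_sqrt mul_self_sqrt le_sqrt_of_sq_le)
open Matrix renaming mul_assoc → mmul_assoc, sub_mul → msub_mul, smul_mul → msmul_mul, mul_smul → mmul_smul, mul_sub → mmul_sub, mul_one → mmul_one, one_mul → mone_mul, mul_add → mmul_add, add_mul → madd_mul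
local notation "Mat" m:max n:max => Matrix (Fin m) (Fin n) ℝ
local notation "ŵ[" X "," U "," ξ "]" => coeff X (observe U ξ)

/-! ### Euclidean norm and spectral norm -/

section Norms
variable {m n d l : ℕ}

theorem vnorm_eq_norm (x : Fin n → ℝ) : vnorm x = ‖WithLp.toLp 2 x‖ := by
  rw [vnorm, EuclideanSpace.norm_eq]
  congr 1
  simp [dotProduct, sq]

theorem vnorm_nonneg (x : Fin n → ℝ) : 0 ≤ vnorm x := sqrt_nonneg _

theorem dotProduct_self_nonneg' (x : Fin n → ℝ) : 0 ≤ x ⬝ᵥ x :=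
  sum_nonneg fun _ _ => mul_self_nonneg _

theorem vnorm_sq (x : Fin n → ℝ) : vnorm x ^ 2 = x ⬝ᵥ x :=
  sq_sqrt (dotProduct_self_nonneg' x)

theorem vnorm_sq_eq_sum (x : Fin n → ℝ) : vnorm x ^ 2 = ∑ i, x i ^ 2 := by
  rw [vnorm_sq]; simp [dotProduct, sq]

theorem vnorm_add_le (x y : Fin n → ℝ) : vnorm (x + y) ≤ vnorm x + vnorm y := by
  simp only [vnorm_eq_norm, WithLp.toLp_add]; exact norm_add_le _ _

theorem vnorm_sub_le (x y : Fin n → ℝ) : vnorm (x - y) ≤ vnorm x + vnorm y := by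
  simp only [vnorm_eq_norm, WithLp.toLp_sub]; exact norm_sub_le _ _

theorem vnorm_smul (c : ℝ) (x : Fin n → ℝ) : vnorm (c • x) = |c| * vnorm x := by
  simp only [vnorm_eq_norm, WithLp.toLp_smul, norm_smul, norm_eq_abs]

theorem abs_apply_le_vnorm (x : Fin n → ℝ) (i : Fin n) : |x i| ≤ vnorm x := by
  rw [vnorm_eq_norm]; exact PiLp.norm_apply_le (WithLp.toLp 2 x) i

theorem vnorm_eq_zero {x : Fin n → ℝ} : vnorm x = 0 ↔ x = 0 := by
  rw [vnorm_eq_norm, norm_eq_zero, WithLp.toLp_eq_zero]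

theorem vnorm_le_sum (x : Fin n → ℝ) : vnorm x ≤ ∑ i, |x i| := by
  rw [vnorm, Real.sqrt_le_left (sum_nonneg fun _ _ => abs_nonneg _)]
  calc x ⬝ᵥ x = ∑ i, |x i| * |x i| := by simp [dotProduct]
    _ ≤ ∑ i, |x i| * ∑ j, |x j| := sum_le_sum fun i _ =>
      mul_le_mul_of_nonneg_left (single_le_sum (f := fun j => |x j|)
        (fun _ _ => abs_nonneg _) (mem_univ i)) (abs_nonneg _)
    _ = _ := by rw [← sum_mul, sq]

theorem continuous_vnorm : Continuous (vnorm : (Fin n → ℝ) → ℝ) := by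
  unfold vnorm; fun_prop

theorem abs_dotProduct_le (x y : Fin n → ℝ) : |x ⬝ᵥ y| ≤ vnorm x * vnorm y := by
  have := abs_real_inner_le_norm (WithLp.toLp 2 y) (WithLp.toLp 2 x)
  simp only [EuclideanSpace.inner_toLp_toLp, star_trivial] at this
  rw [vnorm_eq_norm, vnorm_eq_norm, mul_comm]; exact this

theorem vnorm_mulVec_le (A : Mat m n) (x : Fin n → ℝ) :
    vnorm (A *ᵥ x) ≤ ‖A‖ * vnorm x := by
  have := Matrix.l2_opNorm_mulVec A (WithLp.toLp 2 x)
  rw [vnorm_eq_norm, vnorm_eq_norm]; exact this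

theorem norm_le_of_vnorm_le (A : Mat m n) {c : ℝ} (hc : 0 ≤ c)
    (h : ∀ x, vnorm (A *ᵥ x) ≤ c * vnorm x) : ‖A‖ ≤ c := by
  rw [Matrix.l2_opNorm_def]
  refine ContinuousLinearMap.opNorm_le_bound _ hc fun x => ?_
  have := h (WithLp.ofLp x)
  rw [vnorm_eq_norm, vnorm_eq_norm] at this
  exact this

theorem norm_transpose (A : Mat m n) : ‖Aᵀ‖ = ‖A‖ := by
  rw [← conjTranspose_eq_transpose_of_trivial, Matrix.l2_opNorm_conjTranspose]

theorem norm_transpose_mul_self (A : Mat m n) : ‖Aᵀ * A‖ = ‖A‖ ^ 2 := by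
  rw [← conjTranspose_eq_transpose_of_trivial, Matrix.l2_opNorm_conjTranspose_mul_self, sq]

theorem norm_mul_le_mul (A : Mat m n) (B : Mat n l) :
    ‖A * B‖ ≤ ‖A‖ * ‖B‖ := Matrix.l2_opNorm_mul A B

theorem vecMulVec_mulVec' (a : Fin m → ℝ) (b x : Fin n → ℝ) :
    vecMulVec a b *ᵥ x = (b ⬝ᵥ x) • a := by
  ext i
  simp only [Matrix.mulVec, vecMulVec_apply, dotProduct, Pi.smul_apply, smul_eq_mul,
    sum_mul]
  exact sum_congr rfl fun _ _ => by ring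

theorem norm_vecMulVec_le (a : Fin m → ℝ) (b : Fin n → ℝ) :
    ‖vecMulVec a b‖ ≤ vnorm a * vnorm b := by
  refine norm_le_of_vnorm_le _ (mul_nonneg (vnorm_nonneg _) (vnorm_nonneg _)) fun x => ?_
  rw [vecMulVec_mulVec', vnorm_smul]
  calc |b ⬝ᵥ x| * vnorm a ≤ (vnorm b * vnorm x) * vnorm a :=
        mul_le_mul_of_nonneg_right (abs_dotProduct_le b x) (vnorm_nonneg _)
    _ = _ := by ring

theorem mulVec_single_eq (A : Mat m n) (i : Fin m) (j : Fin n) :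
    (A *ᵥ Pi.single j 1) i = A i j := by simp

theorem vnorm_single (j : Fin n) : vnorm (Pi.single j (1 : ℝ)) = 1 := by
  simp [vnorm]

theorem vnorm_col_le_norm (A : Mat m n) (j : Fin n) :
    vnorm (fun i => A i j) ≤ ‖A‖ := by
  have h2 := vnorm_mulVec_le A (Pi.single j 1)
  rw [vnorm_single, mul_one] at h2
  convert h2 using 2
  ext i; rw [mulVec_single_eq]

theorem sq_norm_le_sum (A : Mat m n) : ‖A‖ ^ 2 ≤ ∑ i, ∑ j, A i j ^ 2 := by
  have hs : 0 ≤ ∑ i, ∑ j, A i j ^ 2 :=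
    sum_nonneg fun _ _ => sum_nonneg fun _ _ => sq_nonneg _
  have : ‖A‖ ≤ √(∑ i, ∑ j, A i j ^ 2) := by
    refine norm_le_of_vnorm_le _ (sqrt_nonneg _) fun x => ?_
    have h0 : 0 ≤ √(∑ i, ∑ j, A i j ^ 2) * vnorm x := mul_nonneg (sqrt_nonneg _) (vnorm_nonneg _)
    refine (sq_le_sq₀ (vnorm_nonneg _) h0).1 ?_
    rw [vnorm_sq_eq_sum, mul_pow, sq_sqrt hs, vnorm_sq_eq_sum, sum_mul]
    refine sum_le_sum (f := fun i => (A *ᵥ x) i ^ 2) fun i _ => ?_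
    exact Finset.sum_mul_sq_le_sq_mul_sq Finset.univ (A i) x
  calc ‖A‖ ^ 2 ≤ √(∑ i, ∑ j, A i j ^ 2) ^ 2 := by gcongr
    _ = _ := sq_sqrt hs

theorem sum_sq_le_norm (A : Mat m n) : ∑ i, ∑ j, A i j ^ 2 ≤ n * ‖A‖ ^ 2 := by
  rw [sum_comm]
  calc ∑ j, ∑ i, A i j ^ 2 = ∑ j : Fin n, vnorm (fun i => A i j) ^ 2 := by
        simp only [vnorm_sq_eq_sum]
    _ ≤ ∑ _j : Fin n, ‖A‖ ^ 2 := sum_le_sum fun j _ => by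
        have := vnorm_col_le_norm A j
        have := vnorm_nonneg fun i => A i j
        gcongr
    _ = _ := by simp

theorem norm_one_le_one : ‖(1 : Mat d d)‖ ≤ 1 :=
  norm_le_of_vnorm_le _ zero_le_one fun x => by simp

theorem norm_le_one_of_isometry {U : Mat n d} (hU : Uᵀ * U = 1) : ‖U‖ ≤ 1 := by
  have h := norm_transpose_mul_self U
  rw [hU] at h
  have := norm_one_le_one (d := d)
  nlinarith [norm_nonneg U]

theorem norm_le_one_of_projection {E : Mat d d} (h1 : Eᵀ = E) (h2 : E * E = E) :
    ‖E‖ ≤ 1 := by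
  have h := norm_transpose_mul_self E
  rw [h1, h2] at h
  by_contra hc
  push Not at hc
  nlinarith

theorem norm_mask_le (v : Fin n → Bool) : ‖mask v‖ ≤ 1 :=
  norm_le_one_of_projection (mask_transpose v) (mask_mul_mask v)

theorem mask_mulVec_apply (v : Fin n → Bool) (x : Fin n → ℝ) (i : Fin n) :
    (mask v *ᵥ x) i = if v i then x i else 0 := by
  rw [mask, Matrix.mulVec_diagonal]; split_ifs <;> simp

theorem vecMulVec_mul' (a : Fin m → ℝ) (b : Fin n → ℝ) (A : Mat n l) :
    vecMulVec a b * A = vecMulVec a (Aᵀ *ᵥ b) := by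
  rw [Matrix.vecMulVec_mul, mulVec_transpose]

theorem mul_vecMulVec' (A : Mat l m) (a : Fin m → ℝ) (b : Fin n → ℝ) :
    A * vecMulVec a b = vecMulVec (A *ᵥ a) b := by
  rw [Matrix.mul_vecMulVec]

theorem vecMulVec_mul_vecMulVec' (a : Fin m → ℝ) (b c : Fin n → ℝ) (e : Fin l → ℝ) :
    vecMulVec a b * vecMulVec c e = (b ⬝ᵥ c) • vecMulVec a e := by
  rw [mul_vecMulVec', vecMulVec_mulVec', smul_vecMulVec]

theorem dotProduct_mulVec_transpose (A : Mat m n) (x : Fin m → ℝ) (y : Fin n → ℝ) :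
    x ⬝ᵥ (A *ᵥ y) = (Aᵀ *ᵥ x) ⬝ᵥ y := by
  rw [Matrix.dotProduct_mulVec, mulVec_transpose]

end Norms

/-! ### Positive (semi)definite matrices -/

section Pos
variable {n d : ℕ}

theorem posSemidef_iff' {A : Mat d d} :
    A.PosSemidef ↔ Aᵀ = A ∧ ∀ x, 0 ≤ x ⬝ᵥ (A *ᵥ x) := by
  constructor
  · intro h
    refine ⟨?_, fun x => by simpa using h.dotProduct_mulVec_nonneg x⟩
    rw [← conjTranspose_eq_transpose_of_trivial]; exact h.isHermitian
  · rintro ⟨h1, h2⟩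
    refine Matrix.PosSemidef.of_dotProduct_mulVec_nonneg ?_ fun x => by simpa using h2 x
    rw [Matrix.IsHermitian, conjTranspose_eq_transpose_of_trivial, h1]

/-- `A ≥ c I`. -/
def AtLeast (c : ℝ) (A : Mat d d) : Prop :=
  Aᵀ = A ∧ ∀ x, c * (x ⬝ᵥ x) ≤ x ⬝ᵥ (A *ᵥ x)

theorem atLeast_iff {c : ℝ} {A : Mat d d} :
    AtLeast c A ↔ (A - c • (1 : Mat d d)).PosSemidef := by
  rw [posSemidef_iff', AtLeast]
  simp [sub_mulVec, smul_mulVec]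

theorem isHermitian_iff' {A : Mat d d} : A.IsHermitian ↔ Aᵀ = A := by
  rw [Matrix.IsHermitian, conjTranspose_eq_transpose_of_trivial]

theorem posSemidef_gram (X : Mat n d) : (Xᵀ * X).PosSemidef := by
  rw [← conjTranspose_eq_transpose_of_trivial]
  exact Matrix.posSemidef_conjTranspose_mul_self X

namespace AtLeast
variable {c : ℝ} {A B : Mat d d}

theorem mono (h : AtLeast c A) {c' : ℝ} (hc : c' ≤ c) : AtLeast c' A :=
  ⟨h.1, fun x => (mul_le_mul_of_nonneg_right hc (dotProduct_self_nonneg' x)).trans (h.2 x)⟩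

theorem add_posSemidef (h : AtLeast c A) (hB : B.PosSemidef) : AtLeast c (A + B) := by
  rw [posSemidef_iff'] at hB
  refine ⟨by rw [transpose_add, h.1, hB.1], fun x => ?_⟩
  rw [Matrix.add_mulVec, dotProduct_add]
  linarith [h.2 x, hB.2 x]

theorem smul (h : AtLeast c A) {r : ℝ} (hr : 0 ≤ r) : AtLeast (r * c) (r • A) := by
  refine ⟨by rw [transpose_smul, h.1], fun x => ?_⟩
  rw [smul_mulVec, dotProduct_smul, smul_eq_mul, mul_assoc]
  exact mul_le_mul_of_nonneg_left (h.2 x) hr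

theorem posDef (hc : 0 < c) (h : AtLeast c A) : A.PosDef := by
  refine Matrix.PosDef.of_dotProduct_mulVec_pos (isHermitian_iff'.2 h.1) fun x hx => ?_
  have h1 : 0 < x ⬝ᵥ x :=
    lt_of_le_of_ne (dotProduct_self_nonneg' x) (fun h => hx (dotProduct_self_eq_zero.1 h.symm))
  simpa using (mul_pos hc h1).trans_le (h.2 x)

theorem isUnit_det (hc : 0 < c) (h : AtLeast c A) : IsUnit A.det :=
  (isUnit_iff_isUnit_det _).mp (h.posDef hc).isUnit

theorem vnorm_le (h : AtLeast c A) (x : Fin d → ℝ) : c * vnorm x ≤ vnorm (A *ᵥ x) := by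
  by_cases hx : vnorm x = 0
  · rw [hx, mul_zero]; exact vnorm_nonneg _
  have hpos : 0 < vnorm x := lt_of_le_of_ne (vnorm_nonneg x) (Ne.symm hx)
  have h1 := h.2 x
  have h2 := (le_abs_self _).trans (abs_dotProduct_le x (A *ᵥ x))
  rw [← vnorm_sq] at h1
  nlinarith

theorem norm_inv_le (hc : 0 < c) (h : AtLeast c A) : ‖A⁻¹‖ ≤ c⁻¹ := by
  refine norm_le_of_vnorm_le _ (inv_nonneg.2 hc.le) fun x => ?_
  have h1 := h.vnorm_le (A⁻¹ *ᵥ x)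
  rw [mulVec_mulVec, mul_nonsing_inv _ (h.isUnit_det hc), one_mulVec] at h1
  rw [inv_mul_eq_div, le_div_iff₀ hc]; linarith

theorem of_norm_sub_le (h : AtLeast c A) (hB : Bᵀ = B) {η : ℝ} (hAB : ‖A - B‖ ≤ η) :
    AtLeast (c - η) B := by
  refine ⟨hB, fun x => ?_⟩
  have h1 := h.2 x
  have h2 := (le_abs_self _).trans (abs_dotProduct_le x ((A - B) *ᵥ x))
  have h3 := vnorm_mulVec_le (A - B) x
  have h4 : vnorm x * vnorm ((A - B) *ᵥ x) ≤ η * vnorm x ^ 2 := by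
    have := vnorm_nonneg x
    calc _ ≤ vnorm x * (η * vnorm x) := by gcongr; exact h3.trans (by gcongr)
      _ = _ := by ring
  have h5 : x ⬝ᵥ ((A - B) *ᵥ x) = x ⬝ᵥ (A *ᵥ x) - x ⬝ᵥ (B *ᵥ x) := by
    rw [sub_mulVec, dotProduct_sub]
  rw [h5] at h2
  rw [← vnorm_sq] at *
  linarith

theorem transpose_inv (h : AtLeast c A) : A⁻¹ᵀ = A⁻¹ := by
  rw [Matrix.transpose_nonsing_inv, h.1]

end AtLeast

theorem exists_atLeast_of_posDef {A : Mat d d} (h : A.PosDef) :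
    ∃ η : ℝ, 0 < η ∧ AtLeast η A := by
  have hdet : IsUnit A.det := (isUnit_iff_isUnit_det _).mp h.isUnit
  have hs : Aᵀ = A := isHermitian_iff'.1 h.isHermitian
  have hS := matSqrt_mul_self h.posSemidef
  have hSs : (matSqrt A)ᵀ = matSqrt A := by
    have : IsSelfAdjoint (matSqrt A) := IsSelfAdjoint.cfc
    exact isHermitian_iff'.1 this
  have hSu : IsUnit (matSqrt A).det := by
    have : IsUnit ((matSqrt A).det * (matSqrt A).det) := by rw [← Matrix.det_mul, hS]; exact hdet
    exact isUnit_of_mul_isUnit_left this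
  refine ⟨(‖(matSqrt A)⁻¹‖ ^ 2 + 1)⁻¹, by positivity, hs, fun x => ?_⟩
  have h1 : x ⬝ᵥ (A *ᵥ x) = vnorm (matSqrt A *ᵥ x) ^ 2 := by
    rw [vnorm_sq, ← hS, ← mulVec_mulVec, dotProduct_mulVec_transpose, hSs, hS]
  have h2 := vnorm_mulVec_le (matSqrt A)⁻¹ (matSqrt A *ᵥ x)
  rw [mulVec_mulVec, nonsing_inv_mul _ hSu, one_mulVec] at h2
  rw [h1, ← vnorm_sq, inv_mul_eq_div, div_le_iff₀ (by positivity)]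
  have h3 : vnorm x ^ 2 ≤ (‖(matSqrt A)⁻¹‖ * vnorm (matSqrt A *ᵥ x)) ^ 2 := by
    have := vnorm_nonneg x
    gcongr
  nlinarith [sq_nonneg (vnorm (matSqrt A *ᵥ x))]

theorem enough_atLeast {ε : ℝ} {X : Mat n d} {v : Fin n → Bool}
    (h : Enough ε X v) : AtLeast ε (maskedGram X v) := atLeast_iff.2 h.posSemidef

theorem enough_of_atLeast {ε c : ℝ} {X : Mat n d} {v : Fin n → Bool}
    (hc : ε < c) (h : AtLeast c (maskedGram X v)) : Enough ε X v := by
  have : AtLeast (c - ε) (maskedGram X v - ε • (1 : Mat d d)) := by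
    refine ⟨by simp [h.1], fun x => ?_⟩
    have := h.2 x
    simp only [sub_mulVec, smul_mulVec, one_mulVec, dotProduct_sub,
      dotProduct_smul, smul_eq_mul]
    linarith
  exact this.posDef (sub_pos.2 hc)

/-! ### Square roots -/

theorem finite_spectrum (A : Mat d d) : (spectrum ℝ A).Finite :=
  Matrix.finite_real_spectrum

theorem cfc_mul_cfc (f g : ℝ → ℝ) (A : Mat d d) :
    cfc f A * cfc g A = cfc (fun x => f x * g x) A :=
  (cfc_mul f g A ((finite_spectrum A).continuousOn _) ((finite_spectrum A).continuousOn _)).symm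

theorem cfc_id_of_isHermitian {A : Mat d d} (hA : A.IsHermitian) :
    cfc (id : ℝ → ℝ) A = A := cfc_id ℝ A hA.isSelfAdjoint

theorem transpose_cfc (f : ℝ → ℝ) (A : Mat d d) : (cfc f A)ᵀ = cfc f A := by
  have : IsSelfAdjoint (cfc f A) := IsSelfAdjoint.cfc
  exact isHermitian_iff'.1 this

theorem transpose_matSqrt (A : Mat d d) : (matSqrt A)ᵀ = matSqrt A :=
  transpose_cfc _ _

theorem transpose_invSqrt (A : Mat d d) : (invSqrt A)ᵀ = invSqrt A :=
  transpose_cfc _ _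

theorem spectrum_nonneg {A : Mat d d} (hA : A.PosSemidef) {x : ℝ}
    (hx : x ∈ spectrum ℝ A) : 0 ≤ x := by
  rw [hA.isHermitian.spectrum_real_eq_range_eigenvalues] at hx
  obtain ⟨i, rfl⟩ := hx
  exact hA.eigenvalues_nonneg i

theorem spectrum_pos {A : Mat d d} (hA : A.PosDef) {x : ℝ}
    (hx : x ∈ spectrum ℝ A) : 0 < x := by
  rw [hA.isHermitian.spectrum_real_eq_range_eigenvalues] at hx
  obtain ⟨i, rfl⟩ := hx
  exact hA.eigenvalues_pos i

theorem invSqrt_mul_invSqrt {A : Mat d d} (hA : A.PosDef) :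
    invSqrt A * invSqrt A = A⁻¹ := by
  rw [invSqrt_eq hA, ← Matrix.mul_inv_rev, matSqrt_mul_self hA.posSemidef]

theorem isUnit_det_matSqrt {A : Mat d d} (hA : A.PosDef) :
    IsUnit (matSqrt A).det := by
  have : IsUnit ((matSqrt A).det * (matSqrt A).det) := by
    rw [← Matrix.det_mul, matSqrt_mul_self hA.posSemidef]
    exact (isUnit_iff_isUnit_det _).mp hA.isUnit
  exact isUnit_of_mul_isUnit_left this

theorem invSqrt_mul_matSqrt {A : Mat d d} (hA : A.PosDef) :
    invSqrt A * matSqrt A = 1 := by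
  rw [invSqrt_eq hA, nonsing_inv_mul _ (isUnit_det_matSqrt hA)]

theorem matSqrt_mul_invSqrt {A : Mat d d} (hA : A.PosDef) :
    matSqrt A * invSqrt A = 1 := by
  rw [invSqrt_eq hA, mul_nonsing_inv _ (isUnit_det_matSqrt hA)]

theorem invSqrt_mul_mul_invSqrt {A : Mat d d} (hA : A.PosDef) :
    invSqrt A * A * invSqrt A = 1 := by
  nth_rewrite 2 [← matSqrt_mul_self hA.posSemidef]
  rw [← mmul_assoc, invSqrt_mul_matSqrt hA, mone_mul, matSqrt_mul_invSqrt hA]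

theorem invSqrt_one : invSqrt (1 : Mat d d) = 1 := by
  have h := matSqrt_mul_invSqrt (d := d) Matrix.PosDef.one
  have : matSqrt (1 : Mat d d) = 1 := by
    rw [matSqrt, cfc_apply_one]; simp
  rwa [this, mone_mul] at h

theorem norm_mul_invSqrt_gram_le_one (X : Mat n d) :
    ‖X * invSqrt (Xᵀ * X)‖ ≤ 1 := by
  set W := Xᵀ * X with hW
  have hpsd : W.PosSemidef := posSemidef_gram X
  have h1 : (X * invSqrt W)ᵀ * (X * invSqrt W) = cfc (fun x : ℝ => if x = 0 then 0 else 1) W := by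
    rw [transpose_mul, transpose_invSqrt, mmul_assoc, ← mmul_assoc Xᵀ, ← hW]
    nth_rewrite 2 [← cfc_id_of_isHermitian hpsd.isHermitian]
    rw [invSqrt, cfc_mul_cfc, cfc_mul_cfc]
    refine cfc_congr fun x hx => ?_
    have hx0 := spectrum_nonneg hpsd hx
    by_cases h0 : x = 0
    · simp [h0]
    · have : √x * √x = x := mul_self_sqrt hx0
      have h2 : √x ≠ 0 := by
        intro h; rw [h] at this; exact h0 (by linarith)
      simp only [id, h0, if_false]
      field_simp
      rw [sq]; exact this.symm
  have h2 : ‖cfc (fun x : ℝ => if x = 0 then (0 : ℝ) else 1) W‖ ≤ 1 := by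
    refine norm_le_one_of_projection (transpose_cfc _ _) ?_
    rw [cfc_mul_cfc]
    refine cfc_congr fun x _ => ?_
    by_cases h0 : x = 0 <;> simp [h0]
  have h3 := norm_transpose_mul_self (X * invSqrt W)
  rw [h1] at h3
  nlinarith [norm_nonneg (X * invSqrt W)]

theorem norm_cosSim_le_one {U : Mat n d} (hU : Uᵀ * U = 1)
    (X : Mat n d) : ‖cosSim U X‖ ≤ 1 := by
  rw [cosSim, mmul_assoc]
  calc _ ≤ ‖Uᵀ‖ * ‖X * invSqrt (Xᵀ * X)‖ := norm_mul_le_mul _ _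
    _ ≤ 1 * 1 := by
      gcongr
      · rw [norm_transpose]; exact norm_le_one_of_isometry hU
      · exact norm_mul_invSqrt_gram_le_one X
    _ = 1 := one_mul 1

theorem cosSim_of_orthonormal (U : Mat n d) {X : Mat n d}
    (hX : Xᵀ * X = 1) : cosSim U X = Uᵀ * X := by
  rw [cosSim, hX, invSqrt_one, mmul_one]

theorem invSqrt_mul_self_of_posDef {B : Mat d d} (hB : B.PosDef) :
    invSqrt (B * B) = B⁻¹ := by
  have hsq : B * B = cfc (fun x : ℝ => x * x) B := by
    nth_rewrite 1 2 [← cfc_id_of_isHermitian hB.isHermitian]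
    rw [cfc_mul_cfc]; rfl
  have h1 : invSqrt (B * B) = cfc (fun x : ℝ => x⁻¹) B := by
    rw [invSqrt, hsq, ← cfc_comp (fun x : ℝ => (√x)⁻¹) (fun x => x * x) B hB.isHermitian.isSelfAdjoint
      (((finite_spectrum B).image _).continuousOn _) ((finite_spectrum B).continuousOn _)]
    refine cfc_congr fun x hx => ?_
    simp [Real.sqrt_mul_self (spectrum_pos hB hx).le]
  rw [h1]
  symm
  apply inv_eq_right_inv
  nth_rewrite 1 [← cfc_id_of_isHermitian hB.isHermitian]
  rw [cfc_mul_cfc, ← cfc_one ℝ B hB.isHermitian.isSelfAdjoint]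
  refine cfc_congr fun x hx => ?_
  simp [(spectrum_pos hB hx).ne']

theorem norm_invSqrt_sq_le {c : ℝ} (hc : 0 < c) {A : Mat d d} (h : AtLeast c A) :
    ‖invSqrt A‖ ^ 2 ≤ c⁻¹ := by
  rw [← norm_transpose_mul_self, transpose_invSqrt, invSqrt_mul_invSqrt (h.posDef hc)]
  exact h.norm_inv_le hc

theorem posSemidef_matSqrt (A : Mat d d) :
    (matSqrt A).PosSemidef := by
  have : matSqrt A = cfc (fun x => √(√x)) A * cfc (fun x => √(√x)) A := by
    rw [cfc_mul_cfc, matSqrt]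
    exact cfc_congr fun x _ => (mul_self_sqrt (sqrt_nonneg x)).symm
  rw [this]
  nth_rewrite 1 [← transpose_cfc]
  exact posSemidef_gram _

theorem posDef_matSqrt {A : Mat d d} (hA : A.PosDef) : (matSqrt A).PosDef :=
  (posSemidef_matSqrt A).posDef_iff_isUnit.2
    ((isUnit_iff_isUnit_det _).2 (isUnit_det_matSqrt hA))

theorem atLeast_of_norm_inv_le {c : ℝ} (hc : 0 < c) {A : Mat d d} (hA : A.PosDef)
    (h : ‖A⁻¹‖ ≤ c⁻¹) : AtLeast c A := by
  refine ⟨isHermitian_iff'.1 hA.isHermitian, fun x => ?_⟩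
  have hi : ‖invSqrt A‖ ^ 2 ≤ c⁻¹ := by
    rw [← norm_transpose_mul_self, transpose_invSqrt, invSqrt_mul_invSqrt hA]; exact h
  have h1 : x ⬝ᵥ (A *ᵥ x) = vnorm (matSqrt A *ᵥ x) ^ 2 := by
    nth_rewrite 1 [← matSqrt_mul_self hA.posSemidef]
    rw [vnorm_sq, ← mulVec_mulVec, dotProduct_mulVec_transpose, transpose_matSqrt]
  have h2 := vnorm_mulVec_le (invSqrt A) (matSqrt A *ᵥ x)
  rw [mulVec_mulVec, invSqrt_mul_matSqrt hA, one_mulVec] at h2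
  have h3 : vnorm x ^ 2 ≤ c⁻¹ * vnorm (matSqrt A *ᵥ x) ^ 2 := by
    have := vnorm_nonneg x
    calc _ ≤ (‖invSqrt A‖ * vnorm (matSqrt A *ᵥ x)) ^ 2 := by gcongr
      _ = ‖invSqrt A‖ ^ 2 * vnorm (matSqrt A *ᵥ x) ^ 2 := by ring
      _ ≤ _ := by gcongr
  rw [h1, ← vnorm_sq]
  rw [inv_mul_eq_div, le_div_iff₀ hc] at h3
  linarith

theorem atLeast_matSqrt {c : ℝ} (hc : 0 < c) {A : Mat d d} (h : AtLeast c A) :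
    AtLeast (√c) (matSqrt A) := by
  have hA := h.posDef hc
  refine atLeast_of_norm_inv_le (sqrt_pos.2 hc) (posDef_matSqrt hA) ?_
  rw [← invSqrt_eq hA]
  have := norm_invSqrt_sq_le hc h
  rw [← Real.sqrt_inv]
  exact le_sqrt_of_sq_le this

/-- The principal square root is Lipschitz on `{A ≥ c}`. -/
theorem norm_matSqrt_sub_le {c : ℝ} (hc : 0 < c) {A B : Mat d d}
    (hA : AtLeast c A) (hB : AtLeast c B) :
    ‖matSqrt A - matSqrt B‖ ≤ √d / (2 * √c) * ‖A - B‖ := by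
  set S := matSqrt A
  set R := matSqrt B
  set D := S - R with hD
  have hc' : 0 < √c := sqrt_pos.2 hc
  have hS : AtLeast (√c) S := atLeast_matSqrt hc hA
  have hR : AtLeast (√c) R := atLeast_matSqrt hc hB
  have hDs : Dᵀ = D := by rw [hD, transpose_sub, hS.1, hR.1]
  have hAB : A - B = S * D + D * R := by
    rw [hD, mmul_sub, msub_mul, matSqrt_mul_self (hA.posDef hc).posSemidef,
      matSqrt_mul_self (hB.posDef hc).posSemidef]
    abel
  set F := ∑ i, ∑ j, D i j ^ 2 with hF
  have hF0 : 0 ≤ F := sum_nonneg fun _ _ => sum_nonneg fun _ _ => sq_nonneg _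
  have hcol : ∀ j, vnorm (fun i => D i j) ^ 2 = ∑ i, D i j ^ 2 := fun j => vnorm_sq_eq_sum _
  have hrow : ∀ i, vnorm (D i) ^ 2 = ∑ j, D i j ^ 2 := fun j => vnorm_sq_eq_sum _
  have h1 : √c * F ≤ ∑ i, ∑ j, D i j * (S * D) i j := by
    rw [hF, sum_comm, sum_comm (f := fun i j => D i j * (S * D) i j), mul_sum]
    refine sum_le_sum fun j _ => ?_
    have := hS.2 (fun i => D i j)
    rw [← vnorm_sq, hcol] at this
    refine this.trans (le_of_eq ?_)
    simp [dotProduct, Matrix.mulVec, Matrix.mul_apply]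
  have h2 : √c * F ≤ ∑ i, ∑ j, D i j * (D * R) i j := by
    rw [hF, mul_sum]
    refine sum_le_sum fun i _ => ?_
    have := hR.2 (D i)
    rw [← vnorm_sq, hrow] at this
    refine this.trans (le_of_eq ?_)
    have hsym : ∀ k j, R k j = R j k := fun k j => by
      conv_lhs => rw [← hR.1]
      rfl
    simp only [dotProduct, Matrix.mulVec, Matrix.mul_apply]
    refine sum_congr rfl fun j _ => ?_
    congr 1
    refine sum_congr rfl fun k _ => ?_
    rw [hsym]; ring
  have h3 : 2 * √c * F ≤ ∑ i, ∑ j, D i j * (A - B) i j := by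
    rw [hAB]
    simp only [Matrix.add_apply, mul_add, sum_add_distrib]
    linarith
  have h4 : (∑ i, ∑ j, D i j * (A - B) i j) ^ 2 ≤ F * ∑ i, ∑ j, (A - B) i j ^ 2 := by
    rw [hF]
    simp only [← Fintype.sum_prod_type']
    exact Finset.sum_mul_sq_le_sq_mul_sq _ _ _
  have h5 := sum_sq_le_norm (A - B)
  have h6 : (2 * √c * F) ^ 2 ≤ F * (d * ‖A - B‖ ^ 2) := by
    calc (2 * √c * F) ^ 2 ≤ (∑ i, ∑ j, D i j * (A - B) i j) ^ 2 := by gcongr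
      _ ≤ _ := h4.trans (by gcongr)
  have h7 : 4 * c * F ≤ d * ‖A - B‖ ^ 2 := by
    rcases hF0.eq_or_lt with h0 | h0
    · rw [← h0, mul_zero]; positivity
    · have : (2 * √c * F) ^ 2 = F * (4 * c * F) := by
        rw [mul_pow, mul_pow, sq_sqrt hc.le]; ring
      rw [this] at h6
      exact le_of_mul_le_mul_left h6 h0
  have h8 : ‖D‖ ^ 2 ≤ F := sq_norm_le_sum D
  refine (sq_le_sq₀ (norm_nonneg _) (by positivity)).1 ?_
  rw [mul_pow, div_pow, mul_pow, sq_sqrt hc.le, sq_sqrt (Nat.cast_nonneg d),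
    div_mul_eq_mul_div, le_div_iff₀ (by positivity)]
  nlinarith

/-- The inverse square root of a rank-one perturbation of the identity. -/
theorem posSemidef_vecMulVec_self (w : Fin d → ℝ) : (vecMulVec w w).PosSemidef := by
  rw [posSemidef_iff']
  refine ⟨transpose_vecMulVec w w, fun x => ?_⟩
  rw [vecMulVec_mulVec', dotProduct_smul, dotProduct_comm x w]
  exact mul_self_nonneg _

theorem invSqrt_one_add_vecMulVec (w : Fin d → ℝ) {s : ℝ} (hs : 0 ≤ s) :
    invSqrt (1 + s • vecMulVec w w) =
      1 - (s / (√(1 + s * vnorm w ^ 2) * (1 + √(1 + s * vnorm w ^ 2)))) • vecMulVec w w := by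
  set b := vnorm w ^ 2 with hb
  have hb0 : 0 ≤ b := sq_nonneg _
  set N := √(1 + s * b)
  have hN2 : N * N = 1 + s * b := mul_self_sqrt (by positivity)
  have hN0 : 0 < N := sqrt_pos.2 (by positivity)
  have hww : ∀ p q : ℝ, (1 + p • vecMulVec w w) * (1 + q • vecMulVec w w) =
      1 + (p + q + p * q * b) • vecMulVec w w := by
    intro p q
    rw [mmul_add, mmul_one, madd_mul, mone_mul, msmul_mul,
      mmul_smul, vecMulVec_mul_vecMulVec', ← vnorm_sq, ← hb, smul_smul, smul_smul]
    module
  set B : Mat d d := 1 + (s / (1 + N)) • vecMulVec w w with hB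
  have hBB : B * B = 1 + s • vecMulVec w w := by
    rw [hB, hww]
    congr 2
    field_simp
    nlinarith
  have hpd : B.PosDef := Matrix.PosDef.one.add_posSemidef ((posSemidef_vecMulVec_self w).smul (by positivity))
  rw [← hBB, invSqrt_mul_self_of_posDef hpd]
  apply inv_eq_right_inv
  rw [hB, sub_eq_add_neg, ← neg_smul, hww]
  have : s / (1 + N) + -(s / (N * (1 + N))) + s / (1 + N) * -(s / (N * (1 + N))) * b = 0 := by
    field_simp
    nlinarith
  rw [this, zero_smul, add_zero]

theorem posDef_one_add_vecMulVec (w : Fin d → ℝ) {s : ℝ} (hs : 0 ≤ s) :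
    (1 + s • vecMulVec w w).PosDef :=
  Matrix.PosDef.one.add_posSemidef ((posSemidef_vecMulVec_self w).smul hs)

end Pos

/-! ### Measurability -/

section Meas
variable {n d : ℕ}

instance measurableSpaceMatrix {m n : Type*} : MeasurableSpace (Matrix m n ℝ) :=
  inferInstanceAs (MeasurableSpace (m → n → ℝ))

instance borelSpaceMatrix {m n : Type*} [Fintype m] [Fintype n] : BorelSpace (Matrix m n ℝ) :=
  inferInstanceAs (BorelSpace (m → n → ℝ))

theorem isClosed_posSemidef : IsClosed {A : Mat d d | A.PosSemidef} := by
  have : {A : Mat d d | A.PosSemidef} =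
      {A | Aᵀ = A} ∩ ⋂ x : Fin d → ℝ, {A | 0 ≤ x ⬝ᵥ (A *ᵥ x)} := by
    ext A; simp [posSemidef_iff']
  rw [this]
  refine (isClosed_eq (by fun_prop) (by fun_prop)).inter (isClosed_iInter fun x => ?_)
  exact isClosed_le continuous_const (by fun_prop)

theorem isClosed_atLeast (c : ℝ) : IsClosed {A : Mat d d | AtLeast c A} := by
  simp only [atLeast_iff]
  exact isClosed_posSemidef.preimage (f := fun A : Mat d d => A - c • 1)
    (by fun_prop)

theorem measurableSet_posDef : MeasurableSet {A : Mat d d | A.PosDef} := by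
  have : {A : Mat d d | A.PosDef} = {A | A.PosSemidef} ∩ {A | A.det = 0}ᶜ := by
    ext A
    simp only [mem_ofPred_eq, mem_inter_iff, mem_compl_iff]
    constructor
    · intro h
      exact ⟨h.posSemidef, h.det_pos.ne'⟩
    · rintro ⟨h1, h2⟩
      exact h1.posDef_iff_isUnit.2 ((isUnit_iff_isUnit_det _).2 (isUnit_iff_ne_zero.2 h2))
  rw [this]
  exact isClosed_posSemidef.measurableSet.inter
    (isClosed_eq (by fun_prop) continuous_const).measurableSet.compl

/-- A function on `[0, ∞)` which is a pointwise limit of continuous functions acts measurably on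
positive semidefinite matrices. -/
theorem measurable_cfc_of_tendsto {β : Type*} [MeasurableSpace β] {M : β → Mat d d}
    (hM : Measurable M) (hpsd : ∀ b, (M b).PosSemidef) {f : ℝ → ℝ} {F : ℕ → ℝ → ℝ}
    (hF : ∀ k, Continuous (F k))
    (hlim : ∀ x, 0 ≤ x → Filter.Tendsto (fun k => F k x) Filter.atTop (nhds (f x))) :
    Measurable fun b => cfc f (M b) := by
  have hpoly : ∀ k : ℕ, ∃ p : Polynomial ℝ, ∀ x ∈ Icc (0 : ℝ) k, |p.eval x - F k x| < 1 / (k + 1) := by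
    intro k
    exact exists_polynomial_near_of_continuousOn 0 k (F k) (hF k).continuousOn _ (by positivity)
  choose p hp using hpoly
  have hlim' : ∀ x, 0 ≤ x → Filter.Tendsto (fun k => (p k).eval x) Filter.atTop (nhds (f x)) := by
    intro x hx
    have h1 : Filter.Tendsto (fun k : ℕ => (p k).eval x - F k x) Filter.atTop (nhds 0) := by
      refine squeeze_zero_norm' ?_ (tendsto_one_div_add_atTop_nhds_zero_nat (𝕜 := ℝ))
      filter_upwards [Filter.eventually_ge_atTop ⌈x⌉₊] with k hk
      exact (hp k x ⟨hx, (Nat.le_ceil x).trans (by exact_mod_cast hk)⟩).le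
    simpa using h1.add (hlim x hx)
  have hmeas : ∀ k, Measurable fun b => cfc (fun x => (p k).eval x) (M b) := by
    intro k
    have : (fun b => cfc (fun x => (p k).eval x) (M b)) = fun b => Polynomial.aeval (M b) (p k) := by
      funext b
      exact cfc_polynomial (p k) (M b) (hpsd b).isHermitian
    rw [this]
    have hc : Continuous fun A : Mat d d => Polynomial.aeval A (p k) :=
      Polynomial.continuous_aeval (p k)
    exact hc.measurable.comp hM
  refine measurable_of_tendsto_metrizable hmeas ?_
  rw [tendsto_pi_nhds]
  intro b
  refine tendsto_cfc_fun ?_ (Filter.Eventually.of_forall fun k =>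
    (finite_spectrum (M b)).continuousOn _)
  rw [Metric.tendstoUniformlyOn_iff]
  intro e he
  have h1 : ∀ x ∈ spectrum ℝ (M b), ∀ᶠ k in Filter.atTop, dist (f x) ((p k).eval x) < e := by
    intro x hx
    have := Metric.tendsto_nhds.1 (hlim' x (spectrum_nonneg (hpsd b) hx)) e he
    simpa [dist_comm] using this
  exact ((finite_spectrum (M b)).eventually_all).2 h1

theorem measurable_invSqrt {β : Type*} [MeasurableSpace β] {M : β → Mat d d}
    (hM : Measurable M) (hpsd : ∀ b, (M b).PosSemidef) : Measurable fun b => invSqrt (M b) := by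
  refine measurable_cfc_of_tendsto hM hpsd (F := fun k x => √x / (|x| + 1 / ((k : ℝ) + 1))) ?_ ?_
  · intro k
    refine Continuous.div (by fun_prop) (by fun_prop) fun x => ?_
    positivity
  · intro x hx
    rcases hx.eq_or_lt with h0 | h0
    · subst h0; simp
    · have h1 : Filter.Tendsto (fun k : ℕ => |x| + 1 / ((k : ℝ) + 1)) Filter.atTop (nhds |x|) := by
        simpa using tendsto_const_nhds.add (tendsto_one_div_add_atTop_nhds_zero_nat (𝕜 := ℝ))
      have h2 := (tendsto_const_nhds (x := √x)).div h1 (abs_pos.2 h0.ne').ne'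
      have h3 : (√x)⁻¹ = √x / |x| := by
        rw [abs_of_pos h0, inv_eq_one_div, div_eq_div_iff (sqrt_pos.2 h0).ne' h0.ne', one_mul,
          mul_self_sqrt hx]
      rw [h3]
      exact h2

theorem measurable_matrix_mul {β : Type*} [MeasurableSpace β] {k l m : ℕ}
    {F : β → Mat k l} {G : β → Mat l m}
    (hF : Measurable F) (hG : Measurable G) : Measurable fun b => F b * G b := by
  have : Continuous fun p : Mat k l × Mat l m => p.1 * p.2 := by
    fun_prop
  exact this.measurable.comp (hF.prodMk hG)

theorem measurable_matrix_mulVec {β : Type*} [MeasurableSpace β] {k l : ℕ}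
    {F : β → Mat k l} {G : β → Fin l → ℝ}
    (hF : Measurable F) (hG : Measurable G) : Measurable fun b => F b *ᵥ G b := by
  have : Continuous fun p : Mat k l × (Fin l → ℝ) => p.1 *ᵥ p.2 := by
    fun_prop
  exact this.measurable.comp (hF.prodMk hG)

theorem measurable_matrix_vecMulVec {β : Type*} [MeasurableSpace β] {k l : ℕ}
    {F : β → Fin k → ℝ} {G : β → Fin l → ℝ}
    (hF : Measurable F) (hG : Measurable G) : Measurable fun b => vecMulVec (F b) (G b) := by
  have : Continuous fun p : (Fin k → ℝ) × (Fin l → ℝ) => vecMulVec p.1 p.2 := by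
    fun_prop
  exact this.measurable.comp (hF.prodMk hG)

theorem measurable_matrix_transpose {β : Type*} [MeasurableSpace β] {k l : ℕ}
    {F : β → Mat k l} (hF : Measurable F) : Measurable fun b => (F b)ᵀ := by
  have : Continuous fun p : Mat k l => pᵀ := by fun_prop
  exact this.measurable.comp hF

theorem measurable_matrix_inv {β : Type*} [MeasurableSpace β] {k : ℕ}
    {F : β → Mat k k} (hF : Measurable F) : Measurable fun b => (F b)⁻¹ := by
  simp only [Matrix.inv_def, Ring.inverse_eq_inv']
  have h1 : Continuous fun p : Mat k k => p.det := by fun_prop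
  have h2 : Continuous fun p : Mat k k => p.adjugate := by fun_prop
  exact (h1.measurable.comp hF).inv.smul (h2.measurable.comp hF)

theorem measurable_gram {β : Type*} [MeasurableSpace β] {k l : ℕ}
    {F : β → Mat k l} (hF : Measurable F) : Measurable fun b => (F b)ᵀ * F b :=
  measurable_matrix_mul (measurable_matrix_transpose hF) hF

theorem measurable_cosSim {β : Type*} [MeasurableSpace β] (U : Mat n d)
    {F : β → Mat n d} (hF : Measurable F) : Measurable fun b => cosSim U (F b) :=
  measurable_matrix_mul (measurable_matrix_mul measurable_const hF)
    (measurable_invSqrt (measurable_gram hF) fun _ => posSemidef_gram _)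

theorem measurable_mask : Measurable (mask : (Fin n → Bool) → Mat n n) :=
  measurable_of_countable _

end Meas

/-! ### Ordinary differential equations and the Euler scheme -/

section ODE
variable {E : Type*} [NormedAddCommGroup E] [NormedSpace ℝ E]

theorem one_add_div_pow_le_exp {C T : ℝ} (hC : 0 ≤ C) {n k : ℕ} (hn : 0 < n)
    (hk : (k : ℝ) ≤ n * T) : (1 + C / n) ^ k ≤ exp (C * T) := by
  have hn' : (0 : ℝ) < n := by exact_mod_cast hn
  calc (1 + C / n) ^ k ≤ exp (C / n) ^ k := by
        gcongr
        rw [add_comm]; exact Real.add_one_le_exp _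
    _ = exp (k * (C / n)) := by rw [← Real.exp_nat_mul]
    _ ≤ exp (C * T) := by
        apply Real.exp_le_exp.2
        rw [mul_div_assoc', div_le_iff₀ hn']
        nlinarith

theorem exists_integral_solution [CompleteSpace E] {g : ℝ → E → E} {T L : ℝ} (hT : 0 ≤ T)
    (hL : 0 ≤ L) (hlip : ∀ s ∈ Icc 0 T, ∀ x y, ‖g s x - g s y‖ ≤ L * ‖x - y‖)
    (hint : ∀ u, Continuous u → IntervalIntegrable (fun s => g s (u s)) volume 0 T) (x₀ : E) :
    ∃ Q : ℝ → E, Continuous Q ∧ ∀ t ∈ Icc 0 T, Q t = x₀ + ∫ s in (0 : ℝ)..t, g s (Q s) := by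
  set lam : ℝ := 2 * (L + 1)
  have hlam0 : 0 < lam := by positivity
  let ext : C(Icc 0 T, E) → ℝ → E := fun y s => exp (lam * s) • y (projIcc 0 T hT s)
  have hext : ∀ y, Continuous (ext y) := fun y => by
    have : Continuous fun s => y (projIcc 0 T hT s) := y.continuous.comp continuous_projIcc
    fun_prop
  have hprim : ∀ y, ContinuousOn (fun t => ∫ s in (0 : ℝ)..t, g s (ext y s)) (Icc 0 T) := fun y => by
    have h := hint _ (hext y)
    rw [intervalIntegrable_iff_integrableOn_Icc_of_le hT] at h
    have := intervalIntegral.continuousOn_primitive_interval (a := 0) (b := T)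
      (by rwa [uIcc_of_le hT] : IntegrableOn (fun s => g s (ext y s)) (uIcc 0 T) volume)
    rwa [uIcc_of_le hT] at this
  let Ψ : C(Icc 0 T, E) → C(Icc 0 T, E) := fun y =>
    ⟨fun t => exp (-(lam * t)) • (x₀ + ∫ s in (0 : ℝ)..t, g s (ext y s)), by
      have h1 : Continuous fun t : Icc 0 T => ∫ s in (0 : ℝ)..t, g s (ext y s) :=
        continuousOn_iff_continuous_domRestrict.1 (hprim y)
      fun_prop⟩
  have hcontr : ContractingWith (1 / 2) Ψ := by
    refine ⟨by norm_num [← NNReal.coe_lt_coe], LipschitzWith.of_dist_le_mul fun y z => ?_⟩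
    rw [ContinuousMap.dist_le (by positivity)]
    intro t
    have ht := t.2
    have hyi : ∀ y, IntervalIntegrable (fun s => g s (ext y s)) volume 0 t := fun y =>
      (hint _ (hext y)).mono_set (by
        rw [uIcc_of_le ht.1, uIcc_of_le hT]; exact Icc_subset_Icc le_rfl ht.2)
    have h1 : Ψ y t - Ψ z t = exp (-(lam * t)) •
        ∫ s in (0 : ℝ)..t, (g s (ext y s) - g s (ext z s)) := by
      rw [intervalIntegral.integral_sub (hyi y) (hyi z)]
      change exp (-(lam * t)) • (x₀ + ∫ s in (0 : ℝ)..t, g s (ext y s)) -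
        exp (-(lam * t)) • (x₀ + ∫ s in (0 : ℝ)..t, g s (ext z s)) = _
      rw [← smul_sub]; congr 1; abel
    have h2 : ‖∫ s in (0 : ℝ)..t, (g s (ext y s) - g s (ext z s))‖ ≤
        ∫ s in (0 : ℝ)..t, L * dist y z * exp (lam * s) := by
      refine intervalIntegral.norm_integral_le_of_norm_le ht.1 ?_ ?_
      · refine ae_of_all _ fun s hs => ?_
        have hs' : s ∈ Icc 0 T := ⟨hs.1.le, hs.2.trans ht.2⟩
        refine (hlip s hs' _ _).trans ?_
        have h3 : ‖ext y s - ext z s‖ ≤ exp (lam * s) * dist y z := by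
          change ‖exp (lam * s) • y (projIcc 0 T hT s) -
            exp (lam * s) • z (projIcc 0 T hT s)‖ ≤ _
          rw [← smul_sub, norm_smul, norm_eq_abs, abs_of_pos (exp_pos _), ← dist_eq_norm]
          gcongr
          exact ContinuousMap.dist_apply_le_dist _
        calc L * ‖ext y s - ext z s‖ ≤ L * (exp (lam * s) * dist y z) := by gcongr
          _ = _ := by ring
      · exact (by fun_prop : Continuous fun s => L * dist y z * exp (lam * s)).intervalIntegrable _ _
    have h3 : ∫ s in (0 : ℝ)..t, L * dist y z * exp (lam * s) =
        L * dist y z * ((exp (lam * t) - 1) / lam) := by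
      rw [intervalIntegral.integral_const_mul, intervalIntegral.integral_comp_mul_left _ hlam0.ne']
      simp [div_eq_inv_mul]
    rw [dist_eq_norm, h1, norm_smul, norm_eq_abs, abs_of_pos (exp_pos _)]
    calc exp (-(lam * t)) * ‖∫ s in (0 : ℝ)..t, (g s (ext y s) - g s (ext z s))‖
        ≤ exp (-(lam * t)) * (L * dist y z * ((exp (lam * t) - 1) / lam)) := by
          rw [← h3]; gcongr
      _ = L / lam * (1 - exp (-(lam * t))) * dist y z := by
          have : exp (-(lam * t)) * exp (lam * t) = 1 := by
            rw [← Real.exp_add]; simp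
          field_simp
          linear_combination dist y z * L * this
      _ ≤ 1 / 2 * 1 * dist y z := by
          have h4 : exp (-(lam * t)) ≤ 1 := Real.exp_le_one_iff.2 (by
            have := ht.1
            have : 0 ≤ lam * t := by positivity
            linarith)
          have h5 : L / lam ≤ 1 / 2 := by
            rw [div_le_div_iff₀ hlam0 two_pos]; linarith
          have h6 := exp_pos (-(lam * t))
          refine mul_le_mul_of_nonneg_right (mul_le_mul h5 (by linarith) (by linarith) (by norm_num))
            dist_nonneg
      _ = _ := by simp
  obtain ⟨y, hy⟩ : ∃ y, Ψ y = y := ⟨_, hcontr.fixedPoint_isFixedPt⟩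
  refine ⟨ext y, hext y, fun t ht => ?_⟩
  have h1 : Ψ y ⟨t, ht⟩ = y ⟨t, ht⟩ := by rw [hy]
  change exp (lam * t) • y (projIcc 0 T hT t) = _
  rw [projIcc_of_mem hT ht, ← h1]
  change exp (lam * t) • exp (-(lam * t)) • (x₀ + ∫ s in (0 : ℝ)..t, g s (ext y s)) = _
  rw [smul_smul, ← Real.exp_add]
  simp

theorem eqOn_of_sub_eq_integral {u v φ : ℝ → E} {T L : ℝ} (hT : 0 ≤ T) (hL : 0 ≤ L)
    (hu : ContinuousOn u (Icc 0 T)) (hv : ContinuousOn v (Icc 0 T))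
    (h : ∀ t ∈ Icc 0 T, u t - v t = ∫ s in (0 : ℝ)..t, φ s)
    (hφ : ∀ s ∈ Icc 0 T, ‖φ s‖ ≤ L * ‖u s - v s‖) : EqOn u v (Icc 0 T) := by
  let e : ℝ → ℝ := IccExtend hT fun s : Icc 0 T => ‖u s - v s‖
  have hec : Continuous e := by
    refine Continuous.Icc_extend' ?_
    exact continuousOn_iff_continuous_domRestrict.1 (hu.sub hv).norm
  have he : ∀ s ∈ Icc 0 T, e s = ‖u s - v s‖ := fun s hs => IccExtend_of_mem hT _ hs
  let w : ℝ → ℝ := fun t => ∫ s in (0 : ℝ)..t, e s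
  have hw : ∀ t, HasDerivAt w (e t) t := fun t => (hec.integral_hasStrictDerivAt 0 t).hasDerivAt
  have hle : ∀ t ∈ Icc 0 T, e t ≤ L * w t := by
    intro t ht
    rw [he t ht, h t ht, ← intervalIntegral.integral_const_mul]
    refine intervalIntegral.norm_integral_le_of_norm_le ht.1 ?_
      ((continuous_const.mul hec).intervalIntegrable _ _)
    refine ae_of_all _ fun s hs => ?_
    have hs' : s ∈ Icc 0 T := ⟨hs.1.le, hs.2.trans ht.2⟩
    rw [he s hs']; exact hφ s hs'
  have he0 : ∀ t ∈ Icc 0 T, 0 ≤ e t := fun t ht => by rw [he t ht]; exact norm_nonneg _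
  have hw0 := eq_zero_of_abs_deriv_le_mul_abs_self_of_eq_zero_right (K := L) (a := 0) (b := T) (f := w)
    (f' := e) (fun t _ => (hw t).continuousAt.continuousWithinAt)
    (fun t _ => (hw t).hasDerivWithinAt) (by simp [w]) (fun t ht => by
      have ht' := Ico_subset_Icc_self ht
      rw [norm_eq_abs, abs_of_nonneg (he0 t ht')]
      exact (hle t ht').trans (mul_le_mul_of_nonneg_left (le_abs_self _) hL))
  intro t ht
  have := hle t ht
  rw [hw0 t ht, mul_zero, he t ht] at this
  exact sub_eq_zero.1 (norm_le_zero_iff.1 this)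

theorem euler_error [CompleteSpace E] {g : ℝ → E → E} {Q : ℝ → E} {T L M : ℝ} {V : ℝ → ℝ} {x₀ : E} (hL : 0 ≤ L)
    (hM : 0 ≤ M)
    (hQ : ∀ t ∈ Icc 0 T, Q t = x₀ + ∫ s in (0 : ℝ)..t, g s (Q s))
    (hint : IntervalIntegrable (fun s => g s (Q s)) volume 0 T)
    (hlip : ∀ s ∈ Icc 0 T, ∀ x y, ‖g s x - g s y‖ ≤ L * ‖x - y‖)
    (hbd : ∀ s ∈ Icc 0 T, ‖g s (Q s)‖ ≤ M)
    (hV : ∀ r s, 0 ≤ r → r ≤ s → s ≤ T → ‖g s (Q r) - g r (Q r)‖ ≤ V s - V r)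
    {n : ℕ} (hn : 0 < n) {s : ℕ → E}
    (hs : ∀ k, s (k + 1) = s k + (1 / (n : ℝ)) • g ((k : ℝ) / n) (s k))
    {k : ℕ} (hk : (k : ℝ) ≤ n * T) :
    ‖s k - Q ((k : ℝ) / n)‖ ≤
      exp (L * T) * (‖s 0 - Q 0‖ + (1 / n) * (L * M * T + (V T - V 0))) := by
  have hn' : (0 : ℝ) < n := by exact_mod_cast hn
  have hVmono : ∀ r s, 0 ≤ r → r ≤ s → s ≤ T → V r ≤ V s := fun r s h1 h2 h3 => by
    have := (norm_nonneg _).trans (hV r s h1 h2 h3); linarith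
  have hmem : ∀ j : ℕ, (j : ℝ) ≤ n * T → (j : ℝ) / n ∈ Icc 0 T := fun j hj =>
    ⟨by positivity, by rw [div_le_iff₀ hn']; linarith⟩
  have hii : ∀ a b, a ∈ Icc 0 T → b ∈ Icc 0 T →
      IntervalIntegrable (fun s => g s (Q s)) volume a b := fun a b ha hb =>
    hint.mono_set (by
      rw [uIcc_of_le (ha.1.trans ha.2)]
      exact uIcc_subset_Icc ha hb)
  have hincr : ∀ a b, a ∈ Icc 0 T → b ∈ Icc 0 T → Q b - Q a = ∫ s in a..b, g s (Q s) := by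
    intro a b ha hb
    have h0 : (0 : ℝ) ∈ Icc 0 T := ⟨le_rfl, ha.1.trans ha.2⟩
    rw [hQ a ha, hQ b hb, ← intervalIntegral.integral_add_adjacent_intervals (hii 0 a h0 ha)
      (hii a b ha hb)]
    abel
  have hmain : ∀ k : ℕ, (k : ℝ) ≤ n * T → ‖s k - Q ((k : ℝ) / n)‖ ≤
      (1 + L / n) ^ k * (‖s 0 - Q 0‖ + (1 / n) * (L * M * (k / n) + (V (k / n) - V 0))) := by
    intro k
    induction k with
    | zero => intro _; simp
    | succ k ih =>
      intro hk
      have hk' : (k : ℝ) ≤ n * T := le_trans (by push_cast; linarith) hk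
      have ih := ih hk'
      set r : ℝ := (k : ℝ) / n with hr
      set r' : ℝ := ((k + 1 : ℕ) : ℝ) / n with hr'
      have hrr : r' = r + 1 / n := by rw [hr, hr']; push_cast; field_simp
      have hrm := hmem k hk'
      have hrm' := hmem (k + 1) hk
      have hle : r ≤ r' := by rw [hrr]; have : 0 < 1 / (n : ℝ) := by positivity
                              linarith
      have hloc : ‖∫ s in r..r', (g s (Q s) - g r (Q r))‖ ≤
          (L * M * (1 / n) + (V r' - V r)) * |r' - r| := by
        refine intervalIntegral.norm_integral_le_of_norm_le_const fun x hx => ?_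
        rw [uIoc_of_le hle] at hx
        have hxm : x ∈ Icc 0 T := ⟨hrm.1.trans hx.1.le, hx.2.trans hrm'.2⟩
        have h1 : ‖Q x - Q r‖ ≤ M * (1 / n) := by
          rw [hincr r x hrm hxm]
          refine (intervalIntegral.norm_integral_le_of_norm_le_const (C := M) fun y hy => ?_).trans ?_
          · rw [uIoc_of_le hx.1.le] at hy
            exact hbd y ⟨hrm.1.trans hy.1.le, hy.2.trans hxm.2⟩
          · gcongr
            rw [abs_of_nonneg (by linarith [hx.1])]; linarith [hx.2]
        calc ‖g x (Q x) - g r (Q r)‖ ≤ ‖g x (Q x) - g x (Q r)‖ + ‖g x (Q r) - g r (Q r)‖ := by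
              refine le_trans (le_of_eq ?_) (norm_add_le _ _); congr 1; abel
          _ ≤ L * (M * (1 / n)) + (V r' - V r) := by
              gcongr
              · exact (hlip x hxm _ _).trans (by gcongr)
              · exact (hV r x hrm.1 hx.1.le hxm.2).trans (by
                  have := hVmono x r' hxm.1 hx.2 hrm'.2; linarith)
          _ = _ := by ring
      have hdec : s (k + 1) - Q r' = (s k - Q r) + (1 / (n : ℝ)) • (g r (s k) - g r (Q r)) -
          ∫ s in r..r', (g s (Q s) - g r (Q r)) := by
        rw [intervalIntegral.integral_sub (hii r r' hrm hrm') intervalIntegrable_const,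
          ← hincr r r' hrm hrm', intervalIntegral.integral_const, hs k, hrr]
        simp only [add_sub_cancel_left, smul_sub]
        abel
      rw [hdec]
      have habs : |r' - r| = 1 / n := by
        rw [hrr, add_sub_cancel_left, abs_of_pos (by positivity)]
      rw [habs] at hloc
      have h2 : ‖(1 / (n : ℝ)) • (g r (s k) - g r (Q r))‖ ≤ L / n * ‖s k - Q r‖ := by
        rw [norm_smul, norm_eq_abs, abs_of_pos (by positivity)]
        calc 1 / (n : ℝ) * ‖g r (s k) - g r (Q r)‖ ≤ 1 / (n : ℝ) * (L * ‖s k - Q r‖) := by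
              gcongr; exact hlip r hrm _ _
          _ = _ := by ring
      have hq : 1 ≤ (1 + L / n) ^ (k + 1) := one_le_pow₀ (by
        have : 0 ≤ L / n := by positivity
        linarith)
      have hloc0 : 0 ≤ L * M * (1 / n) + (V r' - V r) := by
        have h1 := hVmono r r' hrm.1 hle hrm'.2
        have : 0 ≤ L * M * (1 / n) := by positivity
        linarith
      calc _ ≤ ‖s k - Q r‖ + L / n * ‖s k - Q r‖ + (L * M * (1 / n) + (V r' - V r)) * (1 / n) := by
            refine (norm_sub_le _ _).trans (add_le_add ((norm_add_le _ _).trans ?_) hloc)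
            gcongr
        _ = (1 + L / n) * ‖s k - Q r‖ + 1 * ((L * M * (1 / n) + (V r' - V r)) * (1 / n)) := by ring
        _ ≤ (1 + L / n) * ((1 + L / n) ^ k * (‖s 0 - Q 0‖ + (1 / n) * (L * M * r + (V r - V 0)))) +
            (1 + L / n) ^ (k + 1) * ((L * M * (1 / n) + (V r' - V r)) * (1 / n)) := by
            gcongr
        _ = _ := by rw [hrr]; ring
  have hkm := hmem k hk
  refine (hmain k hk).trans ?_
  have h1 := hVmono 0 (k / n) le_rfl hkm.1 hkm.2
  have h2 := hVmono (k / n) T hkm.1 hkm.2 le_rfl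
  have h3 : 0 ≤ (k : ℝ) / n := hkm.1
  have h4 : 0 ≤ V (k / n) - V 0 := by linarith
  gcongr
  · exact one_add_div_pow_le_exp hL hn hk
  · exact hkm.2

theorem norm_sub_le_of_integral {g : ℝ → E → E} {Q : ℝ → E} {T M : ℝ} {x₀ : E}
    (hQ : ∀ t ∈ Icc 0 T, Q t = x₀ + ∫ s in (0 : ℝ)..t, g s (Q s))
    (hint : IntervalIntegrable (fun s => g s (Q s)) volume 0 T)
    (hbd : ∀ s ∈ Icc 0 T, ‖g s (Q s)‖ ≤ M) {a b : ℝ} (ha : a ∈ Icc 0 T) (hb : b ∈ Icc 0 T) :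
    ‖Q b - Q a‖ ≤ M * |b - a| := by
  have hii : ∀ a b, a ∈ Icc 0 T → b ∈ Icc 0 T →
      IntervalIntegrable (fun s => g s (Q s)) volume a b := fun a b ha hb =>
    hint.mono_set (by
      rw [uIcc_of_le (ha.1.trans ha.2)]
      exact uIcc_subset_Icc ha hb)
  have h0 : (0 : ℝ) ∈ Icc 0 T := ⟨le_rfl, ha.1.trans ha.2⟩
  have : Q b - Q a = ∫ s in a..b, g s (Q s) := by
    rw [hQ a ha, hQ b hb, ← intervalIntegral.integral_add_adjacent_intervals (hii 0 a h0 ha)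
      (hii a b ha hb)]
    abel
  rw [this]
  refine intervalIntegral.norm_integral_le_of_norm_le_const fun y hy => hbd y ?_
  exact uIcc_subset_Icc ha hb (uIoc_subset_uIcc hy)

/-- Uniqueness for an autonomous equation whose right-hand side is Lipschitz near every point of
one of the two solutions. -/
theorem eqOn_of_hasDerivWithinAt {f : E → E} {u v : ℝ → E} {T : ℝ}
    (hu : ∀ t ∈ Icc 0 T, HasDerivWithinAt u (f (u t)) (Icc 0 T) t)
    (hv : ∀ t ∈ Icc 0 T, HasDerivWithinAt v (f (v t)) (Icc 0 T) t) (h0 : u 0 = v 0)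
    (hloc : ∀ t ∈ Icc 0 T, ∃ K : NNReal, ∃ s ∈ nhds (v t), LipschitzOnWith K f s) :
    EqOn u v (Icc 0 T) := by
  rcases lt_or_ge T 0 with hT | hT
  · intro t ht; exact absurd (ht.1.trans ht.2) (not_le.2 hT)
  have huc : ContinuousOn u (Icc 0 T) := fun t ht => (hu t ht).continuousWithinAt
  have hvc : ContinuousOn v (Icc 0 T) := fun t ht => (hv t ht).continuousWithinAt
  have hclosed : IsClosed ({t | u t = v t} ∩ Icc 0 T) := by
    have : {t | u t = v t} ∩ Icc 0 T = Icc 0 T ∩ (fun t => u t - v t) ⁻¹' {0} := by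
      ext t; simp [sub_eq_zero, and_comm]
    rw [this]
    exact (huc.sub hvc).preimage_isClosed_of_isClosed isClosed_Icc isClosed_singleton
  refine hclosed.Icc_subset_of_forall_mem_nhdsWithin h0 ?_
  rintro x ⟨hx, hxI⟩
  have hx' : u x = v x := hx
  have hxm := Ico_subset_Icc_self hxI
  obtain ⟨K, s, hs, hK⟩ := hloc x hxm
  have h1 : ∀ᶠ t in nhdsWithin x (Icc 0 T), u t ∈ s ∧ v t ∈ s :=
    ((huc x hxm).eventually_mem (by rwa [hx'])).and ((hvc x hxm).eventually_mem hs)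
  have hnh : nhdsWithin x (Icc x T) ≤ nhdsWithin x (Icc 0 T) :=
    nhdsWithin_mono _ (Icc_subset_Icc hxI.1 le_rfl)
  have h2 := hnh h1
  obtain ⟨b, hb, hbs⟩ := (mem_nhdsGE_iff_exists_Icc_subset).1
    (by rw [← nhdsWithin_Icc_eq_nhdsGE hxI.2]; exact h2)
  set c := min b T
  have hxc : x < c := lt_min hb hxI.2
  have hsub : Icc x c ⊆ Icc 0 T := Icc_subset_Icc hxI.1 (min_le_right _ _)
  have hder : ∀ (w : ℝ → E), (∀ t ∈ Icc 0 T, HasDerivWithinAt w (f (w t)) (Icc 0 T) t) →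
      ∀ t ∈ Ico x c, HasDerivWithinAt w (f (w t)) (Ici t) t := by
    intro w hw t ht
    have htm := hsub (Ico_subset_Icc_self ht)
    have h3 := (hw t htm).mono (Icc_subset_Icc htm.1 le_rfl : Icc t T ⊆ Icc 0 T)
    exact h3.mono_of_mem_nhdsWithin (Icc_mem_nhdsGE (ht.2.trans_le (min_le_right _ _)))
  have heq : EqOn u v (Icc x c) := by
    refine ODE_solution_unique_of_mem_Icc_right (v := fun _ => f) (s := fun _ => s) (K := K)
      (fun _ _ => hK) (huc.mono hsub) (hder u hu) ?_ (hvc.mono hsub) (hder v hv) ?_ hx'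
    · intro t ht
      exact (hbs ⟨ht.1, (ht.2.trans_le (min_le_left _ _)).le⟩).1
    · intro t ht
      exact (hbs ⟨ht.1, (ht.2.trans_le (min_le_left _ _)).le⟩).2
  refine Filter.mem_of_superset (Ioc_mem_nhdsGT hxc) fun t ht => heq ⟨ht.1.le, ht.2⟩

end ODE

theorem continuous_of_norm_sub_le {E : Type*} [SeminormedAddCommGroup E] {L : ℝ} (hL : 0 ≤ L) {g : E → E}
    (hg : ∀ x y, ‖g x - g y‖ ≤ L * ‖x - y‖) : Continuous g :=
  (LipschitzWith.of_dist_le_mul (K := ⟨L, hL⟩) fun x y => by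
    rw [dist_eq_norm, dist_eq_norm]; exact hg x y).continuous

/-! ### Markov chains driven by independent draws -/

section Chain
variable {Ω 𝒳 𝒟 : Type*} [MeasurableSpace Ω] [MeasurableSpace 𝒳] [MeasurableSpace 𝒟]

theorem indepFun_prodMk_left {α β γ : Type*} [MeasurableSpace α] [MeasurableSpace β]
    [MeasurableSpace γ] {P : Measure Ω} [IsProbabilityMeasure P] {f : Ω → α} {g : Ω → β} {h : Ω → γ}
    (hf : Measurable f) (hg : Measurable g) (hh : Measurable h)
    (h1 : IndepFun f (fun ω => (g ω, h ω)) P) (h2 : IndepFun g h P) :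
    IndepFun (fun ω => (f ω, g ω)) h P := by
  have e1 := (indepFun_iff_map_prod_eq_prod_map_map hf.aemeasurable
    (hg.prodMk hh).aemeasurable).1 h1
  have e2 := (indepFun_iff_map_prod_eq_prod_map_map hg.aemeasurable hh.aemeasurable).1 h2
  have e3 : IndepFun f g P := h1.comp measurable_id measurable_fst
  have e4 := (indepFun_iff_map_prod_eq_prod_map_map hf.aemeasurable hg.aemeasurable).1 e3
  rw [indepFun_iff_map_prod_eq_prod_map_map (hf.prodMk hg).aemeasurable hh.aemeasurable, e4]
  have : IsProbabilityMeasure (P.map f) := Measure.isProbabilityMeasure_map hf.aemeasurable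
  have : IsProbabilityMeasure (P.map g) := Measure.isProbabilityMeasure_map hg.aemeasurable
  have : IsProbabilityMeasure (P.map h) := Measure.isProbabilityMeasure_map hh.aemeasurable
  apply (MeasurableEquiv.prodAssoc (α := α) (β := β) (γ := γ)).map_measurableEquiv_injective
  rw [Measure.prodAssoc_prod, ← e2, ← e1, Measure.map_map (MeasurableEquiv.measurable _)
    ((hf.prodMk hg).prodMk hh)]
  rfl

theorem lintegral_of_indepFun {P : Measure Ω} [IsProbabilityMeasure P] {Y : Ω → 𝒳} {ξ : Ω → 𝒟}
    (hY : Measurable Y) (hξ : Measurable ξ) (h : IndepFun Y ξ P) {F : 𝒳 × 𝒟 → ENNReal}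
    (hF : Measurable F) :
    ∫⁻ ω, F (Y ω, ξ ω) ∂P = ∫⁻ ω, ∫⁻ z, F (Y ω, z) ∂(P.map ξ) ∂P := by
  have : IsProbabilityMeasure (P.map Y) := Measure.isProbabilityMeasure_map hY.aemeasurable
  have : IsProbabilityMeasure (P.map ξ) := Measure.isProbabilityMeasure_map hξ.aemeasurable
  have e := (indepFun_iff_map_prod_eq_prod_map_map hY.aemeasurable hξ.aemeasurable).1 h
  rw [← lintegral_map hF (hY.prodMk hξ), e, lintegral_prod _ hF.aemeasurable,
    lintegral_map hF.lintegral_prod_right' hY]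

variable {P : Measure Ω} [IsProbabilityMeasure P] {X₀ : Ω → 𝒳} {ξ : ℕ → Ω → 𝒟}
  {Φ : ℕ → 𝒳 → 𝒟 → 𝒳} {X : Ω → ℕ → 𝒳}

omit [MeasurableSpace Ω] in
theorem chain_eq_of_past (hΦ : ∀ k, Measurable fun p : 𝒳 × 𝒟 => Φ k p.1 p.2)
    (hX0 : ∀ ω, X ω 0 = X₀ ω) (hX : ∀ ω k, X ω (k + 1) = Φ k (X ω k) (ξ k ω)) (k : ℕ) :
    ∃ ψ : 𝒳 × (Finset.range k → 𝒟) → 𝒳, Measurable ψ ∧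
      ∀ ω, X ω k = ψ (X₀ ω, fun j => ξ j ω) := by
  induction k with
  | zero => exact ⟨Prod.fst, measurable_fst, hX0⟩
  | succ k ih =>
    obtain ⟨ψ, hψ, hψX⟩ := ih
    refine ⟨fun p => Φ k (ψ (p.1, fun j => p.2 ⟨j, Finset.mem_range.2
      ((Finset.mem_range.1 j.2).trans (Nat.lt_succ_self k))⟩)) (p.2 ⟨k, Finset.self_mem_range_succ k⟩),
      ?_, fun ω => ?_⟩
    · refine (hΦ k).comp ((hψ.comp (measurable_fst.prodMk ?_)).prodMk ?_)
      · exact measurable_pi_lambda _ fun j => (measurable_pi_apply _).comp measurable_snd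
      · exact (measurable_pi_apply _).comp measurable_snd
    · rw [hX, hψX]

theorem measurable_chain (hX₀ : Measurable X₀) (hξ : ∀ k, Measurable (ξ k))
    (hΦ : ∀ k, Measurable fun p : 𝒳 × 𝒟 => Φ k p.1 p.2)
    (hX0 : ∀ ω, X ω 0 = X₀ ω) (hX : ∀ ω k, X ω (k + 1) = Φ k (X ω k) (ξ k ω)) (k : ℕ) :
    Measurable fun ω => X ω k := by
  induction k with
  | zero => simpa only [hX0] using hX₀
  | succ k ih =>
    simp only [hX]
    exact (hΦ k).comp (ih.prodMk (hξ k))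

theorem indepFun_chain (hX₀ : Measurable X₀) (hξ : ∀ k, Measurable (ξ k)) (hind : iIndepFun ξ P)
    (hind0 : IndepFun X₀ (fun ω k => ξ k ω) P)
    (hΦ : ∀ k, Measurable fun p : 𝒳 × 𝒟 => Φ k p.1 p.2)
    (hX0 : ∀ ω, X ω 0 = X₀ ω) (hX : ∀ ω k, X ω (k + 1) = Φ k (X ω k) (ξ k ω)) (k : ℕ) :
    IndepFun (fun ω => (X₀ ω, X ω k)) (ξ k) P := by
  obtain ⟨ψ, hψ, hψX⟩ := chain_eq_of_past (X₀ := X₀) hΦ hX0 hX k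
  have hpast : Measurable fun ω (j : Finset.range k) => ξ j ω :=
    measurable_pi_lambda _ fun j => hξ j
  have h1 : IndepFun X₀ (fun ω => ((fun j : Finset.range k => ξ j ω), ξ k ω)) P := by
    refine hind0.comp (ψ := fun s : ℕ → 𝒟 => ((fun j : Finset.range k => s j), s k)) measurable_id ?_
    exact (measurable_pi_lambda _ fun j => measurable_pi_apply _).prodMk (measurable_pi_apply _)
  have h2 : IndepFun (fun ω (j : Finset.range k) => ξ j ω) (ξ k) P := by
    have := hind.indepFun_finset (Finset.range k) {k} (by simp) hξ
    exact this.comp (ψ := fun s : ({k} : Finset ℕ) → 𝒟 => s ⟨k, mem_singleton_self k⟩)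
      measurable_id (measurable_pi_apply _)
  have h3 := indepFun_prodMk_left hX₀ hpast (hξ k) h1 h2
  have h4 := h3.comp (φ := fun p => (p.1, ψ p)) (measurable_fst.prodMk hψ) measurable_id
  have : (fun ω => (X₀ ω, X ω k)) =
      (fun p : 𝒳 × (Finset.range k → 𝒟) => (p.1, ψ p)) ∘ fun ω => (X₀ ω, fun j => ξ j ω) := by
    funext ω; simp [hψX]
  rw [this]
  exact h4

theorem lintegral_chain_le (hX₀ : Measurable X₀) (hξ : ∀ k, Measurable (ξ k)) (hind : iIndepFun ξ P)
    (hind0 : IndepFun X₀ (fun ω k => ξ k ω) P)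
    (hΦ : ∀ k, Measurable fun p : 𝒳 × 𝒟 => Φ k p.1 p.2)
    (hX0 : ∀ ω, X ω 0 = X₀ ω) (hX : ∀ ω k, X ω (k + 1) = Φ k (X ω k) (ξ k ω))
    {μ : Measure 𝒟} (hμ : ∀ k, P.map (ξ k) = μ) {G : Set 𝒳} (hG : MeasurableSet G)
    {V : ℕ → 𝒳 × 𝒳 → ENNReal} (hV : ∀ k, Measurable (V k)) {c : ENNReal} {K : ℕ}
    (hstep : ∀ k < K, ∀ ω, X₀ ω ∈ G →
      ∫⁻ z, V (k + 1) (X₀ ω, Φ k (X ω k) z) ∂μ ≤ c * V k (X₀ ω, X ω k)) :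
    ∀ k ≤ K, ∫⁻ ω in X₀ ⁻¹' G, V k (X₀ ω, X ω k) ∂P ≤ c ^ k * ∫⁻ ω in X₀ ⁻¹' G, V 0 (X₀ ω, X₀ ω) ∂P := by
  have hS : MeasurableSet (X₀ ⁻¹' G) := hX₀ hG
  intro k
  induction k with
  | zero => intro _; simp [hX0]
  | succ k ih =>
    intro hk
    have hXk := measurable_chain hX₀ hξ hΦ hX0 hX k
    have hindk := indepFun_chain hX₀ hξ hind hind0 hΦ hX0 hX k
    let F : (𝒳 × 𝒳) × 𝒟 → ENNReal := fun p =>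
      (Prod.fst ⁻¹' (Prod.fst ⁻¹' G)).indicator
        (fun p : (𝒳 × 𝒳) × 𝒟 => V (k + 1) (p.1.1, Φ k p.1.2 p.2)) p
    have hFm : Measurable F := by
      refine Measurable.indicator ?_ ((measurable_fst.comp measurable_fst) hG)
      exact (hV (k + 1)).comp ((measurable_fst.comp measurable_fst).prodMk
        ((hΦ k).comp ((measurable_snd.comp measurable_fst).prodMk measurable_snd)))
    have h1 : ∫⁻ ω in X₀ ⁻¹' G, V (k + 1) (X₀ ω, X ω (k + 1)) ∂P =
        ∫⁻ ω, F ((X₀ ω, X ω k), ξ k ω) ∂P := by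
      rw [← lintegral_indicator hS]
      refine lintegral_congr fun ω => ?_
      by_cases h : X₀ ω ∈ G
      · simp [F, indicator, h, hX]
      · simp [F, indicator, h]
    rw [h1, lintegral_of_indepFun (hX₀.prodMk hXk) (hξ k) hindk hFm, hμ]
    calc ∫⁻ ω, ∫⁻ z, F ((X₀ ω, X ω k), z) ∂μ ∂P
        ≤ ∫⁻ ω, (X₀ ⁻¹' G).indicator (fun ω => c * V k (X₀ ω, X ω k)) ω ∂P := by
          refine lintegral_mono fun ω => ?_
          by_cases h : X₀ ω ∈ G
          · have := hstep k (Nat.lt_of_succ_le hk) ω h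
            simpa [F, indicator, h] using this
          · simp [F, indicator, h]
      _ = c * ∫⁻ ω in X₀ ⁻¹' G, V k (X₀ ω, X ω k) ∂P := by
          rw [lintegral_indicator hS]
          exact lintegral_const_mul _ ((hV k).comp (hX₀.prodMk hXk))
      _ ≤ c * (c ^ k * ∫⁻ ω in X₀ ⁻¹' G, V 0 (X₀ ω, X₀ ω) ∂P) := by
          gcongr; exact ih (Nat.le_of_succ_le hk)
      _ = _ := by rw [pow_succ']; ring

end Chain

/-! ### Stochastic approximation -/

section Approximation

/-- Bounds on one step `x ↦ φ x z` of a chain, `z ∼ μ`, seen through the observable `S`: the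
increments of `S` have size `1 / n` and mean `f (S x) / n` up to an error controlled by `h`. -/
structure DriftBounds {E 𝒳 𝒟 : Type*} [NormedAddCommGroup E] [NormedSpace ℝ E] [MeasurableSpace 𝒟]
    (C : ℝ) (n : ℕ) (μ : Measure 𝒟) (S : 𝒳 → E) (h : 𝒳 → ℝ) (φ : 𝒳 → 𝒟 → 𝒳) (f : E → E) (x : 𝒳) :
    Prop where
  sq_integrable : Integrable (fun z => ‖S (φ x z) - S x‖ ^ 2) μ
  sq_le : ∫ z, ‖S (φ x z) - S x‖ ^ 2 ∂μ ≤ C / n ^ 2 * (1 + ‖S x‖ ^ 2)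
  mean_le : ‖∫ z, (S (φ x z) - S x) ∂μ - (1 / (n : ℝ)) • f (S x)‖ ^ 2 ≤
    C / n ^ 2 * (h x + 1 / n + ‖S x‖ ^ 2 * min 1 (h x))
  h_integrable : Integrable (fun z => h (φ x z)) μ
  h_le : ∫ z, h (φ x z) ∂μ ≤ (1 + C / n) * h x + C / n ^ 2

variable {E : Type*} [NormedAddCommGroup E] [NormedSpace ℝ E] [FiniteDimensional ℝ E]

/-- The Euclidean norm on a finite-dimensional space, in coordinates. -/
noncomputable def euclNorm (e : E) : ℝ := ‖toEuclidean e‖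

theorem euclNorm_nonneg (e : E) : 0 ≤ euclNorm e := norm_nonneg _

theorem continuous_euclNorm : Continuous (euclNorm : E → ℝ) :=
  (toEuclidean (E := E)).continuous.norm

variable (E) in
theorem exists_euclNorm_equiv : ∃ a : ℝ, 0 < a ∧ ∀ e : E, euclNorm e ≤ a * ‖e‖ ∧
    ‖e‖ ≤ a * euclNorm e := by
  let A : E →L[ℝ] _ := (toEuclidean (E := E) : E →L[ℝ] EuclideanSpace ℝ (Fin (Module.finrank ℝ E)))
  let B : _ →L[ℝ] E := ((toEuclidean (E := E)).symm : EuclideanSpace ℝ (Fin (Module.finrank ℝ E)) →L[ℝ] E)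
  refine ⟨‖A‖ + ‖B‖ + 1, by positivity, fun e => ⟨?_, ?_⟩⟩
  · refine (A.le_opNorm e).trans ?_
    gcongr
    linarith [norm_nonneg B]
  · have := B.le_opNorm (toEuclidean e)
    have h2 : B (toEuclidean e) = e := (toEuclidean (E := E)).symm_apply_apply e
    rw [h2] at this
    refine this.trans ?_
    have h3 : ‖B‖ ≤ ‖A‖ + ‖B‖ + 1 := by linarith [norm_nonneg A]
    exact mul_le_mul_of_nonneg_right h3 (norm_nonneg _)

theorem euclNorm_add_sq (e r : E) : euclNorm (e + r) ^ 2 =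
    euclNorm e ^ 2 + 2 * inner ℝ (toEuclidean e) (toEuclidean r) + euclNorm r ^ 2 := by
  rw [euclNorm, map_add, norm_add_sq_real]; rfl

theorem inner_toEuclidean_le (e r : E) :
    inner ℝ (toEuclidean e) (toEuclidean r) ≤ euclNorm e * euclNorm r :=
  real_inner_le_norm _ _

variable (E) in
theorem exists_lyapunov_step {L B C₁ : ℝ} (hL : 0 ≤ L) (hC₁ : 0 ≤ C₁) :
    ∃ C : ℝ, 0 ≤ C ∧ ∀ {𝒳 𝒟 : Type} [MeasurableSpace 𝒟] {n : ℕ} (_ : 1 ≤ n) {μ : Measure 𝒟}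
      [IsProbabilityMeasure μ] {S : 𝒳 → E} {h : 𝒳 → ℝ} {φ : 𝒳 → 𝒟 → 𝒳} {f : E → E} {x : 𝒳} {s : E},
      AEStronglyMeasurable (fun z => S (φ x z)) μ → (∀ x, 0 ≤ h x) →
      DriftBounds C₁ n μ S h φ f x → (∀ x y, ‖f x - f y‖ ≤ L * ‖x - y‖) → ‖s‖ ≤ B → ‖f s‖ ≤ B →
      Integrable (fun z => euclNorm (S (φ x z) - (s + (1 / (n : ℝ)) • f s)) ^ 2 + h (φ x z) + 1 / n) μ ∧
      ∫ z, (euclNorm (S (φ x z) - (s + (1 / (n : ℝ)) • f s)) ^ 2 + h (φ x z) + 1 / n) ∂μ ≤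
        (1 + C / n) * (euclNorm (S x - s) ^ 2 + h x + 1 / n) := by
  obtain ⟨a, ha, hab⟩ := exists_euclNorm_equiv E
  refine ⟨1 + 2 * a ^ 2 * L + a ^ 2 * C₁ * (1 + 2 * a ^ 2 + 2 * B ^ 2) +
    2 * a ^ 2 * C₁ * (1 + 2 * a ^ 2 + 2 * B ^ 2) + 2 * a ^ 2 * B ^ 2 + C₁, by positivity, ?_⟩
  intro 𝒳 𝒟 _ n hn μ _ S h φ f x s hmeas hh hD hf hs hfs
  have hn' : (1 : ℝ) ≤ n := by exact_mod_cast hn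
  have hB : 0 ≤ B := (norm_nonneg s).trans hs
  set Δ : 𝒟 → E := fun z => S (φ x z) - S x with hΔ
  have hΔm : AEStronglyMeasurable Δ μ := hmeas.sub aestronglyMeasurable_const
  have hΔ2 : MemLp Δ 2 μ := (memLp_two_iff_integrable_sq_norm hΔm).2 hD.sq_integrable
  have hΔi : Integrable Δ μ := hΔ2.integrable (by norm_num)
  set c : E := (1 / (n : ℝ)) • f s with hc
  set e : E := S x - s with he
  have hsplit : ∀ z, S (φ x z) - (s + c) = e + (Δ z - c) := fun z => by
    simp only [hΔ, he]; abel
  have hRm : AEStronglyMeasurable (fun z => Δ z - c) μ := hΔm.sub aestronglyMeasurable_const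
  have hR2 : MemLp (fun z => Δ z - c) 2 μ := hΔ2.sub (memLp_const c)
  have hRi : Integrable (fun z => Δ z - c) μ := hR2.integrable (by norm_num)
  have hRsq : Integrable (fun z => euclNorm (Δ z - c) ^ 2) μ := by
    refine ((memLp_two_iff_integrable_sq_norm hRm).1 hR2 |>.const_mul (a ^ 2)).mono'
      (((continuous_euclNorm.comp_aestronglyMeasurable hRm)).pow 2) (ae_of_all _ fun z => ?_)
    rw [norm_eq_abs, abs_of_nonneg (sq_nonneg _), ← mul_pow]
    have := euclNorm_nonneg (Δ z - c)
    gcongr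
    exact (hab _).1
  have hin : Integrable (fun z => inner ℝ (toEuclidean e) (toEuclidean (Δ z - c))) μ := by
    have := ((innerSL ℝ (toEuclidean e)).comp (toEuclidean (E := E) : E →L[ℝ] _)).integrable_comp hRi
    exact this
  have hinv : ∫ z, inner ℝ (toEuclidean e) (toEuclidean (Δ z - c)) ∂μ =
      inner ℝ (toEuclidean e) (toEuclidean (∫ z, Δ z ∂μ - c)) := by
    have := ((innerSL ℝ (toEuclidean e)).comp (toEuclidean (E := E) : E →L[ℝ] _)).integral_comp_comm hRi
    rw [integral_sub hΔi (integrable_const c), integral_const] at this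
    simpa using this
  have hfun : (fun z => euclNorm (S (φ x z) - (s + c)) ^ 2 + h (φ x z) + 1 / (n : ℝ)) = fun z =>
      (euclNorm e ^ 2 + 2 * inner ℝ (toEuclidean e) (toEuclidean (Δ z - c)) + euclNorm (Δ z - c) ^ 2)
        + h (φ x z) + 1 / (n : ℝ) := by
    funext z; rw [hsplit, euclNorm_add_sq]
  rw [hfun]
  have hi1 : Integrable (fun z => euclNorm e ^ 2 + 2 * inner ℝ (toEuclidean e) (toEuclidean (Δ z - c))) μ :=
    (integrable_const _).add (hin.const_mul 2)
  have hi2 : Integrable (fun z => euclNorm e ^ 2 +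
      2 * inner ℝ (toEuclidean e) (toEuclidean (Δ z - c)) + euclNorm (Δ z - c) ^ 2) μ := hi1.add hRsq
  have hi3 : Integrable (fun z => euclNorm e ^ 2 +
      2 * inner ℝ (toEuclidean e) (toEuclidean (Δ z - c)) + euclNorm (Δ z - c) ^ 2 + h (φ x z)) μ :=
    hi2.add hD.h_integrable
  refine ⟨hi3.add (integrable_const _), ?_⟩
  rw [integral_add hi3 (integrable_const _), integral_add hi2 hD.h_integrable, integral_add hi1 hRsq,
    integral_add (integrable_const _) (hin.const_mul 2), integral_const_mul, hinv]
  simp only [integral_const, probReal_univ, one_smul]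
  -- quantities
  set N := euclNorm e
  have hN0 : 0 ≤ N := euclNorm_nonneg e
  set ρ : E := ∫ z, Δ z ∂μ - (1 / (n : ℝ)) • f (S x) with hρ
  have hdec : ∫ z, Δ z ∂μ - c = ρ + (1 / (n : ℝ)) • (f (S x) - f s) := by
    rw [hρ, hc, smul_sub]; abel
  have he2 : ‖S x‖ ^ 2 ≤ 2 * a ^ 2 * N ^ 2 + 2 * B ^ 2 := by
    have h1 : ‖S x‖ ≤ a * N + B := by
      have : S x = e + s := by rw [he]; abel
      rw [this]
      exact (norm_add_le _ _).trans (add_le_add (hab e).2 hs)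
    have h2 := norm_nonneg (S x)
    have h3 : ‖S x‖ ^ 2 ≤ (a * N + B) ^ 2 := by gcongr
    nlinarith [sq_nonneg (a * N - B)]
  have hmin : ‖S x‖ ^ 2 * min 1 (h x) ≤ 2 * a ^ 2 * N ^ 2 + 2 * B ^ 2 * h x := by
    have h0 : 0 ≤ min 1 (h x) := le_min zero_le_one (hh x)
    calc ‖S x‖ ^ 2 * min 1 (h x) ≤ (2 * a ^ 2 * N ^ 2 + 2 * B ^ 2) * min 1 (h x) := by gcongr
      _ = 2 * a ^ 2 * N ^ 2 * min 1 (h x) + 2 * B ^ 2 * min 1 (h x) := by ring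
      _ ≤ 2 * a ^ 2 * N ^ 2 * 1 + 2 * B ^ 2 * h x := by
        gcongr
        · exact min_le_left _ _
        · exact min_le_right _ _
      _ = _ := by ring
  have hρn : n * euclNorm ρ ^ 2 ≤ a ^ 2 * C₁ / n * (h x + 1 / n + (2 * a ^ 2 * N ^ 2 + 2 * B ^ 2 * h x)) := by
    have h1 : euclNorm ρ ^ 2 ≤ a ^ 2 * ‖ρ‖ ^ 2 := by
      rw [← mul_pow]
      have := euclNorm_nonneg ρ
      gcongr; exact (hab ρ).1
    have h2 := hD.mean_le
    calc n * euclNorm ρ ^ 2 ≤ n * (a ^ 2 * (C₁ / n ^ 2 * (h x + 1 / n + ‖S x‖ ^ 2 * min 1 (h x)))) := by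
          gcongr; exact h1.trans (by gcongr)
      _ = a ^ 2 * C₁ / n * (h x + 1 / n + ‖S x‖ ^ 2 * min 1 (h x)) := by field_simp
      _ ≤ _ := by gcongr
  have hcross : 2 * inner ℝ (toEuclidean e) (toEuclidean (∫ z, Δ z ∂μ - c)) ≤
      1 / n * N ^ 2 + n * euclNorm ρ ^ 2 + 2 * a ^ 2 * L / n * N ^ 2 := by
    rw [hdec, map_add, inner_add_right]
    have h1 := inner_toEuclidean_le e ρ
    have h2 := inner_toEuclidean_le e ((1 / (n : ℝ)) • (f (S x) - f s))
    have h3 : euclNorm ((1 / (n : ℝ)) • (f (S x) - f s)) ≤ a ^ 2 * L / n * N := by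
      refine (hab _).1.trans ?_
      rw [norm_smul, norm_eq_abs, abs_of_pos (by positivity)]
      calc a * (1 / n * ‖f (S x) - f s‖) ≤ a * (1 / n * (L * (a * N))) := by
            gcongr
            exact (hf _ _).trans (by gcongr; exact (hab e).2)
        _ = _ := by ring
    have h4 : 2 * (N * euclNorm ρ) ≤ 1 / n * N ^ 2 + n * euclNorm ρ ^ 2 := by
      have h5 : 0 ≤ (N - n * euclNorm ρ) ^ 2 / n := by positivity
      have h6 : (N - n * euclNorm ρ) ^ 2 / n = 1 / n * N ^ 2 - 2 * (N * euclNorm ρ) + n * euclNorm ρ ^ 2 := by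
        field_simp; ring
      linarith
    have h5 : N * euclNorm ((1 / (n : ℝ)) • (f (S x) - f s)) ≤ N * (a ^ 2 * L / n * N) := by gcongr
    have h6 : 2 * (N * (a ^ 2 * L / n * N)) = 2 * a ^ 2 * L / n * N ^ 2 := by ring
    linarith
  have hR : ∫ z, euclNorm (Δ z - c) ^ 2 ∂μ ≤
      2 * a ^ 2 * C₁ / n ^ 2 * (1 + (2 * a ^ 2 * N ^ 2 + 2 * B ^ 2)) + 2 * a ^ 2 * B ^ 2 / n ^ 2 := by
    have hpt : ∀ z, euclNorm (Δ z - c) ^ 2 ≤ 2 * a ^ 2 * ‖Δ z‖ ^ 2 + 2 * a ^ 2 * B ^ 2 / n ^ 2 := by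
      intro z
      have h1 : euclNorm (Δ z - c) ≤ a * (‖Δ z‖ + B / n) := by
        refine (hab _).1.trans ?_
        gcongr
        refine (norm_sub_le _ _).trans ?_
        gcongr
        rw [hc, norm_smul, norm_eq_abs, abs_of_pos (by positivity), one_div_mul_eq_div]
        gcongr
      have h2 := euclNorm_nonneg (Δ z - c)
      calc euclNorm (Δ z - c) ^ 2 ≤ (a * (‖Δ z‖ + B / n)) ^ 2 := by gcongr
        _ = a ^ 2 * (‖Δ z‖ + B / n) ^ 2 := by ring
        _ ≤ a ^ 2 * (2 * (‖Δ z‖ ^ 2 + (B / n) ^ 2)) := by gcongr; exact add_sq_le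
        _ = _ := by ring
    calc ∫ z, euclNorm (Δ z - c) ^ 2 ∂μ
        ≤ ∫ z, (2 * a ^ 2 * ‖Δ z‖ ^ 2 + 2 * a ^ 2 * B ^ 2 / n ^ 2) ∂μ :=
          integral_mono hRsq ((hD.sq_integrable.const_mul _).add (integrable_const _)) hpt
      _ = 2 * a ^ 2 * ∫ z, ‖Δ z‖ ^ 2 ∂μ + 2 * a ^ 2 * B ^ 2 / n ^ 2 := by
          rw [integral_add (hD.sq_integrable.const_mul _) (integrable_const _), integral_const_mul]
          simp only [integral_const, probReal_univ, one_smul]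
          rfl
      _ ≤ 2 * a ^ 2 * (C₁ / n ^ 2 * (1 + (2 * a ^ 2 * N ^ 2 + 2 * B ^ 2))) + 2 * a ^ 2 * B ^ 2 / n ^ 2 := by
          gcongr
          exact hD.sq_le.trans (by gcongr)
      _ = _ := by ring
  have hR' : 2 * a ^ 2 * C₁ / n ^ 2 * (1 + (2 * a ^ 2 * N ^ 2 + 2 * B ^ 2)) + 2 * a ^ 2 * B ^ 2 / n ^ 2 ≤
      2 * a ^ 2 * C₁ / n * ((1 + 2 * B ^ 2) * (1 / n) + 2 * a ^ 2 * N ^ 2) + 2 * a ^ 2 * B ^ 2 / n * (1 / n) := by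
    have h1 : 2 * a ^ 2 * C₁ / n ^ 2 * (1 + (2 * a ^ 2 * N ^ 2 + 2 * B ^ 2)) =
      2 * a ^ 2 * C₁ / n * ((1 + 2 * B ^ 2) * (1 / n) + 2 * a ^ 2 * N ^ 2 * (1 / n)) := by
        field_simp; ring
    have h2 : 1 / (n : ℝ) ≤ 1 := by rw [div_le_one (by positivity)]; exact hn'
    have h3 : 2 * a ^ 2 * N ^ 2 * (1 / (n : ℝ)) ≤ 2 * a ^ 2 * N ^ 2 := mul_le_of_le_one_right (by positivity) h2
    rw [h1]
    have h4 : 2 * a ^ 2 * B ^ 2 / (n : ℝ) ^ 2 = 2 * a ^ 2 * B ^ 2 / n * (1 / n) := by field_simp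
    rw [h4]
    gcongr
  have hh1 := hD.h_le
  have hx0 := hh x
  have hfin : N ^ 2 + (1 / n * N ^ 2 + a ^ 2 * C₁ / n * (h x + 1 / n + (2 * a ^ 2 * N ^ 2 + 2 * B ^ 2 * h x)) +
      2 * a ^ 2 * L / n * N ^ 2) + (2 * a ^ 2 * C₁ / n * ((1 + 2 * B ^ 2) * (1 / n) + 2 * a ^ 2 * N ^ 2) +
      2 * a ^ 2 * B ^ 2 / n * (1 / n)) + ((1 + C₁ / n) * h x + C₁ / n ^ 2) + 1 / n ≤
      (1 + (1 + 2 * a ^ 2 * L + a ^ 2 * C₁ * (1 + 2 * a ^ 2 + 2 * B ^ 2) +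
    2 * a ^ 2 * C₁ * (1 + 2 * a ^ 2 + 2 * B ^ 2) + 2 * a ^ 2 * B ^ 2 + C₁) / n) * (N ^ 2 + h x + 1 / n) := by
    rw [← sub_nonneg]
    set m : ℝ := 1 / n with hm
    have hm0 : 0 ≤ m := by positivity
    have hdiv : ∀ y : ℝ, y / n = y * m := fun y => by rw [hm]; ring
    have hdiv2 : C₁ / (n : ℝ) ^ 2 = C₁ * m * m := by rw [hm]; field_simp
    rw [hdiv2]
    simp only [hdiv]
    have : 0 ≤ m * ((h x + m) * (1 + 2 * a ^ 2 * L) + N ^ 2 * (a ^ 2 * C₁ * (1 + 2 * B ^ 2)) +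
       h x * (a ^ 2 * C₁ * (2 * a ^ 2)) +
       m * (a ^ 2 * C₁ * (2 * a ^ 2 + 2 * B ^ 2)) +
       N ^ 2 * (2 * a ^ 2 * C₁ * (1 + 2 * B ^ 2)) + h x * (2 * a ^ 2 * C₁ * (1 + 2 * a ^ 2 + 2 * B ^ 2)) +
       m * (2 * a ^ 2 * C₁ * (2 * a ^ 2)) + (N ^ 2 + h x) * (2 * a ^ 2 * B ^ 2) + N ^ 2 * C₁) := by positivity
    refine this.trans (le_of_eq ?_)
    ring
  linarith

/-- The chain follows the solution of the limiting equation within `O(n ^ (-1/2))`. -/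
theorem exists_chain_estimate {g : ℝ → E → E} {Q : ℝ → E} {T L M B₀ C₁ C₂ : ℝ} {V : ℝ → ℝ}
    {x₀ : E} (hT : 0 ≤ T) (hL : 0 ≤ L) (hC₁ : 0 ≤ C₁)
    (hQ : ∀ t ∈ Icc 0 T, Q t = x₀ + ∫ s in (0 : ℝ)..t, g s (Q s))
    (hint : IntervalIntegrable (fun s => g s (Q s)) volume 0 T)
    (hlip : ∀ s ∈ Icc 0 T, ∀ x y, ‖g s x - g s y‖ ≤ L * ‖x - y‖)
    (hbd : ∀ s ∈ Icc 0 T, ‖g s (Q s)‖ ≤ M)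
    (hV : ∀ r s, 0 ≤ r → r ≤ s → s ≤ T → ‖g s (Q r) - g r (Q r)‖ ≤ V s - V r) :
    ∃ C : ℝ, 0 ≤ C ∧ ∀ {Ω : Type*} [MeasurableSpace Ω] {P : Measure Ω} [IsProbabilityMeasure P]
      {𝒳 𝒟 : Type} [MeasurableSpace 𝒳] [MeasurableSpace 𝒟] [MeasurableSpace E] [BorelSpace E]
      {X₀ : Ω → 𝒳} {ξ : ℕ → Ω → 𝒟} {Φ : ℕ → 𝒳 → 𝒟 → 𝒳} {X : Ω → ℕ → 𝒳} {μ : Measure 𝒟} {G : Set 𝒳}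
      {S : 𝒳 → E} {h : 𝒳 → ℝ} {n : ℕ}, 1 ≤ n → Measurable X₀ → (∀ k, Measurable (ξ k)) →
      iIndepFun ξ P → IndepFun X₀ (fun ω k => ξ k ω) P →
      (∀ k, Measurable fun p : 𝒳 × 𝒟 => Φ k p.1 p.2) → (∀ ω, X ω 0 = X₀ ω) →
      (∀ ω k, X ω (k + 1) = Φ k (X ω k) (ξ k ω)) → (∀ k, P.map (ξ k) = μ) → MeasurableSet G →
      Measurable S → Measurable h → (∀ x, 0 ≤ h x) → (∀ x ∈ G, ‖S x‖ ≤ B₀) →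
      (∀ x ∈ G, h x ≤ C₂ / n) →
      (∀ k : ℕ, ((k + 1 : ℕ) : ℝ) ≤ n * T → ∀ ω, X₀ ω ∈ G →
        DriftBounds C₁ n μ S h (Φ k) (g (k / n)) (X ω k)) →
      ∀ k : ℕ, (k : ℝ) ≤ n * T →
        ∫⁻ ω in X₀ ⁻¹' G, ofReal ‖S (X ω k) - Q (k / n)‖ ∂P ≤
          ofReal (C / √n) +
            ofReal C * ∫⁻ ω in X₀ ⁻¹' G, ofReal ‖S (X₀ ω) - Q 0‖ ∂P := by
  obtain ⟨a, ha, hab⟩ := exists_euclNorm_equiv E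
  have hM : 0 ≤ M := (norm_nonneg _).trans (hbd 0 ⟨le_rfl, hT⟩)
  have hV0 : 0 ≤ V T - V 0 := (norm_nonneg _).trans (hV 0 T le_rfl hT le_rfl)
  set c₀ : ℝ := L * M * T + (V T - V 0)
  have hc₀0 : 0 ≤ c₀ := by positivity
  set eL := exp (L * T)
  have heL0 : 0 < eL := exp_pos _
  set q : ℝ := ‖x₀‖ + M * T
  have hQ0 : Q 0 = x₀ := by rw [hQ 0 ⟨le_rfl, hT⟩]; simp
  have hQbd : ∀ t ∈ Icc 0 T, ‖Q t‖ ≤ q := by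
    intro t ht
    have h1 := norm_sub_le_of_integral hQ hint hbd ⟨le_rfl, hT⟩ ht
    rw [hQ0, sub_zero, abs_of_nonneg ht.1] at h1
    have h2 : M * t ≤ M * T := by gcongr; exact ht.2
    calc ‖Q t‖ = ‖x₀ + (Q t - x₀)‖ := by congr 1; abel
      _ ≤ ‖x₀‖ + ‖Q t - x₀‖ := norm_add_le _ _
      _ ≤ _ := by linarith
  have hq0 : 0 ≤ q := by positivity
  set D : ℝ := eL * (|B₀| + q + c₀) with hD
  have hD0 : 0 ≤ D := by positivity
  set B : ℝ := q + D + M + L * D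
  obtain ⟨C₃, hC₃, hlyap⟩ := exists_lyapunov_step E (B := B) hL hC₁
  refine ⟨a / 2 * (exp (C₃ * T) * (|C₂| + 1) + 1) + eL * c₀ + eL, by positivity, ?_⟩
  intro Ω _ P _ 𝒳 𝒟 _ _ _ _ X₀ ξ Φ X μ G S h n hn hX₀ hξ hind hind0 hΦ hX0 hX hμ hG hS hh hh0 hSG hhG hdrift
  have hn' : (1 : ℝ) ≤ n := by exact_mod_cast hn
  have hnpos : (0 : ℝ) < n := by linarith
  have hμp : IsProbabilityMeasure μ := by
    rw [← hμ 0]; exact Measure.isProbabilityMeasure_map (hξ 0).aemeasurable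
  let K : ℕ := ⌊n * T⌋₊
  let gg : ℕ → E → E := fun k => if (k : ℝ) ≤ n * T then g (k / n) else fun _ => 0
  have hmem : ∀ j : ℕ, (j : ℝ) ≤ n * T → (j : ℝ) / n ∈ Icc 0 T := fun j hj =>
    ⟨by positivity, by rw [div_le_iff₀ hnpos]; linarith⟩
  have hgglip : ∀ k x y, ‖gg k x - gg k y‖ ≤ L * ‖x - y‖ := by
    intro k x y
    by_cases hk : (k : ℝ) ≤ n * T
    · simp only [gg, hk, if_true]; exact hlip _ (hmem k hk) x y
    · simp only [gg, hk, if_false, sub_zero, norm_zero]; positivity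
  have hggc : ∀ k, Continuous (gg k) := fun k => continuous_of_norm_sub_le hL (hgglip k)
  let sch : E → ℕ → E := fun e k => Nat.rec e (fun k s => s + (1 / (n : ℝ)) • gg k s) k
  have hsch0 : ∀ e, sch e 0 = e := fun e => rfl
  have hsch1 : ∀ e k, sch e (k + 1) = sch e k + (1 / (n : ℝ)) • gg k (sch e k) := fun e k => rfl
  have hschc : ∀ k, Continuous fun e => sch e k := by
    intro k
    induction k with
    | zero => exact continuous_id
    | succ k ih =>
      simp only [hsch1]
      exact ih.add (((hggc k).comp ih).const_smul _)
  -- the Euler scheme stays close to the solution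
  have heuler : ∀ e, ∀ k : ℕ, (k : ℝ) ≤ n * T → ‖sch e k - Q (k / n)‖ ≤ eL * (‖e - Q 0‖ + 1 / n * c₀) := by
    intro e k hk
    have := euler_error (g := fun t => if t ≤ T then g t else fun _ => 0) (Q := Q) (T := T) (L := L)
      (M := M) (V := V) (x₀ := x₀) hL hM ?_ ?_ ?_ ?_ ?_ hn (s := sch e) ?_ hk
    · simpa [hsch0] using this
    · intro t ht
      rw [hQ t ht]
      congr 1
      refine intervalIntegral.integral_congr fun s hs => ?_
      rw [uIcc_of_le ht.1] at hs
      simp [hs.2.trans ht.2]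
    · refine hint.congr fun s hs => ?_
      rw [uIoc_of_le hT] at hs
      simp [hs.2]
    · intro s hs x y
      simpa [hs.2] using hlip s hs x y
    · intro s hs
      simpa [hs.2] using hbd s hs
    · intro r s h1 h2 h3
      simpa [h3, h2.trans h3] using hV r s h1 h2 h3
    · intro k
      rw [hsch1]
      have : (gg k : E → E) = (if (k : ℝ) / n ≤ T then g (k / n) else fun _ => 0) := by
        have : (k : ℝ) / n ≤ T ↔ (k : ℝ) ≤ n * T := by rw [div_le_iff₀ hnpos, mul_comm]
        simp only [gg, this]
      rw [this]
  have hclose : ∀ x ∈ G, ∀ k : ℕ, (k : ℝ) ≤ n * T → ‖sch (S x) k - Q (k / n)‖ ≤ D := by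
    intro x hx k hk
    refine (heuler _ k hk).trans ?_
    rw [hD]
    refine mul_le_mul_of_nonneg_left (add_le_add ?_ ?_) heL0.le
    · refine (norm_sub_le _ _).trans (add_le_add ((hSG x hx).trans (le_abs_self _)) (hQbd 0 ⟨le_rfl, hT⟩))
    · exact mul_le_of_le_one_left hc₀0 (by rw [div_le_one hnpos]; exact hn')
  have hsB : ∀ x ∈ G, ∀ k : ℕ, (k : ℝ) ≤ n * T → ‖sch (S x) k‖ ≤ B := by
    intro x hx k hk
    have h1 := hclose x hx k hk
    have h2 := hQbd _ (hmem k hk)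
    have h3 : ‖sch (S x) k‖ ≤ ‖sch (S x) k - Q (k / n)‖ + ‖Q (k / n)‖ := by
      simpa using norm_add_le (sch (S x) k - Q (k / n)) (Q (k / n))
    have : 0 ≤ L * D := by positivity
    linarith
  have hfB : ∀ x ∈ G, ∀ k : ℕ, (k : ℝ) ≤ n * T → ‖g (k / n) (sch (S x) k)‖ ≤ B := by
    intro x hx k hk
    have h1 := hclose x hx k hk
    have h2 := hbd _ (hmem k hk)
    have h3 := hlip _ (hmem k hk) (sch (S x) k) (Q (k / n))
    have h4 : ‖g (k / n) (sch (S x) k)‖ ≤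
        ‖g (k / n) (sch (S x) k) - g (k / n) (Q (k / n))‖ + ‖g (k / n) (Q (k / n))‖ := by
      simpa using norm_add_le (g (k / n) (sch (S x) k) - g (k / n) (Q (k / n))) (g (k / n) (Q (k / n)))
    have h5 : L * ‖sch (S x) k - Q (k / n)‖ ≤ L * D := by gcongr
    linarith
  let W : ℕ → 𝒳 × 𝒳 → ℝ := fun k p => euclNorm (S p.2 - sch (S p.1) k) ^ 2 + h p.2 + 1 / n
  have hW0 : ∀ k p, 0 ≤ W k p := fun k p => by
    have := hh0 p.2
    positivity
  have hWm : ∀ k, Measurable (W k) := by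
    intro k
    have h1 : Measurable fun p : 𝒳 × 𝒳 => S p.2 - sch (S p.1) k :=
      (hS.comp measurable_snd).sub ((hschc k).measurable.comp (hS.comp measurable_fst))
    exact (((continuous_euclNorm.measurable.comp h1).pow_const 2).add (hh.comp measurable_snd)).add_const _
  have hcoef : (0 : ℝ) ≤ 1 + C₃ / n := by positivity
  have hgrow := lintegral_chain_le hX₀ hξ hind hind0 hΦ hX0 hX hμ hG
    (V := fun k p => ofReal (W k p)) (c := ofReal (1 + C₃ / n)) (K := K)
    (fun k => (hWm k).ennreal_ofReal) (by
      intro k hk ω hω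
      have hkT : ((k + 1 : ℕ) : ℝ) ≤ n * T :=
        (Nat.le_floor_iff (by positivity)).1 hk
      have hkT' : (k : ℝ) ≤ n * T := le_trans (by push_cast; linarith) hkT
      have hSm : AEStronglyMeasurable (fun z => S (Φ k (X ω k) z)) μ :=
        (hS.comp ((hΦ k).comp measurable_prodMk_left)).aestronglyMeasurable
      have h1 := hlyap (s := sch (S (X₀ ω)) k) hn hSm hh0 (hdrift k hkT ω hω) (hlip _ (hmem k hkT'))
        (hsB _ hω k hkT') (hfB _ hω k hkT')
      have hgg : gg k = g (k / n) := by simp only [gg, hkT', if_true]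
      rw [← ofReal_mul hcoef]
      have h2 : ∀ z, W (k + 1) (X₀ ω, Φ k (X ω k) z) = euclNorm (S (Φ k (X ω k) z) -
          (sch (S (X₀ ω)) k + (1 / (n : ℝ)) • g (k / n) (sch (S (X₀ ω)) k))) ^ 2 +
            h (Φ k (X ω k) z) + 1 / n := fun z => by
        simp only [W, hsch1, hgg]
      simp only [h2]
      rw [← ofReal_integral_eq_lintegral_ofReal h1.1
        (ae_of_all _ fun z => by
          have := hh0 (Φ k (X ω k) z)
          positivity)]
      exact ofReal_le_ofReal h1.2)
  intro k hk
  have hkK : k ≤ K := (Nat.le_floor_iff (by positivity)).2 hk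
  have hSG' : MeasurableSet (X₀ ⁻¹' G) := hX₀ hG
  have hV0' : ∫⁻ ω in X₀ ⁻¹' G, ofReal (W 0 (X₀ ω, X₀ ω)) ∂P ≤ ofReal ((|C₂| + 1) / n) := by
    calc _ ≤ ∫⁻ _ω in X₀ ⁻¹' G, ofReal ((|C₂| + 1) / n) ∂P := by
          refine setLIntegral_mono' hSG' fun ω hω => ofReal_le_ofReal ?_
          have h1 := hhG _ hω
          have h2 : C₂ / n ≤ |C₂| / n := by gcongr; exact le_abs_self _
          simp only [W, hsch0, sub_self]
          have h3 : euclNorm (0 : E) = 0 := by simp [euclNorm]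
          rw [h3, add_div]
          linarith
      _ ≤ _ := by
          rw [setLIntegral_const]
          exact mul_le_of_le_one_right (by positivity) prob_le_one
  have hWk : ∫⁻ ω in X₀ ⁻¹' G, ofReal (W k (X₀ ω, X ω k)) ∂P ≤
      ofReal (exp (C₃ * T) * ((|C₂| + 1) / n)) := by
    refine (hgrow k hkK).trans ?_
    rw [ofReal_mul (exp_pos _).le, ← ENNReal.ofReal_pow hcoef]
    gcongr
    exact one_add_div_pow_le_exp hC₃ hn hk
  have hsq : (0 : ℝ) < √n := sqrt_pos.2 hnpos
  have hsq2 : √(n : ℝ) * √n = n := mul_self_sqrt hnpos.le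
  have hpt : ∀ ω, ‖S (X ω k) - Q (k / n)‖ ≤ a / 2 * (√n * W k (X₀ ω, X ω k)) +
      (a / 2 * (1 / √n) + eL * (1 / n * c₀)) + eL * ‖S (X₀ ω) - Q 0‖ := by
    intro ω
    have h1 : ‖S (X ω k) - Q (k / n)‖ ≤ ‖S (X ω k) - sch (S (X₀ ω)) k‖ + ‖sch (S (X₀ ω)) k - Q (k / n)‖ := by
      simpa using norm_add_le (S (X ω k) - sch (S (X₀ ω)) k) (sch (S (X₀ ω)) k - Q (k / n))
    have h2 := heuler (S (X₀ ω)) k hk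
    have h3 := (hab (S (X ω k) - sch (S (X₀ ω)) k)).2
    set N := euclNorm (S (X ω k) - sch (S (X₀ ω)) k) with hN
    have h4 : N ^ 2 ≤ W k (X₀ ω, X ω k) := by
      have := hh0 (X ω k)
      have h5 : 0 ≤ 1 / (n : ℝ) := by positivity
      simp only [W, ← hN]; linarith
    have h5 : N ≤ 1 / 2 * (√n * N ^ 2 + 1 / √n) := by
      have h6 : 0 ≤ (√n * N - 1) ^ 2 / √n := by positivity
      have h7 : (√n * N - 1) ^ 2 / √n = √n * N ^ 2 - 2 * N + 1 / √n := by
        field_simp; ring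
      linarith
    have h6 : a * N ≤ a * (1 / 2 * (√n * W k (X₀ ω, X ω k) + 1 / √n)) := by
      gcongr; exact h5.trans (by gcongr)
    linarith
  have hsqn : 1 / (n : ℝ) ≤ 1 / √n := by
    apply one_div_le_one_div_of_le hsq
    have : 1 ≤ √(n : ℝ) := Real.one_le_sqrt.2 hn'
    nlinarith
  calc ∫⁻ ω in X₀ ⁻¹' G, ofReal ‖S (X ω k) - Q (k / n)‖ ∂P
      ≤ ∫⁻ ω in X₀ ⁻¹' G, (ofReal (a / 2 * √n) * ofReal (W k (X₀ ω, X ω k)) +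
          ofReal (a / 2 * (1 / √n) + eL * (1 / n * c₀)) +
          ofReal eL * ofReal ‖S (X₀ ω) - Q 0‖) ∂P := by
        refine lintegral_mono fun ω => ?_
        have h0 := hW0 k (X₀ ω, X ω k)
        rw [← ofReal_mul (by positivity), ← ofReal_mul heL0.le,
          ← ofReal_add (by positivity) (by positivity),
          ← ofReal_add (by positivity) (by positivity)]
        refine ofReal_le_ofReal ((hpt ω).trans (le_of_eq ?_))
        ring
    _ = ofReal (a / 2 * √n) * ∫⁻ ω in X₀ ⁻¹' G, ofReal (W k (X₀ ω, X ω k)) ∂P +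
          ofReal (a / 2 * (1 / √n) + eL * (1 / n * c₀)) * P (X₀ ⁻¹' G) +
          ofReal eL * ∫⁻ ω in X₀ ⁻¹' G, ofReal ‖S (X₀ ω) - Q 0‖ ∂P := by
        have hXk := measurable_chain hX₀ hξ hΦ hX0 hX k
        have m1 : Measurable fun ω => ofReal (W k (X₀ ω, X ω k)) :=
          ((hWm k).comp (hX₀.prodMk hXk)).ennreal_ofReal
        have m2 : Measurable fun ω => ofReal ‖S (X₀ ω) - Q 0‖ :=
          (continuous_norm.measurable.comp ((hS.comp hX₀).sub_const _)).ennreal_ofReal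
        rw [lintegral_add_right _ (m2.const_mul _), lintegral_add_right _ measurable_const,
          lintegral_const_mul _ m1, lintegral_const_mul _ m2, setLIntegral_const]
    _ ≤ ofReal (a / 2 * √n) * ofReal (exp (C₃ * T) * ((|C₂| + 1) / n)) +
          ofReal (a / 2 * (1 / √n) + eL * (1 / n * c₀)) * 1 +
          ofReal eL * ∫⁻ ω in X₀ ⁻¹' G, ofReal ‖S (X₀ ω) - Q 0‖ ∂P := by
        gcongr
        exact prob_le_one
    _ ≤ _ := by
        rw [mul_one, ← ofReal_mul (by positivity), ← ofReal_add (by positivity) (by positivity)]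
        gcongr
        · have h1 : a / 2 * √n * (exp (C₃ * T) * ((|C₂| + 1) / n)) =
              a / 2 * (exp (C₃ * T) * (|C₂| + 1)) / √n := by
            field_simp
            rw [sq, hsq2]
          have h2 : eL * (1 / n * c₀) ≤ eL * (1 / √n * c₀) := by gcongr
          rw [h1]
          have h3 : (a / 2 * (exp (C₃ * T) * (|C₂| + 1) + 1) + eL * c₀ + eL) / √n =
            a / 2 * (exp (C₃ * T) * (|C₂| + 1)) / √n + a / 2 * (1 / √n) + eL * (1 / √n * c₀) + eL / √n := by
            ring
          have h4 : 0 ≤ eL / √n := by positivity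
          rw [h3]; linarith
        · have : 0 ≤ a / 2 * (exp (C₃ * T) * (|C₂| + 1) + 1) + eL * c₀ := by positivity
          linarith

end Approximation

/-! ### Moment bounds -/

section Moments
variable {Ω Ω' : Type*} [MeasurableSpace Ω] [MeasurableSpace Ω'] {μ : Measure Ω}

/-- `f` has finite moments of all orders, the `p`-th of them being at most `M p`. -/
structure MomentBound (M : ℕ → ℝ) (f : Ω → ℝ) (μ : Measure Ω) : Prop where
  meas : AEStronglyMeasurable f μ
  int : ∀ p : ℕ, Integrable (fun x => |f x| ^ p) μ
  le : ∀ p : ℕ, ∫ x, |f x| ^ p ∂μ ≤ M p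

namespace MomentBound
variable {M M' : ℕ → ℝ} {f g : Ω → ℝ}

theorem of_dom {b : ℕ → Ω → ℝ} (hf : AEStronglyMeasurable f μ) (hb : ∀ p, Integrable (b p) μ)
    (h : ∀ p x, |f x| ^ p ≤ b p x) (hle : ∀ p, ∫ x, b p x ∂μ ≤ M p) : MomentBound M f μ :=
  have hi : ∀ p : ℕ, Integrable (fun x => |f x| ^ p) μ := fun p =>
    (hb p).mono' ((continuous_abs.comp_aestronglyMeasurable hf).pow p)
      (ae_of_all _ fun x => by rw [norm_eq_abs, abs_of_nonneg (by positivity)]; exact h p x)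
  ⟨hf, hi, fun p => (integral_mono (hi p) (hb p) (h p)).trans (hle p)⟩

theorem mono (hf : MomentBound M f μ) (hg : AEStronglyMeasurable g μ) (h : ∀ x, |g x| ≤ |f x|) :
    MomentBound M g μ :=
  of_dom hg hf.int (fun p x => pow_le_pow_left₀ (abs_nonneg _) (h x) p) hf.le

theorem add (hf : MomentBound M f μ) (hg : MomentBound M' g μ) :
    MomentBound (fun p => 2 ^ p * (M p + M' p)) (fun x => f x + g x) μ := by
  have hpt : ∀ (p : ℕ) x, |f x + g x| ^ p ≤ 2 ^ p * (|f x| ^ p + |g x| ^ p) := fun p x => by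
    calc |f x + g x| ^ p ≤ (|f x| + |g x|) ^ p := by gcongr; exact abs_add_le _ _
      _ ≤ 2 ^ (p - 1) * (|f x| ^ p + |g x| ^ p) := add_pow_le (abs_nonneg _) (abs_nonneg _) p
      _ ≤ _ := by gcongr <;> norm_num
  refine of_dom (hf.meas.add hg.meas) (fun p => ((hf.int p).add (hg.int p)).const_mul _) hpt fun p => ?_
  rw [integral_const_mul, integral_add' (hf.int p) (hg.int p)]
  have := hf.le p
  have := hg.le p
  gcongr

theorem mul (hf : MomentBound M f μ) (hg : MomentBound M' g μ) :
    MomentBound (fun p => M (2 * p) + M' (2 * p)) (fun x => f x * g x) μ := by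
  have hpt : ∀ (p : ℕ) x, |f x * g x| ^ p ≤ |f x| ^ (2 * p) + |g x| ^ (2 * p) := fun p x => by
    rw [abs_mul, mul_pow, pow_mul', pow_mul']
    nlinarith [sq_nonneg (|f x| ^ p - |g x| ^ p), sq_nonneg (|f x| ^ p), sq_nonneg (|g x| ^ p)]
  refine of_dom (hf.meas.mul hg.meas) (fun p => (hf.int _).add (hg.int _)) hpt fun p => ?_
  rw [integral_add' (hf.int _) (hg.int _)]
  exact add_le_add (hf.le _) (hg.le _)

theorem const_mul (hf : MomentBound M f μ) (c : ℝ) :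
    MomentBound (fun p => |c| ^ p * M p) (fun x => c * f x) μ := by
  refine ⟨hf.meas.const_mul c, fun p => ?_, fun p => ?_⟩
  · simp only [abs_mul, mul_pow]; exact (hf.int p).const_mul _
  · simp only [abs_mul, mul_pow, integral_const_mul]
    have := hf.le p
    gcongr

theorem const [IsProbabilityMeasure μ] (c : ℝ) : MomentBound (fun p => |c| ^ p) (fun _ => c) μ :=
  ⟨aestronglyMeasurable_const, fun _ => integrable_const _, fun p => by simp⟩

theorem abs (hf : MomentBound M f μ) : MomentBound M (fun x => |f x|) μ :=
  ⟨continuous_abs.comp_aestronglyMeasurable hf.meas, by simpa using hf.int, by simpa using hf.le⟩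

theorem weaken (hf : MomentBound M f μ) (h : ∀ p, M p ≤ M' p) : MomentBound M' f μ :=
  ⟨hf.meas, hf.int, fun p => (hf.le p).trans (h p)⟩

theorem integrable (hf : MomentBound M f μ) : Integrable f μ := by
  have h := hf.int 1
  simp only [pow_one] at h
  exact (integrable_norm_iff hf.meas).1 h

theorem pow (hf : MomentBound M f μ) (q : ℕ) : MomentBound (fun p => M (q * p)) (fun x => f x ^ q) μ := by
  refine ⟨hf.meas.pow q, fun p => ?_, fun p => ?_⟩
  · simp only [abs_pow, ← pow_mul]; exact hf.int _
  · simp only [abs_pow, ← pow_mul]; exact hf.le _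

/-- Bounds on even moments suffice. -/
theorem of_even [IsProbabilityMeasure μ] (hm : AEStronglyMeasurable f μ)
    (hi : ∀ p : ℕ, Integrable (fun x => f x ^ (2 * p)) μ) (hle : ∀ p : ℕ, ∫ x, f x ^ (2 * p) ∂μ ≤ M p) :
    MomentBound (fun p => 1 + M p) f μ := by
  have hpt : ∀ (p : ℕ) x, |f x| ^ p ≤ 1 + f x ^ (2 * p) := fun p x => by
    have : f x ^ (2 * p) = (|f x| ^ p) ^ 2 := by rw [← pow_mul, mul_comm p 2, pow_mul, pow_mul, sq_abs]
    rw [this]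
    nlinarith [sq_nonneg (|f x| ^ p - 1)]
  refine of_dom hm (fun p => (integrable_const 1).add (hi p)) hpt fun p => ?_
  rw [integral_add' (integrable_const 1) (hi p)]
  simpa using hle p

theorem comp {μ' : Measure Ω'} {φ : Ω' → Ω} (hφ : MeasurePreserving φ μ' μ) (hf : MomentBound M f μ) :
    MomentBound M (fun x => f (φ x)) μ' := by
  refine ⟨hf.meas.comp_measurePreserving hφ, fun p => ?_, fun p => ?_⟩
  · exact (hφ.integrable_comp (hf.int p).aestronglyMeasurable).2 (hf.int p)
  · have h : AEStronglyMeasurable (fun x => |f x| ^ p) (Measure.map φ μ') := by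
      rw [hφ.map_eq]; exact (hf.int p).aestronglyMeasurable
    rw [← integral_map (f := fun x => |f x| ^ p) hφ.measurable.aemeasurable h, hφ.map_eq]
    exact hf.le p

theorem exists_sum {ι : Type*} [DecidableEq ι] (M : ℕ → ℝ) (s : Finset ι) :
    ∃ M' : ℕ → ℝ, ∀ {Ω : Type} [MeasurableSpace Ω] {μ : Measure Ω} [IsProbabilityMeasure μ] {f : ι → Ω → ℝ},
      (∀ i, MomentBound M (f i) μ) → MomentBound M' (fun x => ∑ i ∈ s, f i x) μ := by
  induction s using Finset.induction_on with
  | empty => exact ⟨fun p => |0| ^ p, fun _ => by simpa using const 0⟩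
  | insert i s hi ih =>
    obtain ⟨M', hM'⟩ := ih
    refine ⟨fun p => 2 ^ p * (M p + M' p), fun h => ?_⟩
    simp only [sum_insert hi]
    exact (h i).add (hM' h)

theorem average {n : ℕ} (hn : 1 ≤ n) {f : Fin n → Ω → ℝ} (hf : ∀ i, MomentBound M (f i) μ) :
    MomentBound M (fun x => (∑ i, f i x) / n) μ := by
  have hn' : (0 : ℝ) < n := by exact_mod_cast hn
  have hm : AEStronglyMeasurable (fun x => (∑ i, f i x) / n) μ := by
    have : AEStronglyMeasurable (fun x => ∑ i, f i x) μ :=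
      Finset.aestronglyMeasurable_fun_sum _ fun i _ => (hf i).meas
    exact (continuous_id.div_const (n : ℝ)).comp_aestronglyMeasurable this
  have hpt : ∀ (p : ℕ) x, |(∑ i, f i x) / n| ^ p ≤ ∑ i, (1 / (n : ℝ)) * |f i x| ^ p := fun p x => by
    have h1 : |(∑ i, f i x) / n| ≤ ∑ i, (1 / (n : ℝ)) * |f i x| := by
      rw [abs_div, abs_of_pos hn', ← mul_sum, div_eq_inv_mul, one_div]
      gcongr
      exact Finset.abs_sum_le_sum_abs _ _
    refine (pow_le_pow_left₀ (abs_nonneg _) h1 p).trans ?_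
    refine Real.pow_arith_mean_le_arith_mean_pow Finset.univ (fun _ => 1 / (n : ℝ)) (fun i => |f i x|)
      (fun _ _ => by positivity) ?_ (fun _ _ => abs_nonneg _) p
    simp [hn'.ne']
  have hi := fun (p : ℕ) i (_ : i ∈ Finset.univ) => ((hf i).int p).const_mul (1 / (n : ℝ))
  refine of_dom hm (fun p => integrable_finsetSum _ (hi p)) hpt fun p => ?_
  rw [integral_finsetSum _ (hi p)]
  simp only [integral_const_mul]
  calc _ ≤ ∑ _i : Fin n, (1 / (n : ℝ)) * M p := sum_le_sum fun i _ => by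
        have := (hf i).le p
        gcongr
    _ = M p := by simp [hn'.ne']

end MomentBound

/-! ### Linear forms in independent centred variables -/

theorem abs_add_pow_sub_le (N : ℕ) (s t : ℝ) :
    |(s + t) ^ (N + 2) - s ^ (N + 2) - (N + 2) * s ^ (N + 1) * t| ≤
      (N + 2) ^ 2 * (t ^ 2 * (|s| + |t|) ^ N) := by
  induction N with
  | zero =>
    have : (s + t) ^ (0 + 2) - s ^ (0 + 2) - ((0 : ℕ) + 2) * s ^ (0 + 1) * t = t ^ 2 := by
      push_cast; ring
    rw [this, abs_of_nonneg (sq_nonneg t)]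
    push_cast
    nlinarith [sq_nonneg t]
  | succ N ih =>
    have hdec : (s + t) ^ (N + 1 + 2) - s ^ (N + 1 + 2) - ((N + 1 : ℕ) + 2) * s ^ (N + 1 + 1) * t =
        (N + 2) * (t ^ 2 * s ^ (N + 1)) +
          (s + t) * ((s + t) ^ (N + 2) - s ^ (N + 2) - (N + 2) * s ^ (N + 1) * t) := by
      push_cast; ring
    rw [hdec]
    have h1 : |s ^ (N + 1)| ≤ (|s| + |t|) ^ (N + 1) := by
      rw [abs_pow]; gcongr; linarith [abs_nonneg t]
    calc _ ≤ |(N + 2) * (t ^ 2 * s ^ (N + 1))| +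
          |(s + t) * ((s + t) ^ (N + 2) - s ^ (N + 2) - (N + 2) * s ^ (N + 1) * t)| := abs_add_le _ _
      _ ≤ (N + 2) * (t ^ 2 * (|s| + |t|) ^ (N + 1)) +
          (|s| + |t|) * ((N + 2) ^ 2 * (t ^ 2 * (|s| + |t|) ^ N)) := by
        rw [abs_mul, abs_mul, abs_mul, abs_of_nonneg (sq_nonneg t),
          abs_of_nonneg (by positivity : (0 : ℝ) ≤ (N : ℝ) + 2)]
        gcongr
        exact abs_add_le _ _
      _ = ((N + 2) + (N + 2) ^ 2) * (t ^ 2 * (|s| + |t|) ^ (N + 1)) := by ring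
      _ ≤ _ := by
        push_cast
        gcongr
        nlinarith

theorem add_pow_even_le (p : ℕ) (s t : ℝ) :
    (s + t) ^ (2 * (p + 1)) ≤ s ^ (2 * (p + 1)) + (2 * p + 2) * (s ^ (2 * p + 1) * t) +
      (2 * p + 2) ^ 2 * 2 ^ (2 * p) * (s ^ (2 * p) * t ^ 2 + t ^ (2 * (p + 1))) := by
  have h1 := (abs_le.1 (abs_add_pow_sub_le (2 * p) s t)).2
  have h2 : (|s| + |t|) ^ (2 * p) ≤ 2 ^ (2 * p) * (s ^ (2 * p) + t ^ (2 * p)) := by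
    calc (|s| + |t|) ^ (2 * p) ≤ 2 ^ (2 * p - 1) * (|s| ^ (2 * p) + |t| ^ (2 * p)) :=
          add_pow_le (abs_nonneg _) (abs_nonneg _) _
      _ ≤ 2 ^ (2 * p) * (|s| ^ (2 * p) + |t| ^ (2 * p)) := by
          gcongr
          · norm_num
          · omega
      _ = _ := by simp only [pow_mul, sq_abs]
  have h3 : t ^ 2 * (|s| + |t|) ^ (2 * p) ≤ t ^ 2 * (2 ^ (2 * p) * (s ^ (2 * p) + t ^ (2 * p))) := by
    gcongr
  push_cast at h1
  have h4 : ((2 : ℝ) * p + 2) ^ 2 * (t ^ 2 * (|s| + |t|) ^ (2 * p)) ≤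
      (2 * p + 2) ^ 2 * (t ^ 2 * (2 ^ (2 * p) * (s ^ (2 * p) + t ^ (2 * p)))) := by gcongr
  have h5 : ((2 : ℝ) * p + 2) ^ 2 * (t ^ 2 * (2 ^ (2 * p) * (s ^ (2 * p) + t ^ (2 * p)))) =
     (2 * p + 2) ^ 2 * 2 ^ (2 * p) * (s ^ (2 * p) * t ^ 2 + t ^ (2 * (p + 1))) := by ring
  have h6 : 2 * (p + 1) = 2 * p + 2 := by ring
  rw [h6] at h5 ⊢
  have h7 : ((2 : ℝ) * p + 2) * s ^ (2 * p + 1) * t = (2 * p + 2) * (s ^ (2 * p + 1) * t) := by ring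
  linarith

theorem exists_even_moment_linear_form (M : ℕ → ℝ) (p : ℕ) :
    ∃ C : ℝ, 0 ≤ C ∧ ∀ {Ω ι : Type} [MeasurableSpace Ω] [DecidableEq ι] {P : Measure Ω} [IsProbabilityMeasure P]
      {Y : ι → Ω → ℝ}, iIndepFun Y P → (∀ i, Measurable (Y i)) → (∀ i, MomentBound M (Y i) P) →
      (∀ i, ∫ ω, Y i ω ∂P = 0) → ∀ (β : ι → ℝ) (s : Finset ι),
      ∫ ω, (∑ i ∈ s, β i * Y i ω) ^ (2 * p) ∂P ≤ C * (∑ i ∈ s, β i ^ 2) ^ p := by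
  induction p with
  | zero => exact ⟨1, zero_le_one, fun _ _ _ _ β s => by simp⟩
  | succ p ih =>
    obtain ⟨C, hC, ih⟩ := ih
    set A : ℝ := (2 * p + 2) ^ 2 * 2 ^ (2 * p) with hA
    have hA0 : 0 ≤ A := by positivity
    refine ⟨2 * A * (C * |M 2| + |M (2 * (p + 1))|), by positivity, ?_⟩
    intro Ω ι _ _ P _ Y hind hY hM hmean β s
    have hSM : ∀ s : Finset ι, ∃ M', MomentBound M' (fun ω => ∑ i ∈ s, β i * Y i ω) P := by
      intro s
      induction s using Finset.induction_on with
      | empty => exact ⟨_, by simpa using MomentBound.const 0⟩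
      | insert i s hi ih =>
        obtain ⟨M', hM'⟩ := ih
        simp only [sum_insert hi]
        exact ⟨_, ((hM i).const_mul (β i)).add hM'⟩
    induction s using Finset.induction_on with
    | empty => simp
    | insert i s hi ihs =>
      obtain ⟨M', hM'⟩ := hSM s
      set S : Ω → ℝ := fun ω => ∑ j ∈ s, β j * Y j ω with hS
      have hSm : Measurable S := measurable_fun_sum _ fun j _ => (hY j).const_mul _
      have hindS : IndepFun S (Y i) P := by
        have h1 : iIndepFun (fun j ω => β j * Y j ω) P :=
          hind.comp (fun j x => β j * x) fun j => measurable_id.const_mul _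
        have hind' : IndepFun (fun ω (j : s) => Y j ω) (fun ω (j : ({i} : Finset ι)) => Y j ω) P :=
          hind.indepFun_finset s {i} (by simpa using hi) hY
        have hψ : Measurable fun y : ({i} : Finset ι) → ℝ => y ⟨i, mem_singleton_self i⟩ :=
          measurable_pi_apply _
        have h2 := hind'.comp (φ := fun y : s → ℝ => ∑ j : s, β j * y j)
          (ψ := fun y : ({i} : Finset ι) → ℝ => y ⟨i, mem_singleton_self i⟩)
          (measurable_fun_sum _ fun j _ => (measurable_pi_apply j).const_mul _)
          hψ
        have h3 : S = (fun y : s → ℝ => ∑ j : s, β j * y j) ∘ fun ω (j : s) => Y j ω := by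
          funext ω
          simp only [hS, Function.comp]
          exact (Finset.sum_coe_sort s (fun j => β j * Y j ω)).symm
        rw [h3]; exact h2
      set b := β i ^ 2 with hb
      set B := ∑ j ∈ s, β j ^ 2
      have hB0 : 0 ≤ B := sum_nonneg fun _ _ => sq_nonneg _
      have hb0 : 0 ≤ b := sq_nonneg _
      have hfac : ∀ q r : ℕ, ∫ ω, S ω ^ q * Y i ω ^ r ∂P = (∫ ω, S ω ^ q ∂P) * ∫ ω, Y i ω ^ r ∂P := by
        intro q r
        have h1 := hindS.comp (φ := fun x => x ^ q) (ψ := fun x => x ^ r) (by fun_prop) (by fun_prop)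
        exact h1.integral_mul_eq_mul_integral (hSm.pow_const q).aestronglyMeasurable
          ((hY i).pow_const r).aestronglyMeasurable
      have iS : ∀ q r : ℕ, Integrable (fun ω => S ω ^ q * Y i ω ^ r) P := fun q r =>
        ((hM'.pow q).mul ((hM i).pow r)).integrable
      have hY2 : ∫ ω, Y i ω ^ 2 ∂P ≤ |M 2| := by
        have := (hM i).le 2
        simp only [sq_abs] at this
        exact this.trans (le_abs_self _)
      have hYp : ∫ ω, Y i ω ^ (2 * (p + 1)) ∂P ≤ |M (2 * (p + 1))| := by
        have := (hM i).le (2 * (p + 1))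
        simp only [pow_mul, sq_abs] at this ⊢
        exact this.trans (le_abs_self _)
      have hS0 : ∫ ω, S ω ^ (2 * p) ∂P ≤ C * B ^ p := ih hind hY hM hmean β s
      have hY20 : 0 ≤ ∫ ω, Y i ω ^ 2 ∂P := integral_nonneg fun _ => sq_nonneg _
      have hSp0 : 0 ≤ ∫ ω, S ω ^ (2 * p) ∂P := integral_nonneg fun ω => by
        simp only [pow_mul]; positivity
      have hpt : ∀ ω, (∑ j ∈ insert i s, β j * Y j ω) ^ (2 * (p + 1)) ≤
          S ω ^ (2 * (p + 1)) * Y i ω ^ 0 + ((2 * p + 2) * β i) * (S ω ^ (2 * p + 1) * Y i ω ^ 1) +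
            ((A * b) * (S ω ^ (2 * p) * Y i ω ^ 2) + (A * b ^ (p + 1)) * (S ω ^ 0 * Y i ω ^ (2 * (p + 1)))) := by
        intro ω
        rw [sum_insert hi, add_comm]
        refine (add_pow_even_le p (S ω) (β i * Y i ω)).trans (le_of_eq ?_)
        rw [← hA, hb, ← pow_mul, mul_pow (β i) _ (2 * (p + 1))]
        ring
      have i1 : Integrable (fun ω => S ω ^ (2 * (p + 1)) * Y i ω ^ 0 +
          ((2 * p + 2) * β i) * (S ω ^ (2 * p + 1) * Y i ω ^ 1)) P := (iS _ _).add ((iS _ _).const_mul _)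
      have i2 : Integrable (fun ω => (A * b) * (S ω ^ (2 * p) * Y i ω ^ 2) +
          (A * b ^ (p + 1)) * (S ω ^ 0 * Y i ω ^ (2 * (p + 1)))) P :=
        ((iS _ _).const_mul _).add ((iS _ _).const_mul _)
      obtain ⟨M'', hM''⟩ := hSM (insert i s)
      calc ∫ ω, (∑ j ∈ insert i s, β j * Y j ω) ^ (2 * (p + 1)) ∂P
          ≤ ∫ ω, (S ω ^ (2 * (p + 1)) * Y i ω ^ 0 + ((2 * p + 2) * β i) * (S ω ^ (2 * p + 1) * Y i ω ^ 1) +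
            ((A * b) * (S ω ^ (2 * p) * Y i ω ^ 2) + (A * b ^ (p + 1)) * (S ω ^ 0 * Y i ω ^ (2 * (p + 1))))) ∂P :=
            integral_mono (hM''.pow _).integrable (i1.add i2) hpt
        _ = ∫ ω, S ω ^ (2 * (p + 1)) ∂P + A * b * ((∫ ω, S ω ^ (2 * p) ∂P) * ∫ ω, Y i ω ^ 2 ∂P) +
            A * b ^ (p + 1) * ∫ ω, Y i ω ^ (2 * (p + 1)) ∂P := by
            rw [integral_add i1 i2, integral_add (iS _ _) ((iS _ _).const_mul _),
              integral_add ((iS _ _).const_mul _) ((iS _ _).const_mul _), integral_const_mul,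
              integral_const_mul, integral_const_mul, hfac, hfac, hfac, hfac]
            simp only [pow_one, hmean, pow_zero, integral_const, probReal_univ, one_smul]
            ring
        _ ≤ 2 * A * (C * |M 2| + |M (2 * (p + 1))|) * B ^ (p + 1) + A * b * (C * B ^ p * |M 2|) +
            A * b ^ (p + 1) * |M (2 * (p + 1))| := by
            gcongr
        _ ≤ 2 * A * (C * |M 2| + |M (2 * (p + 1))|) * (b + B) ^ (p + 1) := by
            have h1 : B ^ p ≤ (b + B) ^ p := by gcongr; linarith
            have h2 : b ^ p ≤ (b + B) ^ p := by gcongr; linarith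
            have h3 : B ^ (p + 1) + b * B ^ p / 2 + b * b ^ p / 2 ≤ (b + B) ^ (p + 1) := by
              have e1 : b * B ^ p ≤ b * (b + B) ^ p := by gcongr
              have e2 : b * b ^ p ≤ b * (b + B) ^ p := by gcongr
              have e3 : B * B ^ p ≤ B * (b + B) ^ p := by gcongr
              rw [pow_succ', pow_succ']
              linarith
            set D := C * |M 2| + |M (2 * (p + 1))| with hD
            have hD1 : C * |M 2| ≤ D := by rw [hD]; linarith [abs_nonneg (M (2 * (p + 1)))]
            have hD2 : |M (2 * (p + 1))| ≤ D := by
              have : 0 ≤ C * |M 2| := by positivity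
              rw [hD]; linarith
            have hD0 : 0 ≤ D := by positivity
            have e4 : A * b * (C * B ^ p * |M 2|) ≤ A * (b * B ^ p) * D := by
              calc A * b * (C * B ^ p * |M 2|) = A * (b * B ^ p) * (C * |M 2|) := by ring
                _ ≤ _ := by gcongr
            have e5 : A * b ^ (p + 1) * |M (2 * (p + 1))| ≤ A * (b * b ^ p) * D := by
              rw [pow_succ' b p]; gcongr
            have e6 : 2 * A * D * (B ^ (p + 1) + b * B ^ p / 2 + b * b ^ p / 2) ≤
              2 * A * D * (b + B) ^ (p + 1) := by gcongr
            linarith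
        _ = _ := by rw [sum_insert hi]

/-- A linear form in i.i.d. centred variables, with coefficients of Euclidean norm at most one, has
moments bounded independently of the number of variables. -/
theorem exists_momentBound_linear_form {𝒳 : Type} [MeasurableSpace 𝒳] {ρ : Measure 𝒳}
    [IsProbabilityMeasure ρ] {φ : 𝒳 → ℝ} (hφ : Measurable φ) {M : ℕ → ℝ} (hM : MomentBound M φ ρ)
    (hmean : ∫ x, φ x ∂ρ = 0) :
    ∃ C : ℕ → ℝ, ∀ {n : ℕ} (β : Fin n → ℝ),
      (∀ p, ∫ x, (∑ i, β i * φ (x i)) ^ (2 * p) ∂(Measure.pi fun _ => ρ) ≤ C p * (∑ i, β i ^ 2) ^ p) ∧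
      (∑ i, β i ^ 2 ≤ 1 → MomentBound (fun p => 1 + C p) (fun x => ∑ i, β i * φ (x i)) (Measure.pi fun _ => ρ)) := by
  choose C hC h using exists_even_moment_linear_form M
  refine ⟨C, fun {n} β => ?_⟩
  have hMP : ∀ i : Fin n, MeasurePreserving (Function.eval i) (Measure.pi fun _ : Fin n => ρ) ρ :=
    fun i => measurePreserving_eval (fun _ => ρ) i
  have hY : ∀ i : Fin n, Measurable fun x : Fin n → 𝒳 => φ (x i) := fun i =>
    hφ.comp (measurable_pi_apply i)
  have hMi : ∀ i : Fin n, MomentBound M (fun x : Fin n → 𝒳 => φ (x i)) (Measure.pi fun _ => ρ) :=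
    fun i => hM.comp (hMP i)
  have hind : iIndepFun (fun (i : Fin n) (x : Fin n → 𝒳) => φ (x i)) (Measure.pi fun _ => ρ) :=
    iIndepFun_pi (X := fun _ => φ) fun _ => hφ.aemeasurable
  have hmi : ∀ i : Fin n, ∫ x : Fin n → 𝒳, φ (x i) ∂(Measure.pi fun _ => ρ) = 0 := fun i => by
    rw [integral_comp_eval (μ := fun _ : Fin n => ρ) (f := φ) hM.meas, hmean]
  have hle : ∀ p, ∫ x, (∑ i, β i * φ (x i)) ^ (2 * p) ∂(Measure.pi fun _ => ρ) ≤
      C p * (∑ i, β i ^ 2) ^ p := fun p => h p hind hY hMi hmi β Finset.univ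
  refine ⟨hle, fun hβ => ?_⟩
  have hm : Measurable fun x : Fin n → 𝒳 => ∑ i, β i * φ (x i) :=
    measurable_fun_sum _ fun i _ => (hY i).const_mul _
  obtain ⟨M', hM'⟩ : ∃ M', MomentBound M' (fun x : Fin n → 𝒳 => ∑ i, β i * φ (x i)) (Measure.pi fun _ => ρ) := by
    obtain ⟨M', hM'⟩ := MomentBound.exists_sum (ι := Fin n)
      (fun p => (∑ i, |β i| ^ p) * |M p|) Finset.univ
    refine ⟨M', hM' fun i => ((hMi i).const_mul (β i)).weaken fun p => ?_⟩
    calc |β i| ^ p * M p ≤ |β i| ^ p * |M p| := by gcongr; exact le_abs_self _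
      _ ≤ _ := by
        gcongr
        exact single_le_sum (f := fun i => |β i| ^ p) (fun _ _ => by positivity) (mem_univ i)
  refine MomentBound.of_even hm.aestronglyMeasurable (fun p => (hM'.pow _).integrable) fun p => ?_
  refine (hle p).trans ?_
  have h0 : 0 ≤ ∑ i, β i ^ 2 := sum_nonneg fun _ _ => sq_nonneg _
  exact mul_le_of_le_one_right (hC p) (pow_le_one₀ h0 hβ)

end Moments

/-! ### The law of one draw -/

section DrawLaw
variable {n d : ℕ} {κ : Measure (Fin d → ℝ)} {ν : Measure ℝ} {α : ℝ}

theorem isProbabilityMeasure_maskLaw (hα : α ∈ Ioo (0 : ℝ) 1) : IsProbabilityMeasure (maskLaw α) := by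
  refine ⟨?_⟩
  simp only [maskLaw, Measure.coe_add, Measure.coe_smul, Pi.add_apply, Pi.smul_apply,
    measure_univ, smul_eq_mul, mul_one]
  rw [← ofReal_add hα.1.le (by linarith [hα.2])]
  simp

theorem integral_maskLaw (hα : α ∈ Ioo (0 : ℝ) 1) (f : Bool → ℝ) :
    ∫ b, f b ∂maskLaw α = α * f true + (1 - α) * f false := by
  rw [maskLaw, integral_add_measure (Integrable.of_finite.smul_measure ENNReal.ofReal_ne_top)
    (Integrable.of_finite.smul_measure ENNReal.ofReal_ne_top)]
  simp [ENNReal.toReal_ofReal hα.1.le, ENNReal.toReal_ofReal (by linarith [hα.2] : 0 ≤ 1 - α)]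

/-- The joint law of the coefficients and the noise. -/
noncomputable def signalLaw (n : ℕ) (κ : Measure (Fin d → ℝ)) (ν : Measure ℝ) :
    Measure ((Fin d → ℝ) × (Fin n → ℝ)) := κ.prod (Measure.pi fun _ => ν)

variable [IsProbabilityMeasure κ] [IsProbabilityMeasure ν]

instance : IsProbabilityMeasure (signalLaw n κ ν) := by unfold signalLaw; infer_instance

variable [IsProbabilityMeasure (maskLaw α)]

instance : IsProbabilityMeasure (drawLaw n κ ν α) := by unfold drawLaw; infer_instance

theorem measurePreserving_assoc : MeasurePreserving (MeasurableEquiv.prodAssoc :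
      ((Fin d → ℝ) × (Fin n → ℝ)) × (Fin n → Bool) ≃ᵐ Draw n d)
    ((signalLaw n κ ν).prod (Measure.pi fun _ => maskLaw α)) (drawLaw n κ ν α) :=
  ⟨MeasurableEquiv.measurable _, Measure.prodAssoc_prod⟩

theorem integral_draw {E : Type*} [NormedAddCommGroup E] [NormedSpace ℝ E] {f : Draw n d → E}
    (hf : Integrable f (drawLaw n κ ν α)) :
    ∫ ξ, f ξ ∂drawLaw n κ ν α =
      ∫ v, ∫ p, f (p.1, p.2, v) ∂signalLaw n κ ν ∂(Measure.pi fun _ => maskLaw α) := by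
  have hMP := measurePreserving_assoc (n := n) (d := d) (κ := κ) (ν := ν) (α := α)
  rw [← hMP.integral_comp' f]
  exact integral_prod_symm _ (hMP.integrable_comp_of_integrable hf)

theorem measurable_of_sections {E : Type*} [MeasurableSpace E] {f : Draw n d → E}
    (h : ∀ v, Measurable fun p : (Fin d → ℝ) × (Fin n → ℝ) => f (p.1, p.2, v)) : Measurable f := by
  have h1 : Measurable fun x : ((Fin d → ℝ) × (Fin n → ℝ)) × (Fin n → Bool) => f (x.1.1, x.1.2, x.2) :=
    measurable_from_prod_countable_left h
  exact h1.comp (MeasurableEquiv.prodAssoc :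
      ((Fin d → ℝ) × (Fin n → ℝ)) × (Fin n → Bool) ≃ᵐ Draw n d).symm.measurable

theorem integrable_of_sections {f : Draw n d → ℝ} (hf : Measurable f)
    (h : ∀ v, Integrable (fun p : (Fin d → ℝ) × (Fin n → ℝ) => f (p.1, p.2, v)) (signalLaw n κ ν)) :
    Integrable f (drawLaw n κ ν α) := by
  have hMP := measurePreserving_assoc (n := n) (d := d) (κ := κ) (ν := ν) (α := α)
  rw [← hMP.integrable_comp hf.aestronglyMeasurable, integrable_prod_iff'
    (hf.comp hMP.measurable).aestronglyMeasurable]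
  exact ⟨Filter.Eventually.of_forall h, Integrable.of_finite⟩

theorem MomentBound.of_sections {M : ℕ → ℝ} {f : Draw n d → ℝ} (hf : Measurable f)
    (h : ∀ v, MomentBound M (fun p : (Fin d → ℝ) × (Fin n → ℝ) => f (p.1, p.2, v)) (signalLaw n κ ν)) :
    MomentBound M f (drawLaw n κ ν α) := by
  have hi : ∀ p : ℕ, Integrable (fun ξ => |f ξ| ^ p) (drawLaw n κ ν α) := fun p =>
    integrable_of_sections (by fun_prop) fun v => (h v).int p
  refine ⟨hf.aestronglyMeasurable, hi, fun p => ?_⟩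
  rw [integral_draw (hi p)]
  calc _ ≤ ∫ _v : Fin n → Bool, M p ∂(Measure.pi fun _ => maskLaw α) :=
        integral_mono Integrable.of_finite (integrable_const _) fun v => (h v).le p
    _ = M p := by simp

theorem measurePreserving_coef : MeasurePreserving Prod.fst (signalLaw n κ ν) κ := by
  unfold signalLaw; exact measurePreserving_fst

theorem measurePreserving_noise :
    MeasurePreserving Prod.snd (signalLaw n κ ν) (Measure.pi fun _ => ν) := by
  unfold signalLaw; exact measurePreserving_snd

theorem measurePreserving_signal : MeasurePreserving (fun ξ : Draw n d => (ξ.1, ξ.2.1))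
    (drawLaw n κ ν α) (signalLaw n κ ν) := by
  have h : MeasurePreserving Prod.fst ((signalLaw n κ ν).prod (Measure.pi fun _ : Fin n => maskLaw α))
    (signalLaw n κ ν) := measurePreserving_fst
  exact h.comp (measurePreserving_assoc (n := n) (d := d) (κ := κ) (ν := ν) (α := α)).symm

theorem measurePreserving_pattern : MeasurePreserving (fun ξ : Draw n d => ξ.2.2)
    (drawLaw n κ ν α) (Measure.pi fun _ => maskLaw α) := by
  have h : MeasurePreserving Prod.snd ((signalLaw n κ ν).prod (Measure.pi fun _ : Fin n => maskLaw α))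
    (Measure.pi fun _ : Fin n => maskLaw α) := measurePreserving_snd
  exact h.comp (measurePreserving_assoc (n := n) (d := d) (κ := κ) (ν := ν) (α := α)).symm

end DrawLaw

/-! ### Moments of linear statistics -/

section Statistics
variable {n d : ℕ} {κ : Measure (Fin d → ℝ)} {ν : Measure ℝ} {α σ : ℝ} {lam : Fin d → ℝ}

/-- The full data vector `U c + a`. -/
def signal (U : Mat n d) (p : (Fin d → ℝ) × (Fin n → ℝ)) : Fin n → ℝ :=
  U *ᵥ p.1 + p.2

theorem measurable_signal (U : Mat n d) : Measurable (signal U) := by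
  have : Continuous (signal U) := by unfold signal; fun_prop
  exact this.measurable

theorem IsCoefLaw.exists_momentBound (hκ : IsCoefLaw κ lam) : ∃ M, MomentBound M vnorm κ := by
  have h0 : MomentBound (fun p => ∫ c, ‖c‖ ^ p ∂κ) (fun c : Fin d → ℝ => ‖c‖) κ :=
    ⟨continuous_norm.aestronglyMeasurable, by simpa using hκ.moments, fun p => by simp⟩
  refine ⟨_, (h0.const_mul d).mono continuous_vnorm.aestronglyMeasurable fun c => ?_⟩
  rw [abs_of_nonneg (vnorm_nonneg _)]
  refine (vnorm_le_sum c).trans (le_trans ?_ (le_abs_self _))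
  calc ∑ i, |c i| ≤ ∑ _i : Fin d, ‖c‖ := sum_le_sum fun i _ => norm_le_pi_norm c i
    _ = d * ‖c‖ := by simp

theorem IsNoiseLaw.momentBound (hν : IsNoiseLaw ν σ) :
    MomentBound (fun p => ∫ x, |x| ^ p ∂ν) (fun x => x) ν :=
  ⟨continuous_id.aestronglyMeasurable, hν.moments, fun _ => le_rfl⟩

theorem MomentBound.exists_vnorm (M : ℕ → ℝ) (m : ℕ) : ∃ M' : ℕ → ℝ,
    ∀ {Ω : Type} [MeasurableSpace Ω] {μ : Measure Ω} [IsProbabilityMeasure μ] {f : Ω → Fin m → ℝ},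
      (∀ i, MomentBound M (fun x => f x i) μ) → MomentBound M' (fun x => vnorm (f x)) μ := by
  obtain ⟨M', h⟩ := MomentBound.exists_sum (ι := Fin m) M Finset.univ
  refine ⟨M', fun {Ω} _ μ _ f hf => (h fun i => (hf i).abs).mono ?_ fun x => ?_⟩
  · exact continuous_vnorm.comp_aestronglyMeasurable
      (aemeasurable_pi_iff.2 fun i => (hf i).meas.aemeasurable).aestronglyMeasurable
  · rw [abs_of_nonneg (vnorm_nonneg _)]
    exact (vnorm_le_sum _).trans (le_abs_self _)

theorem sum_sq_col_le_one {m : ℕ} {B : Mat n m} (hB : ‖B‖ ≤ 1) (j : Fin m) :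
    ∑ i, B i j ^ 2 ≤ 1 := by
  have h := (vnorm_col_le_norm B j).trans hB
  have h2 := vnorm_sq_eq_sum (fun i => B i j)
  rw [← h2]
  exact pow_le_one₀ (vnorm_nonneg _) h

theorem exists_momentBound_noise (hν : IsNoiseLaw ν σ) (m : ℕ) :
    ∃ M, ∀ {n : ℕ} (B : Mat n m), ‖B‖ ≤ 1 →
      MomentBound M (fun a => vnorm (Bᵀ *ᵥ a)) (Measure.pi fun _ => ν) := by
  have := hν.isProb
  obtain ⟨C, hC⟩ := exists_momentBound_linear_form (φ := fun x : ℝ => x) measurable_id hν.momentBound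
    hν.mean
  obtain ⟨M', hM'⟩ := MomentBound.exists_vnorm (fun p => 1 + C p) m
  exact ⟨M', fun B hB => hM' fun j => (hC fun i => B i j).2 (sum_sq_col_le_one hB j)⟩

theorem exists_momentBound_signal (hν : IsNoiseLaw ν σ) (hκ : IsCoefLaw κ lam) (m : ℕ) :
    ∃ M, ∀ {n : ℕ} {U : Mat n d} (B : Mat n m), Uᵀ * U = 1 → ‖B‖ ≤ 1 →
      MomentBound M (fun p => vnorm (Bᵀ *ᵥ signal U p)) (signalLaw n κ ν) := by
  have := hν.isProb
  have := hκ.isProb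
  obtain ⟨M₁, h₁⟩ := hκ.exists_momentBound
  obtain ⟨M₂, h₂⟩ := exists_momentBound_noise hν m
  refine ⟨_, fun {n U} B hU hB => ((h₁.comp (measurePreserving_coef (n := n) (ν := ν))).add
    ((h₂ B hB).comp (measurePreserving_noise (κ := κ)))).mono ?_ fun p => ?_⟩
  · exact (continuous_vnorm.measurable.comp (measurable_matrix_mulVec measurable_const
      (measurable_signal U))).aestronglyMeasurable
  · rw [abs_of_nonneg (vnorm_nonneg _), abs_of_nonneg (add_nonneg (vnorm_nonneg _) (vnorm_nonneg _)),
      signal, mulVec_add, mulVec_mulVec]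
    refine (vnorm_add_le _ _).trans ?_
    gcongr
    refine (vnorm_mulVec_le _ _).trans (mul_le_of_le_one_left (vnorm_nonneg _) ?_)
    refine (norm_mul_le_mul _ _).trans (mul_le_one₀ ?_ (norm_nonneg _) (norm_le_one_of_isometry hU))
    rwa [norm_transpose]

theorem exists_momentBound_masked (hν : IsNoiseLaw ν σ) (hκ : IsCoefLaw κ lam)
    (hα : α ∈ Ioo (0 : ℝ) 1) (m : ℕ) :
    ∃ M, ∀ {n : ℕ} {U : Mat n d} (B : (Fin n → Bool) → Mat n m),
      Uᵀ * U = 1 → (∀ v, ‖B v‖ ≤ 1) →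
      MomentBound M (fun ξ => vnorm ((B ξ.2.2)ᵀ *ᵥ signal U (ξ.1, ξ.2.1))) (drawLaw n κ ν α) := by
  have := hν.isProb
  have := hκ.isProb
  have := isProbabilityMeasure_maskLaw hα
  obtain ⟨M, h⟩ := exists_momentBound_signal hν hκ m
  refine ⟨M, fun {n U} B hU hB => MomentBound.of_sections (measurable_of_sections fun v => ?_)
    fun v => h (B v) hU (hB v)⟩
  exact continuous_vnorm.measurable.comp (measurable_matrix_mulVec
    (measurable_const (a := (B v)ᵀ)) (measurable_signal U))

theorem exists_momentBound_entries (hν : IsNoiseLaw ν σ) (hκ : IsCoefLaw κ lam)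
    (hα : α ∈ Ioo (0 : ℝ) 1) :
    ∃ M, ∀ {n : ℕ} {U : Mat n d}, 1 ≤ n → Uᵀ * U = 1 →
      MomentBound M (fun ξ => (∑ i, signal U (ξ.1, ξ.2.1) i ^ 4) / n) (drawLaw n κ ν α) := by
  have := hν.isProb
  have := hκ.isProb
  have := isProbabilityMeasure_maskLaw hα
  obtain ⟨M₁, h₁⟩ := hκ.exists_momentBound
  have h₂ := hν.momentBound
  refine ⟨fun p => 2 ^ (4 * p) * (M₁ (4 * p) + ∫ x, |x| ^ (4 * p) ∂ν),
    fun {n U} hn hU => MomentBound.average hn fun i => ?_⟩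
  have hi : MomentBound (fun p => ∫ x, |x| ^ p ∂ν) (fun p : (Fin d → ℝ) × (Fin n → ℝ) => p.2 i)
      (signalLaw n κ ν) := (h₂.comp (measurePreserving_eval (fun _ : Fin n => ν) i)).comp
        (measurePreserving_noise (κ := κ))
  have h : MomentBound (fun p => 2 ^ p * (M₁ p + ∫ x, |x| ^ p ∂ν))
      (fun p : (Fin d → ℝ) × (Fin n → ℝ) => signal U p i) (signalLaw n κ ν) :=
    ((h₁.comp (measurePreserving_coef (n := n) (ν := ν))).add hi.abs).mono
      ((measurable_pi_apply i).comp (measurable_signal U)).aestronglyMeasurable fun p => by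
        rw [abs_of_nonneg (add_nonneg (vnorm_nonneg _) (abs_nonneg _)), signal, Pi.add_apply]
        refine (abs_add_le _ _).trans ?_
        gcongr
        refine (abs_apply_le_vnorm _ i).trans ((vnorm_mulVec_le _ _).trans ?_)
        exact mul_le_of_le_one_left (vnorm_nonneg _) (norm_le_one_of_isometry hU)
  exact (h.comp (measurePreserving_signal (α := α))).pow 4

/-- A sampling indicator, centred. -/
noncomputable def centredMask (α : ℝ) (b : Bool) : ℝ := (if b then 1 else 0) - α

theorem exists_momentBound_pattern (hα : α ∈ Ioo (0 : ℝ) 1) :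
    ∃ M, ∀ {n : ℕ} (β : Fin n → ℝ), ∑ i, β i ^ 2 ≤ 1 →
      MomentBound M (fun v => ∑ i, β i * centredMask α (v i)) (Measure.pi fun _ => maskLaw α) := by
  have := isProbabilityMeasure_maskLaw hα
  have h1 : MomentBound (fun p => |(1 : ℝ)| ^ p) (centredMask α) (maskLaw α) :=
    (MomentBound.const 1).mono (measurable_of_finite _).aestronglyMeasurable fun b => by
      rw [abs_one, centredMask]
      cases b <;> simp [abs_le] <;> constructor <;> linarith [hα.1, hα.2]
  have h2 : ∫ b, centredMask α b ∂maskLaw α = 0 := by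
    rw [integral_maskLaw hα]; simp [centredMask]; ring
  obtain ⟨C, hC⟩ := exists_momentBound_linear_form (measurable_of_finite _) h1 h2
  exact ⟨_, fun β hβ => (hC β).2 hβ⟩

theorem transpose_mul_mask_sub_mul_apply {k l : ℕ} (A : Mat n k)
    (B : Mat n l) (v : Fin n → Bool) (i : Fin k) (j : Fin l) :
    (Aᵀ * (mask v - α • (1 : Mat n n)) * B) i j =
      ∑ x, A x i * B x j * centredMask α (v x) := by
  have : mask v - α • (1 : Mat n n) = Matrix.diagonal fun x => centredMask α (v x) := by
    rw [mask, Matrix.smul_one_eq_diagonal, Matrix.diagonal_sub]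
    rfl
  rw [this, Matrix.mul_apply]
  refine sum_congr rfl fun x _ => ?_
  rw [Matrix.mul_diagonal, Matrix.transpose_apply]; ring

theorem norm_le_sum_abs {k l : ℕ} (A : Mat k l) : ‖A‖ ≤ ∑ i, ∑ j, |A i j| := by
  refine abs_le_of_sq_le_sq' ?_ (by positivity) |>.2
  refine (sq_norm_le_sum A).trans ?_
  have h1 : ∀ (m : ℕ) (f : Fin m → ℝ), (∀ i, 0 ≤ f i) → ∑ i, f i ^ 2 ≤ (∑ i, f i) ^ 2 := fun m f hf =>
    Finset.sum_sq_le_sq_sum_of_nonneg fun i _ => hf i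
  calc ∑ i, ∑ j, A i j ^ 2 = ∑ i, ∑ j, |A i j| ^ 2 := by simp only [sq_abs]
    _ ≤ ∑ i, (∑ j, |A i j|) ^ 2 := sum_le_sum fun i _ => h1 _ _ fun _ => abs_nonneg _
    _ ≤ _ := h1 _ _ fun i => by positivity

theorem exists_momentBound_gram (hα : α ∈ Ioo (0 : ℝ) 1) (k l : ℕ) :
    ∃ M, ∀ {n : ℕ} (A : Mat n k) (B : Mat n l) (s : ℝ), 0 ≤ s →
      (∀ i j, ∑ x, (A x i * B x j) ^ 2 ≤ s ^ 2) → ∃ Y : (Fin n → Bool) → ℝ,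
        MomentBound M Y (Measure.pi fun _ => maskLaw α) ∧ ∀ v, 0 ≤ Y v ∧
          ‖Aᵀ * (mask v - α • (1 : Mat n n)) * B‖ ≤ s * Y v := by
  have := isProbabilityMeasure_maskLaw hα
  obtain ⟨M₁, h₁⟩ := exists_momentBound_pattern hα
  obtain ⟨M₂, h₂⟩ := MomentBound.exists_sum (ι := Fin l) M₁ Finset.univ
  obtain ⟨M₃, h₃⟩ := MomentBound.exists_sum (ι := Fin k) M₂ Finset.univ
  refine ⟨M₃, fun {n} A B s hs hAB => ⟨fun v => ∑ i, ∑ j, |∑ x, s⁻¹ * (A x i * B x j) * centredMask α (v x)|,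
    h₃ fun i => h₂ fun j => (h₁ (fun x => s⁻¹ * (A x i * B x j)) ?_).abs, fun v => ⟨by positivity, ?_⟩⟩⟩
  · simp only [mul_pow _ _ 2, ← mul_sum]
    have h := hAB i j
    simp only [mul_pow _ _ 2] at h
    rcases hs.eq_or_lt with rfl | hs
    · simp
    · rw [inv_pow, inv_mul_le_iff₀ (by positivity)]; simpa using h
  · refine (norm_le_sum_abs _).trans ?_
    simp only [mul_sum]
    refine sum_le_sum fun i _ => sum_le_sum fun j _ => ?_
    rw [transpose_mul_mask_sub_mul_apply]
    rcases hs.eq_or_lt with rfl | hs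
    · have h0 : ∀ x, A x i * B x j = 0 := fun x => by
        have h := hAB i j
        have h1 := single_le_sum (f := fun x => (A x i * B x j) ^ 2) (fun _ _ => sq_nonneg _)
          (mem_univ x)
        have h2 : (A x i * B x j) ^ 2 ≤ 0 := by simpa using h1.trans h
        exact pow_eq_zero_iff two_ne_zero |>.1 (le_antisymm h2 (sq_nonneg _))
      simp [h0]
    · simp only [mul_assoc s⁻¹, ← mul_sum, abs_mul, abs_inv, abs_of_pos hs]
      rw [mul_inv_cancel_left₀ hs.ne']

end Statistics

/-! ### The least-squares fit -/

section LeastSquares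
variable {n d : ℕ} {ε : ℝ}

/-- The matrix whose transpose maps the full data vector to the least-squares coefficients. -/
noncomputable def fitMat (X : Mat n d) (v : Fin n → Bool) : Mat n d :=
  mask v * X * (maskedGram X v)⁻¹

/-- The matrix that maps the full data vector to the residual. -/
noncomputable def residMat (X : Mat n d) (v : Fin n → Bool) :
    Mat n n :=
  mask v - mask v * X * (fitMat X v)ᵀ

/-- The residual `y - Ω X w`. -/
noncomputable def resid (X : Mat n d) (o : Obs n) : Fin n → ℝ :=
  o.1 - mask o.2 *ᵥ (X *ᵥ coeff X o)

/-- The masked iterate, orthonormalized. -/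
noncomputable def isoMat (X : Mat n d) (v : Fin n → Bool) : Mat n d :=
  mask v * X * invSqrt (maskedGram X v)

theorem transpose_maskedGram (X : Mat n d) (v : Fin n → Bool) :
    (maskedGram X v)ᵀ = maskedGram X v := isHermitian_iff'.1 (maskedGram_isHermitian X v)

theorem transpose_fitMat (X : Mat n d) (v : Fin n → Bool) :
    (fitMat X v)ᵀ = (maskedGram X v)⁻¹ * (Xᵀ * mask v) := by
  rw [fitMat, transpose_mul, transpose_mul, mask_transpose, Matrix.transpose_nonsing_inv,
    transpose_maskedGram]

theorem coeff_observe (U X : Mat n d) (ξ : Draw n d) :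
    ŵ[X, U, ξ] = (fitMat X ξ.2.2)ᵀ *ᵥ signal U (ξ.1, ξ.2.1) := by
  rw [transpose_fitMat, coeff, observe, signal]
  simp only [mulVec_mulVec]
  rw [mask_mul_mask]

theorem mask_mulVec_coeff (U X : Mat n d) (ξ : Draw n d) :
    mask ξ.2.2 *ᵥ (X *ᵥ ŵ[X, U, ξ]) =
      (mask ξ.2.2 * X * (fitMat X ξ.2.2)ᵀ) *ᵥ signal U (ξ.1, ξ.2.1) := by
  rw [coeff_observe]; simp only [mulVec_mulVec, mmul_assoc]

theorem resid_observe (U X : Mat n d) (ξ : Draw n d) :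
    resid X (observe U ξ) = residMat X ξ.2.2 *ᵥ signal U (ξ.1, ξ.2.1) := by
  rw [resid, residMat, sub_mulVec, ← mask_mulVec_coeff]; rfl

section
variable {X : Mat n d} {v : Fin n → Bool} (hε : 0 < ε) (h : Enough ε X v)
include hε h

theorem Enough.posDef : (maskedGram X v).PosDef := (enough_atLeast h).posDef hε

theorem Enough.isUnit_det : IsUnit (maskedGram X v).det := (enough_atLeast h).isUnit_det hε

theorem Enough.norm_inv_le : ‖(maskedGram X v)⁻¹‖ ≤ ε⁻¹ := (enough_atLeast h).norm_inv_le hε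

theorem Enough.fitMat_gram : (fitMat X v)ᵀ * fitMat X v = (maskedGram X v)⁻¹ := by
  rw [transpose_fitMat, fitMat]
  have : (maskedGram X v)⁻¹ * (Xᵀ * mask v) * (mask v * X * (maskedGram X v)⁻¹) =
      (maskedGram X v)⁻¹ * (Xᵀ * (mask v * mask v) * X) * (maskedGram X v)⁻¹ := by
    simp only [mmul_assoc]
  rw [this, mask_mul_mask, ← maskedGram, nonsing_inv_mul _ (h.isUnit_det hε), mone_mul]

theorem Enough.norm_fitMat_sq_le : ‖fitMat X v‖ ^ 2 ≤ ε⁻¹ := by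
  rw [← norm_transpose_mul_self, h.fitMat_gram hε]; exact h.norm_inv_le hε

theorem Enough.isoMat_gram : (isoMat X v)ᵀ * isoMat X v = 1 := by
  have : (isoMat X v)ᵀ * isoMat X v =
      invSqrt (maskedGram X v) * (Xᵀ * (mask v * mask v) * X) * invSqrt (maskedGram X v) := by
    rw [isoMat]
    simp only [transpose_mul, mask_transpose, transpose_invSqrt, mmul_assoc]
  rw [this, mask_mul_mask, ← maskedGram]
  exact invSqrt_mul_mul_invSqrt (h.posDef hε)

theorem Enough.isoMat_mul_transpose : isoMat X v * (isoMat X v)ᵀ = mask v * X * (fitMat X v)ᵀ := by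
  have : isoMat X v * (isoMat X v)ᵀ =
      mask v * X * (invSqrt (maskedGram X v) * invSqrt (maskedGram X v)) * (Xᵀ * mask v) := by
    rw [isoMat]
    simp only [transpose_mul, mask_transpose, transpose_invSqrt, mmul_assoc]
  rw [this, invSqrt_mul_invSqrt (h.posDef hε), transpose_fitMat, mmul_assoc (mask v * X)]

theorem Enough.vnorm_fit_le (z : Fin n → ℝ) :
    vnorm ((mask v * X * (fitMat X v)ᵀ) *ᵥ z) ≤ vnorm ((isoMat X v)ᵀ *ᵥ z) := by
  rw [← h.isoMat_mul_transpose hε, ← mulVec_mulVec]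
  exact (vnorm_mulVec_le _ _).trans
    (mul_le_of_le_one_left (vnorm_nonneg _) (norm_le_one_of_isometry (h.isoMat_gram hε)))

/-- Pythagoras: the residual is orthogonal to the fit. -/
theorem Enough.vnorm_resid_sq (z : Fin n → ℝ) : vnorm (residMat X v *ᵥ z) ^ 2 =
    vnorm (mask v *ᵥ z) ^ 2 - vnorm ((isoMat X v)ᵀ *ᵥ z) ^ 2 := by
  set C := isoMat X v with hC
  have h1 : residMat X v = mask v - C * Cᵀ := by rw [residMat, ← h.isoMat_mul_transpose hε]
  have hCC : Cᵀ * C = 1 := h.isoMat_gram hε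
  have hmC : mask v * C = C := by
    rw [hC, isoMat, ← mmul_assoc, ← mmul_assoc, mask_mul_mask]
  have hCm : Cᵀ * mask v = Cᵀ := by
    have := congrArg Matrix.transpose hmC
    rwa [transpose_mul, mask_transpose] at this
  have h2 : (residMat X v)ᵀ * residMat X v = mask v - C * Cᵀ := by
    rw [h1, transpose_sub, mask_transpose, transpose_mul, transpose_transpose,
      msub_mul, mmul_sub, mmul_sub, mask_mul_mask, ← mmul_assoc, hmC,
      mmul_assoc C, hCm, mmul_assoc C Cᵀ, ← mmul_assoc Cᵀ C, hCC, mone_mul]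
    abel
  rw [vnorm_sq, vnorm_sq, vnorm_sq, dotProduct_mulVec_transpose, mulVec_mulVec, h2,
    sub_mulVec, sub_dotProduct, ← mulVec_mulVec z C, dotProduct_mulVec_transpose (mask v),
    mask_transpose, mulVec_mulVec z (mask v) (mask v), mask_mul_mask,
    dotProduct_mulVec_transpose Cᵀ,
    transpose_transpose]

end

theorem transpose_mulVec_resid (X : Mat n d) (o : Obs n) (hε : 0 < ε)
    (h : Enough ε X o.2) : Xᵀ *ᵥ (mask o.2 *ᵥ resid X o) = 0 := by
  have : Xᵀ *ᵥ (mask o.2 *ᵥ resid X o) =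
      Xᵀ *ᵥ (mask o.2 *ᵥ o.1) - maskedGram X o.2 *ᵥ coeff X o := by
    rw [resid, mulVec_sub, mulVec_sub, maskedGram]
    simp only [mulVec_mulVec, mmul_assoc]
    rw [← mmul_assoc (mask o.2) (mask o.2), mask_mul_mask]
  rw [this, coeff, mulVec_mulVec _ (maskedGram X o.2), mul_nonsing_inv _ (h.isUnit_det hε), one_mulVec,
    sub_self]

theorem mask_mulVec_resid (U X : Mat n d) (ξ : Draw n d) :
    mask ξ.2.2 *ᵥ resid X (observe U ξ) = resid X (observe U ξ) := by
  simp only [resid, observe, mulVec_sub, mulVec_mulVec, ← mmul_assoc, mask_mul_mask]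

theorem transpose_mulVec_resid_observe {U X : Mat n d} {ξ : Draw n d} (hε : 0 < ε)
    (h : Enough ε X ξ.2.2) : Xᵀ *ᵥ resid X (observe U ξ) = 0 := by
  rw [← mask_mulVec_resid]
  exact transpose_mulVec_resid X (observe U ξ) hε h

end LeastSquares

/-! ### Second moments -/

section SecondMoments
variable {n d : ℕ} {κ : Measure (Fin d → ℝ)} {ν : Measure ℝ} {α σ : ℝ} {lam : Fin d → ℝ}

/-- The covariance of the full data vector. -/
noncomputable def dataCov (U : Mat n d) (lam : Fin d → ℝ) (σ : ℝ) :
    Mat n n :=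
  U * lamSq lam * Uᵀ + σ ^ 2 • (1 : Mat n n)

theorem integral_coef_mul (hκ : IsCoefLaw κ lam) (f g : Fin d → ℝ) :
    Integrable (fun c => (f ⬝ᵥ c) * (g ⬝ᵥ c)) κ ∧
      ∫ c, (f ⬝ᵥ c) * (g ⬝ᵥ c) ∂κ = f ⬝ᵥ (lamSq lam *ᵥ g) := by
  have := hκ.isProb
  have hi : ∀ i j, Integrable (fun c : Fin d → ℝ => c i * c j) κ := fun i j =>
    (hκ.moments 2).mono' (by fun_prop) (ae_of_all _ fun c => by
      rw [norm_mul, sq]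
      exact mul_le_mul (norm_le_pi_norm c i) (norm_le_pi_norm c j) (norm_nonneg _) (norm_nonneg _))
  have he : (fun c : Fin d → ℝ => (f ⬝ᵥ c) * (g ⬝ᵥ c)) =
      fun c => ∑ i, ∑ j, (f i * g j) * (c i * c j) := by
    funext c
    simp only [dotProduct, sum_mul_sum]
    refine sum_congr rfl fun i _ => sum_congr rfl fun j _ => by ring
  rw [he]
  refine ⟨integrable_finsetSum _ fun i _ => integrable_finsetSum _ fun j _ => (hi i j).const_mul _, ?_⟩
  rw [integral_finsetSum _ fun i _ => integrable_finsetSum _ fun j _ => (hi i j).const_mul _]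
  simp only [dotProduct, lamSq, Matrix.mulVec_diagonal]
  refine sum_congr rfl fun i _ => ?_
  rw [integral_finsetSum _ fun j _ => (hi i j).const_mul _]
  simp only [integral_const_mul, hκ.cov]
  simp
  ring

theorem integral_coef (hκ : IsCoefLaw κ lam) (f : Fin d → ℝ) :
    Integrable (fun c => f ⬝ᵥ c) κ ∧ ∫ c, f ⬝ᵥ c ∂κ = 0 := by
  have := hκ.isProb
  have hi : ∀ i, Integrable (fun c : Fin d → ℝ => c i) κ := fun i =>
    (hκ.moments 1).mono' (measurable_pi_apply i).aestronglyMeasurable (ae_of_all _ fun c => by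
      rw [pow_one]; exact norm_le_pi_norm c i)
  simp only [dotProduct]
  refine ⟨integrable_finsetSum _ fun i _ => (hi i).const_mul _, ?_⟩
  rw [integral_finsetSum _ fun i _ => (hi i).const_mul _]
  simp [integral_const_mul, hκ.mean]

theorem integral_noise_mul (hν : IsNoiseLaw ν σ) (p q : Fin n → ℝ) :
    Integrable (fun a => (p ⬝ᵥ a) * (q ⬝ᵥ a)) (Measure.pi fun _ : Fin n => ν) ∧
      ∫ a, (p ⬝ᵥ a) * (q ⬝ᵥ a) ∂(Measure.pi fun _ : Fin n => ν) = σ ^ 2 * (p ⬝ᵥ q) := by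
  have := hν.isProb
  have hM : ∀ i, MomentBound (fun p => ∫ x, |x| ^ p ∂ν) (fun a : Fin n → ℝ => a i)
      (Measure.pi fun _ => ν) := fun i => 
    hν.momentBound.comp (measurePreserving_eval (fun _ : Fin n => ν) i)
  have hi : ∀ i j, Integrable (fun a : Fin n → ℝ => a i * a j) (Measure.pi fun _ => ν) := fun i j =>
    ((hM i).mul (hM j)).integrable
  have hind : iIndepFun (fun (i : Fin n) (x : Fin n → ℝ) => x i) (Measure.pi fun _ => ν) :=
    iIndepFun_pi (X := fun _ x => x) fun _ => aemeasurable_id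
  have hval : ∀ i j, ∫ a : Fin n → ℝ, a i * a j ∂(Measure.pi fun _ => ν) = if i = j then σ ^ 2 else 0 := by
    intro i j
    split_ifs with hij
    · subst hij
      have h := integral_comp_eval (μ := fun _ : Fin n => ν) (i := i) (f := fun x => x ^ 2)
        (by fun_prop)
      simp only [sq] at h ⊢
      rw [h, ← sq, ← hν.variance]; simp only [sq]
    · have h1 := (hind.indepFun hij).integral_mul_eq_mul_integral
        (measurable_pi_apply i).aestronglyMeasurable (measurable_pi_apply j).aestronglyMeasurable
      have h2 := integral_comp_eval (μ := fun _ : Fin n => ν) (i := i) (f := fun x => x) (by fun_prop)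
      simp only [hν.mean] at h2
      rw [h2, zero_mul] at h1
      exact h1
  have he : (fun a : Fin n → ℝ => (p ⬝ᵥ a) * (q ⬝ᵥ a)) =
      fun a => ∑ i, ∑ j, (p i * q j) * (a i * a j) := by
    funext c
    simp only [dotProduct, sum_mul_sum]
    refine sum_congr rfl fun i _ => sum_congr rfl fun j _ => by ring
  rw [he]
  refine ⟨integrable_finsetSum _ fun i _ => integrable_finsetSum _ fun j _ => (hi i j).const_mul _, ?_⟩
  rw [integral_finsetSum _ fun i _ => integrable_finsetSum _ fun j _ => (hi i j).const_mul _]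
  simp only [dotProduct, mul_sum]
  refine sum_congr rfl fun i _ => ?_
  rw [integral_finsetSum _ fun j _ => (hi i j).const_mul _]
  simp only [integral_const_mul, hval]
  simp
  ring

theorem integral_noise (hν : IsNoiseLaw ν σ) (p : Fin n → ℝ) :
    Integrable (fun a => p ⬝ᵥ a) (Measure.pi fun _ : Fin n => ν) ∧
      ∫ a, p ⬝ᵥ a ∂(Measure.pi fun _ : Fin n => ν) = 0 := by
  have := hν.isProb
  have hM : ∀ i, MomentBound (fun p => ∫ x, |x| ^ p ∂ν) (fun a : Fin n → ℝ => a i)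
      (Measure.pi fun _ => ν) := fun i => 
    hν.momentBound.comp (measurePreserving_eval (fun _ : Fin n => ν) i)
  simp only [dotProduct]
  refine ⟨integrable_finsetSum _ fun i _ => (hM i).integrable.const_mul _, ?_⟩
  rw [integral_finsetSum _ fun i _ => (hM i).integrable.const_mul _]
  have h2 : ∀ i, ∫ a : Fin n → ℝ, a i ∂(Measure.pi fun _ => ν) = 0 := fun i => by
    rw [integral_comp_eval (μ := fun _ : Fin n => ν) (i := i) (f := fun x => x) (by fun_prop), hν.mean]
  simp [integral_const_mul, h2]

theorem integral_comp_measurePreserving {Ω Ω' : Type*} [MeasurableSpace Ω] [MeasurableSpace Ω']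
    {μ : Measure Ω} {μ' : Measure Ω'} {φ : Ω' → Ω} (h : MeasurePreserving φ μ' μ) {f : Ω → ℝ}
    (hf : AEStronglyMeasurable f μ) : ∫ x, f (φ x) ∂μ' = ∫ x, f x ∂μ := by
  rw [← h.map_eq] at hf ⊢
  exact (integral_map h.measurable.aemeasurable hf).symm

theorem integral_signal_mul (hν : IsNoiseLaw ν σ) (hκ : IsCoefLaw κ lam) (U : Mat n d)
    (p q : Fin n → ℝ) :
    Integrable (fun x => (p ⬝ᵥ signal U x) * (q ⬝ᵥ signal U x)) (signalLaw n κ ν) ∧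
      ∫ x, (p ⬝ᵥ signal U x) * (q ⬝ᵥ signal U x) ∂signalLaw n κ ν = p ⬝ᵥ (dataCov U lam σ *ᵥ q) := by
  have := hν.isProb
  have := hκ.isProb
  obtain ⟨icc, hcc⟩ := integral_coef_mul hκ (Uᵀ *ᵥ p) (Uᵀ *ᵥ q)
  obtain ⟨iaa, haa⟩ := integral_noise_mul hν p q
  obtain ⟨ic, hc⟩ := integral_coef hκ (Uᵀ *ᵥ p)
  obtain ⟨ic', hc'⟩ := integral_coef hκ (Uᵀ *ᵥ q)
  obtain ⟨ia, ha⟩ := integral_noise (n := n) hν p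
  obtain ⟨ia', ha'⟩ := integral_noise (n := n) hν q
  have he : (fun x => (p ⬝ᵥ signal U x) * (q ⬝ᵥ signal U x)) = fun x =>
      (((Uᵀ *ᵥ p) ⬝ᵥ x.1) * ((Uᵀ *ᵥ q) ⬝ᵥ x.1) + (p ⬝ᵥ x.2) * (q ⬝ᵥ x.2)) +
        (((Uᵀ *ᵥ p) ⬝ᵥ x.1) * (q ⬝ᵥ x.2) + ((Uᵀ *ᵥ q) ⬝ᵥ x.1) * (p ⬝ᵥ x.2)) := by
    funext x
    simp only [signal, dotProduct_add, dotProduct_mulVec_transpose]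
    ring
  have i1 : Integrable (fun x => ((Uᵀ *ᵥ p) ⬝ᵥ x.1) * ((Uᵀ *ᵥ q) ⬝ᵥ x.1)) (signalLaw n κ ν) :=
    (measurePreserving_coef (n := n) (ν := ν)).integrable_comp_of_integrable icc
  have i2 : Integrable (fun x => (p ⬝ᵥ x.2) * (q ⬝ᵥ x.2)) (signalLaw n κ ν) :=
    (measurePreserving_noise (κ := κ) (ν := ν)).integrable_comp_of_integrable iaa
  have i3 : Integrable (fun x => ((Uᵀ *ᵥ p) ⬝ᵥ x.1) * (q ⬝ᵥ x.2)) (signalLaw n κ ν) := ic.mul_prod ia'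
  have i4 : Integrable (fun x => ((Uᵀ *ᵥ q) ⬝ᵥ x.1) * (p ⬝ᵥ x.2)) (signalLaw n κ ν) := ic'.mul_prod ia
  have e1 : ∫ x, ((Uᵀ *ᵥ p) ⬝ᵥ x.1) * ((Uᵀ *ᵥ q) ⬝ᵥ x.1) ∂signalLaw n κ ν =
      (Uᵀ *ᵥ p) ⬝ᵥ (lamSq lam *ᵥ (Uᵀ *ᵥ q)) := by
    rw [← hcc]
    exact integral_comp_measurePreserving (measurePreserving_coef (n := n) (ν := ν)) icc.1
  have e2 : ∫ x, (p ⬝ᵥ x.2) * (q ⬝ᵥ x.2) ∂signalLaw n κ ν = σ ^ 2 * (p ⬝ᵥ q) := by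
    rw [← haa]
    exact integral_comp_measurePreserving (measurePreserving_noise (κ := κ) (ν := ν)) iaa.1
  have e3 : ∫ x, ((Uᵀ *ᵥ p) ⬝ᵥ x.1) * (q ⬝ᵥ x.2) ∂signalLaw n κ ν = 0 := by
    rw [signalLaw, integral_prod_mul (fun c => (Uᵀ *ᵥ p) ⬝ᵥ c) (fun a => q ⬝ᵥ a), hc, zero_mul]
  have e4 : ∫ x, ((Uᵀ *ᵥ q) ⬝ᵥ x.1) * (p ⬝ᵥ x.2) ∂signalLaw n κ ν = 0 := by
    rw [signalLaw, integral_prod_mul (fun c => (Uᵀ *ᵥ q) ⬝ᵥ c) (fun a => p ⬝ᵥ a), hc', zero_mul]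
  rw [he]
  refine ⟨(i1.add i2).add (i3.add i4), ?_⟩
  have j1 : Integrable (fun x => ((Uᵀ *ᵥ p) ⬝ᵥ x.1) * ((Uᵀ *ᵥ q) ⬝ᵥ x.1) + (p ⬝ᵥ x.2) * (q ⬝ᵥ x.2))
    (signalLaw n κ ν) := i1.add i2
  have j2 : Integrable (fun x => ((Uᵀ *ᵥ p) ⬝ᵥ x.1) * (q ⬝ᵥ x.2) + ((Uᵀ *ᵥ q) ⬝ᵥ x.1) * (p ⬝ᵥ x.2))
    (signalLaw n κ ν) := i3.add i4
  rw [integral_add j1 j2, integral_add i3 i4, e3, e4, integral_add i1 i2, e1, e2]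
  rw [dataCov, Matrix.add_mulVec, dotProduct_add, ← mulVec_mulVec, ← mulVec_mulVec,
    dotProduct_mulVec_transpose U p, smul_mulVec, one_mulVec, dotProduct_smul, smul_eq_mul]
  ring

theorem integral_matrix_apply {Ω : Type*} [MeasurableSpace Ω] {μ : Measure Ω} {k l : ℕ}
    {f : Ω → Mat k l} (h : Integrable f μ) (i : Fin k) (j : Fin l) :
    (∫ x, f x ∂μ) i j = ∫ x, f x i j ∂μ :=
  ((LinearMap.toContinuousLinearMap (Matrix.entryLinearMap ℝ ℝ i j)).integral_comp_comm h).symm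

theorem integrable_of_apply {Ω : Type*} [MeasurableSpace Ω] {μ : Measure Ω} {k l : ℕ}
    {f : Ω → Mat k l} (h : ∀ i j, Integrable (fun x => f x i j) μ) :
    Integrable f μ := by
  have hf : f = fun x => ∑ i, ∑ j, f x i j • Matrix.single i j (1 : ℝ) := by
    funext x
    conv_lhs => rw [Matrix.matrix_eq_sum_single (f x)]
    simp
  rw [hf]
  exact integrable_finsetSum _ fun i _ => integrable_finsetSum _ fun j _ => (h i j).smul_const _

theorem integral_vecMulVec_signal (hν : IsNoiseLaw ν σ) (hκ : IsCoefLaw κ lam)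
    (U : Mat n d) {k l : ℕ} (A : Mat k n) (B : Mat l n) :
    Integrable (fun x => vecMulVec (A *ᵥ signal U x) (B *ᵥ signal U x)) (signalLaw n κ ν) ∧
      ∫ x, vecMulVec (A *ᵥ signal U x) (B *ᵥ signal U x) ∂signalLaw n κ ν =
        A * dataCov U lam σ * Bᵀ := by
  have hi : Integrable (fun x => vecMulVec (A *ᵥ signal U x) (B *ᵥ signal U x))
      (signalLaw n κ ν) := integrable_of_apply fun i j => (integral_signal_mul hν hκ U (A i) (B j)).1
  refine ⟨hi, ?_⟩
  ext i j
  rw [integral_matrix_apply hi]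
  refine (integral_signal_mul hν hκ U (A i) (B j)).2.trans ?_
  rw [mmul_assoc, Matrix.mul_apply_eq_vecMul, Matrix.vecMul, dotProduct]
  simp only [Matrix.mul_apply, dotProduct, Matrix.mulVec, Matrix.transpose_apply]

end SecondMoments

local notation "r[" X "," U "," ξ "]" => resid X (observe U ξ)

/-! ### A random variable dominating all fluctuations -/

section Envelope
variable {n d : ℕ} {κ : Measure (Fin d → ℝ)} {ν : Measure ℝ} {α σ ε : ℝ} {lam : Fin d → ℝ}

/-- `Y` dominates the sizes and the normalized fluctuations of the quantities that enter one step. -/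
structure Envelope (α σ ε : ℝ) (U X : Mat n d) (Y : Draw n d → ℝ) : Prop where
  one_le : ∀ ξ, 1 ≤ Y ξ
  coeff_le : ∀ ξ, Enough ε X ξ.2.2 → vnorm ŵ[X, U, ξ] ≤ Y ξ
  fit_le : ∀ ξ, Enough ε X ξ.2.2 → vnorm ((isoMat X ξ.2.2)ᵀ *ᵥ signal U (ξ.1, ξ.2.1)) ≤ Y ξ
  proj_le : ∀ ξ, vnorm (Uᵀ *ᵥ (mask ξ.2.2 *ᵥ signal U (ξ.1, ξ.2.1))) ≤ Y ξ
  quart_le : ∀ ξ, ∑ i, signal U (ξ.1, ξ.2.1) i ^ 4 ≤ n * Y ξ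
  trace_le : ∀ ξ, |vnorm (mask ξ.2.2 *ᵥ signal U (ξ.1, ξ.2.1)) ^ 2 - n * (α * σ ^ 2)| ≤ √n * Y ξ
  gram_le : ∀ ξ, ‖maskedGram X ξ.2.2 - α • (Xᵀ * X)‖ ≤ √(fourthSum X) * Y ξ
  cross_le : ∀ ξ, ‖Uᵀ * mask ξ.2.2 * X - α • (Uᵀ * X)‖ ≤ √(fourthSum X + 1 / n) * Y ξ
  base_le : ∀ ξ, ‖Uᵀ * mask ξ.2.2 * U - α • (1 : Mat d d)‖ ≤
    √(fourthSum X + 1 / n) * Y ξ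

theorem fourthSum_nonneg (X : Mat n d) : 0 ≤ fourthSum X :=
  sum_nonneg fun _ _ => sum_nonneg fun _ _ => by positivity

theorem sum_mul_sq_le_fourthSum (A B : Mat n d) (i j : Fin d) :
    ∑ x, (A x i * B x j) ^ 2 ≤ (fourthSum A + fourthSum B) / 2 := by
  have h : ∀ (A : Mat n d) (i : Fin d), ∑ x, A x i ^ 4 ≤ fourthSum A := fun A i =>
    sum_le_sum fun x _ => single_le_sum (f := fun j => A x j ^ 4)
      (fun _ _ => by positivity) (mem_univ i)
  calc ∑ x, (A x i * B x j) ^ 2 ≤ ∑ x, (A x i ^ 4 + B x j ^ 4) / 2 := sum_le_sum fun x _ => by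
        nlinarith [sq_nonneg (A x i ^ 2 - B x j ^ 2)]
    _ = (∑ x, A x i ^ 4 + ∑ x, B x j ^ 4) / 2 := by rw [← sum_div, sum_add_distrib]
    _ ≤ _ := by gcongr <;> apply h

theorem exists_momentBound_noise_sq (hν : IsNoiseLaw ν σ) (hκ : IsCoefLaw κ lam)
    (hα : α ∈ Ioo (0 : ℝ) 1) :
    ∃ M, ∀ {n : ℕ}, 1 ≤ n → MomentBound M (fun ξ : Draw n d =>
      ∑ i, (if ξ.2.2 i then 1 else 0) / √n * (ξ.2.1 i ^ 2 - σ ^ 2)) (drawLaw n κ ν α) := by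
  have := hν.isProb
  have := hκ.isProb
  have := isProbabilityMeasure_maskLaw hα
  have hm : ∫ x, (x ^ 2 - σ ^ 2) ∂ν = 0 := by
    rw [integral_sub ((hν.momentBound.pow 2).integrable) (integrable_const _), hν.variance]; simp
  obtain ⟨C, hC⟩ := exists_momentBound_linear_form (φ := fun x : ℝ => x ^ 2 - σ ^ 2) (by fun_prop)
    (by simpa only [sub_eq_add_neg] using (hν.momentBound.pow 2).add (MomentBound.const (-σ ^ 2))) hm
  refine ⟨fun p => 1 + C p, fun {n} hn => MomentBound.of_sections
    (measurable_of_sections fun v => ?_) fun v => ?_⟩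
  · have hc : Continuous fun p : (Fin d → ℝ) × (Fin n → ℝ) =>
        ∑ i, (if v i then (1 : ℝ) else 0) / √n * (p.2 i ^ 2 - σ ^ 2) := by fun_prop
    exact hc.measurable
  have hn' : (0 : ℝ) < n := by exact_mod_cast hn
  have hβ : ∑ i, ((if v i then (1 : ℝ) else 0) / √n) ^ 2 ≤ 1 := by
    calc ∑ i, ((if v i then (1 : ℝ) else 0) / √n) ^ 2 ≤ ∑ _i : Fin n, 1 / (n : ℝ) :=
          sum_le_sum fun i _ => by
            rw [div_pow, sq_sqrt hn'.le]; split_ifs <;> simp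
      _ = 1 := by simp [hn'.ne']
  have h := ((hC fun i => (if v i then 1 else 0) / √n).2 hβ).comp
    (measurePreserving_noise (n := n) (κ := κ) (ν := ν))
  exact h

theorem abs_trace_sub_le (hn : 1 ≤ n) {U : Mat n d} (hU : Uᵀ * U = 1) (ξ : Draw n d) :
    |vnorm (mask ξ.2.2 *ᵥ signal U (ξ.1, ξ.2.1)) ^ 2 - n * (α * σ ^ 2)| ≤
      √n * (|∑ i, (if ξ.2.2 i then 1 else 0) / √n * (ξ.2.1 i ^ 2 - σ ^ 2)| +
        σ ^ 2 * |∑ i, 1 / √n * centredMask α (ξ.2.2 i)| +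
        (vnorm ξ.1 ^ 2 + 2 * (vnorm ξ.1 * vnorm ((mask ξ.2.2 * U)ᵀ *ᵥ ξ.2.1)))) := by
  obtain ⟨c, a, v⟩ := ξ
  simp only
  have hn' : (1 : ℝ) ≤ n := by exact_mod_cast hn
  have hs : 0 < √(n : ℝ) := sqrt_pos.2 (by linarith)
  have hs1 : 1 ≤ √(n : ℝ) := Real.one_le_sqrt.2 hn'
  have h1 : ∑ i, (if v i then (1 : ℝ) else 0) / √n * (a i ^ 2 - σ ^ 2) =
      (∑ i, (if v i then (1 : ℝ) else 0) * (a i ^ 2 - σ ^ 2)) / √n := by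
    rw [sum_div]; exact sum_congr rfl fun i _ => by ring
  have h2 : ∑ i, 1 / √n * centredMask α (v i) = (∑ i, centredMask α (v i)) / √n := by
    rw [sum_div]; exact sum_congr rfl fun i _ => by ring
  have h3 : vnorm (mask v *ᵥ a) ^ 2 = ∑ i, (if v i then (1 : ℝ) else 0) * a i ^ 2 := by
    rw [vnorm_sq_eq_sum]
    refine sum_congr rfl fun i _ => ?_
    rw [mask_mulVec_apply]; split_ifs <;> simp
  have h4 : vnorm (mask v *ᵥ a) ^ 2 - n * (α * σ ^ 2) =
      ∑ i, (if v i then (1 : ℝ) else 0) * (a i ^ 2 - σ ^ 2) + σ ^ 2 * ∑ i, centredMask α (v i) := by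
    have : (n : ℝ) * (α * σ ^ 2) = ∑ _i : Fin n, α * σ ^ 2 := by simp
    rw [h3, this, mul_sum, ← Finset.sum_sub_distrib, ← sum_add_distrib]
    refine sum_congr rfl fun i _ => ?_
    rw [centredMask]; ring
  have h5 : vnorm (mask v *ᵥ signal U (c, a)) ^ 2 = vnorm (mask v *ᵥ a) ^ 2 +
      (vnorm (mask v *ᵥ (U *ᵥ c)) ^ 2 + 2 * (c ⬝ᵥ ((mask v * U)ᵀ *ᵥ a))) := by
    have e : c ⬝ᵥ ((mask v * U)ᵀ *ᵥ a) = (mask v *ᵥ (U *ᵥ c)) ⬝ᵥ (mask v *ᵥ a) := by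
      rw [dotProduct_mulVec_transpose, transpose_transpose, dotProduct_mulVec_transpose (mask v),
        mask_transpose, mulVec_mulVec c, mulVec_mulVec _ (mask v) (mask v * U), ← mmul_assoc,
        mask_mul_mask]
    rw [e, signal, mulVec_add, vnorm_sq, vnorm_sq, vnorm_sq, add_dotProduct, dotProduct_add,
      dotProduct_add, dotProduct_comm (mask v *ᵥ a) (mask v *ᵥ (U *ᵥ c))]
    ring
  have h6 : vnorm (mask v *ᵥ (U *ᵥ c)) ≤ vnorm c := by
    rw [mulVec_mulVec]
    refine (vnorm_mulVec_le _ _).trans (mul_le_of_le_one_left (vnorm_nonneg _) ?_)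
    exact (norm_mul_le_mul _ _).trans
      (mul_le_one₀ (norm_mask_le v) (norm_nonneg _) (norm_le_one_of_isometry hU))
  have h7 := abs_dotProduct_le c ((mask v * U)ᵀ *ᵥ a)
  have h8 : vnorm (mask v *ᵥ (U *ᵥ c)) ^ 2 ≤ vnorm c ^ 2 := pow_le_pow_left₀ (vnorm_nonneg _) h6 2
  have hB : 0 ≤ vnorm c ^ 2 + 2 * (vnorm c * vnorm ((mask v * U)ᵀ *ᵥ a)) := by
    have := vnorm_nonneg c
    have := vnorm_nonneg ((mask v * U)ᵀ *ᵥ a)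
    positivity
  rw [h1, h2, abs_div, abs_div, abs_of_pos hs, h5]
  have e1 : vnorm (mask v *ᵥ a) ^ 2 + (vnorm (mask v *ᵥ (U *ᵥ c)) ^ 2 +
      2 * (c ⬝ᵥ ((mask v * U)ᵀ *ᵥ a))) - n * (α * σ ^ 2) =
      (∑ i, (if v i then (1 : ℝ) else 0) * (a i ^ 2 - σ ^ 2) + σ ^ 2 * ∑ i, centredMask α (v i)) +
      (vnorm (mask v *ᵥ (U *ᵥ c)) ^ 2 + 2 * (c ⬝ᵥ ((mask v * U)ᵀ *ᵥ a))) := by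
    rw [← h4]; ring
  rw [e1]
  set S₁ := ∑ i, (if v i then (1 : ℝ) else 0) * (a i ^ 2 - σ ^ 2)
  set S₂ := ∑ i, centredMask α (v i)
  have e2 : |vnorm (mask v *ᵥ (U *ᵥ c)) ^ 2 + 2 * (c ⬝ᵥ ((mask v * U)ᵀ *ᵥ a))| ≤
      vnorm c ^ 2 + 2 * (vnorm c * vnorm ((mask v * U)ᵀ *ᵥ a)) := by
    refine (abs_add_le _ _).trans (add_le_add ?_ ?_)
    · rwa [abs_of_nonneg (sq_nonneg _)]
    · rw [abs_mul, abs_two]; gcongr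
  calc _ ≤ |S₁| + |σ ^ 2 * S₂| + _ := (abs_add_le _ _).trans (add_le_add_left (abs_add_le _ _) _)
    _ ≤ |S₁| + σ ^ 2 * |S₂| + √n * (vnorm c ^ 2 + 2 * (vnorm c * vnorm ((mask v * U)ᵀ *ᵥ a))) := by
      rw [abs_mul, abs_of_nonneg (sq_nonneg σ)]
      gcongr
      exact e2.trans (le_mul_of_one_le_left hB hs1)
    _ = _ := by field_simp

theorem norm_mask_mul_le_one {U : Mat n d} (hU : Uᵀ * U = 1) (v : Fin n → Bool) :
    ‖mask v * U‖ ≤ 1 :=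
  (norm_mul_le_mul _ _).trans (mul_le_one₀ (norm_mask_le v) (norm_nonneg _) (norm_le_one_of_isometry hU))

open Classical in
theorem exists_envelope (hν : IsNoiseLaw ν σ) (hκ : IsCoefLaw κ lam) (hα : α ∈ Ioo (0 : ℝ) 1)
    (hε : 0 < ε) (C : ℝ) :
    ∃ M : ℕ → ℝ, ∀ {n : ℕ}, 1 ≤ n → ∀ {U : Mat n d}, Uᵀ * U = 1 →
      fourthSum U ≤ C / n → ∀ X : Mat n d, ∃ Y : Draw n d → ℝ,
        Envelope α σ ε U X Y ∧ MomentBound M Y (drawLaw n κ ν α) := by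
  have := hν.isProb
  have := hκ.isProb
  have := isProbabilityMeasure_maskLaw hα
  obtain ⟨Mz, hz⟩ := exists_momentBound_masked hν hκ hα d
  obtain ⟨Mq, hq⟩ := exists_momentBound_entries hν hκ hα
  obtain ⟨Mn, hn2⟩ := exists_momentBound_noise_sq hν hκ hα
  obtain ⟨Mp, hp⟩ := exists_momentBound_pattern hα
  obtain ⟨Mc, hc⟩ := hκ.exists_momentBound
  obtain ⟨Ma, ha⟩ := exists_momentBound_noise hν d
  obtain ⟨Mg, hg⟩ := exists_momentBound_gram hα d d
  set s₀ : ℝ := √(|C| + 1)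
  refine ⟨fun p => 2 ^ p * (2 ^ p * (2 ^ p * (2 ^ p * (2 ^ p * (2 ^ p *
      (|1| ^ p + |(√ε)⁻¹| ^ p * Mz p) + Mz p) + Mz p) + Mq p) + 2 ^ p *
      (2 ^ p * (Mn p + |σ ^ 2| ^ p * Mp p) + 2 ^ p * (Mc (2 * p) + |2| ^ p * (Mc (2 * p) + Ma (2 * p))))) +
      2 ^ p * (2 ^ p * (Mg p + |s₀| ^ p * Mg p) + |s₀| ^ p * Mg p)), fun {n} hn {U} hU hUC X => ?_⟩
  · have hn' : (1 : ℝ) ≤ n := by exact_mod_cast hn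
    have hsn : 0 < √(n : ℝ) := sqrt_pos.2 (by linarith)
    set h := fourthSum X
    have hh0 : 0 ≤ h := fourthSum_nonneg X
    have hUC' : fourthSum U ≤ |C| / n := hUC.trans (by gcongr; exact le_abs_self C)
    have hsq : s₀ ^ 2 = |C| + 1 := sq_sqrt (by positivity)
    have hs2 : (s₀ * √(h + 1 / n)) ^ 2 = (|C| + 1) * (h + 1 / n) := by
      rw [mul_pow, hsq, sq_sqrt (by positivity)]
    have hle : fourthSum U + h ≤ (|C| + 1) * (h + 1 / n) := by
      have : 0 ≤ |C| * h := by positivity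
      have : 0 ≤ 1 / (n : ℝ) := by positivity
      have e : |C| / n = |C| * (1 / n) := by ring
      nlinarith
    have hU0 := fourthSum_nonneg U
    obtain ⟨Y₁, hY₁, hY₁'⟩ := hg X X (√h) (sqrt_nonneg _) fun i j => by
      rw [sq_sqrt hh0]; linarith [sum_mul_sq_le_fourthSum X X i j]
    obtain ⟨Y₂, hY₂, hY₂'⟩ := hg U X (s₀ * √(h + 1 / n)) (by positivity) fun i j => by
      rw [hs2]; linarith [sum_mul_sq_le_fourthSum U X i j]
    obtain ⟨Y₃, hY₃, hY₃'⟩ := hg U U (s₀ * √(h + 1 / n)) (by positivity) fun i j => by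
      rw [hs2]; linarith [sum_mul_sq_le_fourthSum U U i j]
    let B₁ : (Fin n → Bool) → Mat n d := fun v =>
      if Enough ε X v then √ε • fitMat X v else 0
    have hB₁ : ∀ v, ‖B₁ v‖ ≤ 1 := fun v => by
      by_cases hv : Enough ε X v
      · simp only [B₁, hv, if_true, norm_smul, norm_eq_abs, abs_of_nonneg (sqrt_nonneg ε)]
        have h1 := hv.norm_fitMat_sq_le hε
        have h2 : (√ε * ‖fitMat X v‖) ^ 2 ≤ 1 := by
          rw [mul_pow, sq_sqrt hε.le]
          calc ε * ‖fitMat X v‖ ^ 2 ≤ ε * ε⁻¹ := by gcongr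
            _ = 1 := mul_inv_cancel₀ hε.ne'
        exact (sq_le_one_iff₀ (by positivity)).1 h2
      · simp [B₁, hv]
    let B₂ : (Fin n → Bool) → Mat n d := fun v =>
      if Enough ε X v then isoMat X v else 0
    have hB₂ : ∀ v, ‖B₂ v‖ ≤ 1 := fun v => by
      by_cases hv : Enough ε X v
      · simp only [B₂, hv, if_true]; exact norm_le_one_of_isometry (hv.isoMat_gram hε)
      · simp [B₂, hv]
    have f₁ := (hz B₁ hU hB₁).const_mul (√ε)⁻¹
    have f₂ := hz B₂ hU hB₂
    have f₃ := hz (fun v => mask v * U) hU (norm_mask_mul_le_one hU)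
    have f₄ := hq hn hU
    have f₅ := (hn2 hn).abs
    have f₆ : MomentBound Mp (fun ξ : Draw n d => |∑ i, 1 / √n * centredMask α (ξ.2.2 i)|)
        (drawLaw n κ ν α) := ((hp (fun _ : Fin n => 1 / √n) (by
          simp [sq_sqrt (by linarith : (0 : ℝ) ≤ n), (by linarith : (n : ℝ) ≠ 0)])).comp
        measurePreserving_pattern).abs
    have hc' : MomentBound Mc (fun p : (Fin d → ℝ) × (Fin n → ℝ) => vnorm p.1) (signalLaw n κ ν) :=
      hc.comp measurePreserving_coef
    have f₇ : MomentBound Mc (fun ξ : Draw n d => vnorm ξ.1) (drawLaw n κ ν α) := by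
      have h := hc'.comp (measurePreserving_signal (α := α))
      exact h
    have f₈ : MomentBound Ma (fun ξ : Draw n d => vnorm ((mask ξ.2.2 * U)ᵀ *ᵥ ξ.2.1))
        (drawLaw n κ ν α) := MomentBound.of_sections (measurable_of_sections fun v =>
          continuous_vnorm.measurable.comp (measurable_matrix_mulVec
            (measurable_const (a := (mask v * U)ᵀ)) measurable_snd)) fun v => by
        have h := (ha (mask v * U) (norm_mask_mul_le_one hU v)).comp (measurePreserving_noise (κ := κ))
        exact h
    have g₁ := hY₁.comp (measurePreserving_pattern (n := n) (κ := κ) (ν := ν))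
    have g₂ := (hY₂.comp (measurePreserving_pattern (n := n) (κ := κ) (ν := ν))).const_mul s₀
    have g₃ := (hY₃.comp (measurePreserving_pattern (n := n) (κ := κ) (ν := ν))).const_mul s₀
    refine ⟨_, ?_, (((((((MomentBound.const 1).add f₁).add f₂).add f₃).add f₄).add
      ((f₅.add (f₆.const_mul (σ ^ 2))).add ((f₇.pow 2).add ((f₇.mul f₈).const_mul 2)))).add
      ((g₁.add g₂).add g₃))⟩
    have p₁ : ∀ ξ : Draw n d, 0 ≤ (√ε)⁻¹ * vnorm ((B₁ ξ.2.2)ᵀ *ᵥ signal U (ξ.1, ξ.2.1)) := fun ξ =>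
      mul_nonneg (by positivity) (vnorm_nonneg _)
    have p₂ : ∀ ξ : Draw n d, 0 ≤ vnorm ((B₂ ξ.2.2)ᵀ *ᵥ signal U (ξ.1, ξ.2.1)) := fun ξ => vnorm_nonneg _
    have p₃ : ∀ ξ : Draw n d, 0 ≤ vnorm ((mask ξ.2.2 * U)ᵀ *ᵥ signal U (ξ.1, ξ.2.1)) :=
      fun ξ => vnorm_nonneg _
    have p₄ : ∀ ξ : Draw n d, 0 ≤ (∑ i, signal U (ξ.1, ξ.2.1) i ^ 4) / n := fun ξ => by positivity
    have p₅ : ∀ ξ : Draw n d, 0 ≤ |∑ i, (if ξ.2.2 i then 1 else 0) / √n * (ξ.2.1 i ^ 2 - σ ^ 2)| +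
        σ ^ 2 * |∑ i, 1 / √n * centredMask α (ξ.2.2 i)| +
        (vnorm ξ.1 ^ 2 + 2 * (vnorm ξ.1 * vnorm ((mask ξ.2.2 * U)ᵀ *ᵥ ξ.2.1))) := fun ξ => by
      have := vnorm_nonneg ξ.1
      have := vnorm_nonneg ((mask ξ.2.2 * U)ᵀ *ᵥ ξ.2.1)
      positivity
    have q₁ : ∀ ξ : Draw n d, 0 ≤ Y₁ ξ.2.2 := fun ξ => (hY₁' _).1
    have q₂ : ∀ ξ : Draw n d, 0 ≤ s₀ * Y₂ ξ.2.2 := fun ξ => mul_nonneg (sqrt_nonneg _) (hY₂' _).1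
    have q₃ : ∀ ξ : Draw n d, 0 ≤ s₀ * Y₃ ξ.2.2 := fun ξ => mul_nonneg (sqrt_nonneg _) (hY₃' _).1
    have key : ∀ (v : Fin n → Bool) (A B : Mat n d),
        Aᵀ * (mask v - α • (1 : Mat n n)) * B = Aᵀ * mask v * B - α • (Aᵀ * B) := by
      intro v A B
      rw [mmul_sub, msub_mul, mmul_smul, mmul_one, msmul_mul]
    refine ⟨fun ξ => ?_, fun ξ hξ => ?_, fun ξ hξ => ?_, fun ξ => ?_, fun ξ => ?_, fun ξ => ?_,
      fun ξ => ?_, fun ξ => ?_, fun ξ => ?_⟩ <;>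
    replace p₁ := p₁ ξ <;> replace p₂ := p₂ ξ <;> replace p₃ := p₃ ξ <;> replace p₄ := p₄ ξ <;>
    replace p₅ := p₅ ξ <;> replace q₁ := q₁ ξ <;> replace q₂ := q₂ ξ <;> replace q₃ := q₃ ξ
    · linarith
    · have e : (√ε)⁻¹ * vnorm ((B₁ ξ.2.2)ᵀ *ᵥ signal U (ξ.1, ξ.2.1)) = vnorm ŵ[X, U, ξ] := by
        simp only [B₁, hξ, if_true, transpose_smul, smul_mulVec, vnorm_smul,
          abs_of_nonneg (sqrt_nonneg ε), coeff_observe]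
        rw [inv_mul_cancel_left₀ (sqrt_pos.2 hε).ne']
      rw [← e]; linarith
    · have e : B₂ ξ.2.2 = isoMat X ξ.2.2 := by simp only [B₂, hξ, if_true]
      rw [← e]; linarith
    · have e : Uᵀ *ᵥ (mask ξ.2.2 *ᵥ signal U (ξ.1, ξ.2.1)) =
          (mask ξ.2.2 * U)ᵀ *ᵥ signal U (ξ.1, ξ.2.1) := by
        rw [transpose_mul, mask_transpose, mulVec_mulVec]
      rw [e]; linarith
    · rw [← div_le_iff₀' (by linarith)]; linarith
    · refine (abs_trace_sub_le hn hU ξ).trans (mul_le_mul_of_nonneg_left ?_ hsn.le)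
      linarith
    · have h1 := (hY₁' ξ.2.2).2
      rw [key, ← maskedGram] at h1
      refine h1.trans ?_
      gcongr
      linarith
    · have h1 := (hY₂' ξ.2.2).2
      rw [key, mul_comm s₀, mul_assoc] at h1
      refine h1.trans ?_
      gcongr
      linarith
    · have h1 := (hY₃' ξ.2.2).2
      rw [key, hU, mul_comm s₀, mul_assoc] at h1
      refine h1.trans ?_
      gcongr
      linarith

end Envelope

/-! ### Measurability of the algorithms -/

section Measurability
variable {n d : ℕ} {β : Type*} [MeasurableSpace β]
  {F : β → Mat n d} {ξ : β → Draw n d} (hF : Measurable F) (hξ : Measurable ξ)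
  (U : Mat n d) (ε : ℝ)

theorem measurable_vnorm : Measurable (vnorm : (Fin n → ℝ) → ℝ) := continuous_vnorm.measurable

include hξ in
theorem measurable_observe_fst : Measurable fun b => (observe U (ξ b)).1 := by
  have h : Measurable fun b => signal U ((ξ b).1, (ξ b).2.1) :=
    (measurable_signal U).comp (hξ.fst.prodMk hξ.snd.fst)
  exact measurable_matrix_mulVec (measurable_mask.comp hξ.snd.snd) h

include hF hξ

theorem measurable_maskedGram : Measurable fun b => maskedGram (F b) (ξ b).2.2 :=
  measurable_matrix_mul (measurable_matrix_mul (measurable_matrix_transpose hF)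
    (measurable_mask.comp hξ.snd.snd)) hF

theorem measurableSet_enough : MeasurableSet {b | Enough ε (F b) (ξ b).2.2} :=
  ((measurable_maskedGram hF hξ).sub_const _) measurableSet_posDef

theorem measurable_coeff : Measurable fun b => coeff (F b) (observe U (ξ b)) :=
  measurable_matrix_mulVec (measurable_matrix_inv (measurable_maskedGram hF hξ))
    (measurable_matrix_mulVec (measurable_matrix_transpose hF)
      (measurable_matrix_mulVec (measurable_mask.comp hξ.snd.snd) (measurable_observe_fst hξ U)))

theorem measurable_fitted : Measurable fun b => F b *ᵥ coeff (F b) (observe U (ξ b)) :=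
  measurable_matrix_mulVec hF (measurable_coeff hF hξ U)

theorem measurable_resid : Measurable fun b => resid (F b) (observe U (ξ b)) :=
  (measurable_observe_fst hξ U).sub (measurable_matrix_mulVec (measurable_mask.comp hξ.snd.snd)
    (measurable_fitted hF hξ U))

theorem measurable_ojaStep (τ : ℝ) : Measurable fun b => ojaStep ε τ (F b) (observe U (ξ b)) := by
  classical
  have hX : Measurable fun b => F b + (τ / n) • vecMulVec ((observe U (ξ b)).1 +
      (1 - mask (ξ b).2.2) *ᵥ (F b *ᵥ coeff (F b) (observe U (ξ b)))) (coeff (F b) (observe U (ξ b))) :=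
    hF.add ((measurable_matrix_vecMulVec ((measurable_observe_fst hξ U).add
      (measurable_matrix_mulVec (measurable_const.sub (measurable_mask.comp hξ.snd.snd))
        (measurable_fitted hF hξ U))) (measurable_coeff hF hξ U)).const_smul (τ / n : ℝ))
  exact Measurable.ite (measurableSet_enough hF hξ ε) (measurable_matrix_mul hX
    (measurable_invSqrt (measurable_gram hX) fun b => posSemidef_gram _)) hF

theorem measurable_grouseStep (τ : ℝ) :
    Measurable fun b => grouseStep ε τ (F b) (observe U (ξ b)) := by
  classical
  have hw := measurable_coeff hF hξ U
  have hp := measurable_fitted hF hξ U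
  have hr := measurable_resid hF hξ U
  have hvw := measurable_vnorm.comp hw
  have hvp := measurable_vnorm.comp hp
  have hvr := measurable_vnorm.comp hr
  have hθ : Measurable fun b => τ / n * vnorm (resid (F b) (observe U (ξ b))) *
    vnorm (F b *ᵥ coeff (F b) (observe U (ξ b))) := (hvr.const_mul _).mul hvp
  exact Measurable.ite (measurableSet_enough hF hξ ε) (hF.add (measurable_matrix_vecMulVec
    (((((Real.measurable_cos.comp hθ).sub_const 1).div hvp).smul hp).add
      (((Real.measurable_sin.comp hθ).div hvr).smul hr)) (hvw.inv.smul hw))) hF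

theorem measurable_petrelsStep {R : β → Mat d d} (hR : Measurable R) (α γ : ℝ) :
    Measurable fun b => petrelsStep ε α γ (F b, R b) (observe U (ξ b)) := by
  classical
  have hw := measurable_coeff hF hξ U
  have hu : Measurable fun b => γ⁻¹ • (R b *ᵥ coeff (F b) (observe U (ξ b))) :=
    (measurable_matrix_mulVec hR hw).const_smul γ⁻¹
  have hdot : Measurable fun b => coeff (F b) (observe U (ξ b)) ⬝ᵥ
      (γ⁻¹ • (R b *ᵥ coeff (F b) (observe U (ξ b)))) := by
    simp only [dotProduct]
    exact measurable_fun_sum _ fun i _ => ((measurable_pi_apply i).comp hw).mul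
      ((measurable_pi_apply i).comp hu)
  exact Measurable.ite (measurableSet_enough hF hξ ε) ((hF.add (measurable_matrix_mul
    (measurable_matrix_vecMulVec (measurable_matrix_mulVec (measurable_mask.comp hξ.snd.snd)
      ((measurable_observe_fst hξ U).sub (measurable_fitted hF hξ U))) hw) hR)).prodMk
    ((hR.const_smul γ⁻¹).sub (((measurable_const.add (hdot.const_mul α)).const_div α).smul
      (measurable_matrix_vecMulVec hu hu)))) (hF.prodMk hR)

end Measurability

/-! ### Conditional means given the sampling pattern, and their limits -/

section Perturbation
variable {n d : ℕ} {α σ ε c : ℝ} {lam : Fin d → ℝ}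

/-- The regression matrix `Uᵀ X (Xᵀ X)⁻¹`. -/
noncomputable def regMat (U X : Mat n d) : Mat d d :=
  Uᵀ * X * (Xᵀ * X)⁻¹

/-- The limiting second moment of the coefficients `w`. -/
noncomputable def coefLimit (α σ : ℝ) (lam : Fin d → ℝ) (U X : Mat n d) :
    Mat d d :=
  (regMat U X)ᵀ * lamSq lam * regMat U X + σ ^ 2 • (α⁻¹ • (Xᵀ * X)⁻¹)

/-- The limiting mean of `Uᵀ r wᵀ`. -/
noncomputable def crossLimit (α : ℝ) (lam : Fin d → ℝ) (U X : Mat n d) :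
    Mat d d :=
  α • ((1 - Uᵀ * X * (regMat U X)ᵀ) * lamSq lam * regMat U X)

theorem norm_regMat_sq_le {U X : Mat n d} (hU : Uᵀ * U = 1) (hc : 0 < c)
    (hX : AtLeast c (Xᵀ * X)) : ‖regMat U X‖ ^ 2 ≤ c⁻¹ := by
  have h1 : (X * (Xᵀ * X)⁻¹)ᵀ * (X * (Xᵀ * X)⁻¹) = (Xᵀ * X)⁻¹ := by
    rw [transpose_mul, hX.transpose_inv, mmul_assoc, ← mmul_assoc Xᵀ,
      ← mmul_assoc, nonsing_inv_mul _ (hX.isUnit_det hc), mone_mul]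
  have h2 : ‖regMat U X‖ ≤ ‖X * (Xᵀ * X)⁻¹‖ := by
    rw [regMat, mmul_assoc]
    refine (norm_mul_le_mul _ _).trans (mul_le_of_le_one_left (norm_nonneg _) ?_)
    rw [norm_transpose]; exact norm_le_one_of_isometry hU
  calc ‖regMat U X‖ ^ 2 ≤ ‖X * (Xᵀ * X)⁻¹‖ ^ 2 := by gcongr
    _ = ‖(Xᵀ * X)⁻¹‖ := by rw [← norm_transpose_mul_self, h1]
    _ ≤ c⁻¹ := hX.norm_inv_le hc

theorem norm_mul_regMat_transpose_le {U X : Mat n d} (hU : Uᵀ * U = 1) (hc : 0 < c)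
    (hX : AtLeast c (Xᵀ * X)) : ‖Uᵀ * X * (regMat U X)ᵀ‖ ≤ 1 := by
  set E := X * (Xᵀ * X)⁻¹ * Xᵀ with hE
  have h1 : Eᵀ = E := by
    rw [hE, transpose_mul, transpose_mul, hX.transpose_inv, transpose_transpose,
      mmul_assoc]
  have h2 : E * E = E := by
    have : E * E = X * ((Xᵀ * X)⁻¹ * (Xᵀ * X)) * (Xᵀ * X)⁻¹ * Xᵀ := by
      rw [hE]; simp only [mmul_assoc]
    rw [this, nonsing_inv_mul _ (hX.isUnit_det hc), mmul_one]
  have h3 : Uᵀ * X * (regMat U X)ᵀ = Uᵀ * E * U := by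
    rw [regMat, transpose_mul, hX.transpose_inv, transpose_mul, transpose_transpose,
      hE]
    simp only [mmul_assoc]
  have hUn := norm_le_one_of_isometry hU
  rw [h3]
  refine (norm_mul_le_mul _ _).trans (mul_le_one₀ ?_ (norm_nonneg _) hUn)
  refine (norm_mul_le_mul _ _).trans (mul_le_one₀ ?_ (norm_nonneg _) (norm_le_one_of_projection h1 h2))
  rwa [norm_transpose]

section
variable {U X : Mat n d} {v : Fin n → Bool} (hε : 0 < ε) (h : Enough ε X v)
include hε h

theorem Enough.fitMat_dataCov : (fitMat X v)ᵀ * dataCov U lam σ * fitMat X v =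
    (Uᵀ * fitMat X v)ᵀ * lamSq lam * (Uᵀ * fitMat X v) + σ ^ 2 • (maskedGram X v)⁻¹ := by
  rw [dataCov, mmul_add, madd_mul, mmul_smul, mmul_one, msmul_mul,
    h.fitMat_gram hε, transpose_mul, transpose_transpose]
  simp only [mmul_assoc]

theorem Enough.residMat_mul_fitMat : residMat X v * fitMat X v = 0 := by
  rw [residMat, msub_mul, mmul_assoc (mask v * X), h.fitMat_gram hε, fitMat,
    ← mmul_assoc, ← mmul_assoc, mask_mul_mask, sub_self]

theorem Enough.residMat_dataCov : residMat X v * dataCov U lam σ * fitMat X v =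
    residMat X v * U * lamSq lam * (Uᵀ * fitMat X v) := by
  rw [dataCov, mmul_add, madd_mul, mmul_smul, mmul_one, msmul_mul,
    h.residMat_mul_fitMat hε, smul_zero, add_zero]
  simp only [mmul_assoc]

end

set_option maxHeartbeats 1000000 in
theorem exists_perturbation (hα : α ∈ Ioo (0 : ℝ) 1) (hε : 0 < ε) (hc : 0 < c) (σ : ℝ)
    (lam : Fin d → ℝ) :
    ∃ C : ℝ, 0 ≤ C ∧ ∀ {n : ℕ} {U X : Mat n d}, Uᵀ * U = 1 → AtLeast c (Xᵀ * X) →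
      ‖coefLimit α σ lam U X‖ ≤ C ∧ ‖crossLimit α lam U X‖ ≤ C ∧
      ∀ (v : Fin n → Bool) (r : ℝ), Enough ε X v → ‖maskedGram X v - α • (Xᵀ * X)‖ ≤ r →
        ‖Uᵀ * mask v * X - α • (Uᵀ * X)‖ ≤ r →
        ‖Uᵀ * mask v * U - α • (1 : Mat d d)‖ ≤ r →
        ‖(fitMat X v)ᵀ * dataCov U lam σ * fitMat X v - coefLimit α σ lam U X‖ ≤ C * r ∧
        ‖Uᵀ * (residMat X v * dataCov U lam σ * fitMat X v) - crossLimit α lam U X‖ ≤ C * r := by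
  set b : ℝ := 1 + c⁻¹ + ε⁻¹ + α⁻¹ * c⁻¹ + ‖lamSq lam‖ + σ ^ 2
  have hα0 := hα.1
  have p1 : 0 < c⁻¹ := by positivity
  have p2 : 0 < ε⁻¹ := by positivity
  have p3 : 0 < α⁻¹ * c⁻¹ := by positivity
  have p4 := norm_nonneg (lamSq lam)
  have p5 := sq_nonneg σ
  have hb1 : 1 ≤ b := by linarith
  have hb0 : 0 ≤ b := by linarith
  have hsqle : ∀ x : ℝ, 0 ≤ x → x ^ 2 ≤ b → x ≤ b := fun x hx h => by
    by_contra! hlt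
    nlinarith
  have hΛ : ‖lamSq lam‖ ≤ b := by linarith
  have hσ2 : σ ^ 2 ≤ b := by linarith
  have hb2 : b ≤ b ^ 2 := by nlinarith
  have hb3 : b ^ 2 ≤ b ^ 3 := by gcongr <;> norm_num
  have hb4 : b ^ 3 ≤ b ^ 4 := by gcongr <;> norm_num
  refine ⟨8 * b ^ 4, by positivity, fun {n U X} hU hX => ?_⟩
  set V := regMat U X with hV
  set K := Uᵀ * X
  set W := Xᵀ * X
  have hVb : ‖V‖ ≤ b := hsqle _ (norm_nonneg _) ((norm_regMat_sq_le hU hc hX).trans (by linarith))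
  have hP : ‖K * Vᵀ‖ ≤ 1 := norm_mul_regMat_transpose_le hU hc hX
  have hWi : ‖α⁻¹ • W⁻¹‖ ≤ b := by
    rw [norm_smul, norm_eq_abs, abs_of_pos (by positivity)]
    calc α⁻¹ * ‖W⁻¹‖ ≤ α⁻¹ * c⁻¹ :=
          mul_le_mul_of_nonneg_left (hX.norm_inv_le hc) (inv_nonneg.2 hα0.le)
      _ ≤ b := by linarith
  have hVW : V * W = K := by
    rw [hV, regMat, mmul_assoc, nonsing_inv_mul _ (hX.isUnit_det hc), mmul_one]
  have hVt : ‖Vᵀ‖ ≤ b := (norm_transpose _).trans_le hVb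
  have h3 : ∀ {A B D : Mat d d} {x y z : ℝ}, ‖A‖ ≤ x → ‖B‖ ≤ y → ‖D‖ ≤ z →
      ‖A * B * D‖ ≤ x * y * z := fun {A B D x y z} hA hB hD => by
    have hx := (norm_nonneg _).trans hA
    have hy := (norm_nonneg _).trans hB
    exact (norm_mul_le_mul _ _).trans (mul_le_mul ((norm_mul_le_mul _ _).trans
      (mul_le_mul hA hB (norm_nonneg _) hx)) hD (norm_nonneg _) (by positivity))
  have h2 : ∀ {A B : Mat d d} {x y : ℝ}, ‖A‖ ≤ x → ‖B‖ ≤ y →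
      ‖A * B‖ ≤ x * y := fun {A B x y} hA hB =>
    (norm_mul_le_mul _ _).trans (mul_le_mul hA hB (norm_nonneg _) ((norm_nonneg _).trans hA))
  have hS : ‖α • (1 - K * Vᵀ)‖ ≤ 2 * b := by
    rw [norm_smul, norm_eq_abs, abs_of_pos hα0]
    have : ‖1 - K * Vᵀ‖ ≤ 2 := (norm_sub_le _ _).trans (by linarith [norm_one_le_one (d := d)])
    calc α * ‖1 - K * Vᵀ‖ ≤ 1 * 2 := mul_le_mul hα.2.le this (norm_nonneg _) zero_le_one
      _ ≤ 2 * b := by linarith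
  have hcross : crossLimit α lam U X = (α • (1 - K * Vᵀ)) * lamSq lam * V := by
    rw [crossLimit, msmul_mul, msmul_mul]
  refine ⟨?_, ?_, fun v r h hD1 hD2 hD3 => ?_⟩
  · refine (norm_add_le _ _).trans ?_
    have e1 := h3 hVt hΛ hVb
    have e2 : ‖σ ^ 2 • (α⁻¹ • W⁻¹)‖ ≤ b * b := by
      rw [norm_smul, norm_eq_abs, abs_of_nonneg p5]; gcongr
    have e3 : b * b * b + b * b = b ^ 3 + b ^ 2 := by ring
    have e4 : 0 ≤ b ^ 4 := by positivity
    linarith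
  · rw [hcross]
    refine (h3 hS hΛ hVb).trans ?_
    have e3 : 2 * b * b * b = 2 * b ^ 3 := by ring
    have e4 : 0 ≤ b ^ 4 := by positivity
    linarith
  set Z := maskedGram X v
  set Vv := Uᵀ * fitMat X v with hVv
  set Kv := Uᵀ * mask v * X with hKv
  have hr : 0 ≤ r := (norm_nonneg _).trans hD1
  have hZi : ‖Z⁻¹‖ ≤ b := (h.norm_inv_le hε).trans (by linarith)
  have hVvb : ‖Vv‖ ≤ b := by
    have e1 : ‖Vv‖ ≤ ‖fitMat X v‖ := by
      refine (norm_mul_le_mul _ _).trans (mul_le_of_le_one_left (norm_nonneg _) ?_)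
      rw [norm_transpose]; exact norm_le_one_of_isometry hU
    exact e1.trans (hsqle _ (norm_nonneg _) ((h.norm_fitMat_sq_le hε).trans (by linarith)))
  have hVvK : Vv = Kv * Z⁻¹ := by rw [hVv, hKv, fitMat]; simp only [mmul_assoc]; rfl
  have hVvZ : Vv * Z = Kv := by
    rw [hVvK, mmul_assoc, nonsing_inv_mul _ (h.isUnit_det hε), mmul_one]
  set E := (Kv - α • K) - V * (Z - α • W) with hE
  have hEe : E = (Vv - V) * Z := by
    rw [hE, mmul_sub, mmul_smul, hVW, msub_mul, hVvZ]; abel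
  have hEb : ‖E‖ ≤ 2 * b * r := by
    refine (norm_sub_le _ _).trans ?_
    have e1 := h2 hVb hD1
    have e2 : r ≤ b * r := le_mul_of_one_le_left hr hb1
    linarith
  have hdV : ‖Vv - V‖ ≤ 2 * b ^ 2 * r := by
    have e : Vv - V = E * Z⁻¹ := by
      rw [hEe, mmul_assoc, mul_nonsing_inv _ (h.isUnit_det hε), mmul_one]
    rw [e]
    refine (h2 hEb hZi).trans (le_of_eq (by ring))
  have hdZ : ‖Z⁻¹ - α⁻¹ • W⁻¹‖ ≤ b ^ 2 * r := by
    have e : Z⁻¹ - α⁻¹ • W⁻¹ = -(Z⁻¹ * (Z - α • W) * (α⁻¹ • W⁻¹)) := by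
      have e0 : (α • W) * (α⁻¹ • W⁻¹) = 1 := by
        rw [msmul_mul, mmul_smul, smul_smul, mul_inv_cancel₀ hα0.ne', one_smul,
          mul_nonsing_inv _ (hX.isUnit_det hc)]
      rw [mmul_sub, nonsing_inv_mul _ (h.isUnit_det hε), msub_mul, mone_mul,
        mmul_assoc Z⁻¹, e0, mmul_one, neg_sub]
    rw [e, norm_neg]
    exact (h3 hZi hD1 hWi).trans (le_of_eq (by ring))
  have hVvt : ‖Vvᵀ‖ ≤ b := (norm_transpose _).trans_le hVvb
  have hdVt : ‖(Vv - V)ᵀ‖ ≤ 2 * b ^ 2 * r := (norm_transpose _).trans_le hdV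
  constructor
  · rw [h.fitMat_dataCov hε, coefLimit, ← hV, ← hVv]
    have e : Vvᵀ * lamSq lam * Vv + σ ^ 2 • Z⁻¹ - (Vᵀ * lamSq lam * V + σ ^ 2 • (α⁻¹ • W⁻¹)) =
        Vvᵀ * lamSq lam * (Vv - V) + (Vv - V)ᵀ * lamSq lam * V + σ ^ 2 • (Z⁻¹ - α⁻¹ • W⁻¹) := by
      rw [mmul_sub, transpose_sub, msub_mul, msub_mul, smul_sub]; abel
    rw [e]
    have e1 := h3 hVvt hΛ hdV
    have e2 := h3 hdVt hΛ hVb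
    have e3 : ‖σ ^ 2 • (Z⁻¹ - α⁻¹ • W⁻¹)‖ ≤ b * (b ^ 2 * r) := by
      rw [norm_smul, norm_eq_abs, abs_of_nonneg p5]
      gcongr
    refine (norm_add₃_le).trans ?_
    have e4 : b ^ 3 * r ≤ b ^ 4 * r := by gcongr
    have e5 : 0 ≤ b ^ 4 * r := by positivity
    have e6 : b * b * (2 * b ^ 2 * r) + 2 * b ^ 2 * r * b * b + b * (b ^ 2 * r) =
        4 * (b ^ 4 * r) + b ^ 3 * r := by ring
    linarith
  · rw [h.residMat_dataCov hε, hcross]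
    have hPv : Uᵀ * (residMat X v * U * lamSq lam * Vv) =
        (Uᵀ * mask v * U - Kv * Vvᵀ) * lamSq lam * Vv := by
      have : Kv * Vvᵀ = Uᵀ * (mask v * X * (fitMat X v)ᵀ) * U := by
        rw [hKv, hVv, transpose_mul, transpose_transpose]; simp only [mmul_assoc]
      rw [this, residMat]
      simp only [msub_mul, mmul_sub, mmul_assoc]
    have hS' : ‖(Uᵀ * mask v * U - Kv * Vvᵀ) - α • (1 - K * Vᵀ)‖ ≤ 4 * b ^ 2 * r := by
      have hEt : Kv * (Vv - V)ᵀ = Vv * Eᵀ := by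
        have hZt : Zᵀ = Z := transpose_maskedGram X v
        rw [hEe, transpose_mul, hZt, ← mmul_assoc, hVvZ]
      have e : (Uᵀ * mask v * U - Kv * Vvᵀ) - α • (1 - K * Vᵀ) =
          (Uᵀ * mask v * U - α • (1 : Mat d d)) - Vv * Eᵀ - (Kv - α • K) * Vᵀ := by
        rw [← hEt, transpose_sub, mmul_sub, msub_mul, smul_sub, msmul_mul]; abel
      rw [e]
      have e1 : ‖Vv * Eᵀ‖ ≤ b * (2 * b * r) := h2 hVvb ((norm_transpose _).trans_le hEb)
      have e2 := h2 hD2 hVt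
      refine (norm_sub_le _ _).trans ((add_le_add_left (norm_sub_le _ _) _).trans ?_)
      have e3 : b * r ≤ b ^ 2 * r := by gcongr
      have e4 : r ≤ b * r := le_mul_of_one_le_left hr hb1
      have e5 : b * (2 * b * r) = 2 * (b ^ 2 * r) := by ring
      linarith
    rw [hPv]
    set S := α • (1 - K * Vᵀ)
    set S' := Uᵀ * mask v * U - Kv * Vvᵀ
    clear_value S S'
    have e : S' * lamSq lam * Vv - S * lamSq lam * V =
        (S' - S) * lamSq lam * Vv + S * lamSq lam * (Vv - V) := by
      rw [mmul_sub, msub_mul, msub_mul]; abel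
    rw [e]
    have e1 := h3 hS' hΛ hVvb
    have e2 := h3 hS hΛ hdV
    refine (norm_add_le _ _).trans ((add_le_add e1 e2).trans (le_of_eq (by ring)))

end Perturbation

section MomentTools
variable {Ω : Type*} [MeasurableSpace Ω] {μ : Measure Ω} {M : ℕ → ℝ} {Y : Ω → ℝ}
  {E : Type*} [NormedAddCommGroup E]

theorem MomentBound.integrable_of_le (hM : MomentBound M Y μ) {f : Ω → E}
    (hf : AEStronglyMeasurable f μ) {C : ℝ} {p : ℕ} (h : ∀ x, ‖f x‖ ≤ C * |Y x| ^ p) : Integrable f μ :=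
  ((hM.int p).const_mul C).mono' hf (Filter.Eventually.of_forall h)

theorem MomentBound.integral_le (hM : MomentBound M Y μ) {f : Ω → ℝ} {C : ℝ} (hC : 0 ≤ C) {p : ℕ}
    (hf : Integrable f μ) (h : ∀ x, f x ≤ C * |Y x| ^ p) : ∫ x, f x ∂μ ≤ C * M p := by
  calc ∫ x, f x ∂μ ≤ ∫ x, C * |Y x| ^ p ∂μ := integral_mono hf ((hM.int p).const_mul C) h
    _ = C * ∫ x, |Y x| ^ p ∂μ := integral_const_mul _ _
    _ ≤ C * M p := mul_le_mul_of_nonneg_left (hM.le p) hC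

theorem MomentBound.norm_integral_le [NormedSpace ℝ E] (hM : MomentBound M Y μ) {f : Ω → E} {C : ℝ}
    (hC : 0 ≤ C) {p : ℕ} (hf : Integrable f μ) (h : ∀ x, ‖f x‖ ≤ C * |Y x| ^ p) :
    ‖∫ x, f x ∂μ‖ ≤ C * M p :=
  (norm_integral_le_integral_norm f).trans (hM.integral_le hC hf.norm h)

end MomentTools

section Pointwise
variable {n d : ℕ} {α σ ε c : ℝ} {U X : Mat n d} {Y : Draw n d → ℝ}

theorem Envelope.abs_eq (hE : Envelope α σ ε U X Y) (ξ : Draw n d) : |Y ξ| = Y ξ :=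
  abs_of_nonneg (zero_le_one.trans (hE.one_le ξ))

theorem Envelope.pow_le_pow (hE : Envelope α σ ε U X Y) (ξ : Draw n d) {p q : ℕ} (hpq : p ≤ q) :
    Y ξ ^ p ≤ Y ξ ^ q := pow_le_pow_right₀ (hE.one_le ξ) hpq

theorem Envelope.le_of_not_enough (hE : Envelope α σ ε U X Y) (hα : 0 ≤ α) (hX : AtLeast c (Xᵀ * X))
    {ξ : Draw n d} (h : ¬ Enough ε X ξ.2.2) : α * c - ε ≤ √(fourthSum X) * Y ξ := by
  by_contra! hlt
  refine h (enough_of_atLeast (c := α * c - √(fourthSum X) * Y ξ) (by linarith) ?_)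
  refine (hX.smul hα).of_norm_sub_le (transpose_maskedGram _ _) ?_
  rw [norm_sub_rev]; exact hE.gram_le ξ

theorem Envelope.vnorm_resid_sq_sub_le (hE : Envelope α σ ε U X Y) (hε : 0 < ε) (hn : 1 ≤ n)
    {ξ : Draw n d} (h : Enough ε X ξ.2.2) :
    |vnorm r[X, U, ξ] ^ 2 / n - α * σ ^ 2| ≤ 2 * (√n)⁻¹ * Y ξ ^ 2 := by
  have hn' : (1 : ℝ) ≤ n := by exact_mod_cast hn
  have hs1 : 1 ≤ √(n : ℝ) := Real.one_le_sqrt.2 hn'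
  have hnn : (n : ℝ) = √n * √n := (mul_self_sqrt (by linarith)).symm
  have hY := hE.one_le ξ
  rw [resid_observe, h.vnorm_resid_sq hε]
  have h1 := hE.trace_le ξ
  have h2 : vnorm ((isoMat X ξ.2.2)ᵀ *ᵥ signal U (ξ.1, ξ.2.1)) ^ 2 ≤ Y ξ ^ 2 :=
    pow_le_pow_left₀ (vnorm_nonneg _) (hE.fit_le ξ h) 2
  set A := vnorm (mask ξ.2.2 *ᵥ signal U (ξ.1, ξ.2.1)) ^ 2
  set B := vnorm ((isoMat X ξ.2.2)ᵀ *ᵥ signal U (ξ.1, ξ.2.1)) ^ 2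
  have hB : 0 ≤ B := sq_nonneg _
  have e : (A - B) / n - α * σ ^ 2 = ((A - n * (α * σ ^ 2)) - B) / n := by
    field_simp; ring
  rw [e, abs_div, abs_of_pos (by linarith : (0 : ℝ) < n), div_le_iff₀ (by linarith)]
  have e2 : 2 * (√(n : ℝ))⁻¹ * Y ξ ^ 2 * n = 2 * √n * Y ξ ^ 2 := by
    nth_rewrite 2 [hnn]; field_simp
  rw [e2]
  have hY2 : Y ξ ≤ Y ξ ^ 2 := by nlinarith
  calc |A - n * (α * σ ^ 2) - B| ≤ |A - n * (α * σ ^ 2)| + |B| := abs_sub _ _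
    _ ≤ √n * Y ξ + Y ξ ^ 2 := by rw [abs_of_nonneg hB]; exact add_le_add h1 h2
    _ ≤ 2 * √n * Y ξ ^ 2 := by nlinarith [sq_nonneg (Y ξ)]

theorem Envelope.vnorm_resid_sq_le (hE : Envelope α σ ε U X Y) (hε : 0 < ε) (hα : α ∈ Ioo (0 : ℝ) 1)
    (hn : 1 ≤ n) {ξ : Draw n d} (h : Enough ε X ξ.2.2) :
    vnorm r[X, U, ξ] ^ 2 / n ≤ (2 + σ ^ 2) * Y ξ ^ 2 := by
  have hn' : (1 : ℝ) ≤ n := by exact_mod_cast hn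
  have h1 := (abs_le.1 (hE.vnorm_resid_sq_sub_le hε hn h)).2
  have hs1 : (√(n : ℝ))⁻¹ ≤ 1 := inv_le_one_of_one_le₀ (Real.one_le_sqrt.2 hn')
  have hY : 1 ≤ Y ξ ^ 2 := one_le_pow₀ (hE.one_le ξ)
  have h2 : α * σ ^ 2 ≤ σ ^ 2 * Y ξ ^ 2 := by
    have := mul_le_mul hα.2.le hY zero_le_one zero_le_one
    nlinarith [sq_nonneg σ, mul_nonneg (sq_nonneg σ) (sub_nonneg.2 hY), hα.1, hα.2]
  have h3 : 2 * (√(n : ℝ))⁻¹ * Y ξ ^ 2 ≤ 2 * Y ξ ^ 2 := by nlinarith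
  linarith

theorem Envelope.vnorm_transpose_mulVec_resid_le (hE : Envelope α σ ε U X Y) (hε : 0 < ε)
    (hU : Uᵀ * U = 1) {ξ : Draw n d} (h : Enough ε X ξ.2.2) :
    vnorm (Uᵀ *ᵥ r[X, U, ξ]) ≤ 2 * Y ξ := by
  rw [resid_observe, residMat, sub_mulVec, mulVec_sub]
  refine (vnorm_sub_le _ _).trans ?_
  have h1 := hE.proj_le ξ
  have h2 : vnorm (Uᵀ *ᵥ ((mask ξ.2.2 * X * (fitMat X ξ.2.2)ᵀ) *ᵥ signal U (ξ.1, ξ.2.1))) ≤ Y ξ := by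
    refine (vnorm_mulVec_le _ _).trans ?_
    rw [norm_transpose]
    exact (mul_le_of_le_one_left (vnorm_nonneg _) (norm_le_one_of_isometry hU)).trans
      ((h.vnorm_fit_le hε _).trans (hE.fit_le ξ h))
  linarith

theorem vnorm_row_pow_four_le (X : Mat n d) (i : Fin n) :
    vnorm (X i) ^ 4 ≤ d * ∑ j, X i j ^ 4 := by
  have e : vnorm (X i) ^ 4 = (∑ j, X i j ^ 2) ^ 2 := by rw [← vnorm_sq_eq_sum]; ring
  rw [e]
  have := sq_sum_le_card_mul_sum_sq (s := Finset.univ) (f := fun j => X i j ^ 2)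
  simpa [← pow_mul] using this

theorem sum_vnorm_row_pow_four_le (X : Mat n d) :
    ∑ i, vnorm (X i) ^ 4 ≤ d * fourthSum X := by
  rw [fourthSum, mul_sum]
  exact sum_le_sum fun i _ => vnorm_row_pow_four_le X i

theorem Envelope.sum_fit_pow_four_le (hE : Envelope α σ ε U X Y) {ξ : Draw n d}
    (h : Enough ε X ξ.2.2) :
    ∑ i, (X *ᵥ ŵ[X, U, ξ]) i ^ 4 ≤ d * fourthSum X * Y ξ ^ 4 := by
  have hw := hE.coeff_le ξ h
  calc ∑ i, (X *ᵥ ŵ[X, U, ξ]) i ^ 4 ≤ ∑ i, vnorm (X i) ^ 4 * Y ξ ^ 4 :=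
        sum_le_sum fun i _ => by
          have h1 : |(X *ᵥ ŵ[X, U, ξ]) i| ≤ vnorm (X i) * Y ξ :=
            (abs_dotProduct_le _ _).trans (mul_le_mul_of_nonneg_left hw (vnorm_nonneg _))
          have h2 : (X *ᵥ ŵ[X, U, ξ]) i ^ 4 = |(X *ᵥ ŵ[X, U, ξ]) i| ^ 4 := by
            rw [pow_abs, abs_of_nonneg (by positivity)]
          rw [h2, ← mul_pow]
          exact pow_le_pow_left₀ (abs_nonneg _) h1 4
    _ = (∑ i, vnorm (X i) ^ 4) * Y ξ ^ 4 := by rw [sum_mul]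
    _ ≤ _ := mul_le_mul_of_nonneg_right (sum_vnorm_row_pow_four_le X) (by positivity)

theorem Envelope.sum_resid_pow_four_le (hE : Envelope α σ ε U X Y) {ξ : Draw n d}
    (h : Enough ε X ξ.2.2) :
    ∑ i, r[X, U, ξ] i ^ 4 ≤ 8 * (n * Y ξ + d * fourthSum X * Y ξ ^ 4) := by
  have h4 : ∀ x y : ℝ, (x - y) ^ 4 ≤ 8 * (x ^ 4 + y ^ 4) := fun x y => by
    have := add_pow_le (abs_nonneg x) (abs_nonneg y) 4
    have h1 : (x - y) ^ 4 ≤ (|x| + |y|) ^ 4 := by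
      have : (x - y) ^ 4 = |x - y| ^ 4 := by rw [pow_abs, abs_of_nonneg (by positivity)]
      rw [this]; exact pow_le_pow_left₀ (abs_nonneg _) (abs_sub _ _) 4
    have h2 : |x| ^ 4 = x ^ 4 := by rw [pow_abs, abs_of_nonneg (by positivity)]
    have h3 : |y| ^ 4 = y ^ 4 := by rw [pow_abs, abs_of_nonneg (by positivity)]
    rw [h2, h3] at this
    norm_num at this
    linarith
  calc ∑ i, r[X, U, ξ] i ^ 4 ≤
        ∑ i, 8 * (signal U (ξ.1, ξ.2.1) i ^ 4 + (X *ᵥ ŵ[X, U, ξ]) i ^ 4) :=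
        sum_le_sum fun i _ => by
          have e : r[X, U, ξ] i = if ξ.2.2 i then
              signal U (ξ.1, ξ.2.1) i - (X *ᵥ ŵ[X, U, ξ]) i else 0 := by
            rw [resid, Pi.sub_apply, mask_mulVec_apply]
            simp only [observe, mask_mulVec_apply, signal]
            split_ifs with hi
            · simp [hi]
            · simp [hi]
          rw [e]
          split_ifs
          · exact h4 _ _
          · rw [zero_pow four_ne_zero]; positivity
    _ = 8 * (∑ i, signal U (ξ.1, ξ.2.1) i ^ 4 + ∑ i, (X *ᵥ ŵ[X, U, ξ]) i ^ 4) := by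
        rw [← mul_sum, sum_add_distrib]
    _ ≤ _ := by
        have h1 := hE.quart_le ξ
        have h2 := hE.sum_fit_pow_four_le h
        linarith

end Pointwise

/-! ### Means over one draw -/

section Means
variable {n d : ℕ} {κ : Measure (Fin d → ℝ)} {ν : Measure ℝ} {α σ ε c : ℝ} {lam : Fin d → ℝ}
  {U X : Mat n d} {Y : Draw n d → ℝ} {M : ℕ → ℝ}

/-- The draws that pass the test. -/
def passSet (ε : ℝ) (X : Mat n d) : Set (Draw n d) := {ξ | Enough ε X ξ.2.2}

theorem measurableSet_passSet (ε : ℝ) (X : Mat n d) : MeasurableSet (passSet ε X) :=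
  measurableSet_enough (F := fun _ : Draw n d => X) measurable_const measurable_id ε

open Classical in
theorem integral_indicator_passSet (hν : IsNoiseLaw ν σ) (hκ : IsCoefLaw κ lam)
    (hα : α ∈ Ioo (0 : ℝ) 1) {k l : ℕ} {f : Draw n d → Mat k l}
    {g : (Fin n → Bool) → Mat k l}
    (hf : Integrable ((passSet ε X).indicator f) (drawLaw n κ ν α))
    (hg : ∀ v, Enough ε X v → ∫ p, f (p.1, p.2, v) ∂signalLaw n κ ν = g v) :
    ∫ ξ, (passSet ε X).indicator f ξ ∂drawLaw n κ ν α =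
      ∫ v, (if Enough ε X v then g v else 0) ∂(Measure.pi fun _ => maskLaw α) := by
  have := hν.isProb
  have := hκ.isProb
  have := isProbabilityMeasure_maskLaw hα
  rw [integral_draw hf]
  congr 1
  funext v
  by_cases hv : Enough ε X v
  · simp only [hv, if_true, ← hg v hv]
    congr 1
    funext p
    exact indicator_of_mem (show (p.1, p.2, v) ∈ passSet ε X from hv) f
  · simp only [hv, if_false]
    rw [← integral_zero ((Fin d → ℝ) × (Fin n → ℝ)) _ (μ := signalLaw n κ ν)]
    congr 1
    funext p
    exact indicator_of_notMem (show (p.1, p.2, v) ∉ passSet ε X from hv) f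

theorem norm_integral_indicator_sub_le (hν : IsNoiseLaw ν σ) (hκ : IsCoefLaw κ lam)
    (hα : α ∈ Ioo (0 : ℝ) 1) (hE : Envelope α σ ε U X Y) (hM : MomentBound M Y (drawLaw n κ ν α))
    {k l : ℕ} {f : Draw n d → Mat k l}
    {g : (Fin n → Bool) → Mat k l} {L : Mat k l} {a : ℝ} (ha : 0 ≤ a)
    (hf : Integrable ((passSet ε X).indicator f) (drawLaw n κ ν α))
    (hg : ∀ v, Enough ε X v → ∫ p, f (p.1, p.2, v) ∂signalLaw n κ ν = g v)
    (h1 : ∀ ξ ∈ passSet ε X, ‖g ξ.2.2 - L‖ ≤ a * Y ξ) (h2 : ∀ ξ ∉ passSet ε X, ‖L‖ ≤ a * Y ξ) :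
    ‖∫ ξ, (passSet ε X).indicator f ξ ∂drawLaw n κ ν α - L‖ ≤ a * M 1 := by
  classical
  have := hν.isProb
  have := hκ.isProb
  have := isProbabilityMeasure_maskLaw hα
  let g' : (Fin n → Bool) → Mat k l := fun v => if Enough ε X v then g v else 0
  have hMP := measurePreserving_pattern (n := n) (κ := κ) (ν := ν) (α := α)
  have hg'i : Integrable (fun ξ : Draw n d => g' ξ.2.2) (drawLaw n κ ν α) :=
    hMP.integrable_comp_of_integrable (Integrable.of_finite (f := g'))
  have hgp : ∫ ξ : Draw n d, g' ξ.2.2 ∂drawLaw n κ ν α = ∫ v, g' v ∂(Measure.pi fun _ => maskLaw α) := by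
    rw [← hMP.map_eq]
    exact (integral_map hMP.measurable.aemeasurable
      (measurable_of_finite g').aestronglyMeasurable).symm
  have hL : ∫ ξ, g' ξ.2.2 ∂drawLaw n κ ν α - L = ∫ ξ, (g' ξ.2.2 - L) ∂drawLaw n κ ν α := by
    rw [integral_sub hg'i (integrable_const _)]; simp
  rw [integral_indicator_passSet hν hκ hα hf hg]
  erw [← hgp]
  rw [hL]
  refine hM.norm_integral_le (p := 1) ha (hg'i.sub (integrable_const _)) fun ξ => ?_
  rw [pow_one, hE.abs_eq]
  by_cases hξ : Enough ε X ξ.2.2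
  · simp only [g', hξ, if_true]; exact h1 ξ hξ
  · simp only [g', hξ, if_false, zero_sub, norm_neg]; exact h2 ξ hξ

end Means

section StepMeans
variable {n d : ℕ} {κ : Measure (Fin d → ℝ)} {ν : Measure ℝ} {α σ ε c : ℝ} {lam : Fin d → ℝ}
  {U X : Mat n d} {Y : Draw n d → ℝ} {M : ℕ → ℝ}

theorem measurable_coeff_const (U X : Mat n d) :
    Measurable fun ξ : Draw n d => ŵ[X, U, ξ] :=
  measurable_coeff (F := fun _ : Draw n d => X) measurable_const measurable_id U

theorem measurable_resid_const (U X : Mat n d) :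
    Measurable fun ξ : Draw n d => r[X, U, ξ] :=
  measurable_resid (F := fun _ : Draw n d => X) measurable_const measurable_id U

theorem Envelope.integrable_indicator (hE : Envelope α σ ε U X Y) {μ : Measure (Draw n d)}
    (hM : MomentBound M Y μ) {E : Type*} [NormedAddCommGroup E] [MeasurableSpace E] [BorelSpace E]
    [SecondCountableTopology E] {f : Draw n d → E} (hf : Measurable f) {C : ℝ} (hC : 0 ≤ C) (p : ℕ)
    (h : ∀ ξ ∈ passSet ε X, ‖f ξ‖ ≤ C * Y ξ ^ p) : Integrable ((passSet ε X).indicator f) μ := by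
  refine hM.integrable_of_le (C := C) (p := p)
    (hf.indicator (measurableSet_passSet ε X)).aestronglyMeasurable fun ξ => ?_
  rw [hE.abs_eq]
  by_cases hξ : ξ ∈ passSet ε X
  · rw [indicator_of_mem hξ]; exact h ξ hξ
  · rw [indicator_of_notMem hξ, norm_zero]
    have := hE.one_le ξ
    positivity

theorem Envelope.norm_integral_indicator_le (hE : Envelope α σ ε U X Y) {μ : Measure (Draw n d)}
    (hM : MomentBound M Y μ) {E : Type*} [NormedAddCommGroup E] [NormedSpace ℝ E]
    {f : Draw n d → E} {C : ℝ} (hC : 0 ≤ C) {p : ℕ} (hi : Integrable ((passSet ε X).indicator f) μ)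
    (h : ∀ ξ ∈ passSet ε X, ‖f ξ‖ ≤ C * Y ξ ^ p) :
    ‖∫ ξ, (passSet ε X).indicator f ξ ∂μ‖ ≤ C * M p := by
  refine hM.norm_integral_le hC hi fun ξ => ?_
  rw [hE.abs_eq]
  by_cases hξ : ξ ∈ passSet ε X
  · rw [indicator_of_mem hξ]; exact h ξ hξ
  · rw [indicator_of_notMem hξ, norm_zero]
    have := hE.one_le ξ
    positivity

/-- Means of one step, up to errors controlled by the incoherence `fourthSum X`. -/
structure StepMeans (C α σ ε : ℝ) (lam : Fin d → ℝ) (U X : Mat n d)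
    (μ : Measure (Draw n d)) : Prop where
  fail_le : μ.real (passSet ε X)ᶜ ≤ C * min 1 (fourthSum X)
  coef_le : ‖∫ ξ, (passSet ε X).indicator
    (fun ξ => vecMulVec ŵ[X, U, ξ] ŵ[X, U, ξ]) ξ ∂μ -
      coefLimit α σ lam U X‖ ≤ C * √(fourthSum X + 1 / n)
  cross_le : ‖∫ ξ, (passSet ε X).indicator
    (fun ξ => vecMulVec (Uᵀ *ᵥ r[X, U, ξ]) ŵ[X, U, ξ]) ξ ∂μ -
      crossLimit α lam U X‖ ≤ C * √(fourthSum X + 1 / n)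
  energy_le : ‖∫ ξ, (passSet ε X).indicator
    (fun ξ => (vnorm r[X, U, ξ] ^ 2 / n) •
      vecMulVec ŵ[X, U, ξ] ŵ[X, U, ξ]) ξ ∂μ -
      (α * σ ^ 2) • coefLimit α σ lam U X‖ ≤ C * √(fourthSum X + 1 / n)
  resid_le : ∀ i j, |(∫ ξ, (passSet ε X).indicator
    (fun ξ => vecMulVec r[X, U, ξ] ŵ[X, U, ξ]) ξ ∂μ) i j| ≤
      C * (vnorm (U i) + vnorm (X i))

theorem abs_mul_apply_le {k l m : ℕ} (A : Mat k l) (B : Mat l m)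
    (i : Fin k) (j : Fin m) : |(A * B) i j| ≤ vnorm (A i) * ‖B‖ := by
  rw [Matrix.mul_apply]
  exact (abs_dotProduct_le (A i) fun x => B x j).trans
    (mul_le_mul_of_nonneg_left (vnorm_col_le_norm B j) (vnorm_nonneg _))

theorem vnorm_mul_row_le {k l m : ℕ} (A : Mat k l) (B : Mat l m)
    (i : Fin k) : vnorm ((A * B) i) ≤ vnorm (A i) * ‖B‖ := by
  have e : (A * B) i = Bᵀ *ᵥ A i := by
    rw [Matrix.mul_apply_eq_vecMul, mulVec_transpose]
  rw [e, mul_comm]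
  exact (vnorm_mulVec_le _ _).trans_eq (by rw [norm_transpose])

theorem Enough.abs_resid_cov_apply_le (hU : Uᵀ * U = 1) (hε : 0 < ε) {v : Fin n → Bool}
    (h : Enough ε X v) (i : Fin n) (j : Fin d) :
    |(residMat X v * dataCov U lam σ * fitMat X v) i j| ≤
      (1 + ε⁻¹) ^ 2 * ‖lamSq lam‖ * (vnorm (U i) + vnorm (X i)) := by
  have hε' : 0 < ε⁻¹ := by positivity
  set b : ℝ := 1 + ε⁻¹
  have hfit : ‖fitMat X v‖ ≤ b := by
    have h1 := h.norm_fitMat_sq_le hε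
    by_contra! hlt
    nlinarith
  have hUn := norm_le_one_of_isometry hU
  have hV : ‖Uᵀ * fitMat X v‖ ≤ b := by
    refine (norm_mul_le_mul _ _).trans ((mul_le_of_le_one_left (norm_nonneg _) ?_).trans hfit)
    rwa [norm_transpose]
  have hV' : ‖(fitMat X v)ᵀ * U‖ ≤ b := by
    refine (norm_mul_le_mul _ _).trans ((mul_le_of_le_one_right (norm_nonneg _) hUn).trans ?_)
    rwa [norm_transpose]
  have hrow : vnorm ((residMat X v * U) i) ≤ b * (vnorm (U i) + vnorm (X i)) := by
    have e : residMat X v * U = mask v * (U - X * ((fitMat X v)ᵀ * U)) := by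
      rw [residMat]; simp only [msub_mul, mmul_sub, mmul_assoc]
    have hU0 := vnorm_nonneg (U i)
    have hX0 := vnorm_nonneg (X i)
    have h1 : vnorm ((U - X * ((fitMat X v)ᵀ * U)) i) ≤ vnorm (U i) + vnorm (X i) * b := by
      refine (vnorm_sub_le (U i) _).trans (add_le_add le_rfl ?_)
      exact (vnorm_mul_row_le _ _ _).trans (mul_le_mul_of_nonneg_left hV' hX0)
    have h2 : (mask v * (U - X * ((fitMat X v)ᵀ * U))) i =
        if v i then (U - X * ((fitMat X v)ᵀ * U)) i else 0 := by
      funext j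
      rw [mask, Matrix.diagonal_mul]
      split_ifs <;> simp
    rw [e, h2]
    split_ifs
    · refine h1.trans ?_
      nlinarith [mul_nonneg hε'.le hU0]
    · rw [vnorm_eq_zero.2 rfl]; positivity
  rw [h.residMat_dataCov hε, mmul_assoc (residMat X v * U)]
  refine (abs_mul_apply_le _ _ _ _).trans ?_
  have h3 : ‖lamSq lam * (Uᵀ * fitMat X v)‖ ≤ ‖lamSq lam‖ * b :=
    (norm_mul_le_mul _ _).trans (mul_le_mul_of_nonneg_left hV (norm_nonneg _))
  calc vnorm ((residMat X v * U) i) * ‖lamSq lam * (Uᵀ * fitMat X v)‖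
      ≤ (b * (vnorm (U i) + vnorm (X i))) * (‖lamSq lam‖ * b) :=
        mul_le_mul hrow h3 (norm_nonneg _) ((vnorm_nonneg _).trans hrow)
    _ = _ := by ring

open Classical in
set_option maxHeartbeats 1000000 in
theorem exists_stepMeans (hν : IsNoiseLaw ν σ) (hκ : IsCoefLaw κ lam) (hα : α ∈ Ioo (0 : ℝ) 1)
    (hε : 0 < ε) (hc : 0 < c) (hεc : ε < α * c) (M : ℕ → ℝ) :
    ∃ C : ℝ, 0 ≤ C ∧ ∀ {n : ℕ} {U X : Mat n d} {Y : Draw n d → ℝ}, 1 ≤ n →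
      Uᵀ * U = 1 → AtLeast c (Xᵀ * X) → Envelope α σ ε U X Y → MomentBound M Y (drawLaw n κ ν α) →
      StepMeans C α σ ε lam U X (drawLaw n κ ν α) := by
  have := hν.isProb
  have := hκ.isProb
  have := isProbabilityMeasure_maskLaw hα
  obtain ⟨Cp, hCp, hpert⟩ := exists_perturbation hα hε hc σ lam
  set η := α * c - ε with hη
  have hη0 : 0 < η := by rw [hη]; linarith
  set a := Cp + Cp * η⁻¹ with ha
  have ha0 : 0 ≤ a := by positivity
  set Cr := (1 + ε⁻¹) ^ 2 * ‖lamSq lam‖ with hCr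
  have hCr0 : 0 ≤ Cr := by positivity
  set C₁ := max 1 (η⁻¹ ^ 2 * |M 2|)
  set C₂ := a * |M 1| with hC₂
  set C₃ := 2 * |M 4| + α * σ ^ 2 * C₂ with hC₃
  have hC₁0 : 1 ≤ C₁ := le_max_left _ _
  have hC₂0 : 0 ≤ C₂ := by positivity
  have hC₃0 : 0 ≤ C₃ := by have := hα.1; positivity
  refine ⟨C₁ + C₂ + C₃ + Cr + Cp, by linarith, fun {n U X Y} hn hU hX hE hM => ?_⟩
  have hn' : (1 : ℝ) ≤ n := by exact_mod_cast hn
  have hle₁ : C₁ ≤ C₁ + C₂ + C₃ + Cr + Cp := by linarith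
  have hle₂ : C₂ ≤ C₁ + C₂ + C₃ + Cr + Cp := by linarith
  have hle₃ : C₃ ≤ C₁ + C₂ + C₃ + Cr + Cp := by linarith
  have hler : Cr ≤ C₁ + C₂ + C₃ + Cr + Cp := by linarith
  have hC₂eq : C₂ = a * |M 1| := hC₂
  have hC₃eq : C₃ = 2 * |M 4| + α * σ ^ 2 * C₂ := hC₃
  have hC₁eq : η⁻¹ ^ 2 * |M 2| ≤ C₁ := le_max_right _ _
  have haeq : a = Cp + Cp * η⁻¹ := ha
  have hηeq : α * c - ε = η := rfl
  have hCreq : Cr = (1 + ε⁻¹) ^ 2 * ‖lamSq lam‖ := hCr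
  clear_value C₁ C₂ C₃ Cr a η
  set h := fourthSum X
  have hh0 : 0 ≤ h := fourthSum_nonneg X
  set ρ := √(h + 1 / n)
  have hρ0 : 0 ≤ ρ := sqrt_nonneg _
  have hhρ : √h ≤ ρ := Real.sqrt_le_sqrt (by linarith [show 0 ≤ 1 / (n : ℝ) by positivity])
  have hnρ : (√(n : ℝ))⁻¹ ≤ ρ := by
    rw [← Real.sqrt_inv]
    exact Real.sqrt_le_sqrt (by rw [one_div]; linarith)
  obtain ⟨hL₁, hL₂, hp⟩ := hpert hU hX
  have hY1 := hE.one_le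
  have hwm := measurable_coeff_const U X
  have hrm := measurable_resid_const U X
  have hww : ∀ ξ ∈ passSet ε X,
      ‖vecMulVec ŵ[X, U, ξ] ŵ[X, U, ξ]‖ ≤ 1 * Y ξ ^ 2 := fun ξ hξ => by
    have h1 := hE.coeff_le ξ hξ
    refine (norm_vecMulVec_le _ _).trans ?_
    rw [one_mul, sq]
    exact mul_le_mul h1 h1 (vnorm_nonneg _) (zero_le_one.trans (hY1 ξ))
  have iww := hE.integrable_indicator hM (measurable_matrix_vecMulVec hwm hwm) zero_le_one 2 hww
  have hp' : ∀ ξ ∈ passSet ε X,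
      ‖(fitMat X ξ.2.2)ᵀ * dataCov U lam σ * fitMat X ξ.2.2 - coefLimit α σ lam U X‖ ≤ a * ρ * Y ξ ∧
      ‖Uᵀ * (residMat X ξ.2.2 * dataCov U lam σ * fitMat X ξ.2.2) - crossLimit α lam U X‖ ≤
        a * ρ * Y ξ := fun ξ hξ => by
    have hY0 := zero_le_one.trans (hY1 ξ)
    have h1 := hp ξ.2.2 (ρ * Y ξ) hξ
      ((hE.gram_le ξ).trans (mul_le_mul_of_nonneg_right hhρ hY0)) (hE.cross_le ξ) (hE.base_le ξ)
    have h2 : Cp * (ρ * Y ξ) ≤ a * ρ * Y ξ := by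
      rw [mul_assoc]
      refine mul_le_mul_of_nonneg_right ?_ (by positivity)
      rw [haeq]; linarith [show 0 ≤ Cp * η⁻¹ by positivity]
    exact ⟨h1.1.trans h2, h1.2.trans h2⟩
  have hfail : ∀ ξ ∉ passSet ε X, 1 ≤ η⁻¹ * (√h * Y ξ) := fun ξ hξ => by
    have := hE.le_of_not_enough hα.1.le hX hξ
    rw [hηeq] at this
    rw [← div_eq_inv_mul, one_le_div hη0]; exact this
  have hfail' : ∀ ξ ∉ passSet ε X, Cp ≤ a * ρ * Y ξ := fun ξ hξ => by
    have hY0 := zero_le_one.trans (hY1 ξ)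
    have h1 := hfail ξ hξ
    calc Cp = Cp * 1 := (mul_one _).symm
      _ ≤ Cp * (η⁻¹ * (√h * Y ξ)) := mul_le_mul_of_nonneg_left h1 hCp
      _ ≤ Cp * (η⁻¹ * (ρ * Y ξ)) := by gcongr
      _ ≤ Cp * (η⁻¹ * (ρ * Y ξ)) + Cp * (ρ * Y ξ) := by
          linarith [show 0 ≤ Cp * (ρ * Y ξ) by positivity]
      _ = _ := by rw [haeq]; ring
  have hM1 : a * ρ * M 1 ≤ C₂ * ρ := by
    rw [hC₂eq]
    calc a * ρ * M 1 ≤ a * ρ * |M 1| := by gcongr; exact le_abs_self _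
      _ = _ := by ring
  have haρ : 0 ≤ a * ρ := mul_nonneg ha0 hρ0
  have hcoef : ‖∫ ξ, (passSet ε X).indicator
      (fun ξ => vecMulVec ŵ[X, U, ξ] ŵ[X, U, ξ]) ξ ∂drawLaw n κ ν α -
      coefLimit α σ lam U X‖ ≤ C₂ * ρ := by
    refine (norm_integral_indicator_sub_le hν hκ hα hE hM
      (g := fun v => (fitMat X v)ᵀ * dataCov U lam σ * fitMat X v) haρ iww (fun v _ => ?_)
      (fun ξ hξ => (hp' ξ hξ).1) fun ξ hξ => hL₁.trans (hfail' ξ hξ)).trans hM1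
    simp only [coeff_observe]
    rw [(integral_vecMulVec_signal hν hκ U (fitMat X v)ᵀ (fitMat X v)ᵀ).2, transpose_transpose]
  refine ⟨?_, ?_, ?_, ?_, ?_⟩
  · refine le_trans ?_ (mul_le_mul_of_nonneg_right hle₁ (le_min zero_le_one hh0))
    have hreal : (drawLaw n κ ν α).real (passSet ε X)ᶜ =
        ∫ ξ, (passSet ε X)ᶜ.indicator (fun _ => (1 : ℝ)) ξ ∂drawLaw n κ ν α := by
      rw [integral_indicator (measurableSet_passSet ε X).compl]; simp
    have h1 : (drawLaw n κ ν α).real (passSet ε X)ᶜ ≤ C₁ * h := by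
      rw [hreal]
      have h2 : ∀ ξ, (passSet ε X)ᶜ.indicator (fun _ => (1 : ℝ)) ξ ≤ (η⁻¹ ^ 2 * h) * |Y ξ| ^ 2 := by
        intro ξ
        rw [hE.abs_eq]
        by_cases hξ : ξ ∈ passSet ε X
        · rw [indicator_of_notMem (by simpa using hξ)]; positivity
        · rw [indicator_of_mem (by simpa using hξ)]
          calc (1 : ℝ) ≤ (η⁻¹ * (√h * Y ξ)) ^ 2 := one_le_pow₀ (hfail ξ hξ)
            _ = η⁻¹ ^ 2 * (√h) ^ 2 * Y ξ ^ 2 := by ring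
            _ = _ := by rw [sq_sqrt hh0]
      refine (hM.integral_le (by positivity) ((integrable_const (1 : ℝ)).indicator
        (measurableSet_passSet ε X).compl) h2).trans ?_
      calc η⁻¹ ^ 2 * h * M 2 ≤ η⁻¹ ^ 2 * h * |M 2| := by gcongr; exact le_abs_self _
        _ = (η⁻¹ ^ 2 * |M 2|) * h := by ring
        _ ≤ C₁ * h := mul_le_mul_of_nonneg_right hC₁eq hh0
    rcases min_choice 1 h with hm | hm
    · rw [hm, mul_one]; exact measureReal_le_one.trans hC₁0
    · rwa [hm]
  · exact hcoef.trans (mul_le_mul_of_nonneg_right hle₂ hρ0)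
  · refine le_trans ?_ (mul_le_mul_of_nonneg_right hle₂ hρ0)
    have hi := hE.integrable_indicator hM (measurable_matrix_vecMulVec
      (measurable_matrix_mulVec (measurable_const (a := Uᵀ)) hrm) hwm) (C := 2) (by norm_num) 2 fun ξ hξ => by
        refine (norm_vecMulVec_le _ _).trans ?_
        rw [sq, ← mul_assoc]
        exact mul_le_mul (hE.vnorm_transpose_mulVec_resid_le hε hU hξ) (hE.coeff_le ξ hξ) (vnorm_nonneg _)
          (mul_nonneg zero_le_two (zero_le_one.trans (hY1 ξ)))
    refine (norm_integral_indicator_sub_le hν hκ hα hE hM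
      (g := fun v => Uᵀ * (residMat X v * dataCov U lam σ * fitMat X v)) haρ hi (fun v _ => ?_)
      (fun ξ hξ => (hp' ξ hξ).2) fun ξ hξ => hL₂.trans (hfail' ξ hξ)).trans hM1
    simp only [coeff_observe, resid_observe, mulVec_mulVec]
    rw [(integral_vecMulVec_signal hν hκ U (Uᵀ * residMat X v) (fitMat X v)ᵀ).2,
      transpose_transpose]
    simp only [mmul_assoc]
  · refine le_trans ?_ (mul_le_mul_of_nonneg_right hle₃ hρ0)
    set w := fun ξ : Draw n d => ŵ[X, U, ξ]
    set R := fun ξ : Draw n d => vnorm r[X, U, ξ] ^ 2 / n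
    have hRm : Measurable R := ((measurable_vnorm.comp hrm).pow_const 2).div_const _
    have hwwm : Measurable fun ξ => vecMulVec (w ξ) (w ξ) := measurable_matrix_vecMulVec hwm hwm
    have hb : ∀ ξ ∈ passSet ε X, ‖(R ξ - α * σ ^ 2) • vecMulVec (w ξ) (w ξ)‖ ≤
        (2 * ρ) * Y ξ ^ 4 := fun ξ hξ => by
      rw [norm_smul, norm_eq_abs]
      have h1 := hE.vnorm_resid_sq_sub_le hε hn hξ
      have h2 := hww ξ hξ
      calc |R ξ - α * σ ^ 2| * ‖vecMulVec (w ξ) (w ξ)‖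
          ≤ (2 * (√n)⁻¹ * Y ξ ^ 2) * (1 * Y ξ ^ 2) :=
            mul_le_mul h1 h2 (norm_nonneg _) ((abs_nonneg _).trans h1)
        _ = 2 * (√n)⁻¹ * Y ξ ^ 4 := by ring
        _ ≤ _ := by gcongr
    have hi : Integrable ((passSet ε X).indicator fun ξ => (R ξ - α * σ ^ 2) •
        vecMulVec (w ξ) (w ξ)) (drawLaw n κ ν α) :=
      hE.integrable_indicator hM ((hRm.sub_const (α * σ ^ 2)).smul hwwm) (by positivity) 4 hb
    have hi2 : Integrable (fun ξ => (α * σ ^ 2) • (passSet ε X).indicator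
        (fun ξ => vecMulVec (w ξ) (w ξ)) ξ) (drawLaw n κ ν α) := iww.smul (α * σ ^ 2)
    have he : ∀ ξ, (passSet ε X).indicator (fun ξ => R ξ • vecMulVec (w ξ) (w ξ)) ξ =
        (passSet ε X).indicator (fun ξ => (R ξ - α * σ ^ 2) • vecMulVec (w ξ) (w ξ)) ξ +
        (α * σ ^ 2) • (passSet ε X).indicator (fun ξ => vecMulVec (w ξ) (w ξ)) ξ := by
      intro ξ
      by_cases hξ : ξ ∈ passSet ε X
      · simp only [indicator_of_mem hξ, sub_smul]; abel
      · simp only [indicator_of_notMem hξ, smul_zero, add_zero]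
    rw [integral_congr_ae (Filter.Eventually.of_forall he), integral_add hi hi2,
      integral_smul, add_sub_assoc, ← smul_sub]
    refine (norm_add_le _ _).trans ?_
    have h1 := hE.norm_integral_indicator_le hM (by positivity) hi hb
    have h2 : 2 * ρ * M 4 ≤ 2 * |M 4| * ρ := by
      calc 2 * ρ * M 4 ≤ 2 * ρ * |M 4| := by gcongr; exact le_abs_self _
        _ = _ := by ring
    have hασ : 0 ≤ α * σ ^ 2 := mul_nonneg hα.1.le (sq_nonneg σ)
    rw [norm_smul, norm_eq_abs, abs_of_nonneg hασ]
    have h3 := mul_le_mul_of_nonneg_left hcoef hασ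
    rw [hC₃eq]
    linarith
  · intro i j
    refine le_trans ?_ (mul_le_mul_of_nonneg_right hler
      (add_nonneg (vnorm_nonneg _) (vnorm_nonneg _)))
    have hi := hE.integrable_indicator hM (measurable_matrix_vecMulVec hrm hwm)
      (C := (2 + σ ^ 2) * n) (by positivity) 2 fun ξ hξ => by
        refine (norm_vecMulVec_le _ _).trans ?_
        have h1 := hE.vnorm_resid_sq_le hε hα hn hξ
        have h2 := hE.coeff_le ξ hξ
        have h3 := vnorm_nonneg r[X, U, ξ]
        have h4 := vnorm_nonneg ŵ[X, U, ξ]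
        rw [div_le_iff₀ (by linarith)] at h1
        have h5 : vnorm ŵ[X, U, ξ] ^ 2 ≤ Y ξ ^ 2 := pow_le_pow_left₀ h4 h2 2
        have h6 : Y ξ ^ 2 ≤ (2 + σ ^ 2) * n * Y ξ ^ 2 :=
          le_mul_of_one_le_left (sq_nonneg _) (by nlinarith [sq_nonneg σ])
        nlinarith [sq_nonneg (vnorm r[X, U, ξ] - vnorm ŵ[X, U, ξ])]
    rw [integral_indicator_passSet hν hκ hα hi (g := fun v => residMat X v * dataCov U lam σ * fitMat X v)
      fun v _ => by
        simp only [coeff_observe, resid_observe]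
        rw [(integral_vecMulVec_signal hν hκ U (residMat X v) (fitMat X v)ᵀ).2, transpose_transpose],
      integral_matrix_apply Integrable.of_finite, ← norm_eq_abs]
    have hb0 : 0 ≤ Cr * (vnorm (U i) + vnorm (X i)) :=
      mul_nonneg hCr0 (add_nonneg (vnorm_nonneg _) (vnorm_nonneg _))
    refine (norm_integral_le_of_norm_le_const (C := Cr * (vnorm (U i) + vnorm (X i)))
      (ae_of_all _ fun v => ?_)).trans (by simp)
    by_cases hv : Enough ε X v
    · simp only [hv, if_true, norm_eq_abs, hCreq]
      exact hv.abs_resid_cov_apply_le hU hε i j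
    · simp only [hv, if_false, Matrix.zero_apply, norm_zero]; exact hb0

end StepMeans

/-! ### Growth of the incoherence -/

section FourthSum
variable {n d : ℕ} {κ : Measure (Fin d → ℝ)} {ν : Measure ℝ} {α σ ε c : ℝ} {lam : Fin d → ℝ}
  {U X : Mat n d} {Y : Draw n d → ℝ} {M : ℕ → ℝ}

theorem add_pow_four_le (x y : ℝ) : (x + y) ^ 4 ≤ 8 * (x ^ 4 + y ^ 4) := by
  have h1 : (x + y) ^ 2 ≤ 2 * (x ^ 2 + y ^ 2) := by nlinarith [sq_nonneg (x - y)]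
  have h2 : ((x + y) ^ 2) ^ 2 ≤ (2 * (x ^ 2 + y ^ 2)) ^ 2 := pow_le_pow_left₀ (sq_nonneg _) h1 2
  nlinarith [sq_nonneg (x ^ 2 - y ^ 2)]

theorem add_add_pow_four_le {N : ℝ} (hN : 1 ≤ N) (x δ e : ℝ) :
    (x + δ + e) ^ 4 ≤ (1 + 7 / N) * x ^ 4 + 4 * (x ^ 3 * δ) + 58 * (N * δ ^ 4 + N ^ 3 * e ^ 4) := by
  have hN0 : 0 < N := by linarith
  have young : ∀ a b : ℝ, 2 * (a * b) ≤ a ^ 2 / N + N * b ^ 2 := fun a b => by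
    have h := sq_nonneg (a - N * b)
    have : a ^ 2 / N + N * b ^ 2 - 2 * (a * b) = (a - N * b) ^ 2 / N := by field_simp; ring
    have h2 : 0 ≤ (a - N * b) ^ 2 / N := by positivity
    linarith
  set t := δ + e with ht
  have h1 := young (x ^ 2) (t ^ 2)
  have h2 : 4 * (x * t ^ 3) ≤ 2 * (x ^ 2 * t ^ 2) + 2 * t ^ 4 := by nlinarith [sq_nonneg (x * t - t ^ 2)]
  have h3 := add_pow_four_le δ e
  have h4 := young (x ^ 2) (2 * (x * e))
  have h5 := young (x ^ 2) (N * e ^ 2)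
  have h6 : t ^ 4 ≤ N * t ^ 4 := le_mul_of_one_le_left (by positivity) hN
  have h7 : N * e ^ 4 ≤ N ^ 3 * e ^ 4 := by
    refine mul_le_mul_of_nonneg_right ?_ (by positivity)
    nlinarith [sq_nonneg (N - 1), mul_nonneg (mul_nonneg hN0.le hN0.le) (sub_nonneg.2 hN)]
  have h8 : N * t ^ 4 ≤ 8 * (N * δ ^ 4) + 8 * (N * e ^ 4) := by
    have := mul_le_mul_of_nonneg_left h3 hN0.le
    rw [← ht] at this
    linarith
  have e1 : (x + δ + e) ^ 4 = x ^ 4 + 4 * (x ^ 3 * δ) + 4 * (x ^ 3 * e) + 6 * (x ^ 2 * t ^ 2) +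
      4 * (x * t ^ 3) + t ^ 4 := by rw [ht]; ring
  have e2 : (1 + 7 / N) * x ^ 4 = x ^ 4 + 7 * ((x ^ 2) ^ 2 / N) := by ring
  have h4' : 4 * (x ^ 3 * e) ≤ (x ^ 2) ^ 2 / N + 4 * N * (x ^ 2 * e ^ 2) := by
    calc 4 * (x ^ 3 * e) = 2 * (x ^ 2 * (2 * (x * e))) := by ring
      _ ≤ _ := h4
      _ = _ := by ring
  have h5' : 4 * N * (x ^ 2 * e ^ 2) ≤ 2 * ((x ^ 2) ^ 2 / N) + 2 * (N ^ 3 * e ^ 4) := by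
    calc 4 * N * (x ^ 2 * e ^ 2) = 2 * (2 * (x ^ 2 * (N * e ^ 2))) := by ring
      _ ≤ 2 * ((x ^ 2) ^ 2 / N + N * (N * e ^ 2) ^ 2) := by linarith
      _ = _ := by ring
  have h1' : 2 * (x ^ 2 * t ^ 2) ≤ (x ^ 2) ^ 2 / N + N * t ^ 4 := by
    calc 2 * (x ^ 2 * t ^ 2) ≤ _ := h1
      _ = _ := by ring
  have p1 : 0 ≤ N * δ ^ 4 := by positivity
  rw [e1, e2]
  linarith

/-- The linear functional `A ↦ ∑ X i j ^ 3 (A Dᵀ) i j`. -/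
noncomputable def cubicForm (X : Mat n d) (D : Mat d d) :
    Mat n d →L[ℝ] ℝ :=
  LinearMap.toContinuousLinearMap
    { toFun := fun A => ∑ i, ∑ j, X i j ^ 3 * (A * Dᵀ) i j
      map_add' := fun A B => by
        simp only [madd_mul, Matrix.add_apply, mul_add, sum_add_distrib]
      map_smul' := fun c A => by
        simp only [msmul_mul, Matrix.smul_apply, smul_eq_mul, mul_sum, RingHom.id_apply]
        refine sum_congr rfl fun i _ => sum_congr rfl fun j _ => by ring }

theorem cubicForm_apply (X : Mat n d) (D : Mat d d)
    (A : Mat n d) : cubicForm X D A = ∑ i, ∑ j, X i j ^ 3 * (A * Dᵀ) i j := rfl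

theorem cubicForm_le {A : Mat n d} {D : Mat d d} {C : ℝ} (hC : 0 ≤ C)
    (hA : ∀ i j, |A i j| ≤ C * (vnorm (U i) + vnorm (X i))) :
    cubicForm X D A ≤ d ^ 3 * C * ‖D‖ * (2 * fourthSum X + fourthSum U) := by
  have hrow : ∀ i, vnorm (A i) ≤ d * (C * (vnorm (U i) + vnorm (X i))) := fun i => by
    refine (vnorm_le_sum _).trans ((sum_le_sum fun j _ => hA i j).trans_eq ?_)
    simp
  have hterm : ∀ i j, X i j ^ 3 * (A * Dᵀ) i j ≤
      d * C * ‖D‖ * (2 * vnorm (X i) ^ 4 + vnorm (U i) ^ 4) := fun i j => by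
    have hX0 := vnorm_nonneg (X i)
    have hU0 := vnorm_nonneg (U i)
    have h1 : |(A * Dᵀ) i j| ≤ d * (C * (vnorm (U i) + vnorm (X i))) * ‖D‖ := by
      refine (abs_mul_apply_le _ _ _ _).trans ?_
      rw [norm_transpose]
      exact mul_le_mul_of_nonneg_right (hrow i) (norm_nonneg _)
    have h2 : |X i j| ^ 3 ≤ vnorm (X i) ^ 3 := pow_le_pow_left₀ (abs_nonneg _) (abs_apply_le_vnorm _ _) 3
    have h3 : vnorm (X i) ^ 3 * (vnorm (U i) + vnorm (X i)) ≤
        2 * vnorm (X i) ^ 4 + vnorm (U i) ^ 4 := by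
      generalize vnorm (X i) = a at *
      generalize vnorm (U i) = b at *
      have : a ^ 3 * b ≤ a ^ 4 + b ^ 4 := by
        have e1 : a ^ 3 * b ≤ (a ^ 4 + a ^ 2 * b ^ 2) / 2 := by nlinarith [sq_nonneg (a ^ 2 - a * b)]
        nlinarith [sq_nonneg (a ^ 2 - b ^ 2), sq_nonneg (a ^ 2), sq_nonneg (b ^ 2)]
      nlinarith
    calc X i j ^ 3 * (A * Dᵀ) i j ≤ |X i j ^ 3 * (A * Dᵀ) i j| := le_abs_self _
      _ = |X i j| ^ 3 * |(A * Dᵀ) i j| := by rw [abs_mul, abs_pow]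
      _ ≤ vnorm (X i) ^ 3 * (d * (C * (vnorm (U i) + vnorm (X i))) * ‖D‖) :=
          mul_le_mul h2 h1 (abs_nonneg _) (by positivity)
      _ = d * C * ‖D‖ * (vnorm (X i) ^ 3 * (vnorm (U i) + vnorm (X i))) := by ring
      _ ≤ _ := mul_le_mul_of_nonneg_left h3 (by positivity)
  rw [cubicForm_apply]
  calc ∑ i, ∑ j, X i j ^ 3 * (A * Dᵀ) i j
      ≤ ∑ i, ∑ _j : Fin d, d * C * ‖D‖ * (2 * vnorm (X i) ^ 4 + vnorm (U i) ^ 4) :=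
        sum_le_sum fun i _ => sum_le_sum fun j _ => hterm i j
    _ = d ^ 2 * C * ‖D‖ * (2 * ∑ i, vnorm (X i) ^ 4 + ∑ i, vnorm (U i) ^ 4) := by
        simp only [Finset.sum_const, Finset.card_univ, Fintype.card_fin, nsmul_eq_mul, mul_sum,
          ← sum_add_distrib]
        refine sum_congr rfl fun i _ => by ring
    _ ≤ d ^ 2 * C * ‖D‖ * (2 * (d * fourthSum X) + d * fourthSum U) := by
        have h1 := sum_vnorm_row_pow_four_le X
        have h2 := sum_vnorm_row_pow_four_le U
        refine mul_le_mul_of_nonneg_left (by linarith) (by positivity)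
    _ = _ := by ring

theorem measurable_fourthSum : Measurable (fourthSum : Mat n d → ℝ) := by
  have : Continuous (fourthSum : Mat n d → ℝ) := by
    unfold fourthSum; fun_prop
  exact this.measurable

theorem sum_vecMulVec_pow_four_le {a : Fin n → ℝ} {b : Fin d → ℝ} {A B : ℝ} (hA : ∑ i, a i ^ 4 ≤ A)
    (hB : vnorm b ≤ B) : ∑ i, ∑ j, vecMulVec a b i j ^ 4 ≤ d * (A * B ^ 4) := by
  have hb : ∀ j, b j ^ 4 ≤ B ^ 4 := fun j => by
    have h : b j ^ 4 = |b j| ^ 4 := by rw [pow_abs, abs_of_nonneg (by positivity)]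
    rw [h]; exact pow_le_pow_left₀ (abs_nonneg _) ((abs_apply_le_vnorm _ _).trans hB) 4
  calc ∑ i, ∑ j, vecMulVec a b i j ^ 4 = (∑ i, a i ^ 4) * ∑ j, b j ^ 4 := by
        rw [sum_mul_sum]
        refine sum_congr rfl fun i _ => sum_congr rfl fun j _ => ?_
        rw [vecMulVec_apply, mul_pow]
    _ ≤ A * ∑ _j : Fin d, B ^ 4 := mul_le_mul hA (sum_le_sum fun j _ => hb j)
        (sum_nonneg fun _ _ => by positivity) ((sum_nonneg fun _ _ => by positivity).trans hA)
    _ = _ := by simp; ring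

/-- One step, on the event that the test is passed, up to a small error in the direction of the fit. -/
structure UpdateBound (C₀ : ℝ) (p₀ : ℕ) (ε : ℝ) (U X : Mat n d) (Y : Draw n d → ℝ)
    (D : Mat d d) (X' : Draw n d → Mat n d) (η ζ : Draw n d → ℝ) :
    Prop where
  meas : Measurable X'
  norm_le : ‖D‖ ≤ C₀ / n
  fail : ∀ ξ ∉ passSet ε X, X' ξ = X
  pass : ∀ ξ ∈ passSet ε X, X' ξ = X +
    vecMulVec r[X, U, ξ] (D *ᵥ ŵ[X, U, ξ]) +
    vecMulVec (η ξ • r[X, U, ξ] + ζ ξ • (X *ᵥ ŵ[X, U, ξ]))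
      ŵ[X, U, ξ]
  along_le : ∀ ξ ∈ passSet ε X, |η ξ| ≤ C₀ / n ^ 2 * Y ξ ^ p₀
  fit_le : ∀ ξ ∈ passSet ε X, |ζ ξ| ≤ C₀ / n * Y ξ ^ p₀

set_option maxHeartbeats 1000000 in
theorem UpdateBound.fourthSum_le {C₀ : ℝ} {p₀ : ℕ} {D : Mat d d}
    {X' : Draw n d → Mat n d} {η ζ : Draw n d → ℝ} (hn : 1 ≤ n)
    (hE : Envelope α σ ε U X Y) (hX' : UpdateBound C₀ p₀ ε U X Y D X' η ζ) (ξ : Draw n d) :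
    fourthSum (X' ξ) ≤ (1 + 7 / n) * fourthSum X +
      4 * cubicForm X D ((passSet ε X).indicator
        (fun ξ => vecMulVec r[X, U, ξ] ŵ[X, U, ξ]) ξ) +
      (58 * (8 * d * C₀ ^ 4 * (1 + d) + 8 * d * C₀ ^ 4 * (8 + 9 * d))) * (fourthSum X / n + 1 / n ^ 2) *
        Y ξ ^ (4 * p₀ + 8) := by
  have hn' : (1 : ℝ) ≤ n := by exact_mod_cast hn
  have hn0 : (0 : ℝ) < n := by linarith
  set h := fourthSum X with hh
  have hh0 : 0 ≤ h := fourthSum_nonneg X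
  have hY := hE.one_le ξ
  have hY0 : 0 ≤ Y ξ := by linarith
  by_cases hξ : ξ ∈ passSet ε X
  swap
  · rw [hX'.fail ξ hξ, indicator_of_notMem hξ, map_zero, ← hh]
    have h1 : 0 ≤ 7 / (n : ℝ) * h := by positivity
    have h2 : 0 ≤ (58 * (8 * d * C₀ ^ 4 * (1 + d) + 8 * d * C₀ ^ 4 * (8 + 9 * d))) * (h / n + 1 / n ^ 2) *
        Y ξ ^ (4 * p₀ + 8) := by positivity
    linarith
  rw [hX'.pass ξ hξ, indicator_of_mem hξ]
  set w := ŵ[X, U, ξ]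
  set r := r[X, U, ξ]
  set R := 8 * (n * Y ξ + d * h * Y ξ ^ 4) with hR
  have hr4 : ∑ i, r i ^ 4 ≤ R := hE.sum_resid_pow_four_le hξ
  have hf4 : ∑ i, (X *ᵥ w) i ^ 4 ≤ d * h * Y ξ ^ 4 := hE.sum_fit_pow_four_le hξ
  have hwY : vnorm w ≤ Y ξ := hE.coeff_le ξ hξ
  have hC0 : 0 ≤ C₀ / n := (norm_nonneg _).trans hX'.norm_le
  have hDw : vnorm (D *ᵥ w) ≤ C₀ / n * Y ξ :=
    (vnorm_mulVec_le _ _).trans (mul_le_mul hX'.norm_le hwY (vnorm_nonneg _) hC0)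
  have hδ : ∑ i, ∑ j, vecMulVec r (D *ᵥ w) i j ^ 4 ≤ d * (R * (C₀ / n * Y ξ) ^ 4) :=
    sum_vecMulVec_pow_four_le hr4 hDw
  have he4 : ∑ i, (η ξ • r + ζ ξ • (X *ᵥ w)) i ^ 4 ≤
      8 * ((C₀ / n ^ 2 * Y ξ ^ p₀) ^ 4 * R + (C₀ / n * Y ξ ^ p₀) ^ 4 * (d * h * Y ξ ^ 4)) := by
    have pow4 : ∀ x y : ℝ, |x| ≤ y → x ^ 4 ≤ y ^ 4 := fun x y hxy => by
      have : x ^ 4 = |x| ^ 4 := by rw [pow_abs, abs_of_nonneg (by positivity)]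
      rw [this]; exact pow_le_pow_left₀ (abs_nonneg _) hxy 4
    have h1 := pow4 _ _ (hX'.along_le ξ hξ)
    have h2 := pow4 _ _ (hX'.fit_le ξ hξ)
    calc ∑ i, (η ξ • r + ζ ξ • (X *ᵥ w)) i ^ 4 ≤
          ∑ i, 8 * (η ξ ^ 4 * r i ^ 4 + ζ ξ ^ 4 * (X *ᵥ w) i ^ 4) := sum_le_sum fun i _ => by
            rw [← mul_pow, ← mul_pow]
            exact add_pow_four_le _ _
      _ = 8 * (η ξ ^ 4 * ∑ i, r i ^ 4 + ζ ξ ^ 4 * ∑ i, (X *ᵥ w) i ^ 4) := by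
          rw [← mul_sum, sum_add_distrib, mul_sum, mul_sum]
      _ ≤ _ := by
          refine mul_le_mul_of_nonneg_left (add_le_add ?_ ?_) (by norm_num)
          · exact mul_le_mul h1 hr4 (sum_nonneg fun _ _ => by positivity) (by positivity)
          · exact mul_le_mul h2 hf4 (sum_nonneg fun _ _ => by positivity) (by positivity)
  have he := sum_vecMulVec_pow_four_le he4 hwY
  have hsum : fourthSum (X + vecMulVec r (D *ᵥ w) +
      vecMulVec (η ξ • r + ζ ξ • (X *ᵥ w)) w) ≤ (1 + 7 / n) * h +
      4 * cubicForm X D (vecMulVec r w) +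
      58 * (n * ∑ i, ∑ j, vecMulVec r (D *ᵥ w) i j ^ 4 +
        n ^ 3 * ∑ i, ∑ j, vecMulVec (η ξ • r + ζ ξ • (X *ᵥ w)) w i j ^ 4) := by
    have hDt : vecMulVec r w * Dᵀ = vecMulVec r (D *ᵥ w) := by
      rw [vecMulVec_mul', transpose_transpose]
    rw [cubicForm_apply, hDt, fourthSum]
    calc _ ≤ ∑ i, ∑ j, ((1 + 7 / n) * X i j ^ 4 + 4 * (X i j ^ 3 * vecMulVec r (D *ᵥ w) i j) +
          58 * (n * vecMulVec r (D *ᵥ w) i j ^ 4 +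
            n ^ 3 * vecMulVec (η ξ • r + ζ ξ • (X *ᵥ w)) w i j ^ 4)) :=
          sum_le_sum fun i _ => sum_le_sum fun j _ => add_add_pow_four_le hn' _ _ _
      _ = _ := by
          rw [hh, fourthSum]
          simp only [sum_add_distrib, ← mul_sum]
  refine hsum.trans ?_
  rw [add_assoc, add_assoc]
  refine add_le_add le_rfl (add_le_add le_rfl ?_)
  have hYp : ∀ q, q ≤ 4 * p₀ + 8 → Y ξ ^ q ≤ Y ξ ^ (4 * p₀ + 8) := fun q hq => hE.pow_le_pow ξ hq
  set P := Y ξ ^ (4 * p₀ + 8) with hP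
  have hP0 : 0 ≤ P := by positivity
  have hninv : (1 : ℝ) / n ≤ 1 := by rw [div_le_one hn0]; exact hn'
  set u : ℝ := 1 / n with hu
  have hu0 : 0 < u := by positivity
  have hnu : (n : ℝ) = u⁻¹ := by rw [hu]; simp
  have hC4 : 0 ≤ C₀ ^ 4 := by positivity
  have b1 : (n : ℝ) * (d * (R * (C₀ / n * Y ξ) ^ 4)) ≤ 8 * d * C₀ ^ 4 * (1 + d) * (h / n + 1 / n ^ 2) * P := by
    have e1 : (n : ℝ) * (d * (R * (C₀ / n * Y ξ) ^ 4)) =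
        8 * d * C₀ ^ 4 * (u ^ 2 * Y ξ ^ 5 + d * (h * u ^ 3 * Y ξ ^ 8)) := by
      rw [hR, hnu]; field_simp
    have e2 : h / n + 1 / (n : ℝ) ^ 2 = h * u + u ^ 2 := by rw [hu]; ring
    rw [e1, e2]
    have h5 := hYp 5 (by omega)
    have h8 := hYp 8 (by omega)
    have c1 : u ^ 2 * Y ξ ^ 5 ≤ (h * u + u ^ 2) * P :=
      mul_le_mul (by linarith [show 0 ≤ h * u by positivity]) h5 (by positivity) (by positivity)
    have c2 : h * u ^ 3 * Y ξ ^ 8 ≤ (h * u + u ^ 2) * P := by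
      refine mul_le_mul ?_ h8 (by positivity) (by positivity)
      have : u ^ 3 ≤ u := pow_le_of_le_one hu0.le hninv (by norm_num)
      nlinarith [sq_nonneg u]
    have c3 : (d : ℝ) * (h * u ^ 3 * Y ξ ^ 8) ≤ d * ((h * u + u ^ 2) * P) :=
      mul_le_mul_of_nonneg_left c2 (Nat.cast_nonneg d)
    calc 8 * d * C₀ ^ 4 * (u ^ 2 * Y ξ ^ 5 + d * (h * u ^ 3 * Y ξ ^ 8))
        ≤ 8 * d * C₀ ^ 4 * ((h * u + u ^ 2) * P + d * ((h * u + u ^ 2) * P)) :=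
          mul_le_mul_of_nonneg_left (add_le_add c1 c3) (by positivity)
      _ = _ := by ring
  have b2 : (n : ℝ) ^ 3 * (d * (8 * ((C₀ / n ^ 2 * Y ξ ^ p₀) ^ 4 * R +
      (C₀ / n * Y ξ ^ p₀) ^ 4 * (d * h * Y ξ ^ 4)) * Y ξ ^ 4)) ≤
      8 * d * C₀ ^ 4 * (8 + 9 * d) * (h / n + 1 / n ^ 2) * P := by
    have e1 : (n : ℝ) ^ 3 * (d * (8 * ((C₀ / n ^ 2 * Y ξ ^ p₀) ^ 4 * R +
        (C₀ / n * Y ξ ^ p₀) ^ 4 * (d * h * Y ξ ^ 4)) * Y ξ ^ 4)) =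
        8 * d * C₀ ^ 4 * (8 * (u ^ 4 * Y ξ ^ (4 * p₀ + 5)) + 8 * d * (h * u ^ 5 * Y ξ ^ (4 * p₀ + 8)) +
          d * (h * u * Y ξ ^ (4 * p₀ + 8))) := by
      have y5 : Y ξ ^ (4 * p₀ + 5) = (Y ξ ^ p₀) ^ 4 * Y ξ ^ 5 := by rw [pow_add, ← pow_mul, mul_comm 4]
      have y8 : Y ξ ^ (4 * p₀ + 8) = (Y ξ ^ p₀) ^ 4 * Y ξ ^ 8 := by rw [pow_add, ← pow_mul, mul_comm 4]
      rw [y5, y8, hR, hnu]; field_simp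
    have e2 : h / n + 1 / (n : ℝ) ^ 2 = h * u + u ^ 2 := by rw [hu]; ring
    rw [e1, e2]
    have h5 := hYp (4 * p₀ + 5) (by omega)
    have hhu : 0 ≤ h * u := by positivity
    have c1 : u ^ 4 * Y ξ ^ (4 * p₀ + 5) ≤ (h * u + u ^ 2) * P := by
      refine mul_le_mul ?_ h5 (by positivity) (by positivity)
      have : u ^ 4 ≤ u ^ 2 := pow_le_pow_of_le_one hu0.le hninv (by norm_num)
      linarith
    have c2 : h * u ^ 5 * P ≤ (h * u + u ^ 2) * P := by
      refine mul_le_mul_of_nonneg_right ?_ hP0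
      have : u ^ 5 ≤ u := pow_le_of_le_one hu0.le hninv (by norm_num)
      nlinarith [sq_nonneg u]
    have c3 : h * u * P ≤ (h * u + u ^ 2) * P :=
      mul_le_mul_of_nonneg_right (by linarith [sq_nonneg u]) hP0
    have hd : (0 : ℝ) ≤ d := Nat.cast_nonneg d
    have c2' := mul_le_mul_of_nonneg_left c2 (by positivity : (0 : ℝ) ≤ 8 * d)
    have c3' := mul_le_mul_of_nonneg_left c3 hd
    rw [← hP]
    calc _ ≤ 8 * d * C₀ ^ 4 * (8 * ((h * u + u ^ 2) * P) + 8 * d * ((h * u + u ^ 2) * P) +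
          d * ((h * u + u ^ 2) * P)) := mul_le_mul_of_nonneg_left (by linarith) (by positivity)
      _ = _ := by ring
  have a1 := mul_le_mul_of_nonneg_left hδ hn0.le
  have a2 := mul_le_mul_of_nonneg_left he (by positivity : (0 : ℝ) ≤ (n : ℝ) ^ 3)
  calc _ ≤ 58 * (8 * d * C₀ ^ 4 * (1 + d) * (h / n + 1 / n ^ 2) * P +
        8 * d * C₀ ^ 4 * (8 + 9 * d) * (h / n + 1 / n ^ 2) * P) :=
        mul_le_mul_of_nonneg_left (add_le_add (a1.trans b1) (a2.trans b2)) (by norm_num)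
    _ = _ := by ring

theorem exists_fourthSum_step (hν : IsNoiseLaw ν σ) (hκ : IsCoefLaw κ lam) (hα : α ∈ Ioo (0 : ℝ) 1)
    (M : ℕ → ℝ) (C₀ CU : ℝ) {CS : ℝ} (hCS : 0 ≤ CS) (p₀ : ℕ) :
    ∃ C : ℝ, 0 ≤ C ∧ ∀ {n : ℕ} {U X : Mat n d} {Y : Draw n d → ℝ}
      {D : Mat d d} {X' : Draw n d → Mat n d} {η ζ : Draw n d → ℝ},
      1 ≤ n → fourthSum U ≤ CU / n → 0 < ε → Envelope α σ ε U X Y → MomentBound M Y (drawLaw n κ ν α) →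
      StepMeans CS α σ ε lam U X (drawLaw n κ ν α) → UpdateBound C₀ p₀ ε U X Y D X' η ζ →
      Integrable (fun ξ => fourthSum (X' ξ)) (drawLaw n κ ν α) ∧
      ∫ ξ, fourthSum (X' ξ) ∂drawLaw n κ ν α ≤ (1 + C / n) * fourthSum X + C / n ^ 2 := by
  have := hν.isProb
  have := hκ.isProb
  have := isProbabilityMeasure_maskLaw hα
  set B : ℝ := 58 * (8 * d * C₀ ^ 4 * (1 + d) + 8 * d * C₀ ^ 4 * (8 + 9 * d))
  have hB0 : 0 ≤ B := by positivity
  set m := |M (4 * p₀ + 8)|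
  set L : ℝ := d ^ 3 * CS * |C₀| with hL
  have hL0 : 0 ≤ L := by positivity
  refine ⟨7 + 8 * L + 4 * L * |CU| + B * m, by positivity, ?_⟩
  intro n U X Y D X' η ζ hn hU hε hE hM hS hX'
  have hn' : (1 : ℝ) ≤ n := by exact_mod_cast hn
  have hn0 : (0 : ℝ) < n := by linarith
  set h := fourthSum X
  have hh0 : 0 ≤ h := fourthSum_nonneg X
  set f := (passSet ε X).indicator
    (fun ξ => vecMulVec r[X, U, ξ] ŵ[X, U, ξ])
  have hfi : Integrable f (drawLaw n κ ν α) := hE.integrable_indicator hM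
    (measurable_matrix_vecMulVec (measurable_resid_const U X) (measurable_coeff_const U X))
      (C := (2 + σ ^ 2) * n) (by positivity) 2 fun ξ hξ => by
        refine (norm_vecMulVec_le _ _).trans ?_
        have h1 := hE.vnorm_resid_sq_le hε hα hn hξ
        have h2 := hE.coeff_le ξ hξ
        have h3 := vnorm_nonneg r[X, U, ξ]
        have h4 := vnorm_nonneg ŵ[X, U, ξ]
        rw [div_le_iff₀ hn0] at h1
        have h5 : vnorm ŵ[X, U, ξ] ^ 2 ≤ Y ξ ^ 2 := pow_le_pow_left₀ h4 h2 2
        have h6 : Y ξ ^ 2 ≤ (2 + σ ^ 2) * n * Y ξ ^ 2 :=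
          le_mul_of_one_le_left (sq_nonneg _) (by nlinarith [sq_nonneg σ])
        nlinarith [sq_nonneg (vnorm r[X, U, ξ] - vnorm ŵ[X, U, ξ])]
  set q : ℝ := h / n + 1 / n ^ 2 with hq
  have hq0 : 0 ≤ q := by positivity
  have hpt : ∀ ξ, fourthSum (X' ξ) ≤ (1 + 7 / n) * h + 4 * cubicForm X D (f ξ) +
      (B * q) * |Y ξ| ^ (4 * p₀ + 8) := fun ξ => by
    rw [hE.abs_eq]; exact hX'.fourthSum_le hn hE ξ
  have i1 : Integrable (fun ξ => (1 + 7 / (n : ℝ)) * h + 4 * cubicForm X D (f ξ)) (drawLaw n κ ν α) :=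
    (integrable_const _).add (((cubicForm X D).integrable_comp hfi).const_mul 4)
  have i2 : Integrable (fun ξ => (B * q) * |Y ξ| ^ (4 * p₀ + 8)) (drawLaw n κ ν α) :=
    (hM.int _).const_mul _
  have hi : Integrable (fun ξ => fourthSum (X' ξ)) (drawLaw n κ ν α) :=
    (i1.add i2).mono' (measurable_fourthSum.comp hX'.meas).aestronglyMeasurable
      (ae_of_all _ fun ξ => by
        rw [norm_eq_abs, abs_of_nonneg (fourthSum_nonneg _)]; exact hpt ξ)
  refine ⟨hi, ?_⟩
  have hle : ∫ ξ, fourthSum (X' ξ) ∂drawLaw n κ ν α ≤ ∫ ξ, ((1 + 7 / (n : ℝ)) * h + 4 * cubicForm X D (f ξ)) +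
      (B * q) * |Y ξ| ^ (4 * p₀ + 8) ∂drawLaw n κ ν α := integral_mono hi (i1.add i2) hpt
  refine hle.trans ?_
  have hDn : ‖D‖ ≤ |C₀| / n := hX'.norm_le.trans (by gcongr; exact le_abs_self _)
  have hcub : cubicForm X D (∫ ξ, f ξ ∂drawLaw n κ ν α) ≤ L / n * (2 * h + |CU| / n) := by
    refine (cubicForm_le hCS fun i j => hS.resid_le i j).trans ?_
    have hU' : fourthSum U ≤ |CU| / n := hU.trans (by gcongr; exact le_abs_self _)
    have hU0 := fourthSum_nonneg U
    calc d ^ 3 * CS * ‖D‖ * (2 * h + fourthSum U) ≤ d ^ 3 * CS * (|C₀| / n) * (2 * h + |CU| / n) := by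
          gcongr
      _ = _ := by rw [hL]; ring
  rw [integral_add i1 i2, integral_add (integrable_const _) (((cubicForm X D).integrable_comp hfi).const_mul 4),
    integral_const_mul, integral_const_mul, ContinuousLinearMap.integral_comp_comm _ hfi]
  have hMm : B * q * ∫ ξ, |Y ξ| ^ (4 * p₀ + 8) ∂drawLaw n κ ν α ≤ B * q * m :=
    mul_le_mul_of_nonneg_left ((hM.le _).trans (le_abs_self _)) (by positivity)
  rw [← integral_const_mul] at hMm
  have e : (1 + (7 + 8 * L + 4 * L * |CU| + B * m) / n) * h + (7 + 8 * L + 4 * L * |CU| + B * m) / n ^ 2 =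
      ((1 + 7 / n) * h + 4 * (L / n * (2 * h + |CU| / n)) + B * q * m) +
        (4 * L * |CU| / n * h + (7 + 8 * L) / n ^ 2) := by rw [hq]; ring
  have p1 : 0 ≤ 4 * L * |CU| / n * h + (7 + 8 * L) / n ^ 2 := by positivity
  rw [e]
  simp only [integral_const, probReal_univ, one_smul]
  linarith

end FourthSum

/-! ### One step of Oja's method and of GROUSE -/

section Scalar

theorem abs_sin_sub_self_le {x : ℝ} (hx : 0 ≤ x) : |sin x - x| ≤ x ^ 3 := by
  have h1 := Real.sin_le hx
  have h2 := Real.sin_ge_sub_cube hx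
  have h3 : 0 ≤ x ^ 3 := by positivity
  rw [abs_le]
  constructor <;> linarith

theorem abs_cos_sub_le {x : ℝ} : |cos x - 1 + x ^ 2 / 2| ≤ 3 * x ^ 4 := by
  have h1 := Real.one_sub_sq_div_two_le_cos (x := x)
  rw [abs_of_nonneg (by linarith)]
  by_cases hx : |x| ≤ 1
  · have h2 := (abs_le.1 (Real.cos_bound hx)).2
    have h3 : |x| ^ 4 = x ^ 4 := by rw [pow_abs, abs_of_nonneg (by positivity)]
    rw [h3] at h2
    have h4 : 0 ≤ x ^ 4 := by positivity
    linarith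
  · have h2 := Real.cos_le_one x
    have h3 : 1 ≤ x ^ 2 := by
      rw [not_le] at hx
      nlinarith [sq_abs x]
    nlinarith

/-- The step sizes along the residual and along the fit after orthonormalization. -/
theorem normalized_step_bounds {h b R N s : ℝ} (hh : 0 ≤ h) (hR : 0 ≤ R)
    (hs : s = 2 * h + h ^ 2 * (R + b ^ 2)) (hN : N = √(1 + s * b ^ 2)) :
    |h / N - h| ≤ h * (s * b ^ 2) ∧
    |h / N - s / (N * (1 + N)) + h ^ 2 * R / 2| ≤ h ^ 2 * R * (s * b ^ 2) := by
  have hs0 : 0 ≤ s := by rw [hs]; positivity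
  have hN2 : N ^ 2 = 1 + s * b ^ 2 := by rw [hN, sq_sqrt (by positivity)]
  have hN1 : 1 ≤ N := by
    rw [hN, one_le_sqrt]; linarith [mul_nonneg hs0 (sq_nonneg b)]
  have hN0 : 0 < N := by linarith
  have hNs : N - 1 ≤ s * b ^ 2 := by nlinarith
  have hN' : 1 - N⁻¹ ≤ N - 1 := by
    have : 1 - N⁻¹ = (N - 1) / N := by field_simp
    rw [this]; exact div_le_self (by linarith) hN1
  have hNi : N⁻¹ ≤ 1 := inv_le_one_of_one_le₀ hN1
  constructor
  · have e : h / N - h = -(h * (1 - N⁻¹)) := by ring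
    rw [e, abs_neg, abs_of_nonneg (mul_nonneg hh (by linarith))]
    exact mul_le_mul_of_nonneg_left (hN'.trans hNs) hh
  · set m := 1 + h * b ^ 2 with hm
    have hm1 : 1 ≤ m := by rw [hm]; linarith [mul_nonneg hh (sq_nonneg b)]
    have hmN : m ≤ N := by
      refine (sq_le_sq₀ (by linarith) hN0.le).1 ?_
      rw [hN2, hs, hm]
      nlinarith [mul_nonneg (mul_nonneg (sq_nonneg h) hR) (sq_nonneg b)]
    have e : h / N - s / (N * (1 + N)) + h ^ 2 * R / 2 =
        h ^ 2 * R * ((N ^ 2 + N * m - 2) / (2 * N * (N + m))) := by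
      have hNm : N + m ≠ 0 := by positivity
      have hN1' : 1 + N ≠ 0 := by positivity
      have key : (h * (1 + N) - s) * (N + m) = -(h ^ 2 * R) * (1 + N) := by
        have k1 : N ^ 2 = m ^ 2 + h ^ 2 * R * b ^ 2 := by rw [hN2, hs, hm]; ring
        have k2 : h * (1 + N) - s = h * (N - m) - h ^ 2 * R := by rw [hs, hm]; ring
        rw [k2]
        have k3 : h * (N - m) * (N + m) = h * (h ^ 2 * R * b ^ 2) := by
          have : (N - m) * (N + m) = h ^ 2 * R * b ^ 2 := by linear_combination k1
          rw [mul_assoc, this]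
        have k4 : h * (h ^ 2 * R * b ^ 2) = h ^ 2 * R * (m - 1) := by rw [hm]; ring
        linear_combination k3 + k4
      have e1 : h / N - s / (N * (1 + N)) = -(h ^ 2 * R) / (N * (N + m)) := by
        rw [div_sub_div _ _ hN0.ne' (by positivity), div_eq_div_iff (by positivity) (by positivity)]
        linear_combination N ^ 2 * key
      rw [e1]
      field_simp
      ring
    have hden : (0 : ℝ) < 2 * N * (N + m) := by positivity
    have hnum : 0 ≤ N ^ 2 + N * m - 2 := by nlinarith
    rw [e, abs_of_nonneg (mul_nonneg (by positivity) (div_nonneg hnum hden.le))]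
    refine mul_le_mul_of_nonneg_left ?_ (by positivity)
    rw [div_le_iff₀ hden]
    have h4 : 2 ≤ 2 * N * (N + m) := by nlinarith
    have h5 : N ^ 2 + N * m - 2 ≤ 2 * (s * b ^ 2) := by nlinarith
    nlinarith [mul_nonneg hs0 (sq_nonneg b)]

theorem geodesic_step_bounds {h b R θ : ℝ} (hh : 0 ≤ h) (hR : 0 ≤ R) (hb : 0 ≤ b) (hθ : θ = h * R * b) :
    |(if R * b = 0 then h else sin θ / (R * b)) - h| ≤ h * (h ^ 2 * R ^ 2 * b ^ 2) ∧
    |(if b = 0 then -(h ^ 2 * R ^ 2 / 2) else (cos θ - 1) / b ^ 2) + h ^ 2 * R ^ 2 / 2| ≤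
      3 * ((h ^ 2 * R ^ 2) ^ 2 * b ^ 2) := by
  have hθ0 : 0 ≤ θ := by rw [hθ]; positivity
  constructor
  · split_ifs with h0
    · rw [sub_self, abs_zero]; positivity
    · have hp : 0 < R * b := lt_of_le_of_ne (by positivity) (Ne.symm h0)
      have e : sin θ / (R * b) - h = (sin θ - θ) / (R * b) := by
        rw [sub_div, hθ, mul_assoc, mul_div_cancel_right₀ _ h0]
      rw [e, abs_div, abs_of_pos hp, div_le_iff₀ hp]
      refine (abs_sin_sub_self_le hθ0).trans_eq ?_
      rw [hθ]; ring
  · split_ifs with h0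
    · rw [neg_add_cancel, abs_zero]; positivity
    · have hp : 0 < b ^ 2 := by positivity
      have e : (cos θ - 1) / b ^ 2 + h ^ 2 * R ^ 2 / 2 = (cos θ - 1 + θ ^ 2 / 2) / b ^ 2 := by
        rw [hθ]; field_simp
      rw [e, abs_div, abs_of_pos hp, div_le_iff₀ hp]
      refine abs_cos_sub_le.trans_eq ?_
      rw [hθ]; ring

end Scalar

section Tangent
variable {n d : ℕ} {α σ ε τ : ℝ} {U X : Mat n d} {Y : Draw n d → ℝ}

/-- One step that moves `X` along the residual by approximately `τ / n` and keeps it orthonormal. -/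
structure TangentStep (C₀ : ℝ) (p₀ : ℕ) (ε τ : ℝ) (U X : Mat n d) (Y : Draw n d → ℝ)
    (X' : Draw n d → Mat n d) (η ζ : Draw n d → ℝ) : Prop where
  fail : ∀ ξ ∉ passSet ε X, X' ξ = X
  pass : ∀ ξ ∈ passSet ε X, X' ξ = X +
    vecMulVec (η ξ • r[X, U, ξ] + ζ ξ • (X *ᵥ ŵ[X, U, ξ]))
      ŵ[X, U, ξ]
  along_le : ∀ ξ ∈ passSet ε X, |η ξ - τ / n| ≤ C₀ / n ^ 2 * Y ξ ^ p₀
  fit_le : ∀ ξ ∈ passSet ε X, |ζ ξ + (τ / n) ^ 2 * vnorm r[X, U, ξ] ^ 2 / 2| ≤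
    C₀ / n ^ 2 * Y ξ ^ p₀

theorem vnorm_mulVec_of_orthonormal (hX : Xᵀ * X = 1) (w : Fin d → ℝ) : vnorm (X *ᵥ w) = vnorm w := by
  rw [← sq_eq_sq₀ (vnorm_nonneg _) (vnorm_nonneg _), vnorm_sq, vnorm_sq, dotProduct_mulVec_transpose,
    mulVec_mulVec, hX, one_mulVec]

theorem gram_add_vecMulVec (hX : Xᵀ * X = 1) {r : Fin n → ℝ} (hr : Xᵀ *ᵥ r = 0) (η ζ : ℝ) (w : Fin d → ℝ) :
    (X + vecMulVec (η • r + ζ • (X *ᵥ w)) w)ᵀ * (X + vecMulVec (η • r + ζ • (X *ᵥ w)) w) =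
      1 + (2 * ζ + η ^ 2 * vnorm r ^ 2 + ζ ^ 2 * vnorm w ^ 2) • vecMulVec w w := by
  set a := η • r + ζ • (X *ᵥ w) with ha
  have h1 : Xᵀ *ᵥ a = ζ • w := by
    rw [ha, mulVec_add, mulVec_smul, mulVec_smul, hr, mulVec_mulVec, hX,
      one_mulVec, smul_zero, zero_add]
  have h2 : r ⬝ᵥ (X *ᵥ w) = 0 := by rw [dotProduct_mulVec_transpose, hr, zero_dotProduct]
  have h3 : a ⬝ᵥ a = η ^ 2 * vnorm r ^ 2 + ζ ^ 2 * vnorm w ^ 2 := by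
    rw [ha, add_dotProduct, dotProduct_add, dotProduct_add, smul_dotProduct, smul_dotProduct, smul_dotProduct,
      smul_dotProduct, dotProduct_smul, dotProduct_smul, dotProduct_smul, dotProduct_smul,
      dotProduct_comm (X *ᵥ w) r, h2, ← vnorm_sq, ← vnorm_sq, vnorm_mulVec_of_orthonormal hX]
    simp only [smul_eq_mul]; ring
  rw [transpose_add, transpose_vecMulVec, madd_mul, mmul_add, mmul_add, hX,
    mul_vecMulVec', h1, vecMulVec_mul_vecMulVec', h3, vecMulVec_mul', h1, smul_vecMulVec,
    vecMulVec_smul]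
  module

theorem ojaStep_eq_of_enough (hε : 0 < ε) (hτ : 0 ≤ τ) (hX : Xᵀ * X = 1) {ξ : Draw n d}
    (h : Enough ε X ξ.2.2) {s N : ℝ}
    (hs : s = 2 * (τ / n) + (τ / n) ^ 2 * (vnorm r[X, U, ξ] ^ 2 +
      vnorm ŵ[X, U, ξ] ^ 2))
    (hN : N = √(1 + s * vnorm ŵ[X, U, ξ] ^ 2)) :
    ojaStep ε τ X (observe U ξ) = X + vecMulVec ((τ / n / N) • r[X, U, ξ] +
      (τ / n / N - s / (N * (1 + N))) • (X *ᵥ ŵ[X, U, ξ])) ŵ[X, U, ξ] ∧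
    (ojaStep ε τ X (observe U ξ))ᵀ * ojaStep ε τ X (observe U ξ) = 1 := by
  have h' : Enough ε X (observe U ξ).2 := h
  have hr := transpose_mulVec_resid_observe (U := U) hε h
  have hy : (observe U ξ).1 + (1 - mask (observe U ξ).2) *ᵥ (X *ᵥ ŵ[X, U, ξ]) =
      r[X, U, ξ] + X *ᵥ ŵ[X, U, ξ] := by
    rw [resid, sub_mulVec, one_mulVec]; abel
  rw [ojaStep, if_pos h']
  simp only [hy]
  generalize ŵ[X, U, ξ] = w at *
  generalize r[X, U, ξ] = r at *
  have hh : 0 ≤ τ / n := div_nonneg hτ (Nat.cast_nonneg n)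
  generalize τ / (n : ℝ) = q at *
  have hs0 : 0 ≤ s := by rw [hs]; positivity
  have hXt : X + q • vecMulVec (r + X *ᵥ w) w =
      X + vecMulVec (q • r + q • (X *ᵥ w)) w := by
    rw [← smul_add, smul_vecMulVec]
  have hg := gram_add_vecMulVec hX hr q q w
  have hcoef : 2 * q + q ^ 2 * vnorm r ^ 2 + q ^ 2 * vnorm w ^ 2 = s := by rw [hs]; ring
  rw [hcoef] at hg
  rw [hXt, hg]
  have hpd := posDef_one_add_vecMulVec w hs0
  constructor
  · have hN1 : 1 ≤ N := by
      rw [hN, one_le_sqrt]; linarith [mul_nonneg hs0 (sq_nonneg (vnorm w))]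
    have hN0 : 0 < N := by linarith
    have hN2 : N ^ 2 = 1 + s * vnorm w ^ 2 := by rw [hN, sq_sqrt (by positivity)]
    rw [invSqrt_one_add_vecMulVec w hs0, ← hN]
    set φ := s / (N * (1 + N)) with hφ
    have e1 : q * (1 - φ * vnorm w ^ 2) = q / N := by
      have : φ * vnorm w ^ 2 = 1 - N⁻¹ := by
        rw [hφ]; field_simp; linear_combination -hN2
      rw [this]; ring
    rw [mmul_sub, mmul_one, mmul_smul, madd_mul, mul_vecMulVec',
      vecMulVec_mul_vecMulVec', ← vnorm_sq, ← e1]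
    simp only [add_vecMulVec, smul_vecMulVec]
    module
  · rw [transpose_mul, transpose_invSqrt, mmul_assoc, ← mmul_assoc _ _ (invSqrt _), hg,
      ← mmul_assoc]
    exact invSqrt_mul_mul_invSqrt hpd

theorem grouseStep_eq_of_enough (hX : Xᵀ * X = 1) {ξ : Draw n d} (h : Enough ε X ξ.2.2) {θ : ℝ}
    (hθ : θ = τ / n * vnorm r[X, U, ξ] * vnorm ŵ[X, U, ξ]) :
    grouseStep ε τ X (observe U ξ) = X + vecMulVec
      ((sin θ / (vnorm r[X, U, ξ] * vnorm ŵ[X, U, ξ])) •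
          r[X, U, ξ] +
        ((cos θ - 1) / vnorm ŵ[X, U, ξ] ^ 2) • (X *ᵥ ŵ[X, U, ξ]))
      ŵ[X, U, ξ] := by
  have h' : Enough ε X (observe U ξ).2 := h
  have hr : (observe U ξ).1 - mask (observe U ξ).2 *ᵥ (X *ᵥ ŵ[X, U, ξ]) =
      r[X, U, ξ] := rfl
  rw [grouseStep, if_pos h']
  simp only [hr, vnorm_mulVec_of_orthonormal hX, ← hθ]
  generalize ŵ[X, U, ξ] = w at *
  generalize r[X, U, ξ] = r at *
  have e1 : (vnorm w)⁻¹ * ((cos θ - 1) / vnorm w) = (cos θ - 1) / vnorm w ^ 2 := by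
    rw [div_eq_mul_inv, div_eq_mul_inv, ← inv_pow]; ring
  have e2 : (vnorm w)⁻¹ * (sin θ / vnorm r) = sin θ / (vnorm r * vnorm w) := by
    rw [div_eq_mul_inv, div_eq_mul_inv, mul_inv]; ring
  rw [vecMulVec_smul, ← smul_vecMulVec, smul_add, smul_smul, smul_smul, e1, e2,
    add_comm (((cos θ - 1) / vnorm w ^ 2) • (X *ᵥ w))]

theorem transpose_grouseStep_mul_self (hε : 0 < ε) (hX : Xᵀ * X = 1) (ξ : Draw n d) :
    (grouseStep ε τ X (observe U ξ))ᵀ * grouseStep ε τ X (observe U ξ) = 1 := by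
  by_cases h : Enough ε X ξ.2.2
  · have hr := transpose_mulVec_resid_observe (U := U) hε h
    rw [grouseStep_eq_of_enough hX h rfl, gram_add_vecMulVec hX hr]
    generalize ŵ[X, U, ξ] = w at *
    generalize r[X, U, ξ] = r at *
    by_cases hw : vnorm w = 0
    · rw [vnorm_eq_zero.1 hw]; simp
    · by_cases hr0 : vnorm r = 0
      · rw [hr0]; simp
      · generalize τ / n * vnorm r * vnorm w = θ
        have e : 2 * ((cos θ - 1) / vnorm w ^ 2) +
            (sin θ / (vnorm r * vnorm w)) ^ 2 * vnorm r ^ 2 +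
            ((cos θ - 1) / vnorm w ^ 2) ^ 2 * vnorm w ^ 2 = 0 := by
          field_simp
          linear_combination Real.sin_sq_add_cos_sq θ
        rw [e, zero_smul, add_zero]
  · have h' : ¬ Enough ε X (observe U ξ).2 := h
    rw [grouseStep, if_neg h', hX]

theorem transpose_ojaStep_mul_self (hε : 0 < ε) (hτ : 0 ≤ τ) (hX : Xᵀ * X = 1) (ξ : Draw n d) :
    (ojaStep ε τ X (observe U ξ))ᵀ * ojaStep ε τ X (observe U ξ) = 1 := by
  by_cases h : Enough ε X ξ.2.2
  · exact (ojaStep_eq_of_enough hε hτ hX h rfl rfl).2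
  · have h' : ¬ Enough ε X (observe U ξ).2 := h
    rw [ojaStep, if_neg h', hX]

theorem exists_tangentStep_ojaStep (hε : 0 < ε) (hα : α ∈ Ioo (0 : ℝ) 1) (hn : 1 ≤ n) {B : ℝ}
    (hτ : 0 ≤ τ) (hτB : τ ≤ B) (hX : Xᵀ * X = 1) (hE : Envelope α σ ε U X Y) :
    ∃ η ζ, TangentStep ((1 + B) ^ 4 * (3 + σ ^ 2) ^ 2 * 4) 8 ε τ U X Y
      (fun ξ => ojaStep ε τ X (observe U ξ)) η ζ := by
  set s : Draw n d → ℝ := fun ξ => 2 * (τ / n) + (τ / n) ^ 2 * (vnorm r[X, U, ξ] ^ 2 +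
    vnorm ŵ[X, U, ξ] ^ 2) with hs
  set N : Draw n d → ℝ := fun ξ => √(1 + s ξ * vnorm ŵ[X, U, ξ] ^ 2)
  have hB : 0 ≤ B := hτ.trans hτB
  have hn' : (1 : ℝ) ≤ n := by exact_mod_cast hn
  have hn0 : (0 : ℝ) < n := by linarith
  set K : ℝ := (1 + B) ^ 2 * (3 + σ ^ 2) with hK
  have hb : ∀ ξ ∈ passSet ε X, s ξ * vnorm ŵ[X, U, ξ] ^ 2 ≤ 2 * K / n * Y ξ ^ 4 ∧
      (τ / n) ^ 2 * vnorm r[X, U, ξ] ^ 2 ≤ K / n * Y ξ ^ 2 := fun ξ hξ => by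
    have hR := hE.vnorm_resid_sq_le hε hα hn hξ
    have hw := hE.coeff_le ξ hξ
    have hY := hE.one_le ξ
    have hw2 : vnorm ŵ[X, U, ξ] ^ 2 ≤ Y ξ ^ 2 := pow_le_pow_left₀ (vnorm_nonneg _) hw 2
    rw [hs]
    simp only
    generalize vnorm r[X, U, ξ] = R at *
    generalize vnorm ŵ[X, U, ξ] = b at *
    generalize Y ξ = y at *
    have hy2 : 1 ≤ y ^ 2 := by nlinarith
    have hτn : τ / n ≤ B / n := div_le_div_of_nonneg_right hτB hn0.le
    have hτn0 : 0 ≤ τ / n := by positivity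
    have hR' : R ^ 2 / n ≤ (2 + σ ^ 2) * y ^ 2 := hR
    have hb' : b ^ 2 / n ≤ y ^ 2 := (div_le_self (sq_nonneg b) hn').trans hw2
    have e1 : (τ / n) ^ 2 * R ^ 2 = τ ^ 2 / n * (R ^ 2 / n) := by field_simp
    have e2 : (τ / n) ^ 2 * (R ^ 2 + b ^ 2) = τ ^ 2 / n * (R ^ 2 / n + b ^ 2 / n) := by field_simp
    have hτ2 : τ ^ 2 / n ≤ (1 + B) ^ 2 / n :=
      div_le_div_of_nonneg_right (pow_le_pow_left₀ hτ (by linarith) 2) hn0.le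
    have hτ20 : 0 ≤ τ ^ 2 / n := by positivity
    have g1 : τ ^ 2 / n * (R ^ 2 / n + b ^ 2 / n) ≤ (1 + B) ^ 2 / n * ((3 + σ ^ 2) * y ^ 2) :=
      mul_le_mul hτ2 (by linarith) (by positivity) (by positivity)
    have g2 : (τ / n) ^ 2 * R ^ 2 ≤ K / n * y ^ 2 := by
      rw [e1]
      calc τ ^ 2 / n * (R ^ 2 / n) ≤ τ ^ 2 / n * (R ^ 2 / n + b ^ 2 / n) :=
            mul_le_mul_of_nonneg_left (by linarith [show 0 ≤ b ^ 2 / (n : ℝ) by positivity]) hτ20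
        _ ≤ _ := g1
        _ = _ := by rw [hK]; ring
    refine ⟨?_, g2⟩
    have g3 : 2 * (τ / n) ≤ K / n * y ^ 2 := by
      have k1 : 2 * τ ≤ K := by
        have : 2 * τ ≤ (1 + B) ^ 2 * 3 := by nlinarith
        nlinarith [mul_nonneg (sq_nonneg (1 + B)) (sq_nonneg σ)]
      calc 2 * (τ / n) = 2 * τ / n * 1 := by ring
        _ ≤ K / n * y ^ 2 := mul_le_mul (div_le_div_of_nonneg_right k1 hn0.le) hy2 (by norm_num)
            (by positivity)
    calc (2 * (τ / n) + (τ / n) ^ 2 * (R ^ 2 + b ^ 2)) * b ^ 2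
        ≤ (K / n * y ^ 2 + K / n * y ^ 2) * y ^ 2 := by
          refine mul_le_mul (add_le_add g3 ?_) hw2 (sq_nonneg _) (by positivity)
          rw [e2]; exact g1.trans_eq (by rw [hK]; ring)
      _ = _ := by ring
  refine ⟨fun ξ => τ / n / N ξ, fun ξ => τ / n / N ξ - s ξ / (N ξ * (1 + N ξ)), ?_, ?_, ?_, ?_⟩
  · intro ξ hξ
    have h' : ¬ Enough ε X (observe U ξ).2 := hξ
    rw [ojaStep, if_neg h']
  · exact fun ξ hξ => (ojaStep_eq_of_enough hε hτ hX hξ rfl rfl).1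
  · intro ξ hξ
    have h0 : 0 ≤ τ / n := by positivity
    obtain ⟨h1, -⟩ := normalized_step_bounds h0 (sq_nonneg (vnorm r[X, U, ξ]))
      (b := vnorm ŵ[X, U, ξ]) (s := s ξ) (N := N ξ) rfl rfl
    refine h1.trans ?_
    have h2 := (hb ξ hξ).1
    have hY := hE.one_le ξ
    have h3 : τ / n ≤ (1 + B) / n := div_le_div_of_nonneg_right (by linarith) hn0.le
    have h4 : Y ξ ^ 4 ≤ Y ξ ^ 8 := hE.pow_le_pow ξ (by norm_num)
    have hY4 : 0 ≤ Y ξ ^ 4 := by positivity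
    have hs0 : 0 ≤ s ξ * vnorm ŵ[X, U, ξ] ^ 2 := by simp only [hs]; positivity
    have hK0 : 0 ≤ K := by positivity
    calc τ / n * (s ξ * vnorm ŵ[X, U, ξ] ^ 2)
        ≤ (1 + B) / n * (2 * K / n * Y ξ ^ 8) :=
          mul_le_mul h3 (h2.trans (mul_le_mul_of_nonneg_left h4 (by positivity))) hs0 (by positivity)
      _ = (2 * (1 + B) * K) / n ^ 2 * Y ξ ^ 8 := by field_simp
      _ ≤ _ := by
        refine mul_le_mul_of_nonneg_right (div_le_div_of_nonneg_right ?_ (by positivity)) (by positivity)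
        have k1 : 1 ≤ 1 + B := by linarith
        have k2 : (1 + B) ^ 3 ≤ (1 + B) ^ 4 := pow_le_pow_right₀ k1 (by norm_num)
        have k3 : 3 + σ ^ 2 ≤ (3 + σ ^ 2) ^ 2 := by nlinarith [sq_nonneg σ]
        calc 2 * (1 + B) * K = 2 * ((1 + B) ^ 3 * (3 + σ ^ 2)) := by rw [hK]; ring
          _ ≤ 2 * ((1 + B) ^ 4 * (3 + σ ^ 2) ^ 2) :=
            mul_le_mul_of_nonneg_left (mul_le_mul k2 k3 (by positivity) (by positivity)) (by norm_num)
          _ ≤ _ := by nlinarith [show 0 ≤ (1 + B) ^ 4 * (3 + σ ^ 2) ^ 2 by positivity]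
  · intro ξ hξ
    have h0 : 0 ≤ τ / n := by positivity
    obtain ⟨-, h1⟩ := normalized_step_bounds h0 (sq_nonneg (vnorm r[X, U, ξ]))
      (b := vnorm ŵ[X, U, ξ]) (s := s ξ) (N := N ξ) rfl rfl
    refine h1.trans ?_
    obtain ⟨h2, h3⟩ := hb ξ hξ
    have hY := hE.one_le ξ
    have hs0 : 0 ≤ s ξ * vnorm ŵ[X, U, ξ] ^ 2 := by simp only [hs]; positivity
    have h4 : Y ξ ^ 6 ≤ Y ξ ^ 8 := hE.pow_le_pow ξ (by norm_num)
    have hK0 : 0 ≤ K := by positivity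
    calc _ ≤ K / n * Y ξ ^ 2 * (2 * K / n * Y ξ ^ 4) := mul_le_mul h3 h2 hs0 (by positivity)
      _ = 2 * K ^ 2 / n ^ 2 * Y ξ ^ 6 := by field_simp
      _ ≤ 2 * K ^ 2 / n ^ 2 * Y ξ ^ 8 := mul_le_mul_of_nonneg_left h4 (by positivity)
      _ ≤ _ := by
        refine mul_le_mul_of_nonneg_right (div_le_div_of_nonneg_right ?_ (by positivity)) (by positivity)
        rw [hK]
        nlinarith [show 0 ≤ (1 + B) ^ 4 * (3 + σ ^ 2) ^ 2 by positivity]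

theorem exists_tangentStep_grouseStep (hε : 0 < ε) (hα : α ∈ Ioo (0 : ℝ) 1) (hn : 1 ≤ n) {B : ℝ}
    (hτ : 0 ≤ τ) (hτB : τ ≤ B) (hX : Xᵀ * X = 1) (hE : Envelope α σ ε U X Y) :
    ∃ η ζ, TangentStep ((1 + B) ^ 4 * (3 + σ ^ 2) ^ 2 * 4) 8 ε τ U X Y
      (fun ξ => grouseStep ε τ X (observe U ξ)) η ζ := by
  have hB : 0 ≤ B := hτ.trans hτB
  have hn' : (1 : ℝ) ≤ n := by exact_mod_cast hn
  have hn0 : (0 : ℝ) < n := by linarith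
  set r : Draw n d → Fin n → ℝ := fun ξ => r[X, U, ξ]
  set w : Draw n d → Fin d → ℝ := fun ξ => ŵ[X, U, ξ]
  set θ : Draw n d → ℝ := fun ξ => τ / n * vnorm (r ξ) * vnorm (w ξ)
  refine ⟨fun ξ => if vnorm (r ξ) * vnorm (w ξ) = 0 then τ / n else
      sin (θ ξ) / (vnorm (r ξ) * vnorm (w ξ)),
    fun ξ => if vnorm (w ξ) = 0 then -((τ / n) ^ 2 * vnorm (r ξ) ^ 2 / 2) else
      (cos (θ ξ) - 1) / vnorm (w ξ) ^ 2, ?_, ?_, ?_, ?_⟩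
  · intro ξ hξ
    have h' : ¬ Enough ε X (observe U ξ).2 := hξ
    rw [grouseStep, if_neg h']
  · intro ξ hξ
    rw [grouseStep_eq_of_enough hX hξ (θ := θ ξ) rfl]
    change X + vecMulVec ((sin (θ ξ) / (vnorm (r ξ) * vnorm (w ξ))) • r ξ +
      ((cos (θ ξ) - 1) / vnorm (w ξ) ^ 2) • (X *ᵥ w ξ)) (w ξ) = X + vecMulVec
        ((if vnorm (r ξ) * vnorm (w ξ) = 0 then τ / n else
          sin (θ ξ) / (vnorm (r ξ) * vnorm (w ξ))) • r ξ +
        (if vnorm (w ξ) = 0 then -((τ / n) ^ 2 * vnorm (r ξ) ^ 2 / 2) else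
          (cos (θ ξ) - 1) / vnorm (w ξ) ^ 2) • (X *ᵥ w ξ)) (w ξ)
    by_cases h1 : vnorm (w ξ) = 0
    · have z : ∀ a : Fin n → ℝ, vecMulVec a (0 : Fin d → ℝ) = 0 := fun a => by
        ext i j; simp [vecMulVec_apply]
      rw [vnorm_eq_zero.1 h1, z, z]
    · by_cases h2 : vnorm (r ξ) = 0
      · rw [vnorm_eq_zero.1 h2]; simp [h1]
      · simp [h1, h2]
  all_goals
    intro ξ hξ
    have hR : vnorm (r ξ) ^ 2 / n ≤ (2 + σ ^ 2) * Y ξ ^ 2 := hE.vnorm_resid_sq_le hε hα hn hξ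
    have hw' : vnorm (w ξ) ≤ Y ξ := hE.coeff_le ξ hξ
    have hY := hE.one_le ξ
    have hr0 := vnorm_nonneg (r ξ)
    have hw0 := vnorm_nonneg (w ξ)
    have h0 : 0 ≤ τ / n := by positivity
    have hτB' : τ ≤ 1 + B := by linarith
    have hτn : τ / n ≤ (1 + B) / n := div_le_div_of_nonneg_right hτB' hn0.le
    have hw2 : vnorm (w ξ) ^ 2 ≤ Y ξ ^ 2 := pow_le_pow_left₀ hw0 hw' 2
    have hE2 : (τ / n) ^ 2 * vnorm (r ξ) ^ 2 ≤ (1 + B) ^ 2 * (3 + σ ^ 2) / n * Y ξ ^ 2 := by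
      have e1 : (τ / n) ^ 2 * vnorm (r ξ) ^ 2 = τ ^ 2 / n * (vnorm (r ξ) ^ 2 / n) := by field_simp
      rw [e1]
      calc τ ^ 2 / n * (vnorm (r ξ) ^ 2 / n) ≤ (1 + B) ^ 2 / n * ((3 + σ ^ 2) * Y ξ ^ 2) := by
            refine mul_le_mul (div_le_div_of_nonneg_right (pow_le_pow_left₀ hτ hτB' 2) hn0.le)
              (hR.trans ?_) (by positivity) (by positivity)
            exact mul_le_mul_of_nonneg_right (by linarith) (sq_nonneg _)
        _ = _ := by ring
  · refine (geodesic_step_bounds h0 hr0 hw0 (θ := θ ξ) rfl).1.trans ?_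
    have h4 : Y ξ ^ 4 ≤ Y ξ ^ 8 := hE.pow_le_pow ξ (by norm_num)
    calc _ ≤ (1 + B) / n * ((1 + B) ^ 2 * (3 + σ ^ 2) / n * Y ξ ^ 2 * Y ξ ^ 2) :=
          mul_le_mul hτn (mul_le_mul hE2 hw2 (sq_nonneg _) (by positivity)) (by positivity) (by positivity)
      _ = (1 + B) ^ 3 * (3 + σ ^ 2) / n ^ 2 * Y ξ ^ 4 := by field_simp
      _ ≤ (1 + B) ^ 3 * (3 + σ ^ 2) / n ^ 2 * Y ξ ^ 8 := mul_le_mul_of_nonneg_left h4 (by positivity)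
      _ ≤ _ := by
        refine mul_le_mul_of_nonneg_right (div_le_div_of_nonneg_right ?_ (by positivity)) (by positivity)
        have k1 : 1 ≤ 1 + B := by linarith
        have k2 : (1 + B) ^ 3 ≤ (1 + B) ^ 4 := pow_le_pow_right₀ k1 (by norm_num)
        have k3 : 3 + σ ^ 2 ≤ (3 + σ ^ 2) ^ 2 := by nlinarith [sq_nonneg σ]
        refine (mul_le_mul k2 k3 (by positivity) (by positivity)).trans ?_
        linarith [show 0 ≤ (1 + B) ^ 4 * (3 + σ ^ 2) ^ 2 by positivity]
  · refine (geodesic_step_bounds h0 hr0 hw0 (θ := θ ξ) rfl).2.trans ?_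
    have h4 : Y ξ ^ 6 ≤ Y ξ ^ 8 := hE.pow_le_pow ξ (by norm_num)
    calc _ ≤ 3 * (((1 + B) ^ 2 * (3 + σ ^ 2) / n * Y ξ ^ 2) ^ 2 * Y ξ ^ 2) :=
          mul_le_mul_of_nonneg_left (mul_le_mul (pow_le_pow_left₀ (by positivity) hE2 2) hw2
            (sq_nonneg _) (by positivity)) (by norm_num)
      _ = 3 * ((1 + B) ^ 4 * (3 + σ ^ 2) ^ 2) / n ^ 2 * Y ξ ^ 6 := by field_simp
      _ ≤ 3 * ((1 + B) ^ 4 * (3 + σ ^ 2) ^ 2) / n ^ 2 * Y ξ ^ 8 :=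
        mul_le_mul_of_nonneg_left h4 (by positivity)
      _ ≤ _ := by
        refine mul_le_mul_of_nonneg_right (div_le_div_of_nonneg_right ?_ (by positivity)) (by positivity)
        linarith [show 0 ≤ (1 + B) ^ 4 * (3 + σ ^ 2) ^ 2 by positivity]

end Tangent

/-! ### Drift of the orthonormalized methods -/

section OrthonormalDrift
variable {n d : ℕ} {κ : Measure (Fin d → ℝ)} {ν : Measure ℝ} {α σ ε τ : ℝ} {lam : Fin d → ℝ}
  {U X : Mat n d} {Y : Draw n d → ℝ} {M : ℕ → ℝ}

/-- The part of the drift that is linear in the step size. -/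
noncomputable def driftLin (α : ℝ) (lam : Fin d → ℝ) (Q : Mat d d) :
    Mat d d := (α • lamSq lam) * Q - Q * Qᵀ * (α • lamSq lam) * Q

/-- The part of the drift that is quadratic in the step size. -/
noncomputable def driftQuad (α σ : ℝ) (lam : Fin d → ℝ) (Q : Mat d d) :
    Mat d d := (σ ^ 4 / 2) • Q + (σ ^ 2 / 2) • (Q * Qᵀ * (α • lamSq lam) * Q)

theorem drift_smul_one (α σ : ℝ) (lam : Fin d → ℝ) (Q : Mat d d) (t : ℝ) :
    drift α σ lam Q (t • (1 : Mat d d)) =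
      t • driftLin α lam Q - t ^ 2 • driftQuad α σ lam Q := by
  rw [drift, driftLin, driftQuad]
  simp only [mmul_smul, mmul_one, mmul_add, madd_mul, msmul_mul]
  module

theorem regMat_of_orthonormal (U : Mat n d) (hX : Xᵀ * X = 1) : regMat U X = Uᵀ * X := by
  rw [regMat, hX, inv_one, mmul_one]

theorem crossLimit_of_orthonormal (U : Mat n d) (hX : Xᵀ * X = 1) :
    crossLimit α lam U X = driftLin α lam (Uᵀ * X) := by
  rw [crossLimit, regMat_of_orthonormal U hX, driftLin]
  simp only [msub_mul, mone_mul, msmul_mul, mmul_smul, smul_sub, mmul_assoc]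

theorem mul_coefLimit_of_orthonormal (hα : α ≠ 0) (U : Mat n d) (hX : Xᵀ * X = 1) :
    (1 / 2 : ℝ) • (Uᵀ * X * ((α * σ ^ 2) • coefLimit α σ lam U X)) = driftQuad α σ lam (Uᵀ * X) := by
  rw [coefLimit, regMat_of_orthonormal U hX, driftQuad, hX, inv_one]
  generalize Uᵀ * X = Q
  simp only [mmul_smul, msmul_mul, mmul_add, smul_add, smul_smul, mmul_one,
    mmul_assoc]
  rw [add_comm]
  congr 2
  · field_simp
  · ring

theorem TangentStep.updateBound {C₀ B : ℝ} {X' : Draw n d → Mat n d} {η ζ : Draw n d → ℝ}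
    (hn : 1 ≤ n) (hC₀ : 0 ≤ C₀) (hε : 0 < ε) (hα : α ∈ Ioo (0 : ℝ) 1) (hτ : 0 ≤ τ) (hτB : τ ≤ B)
    (hE : Envelope α σ ε U X Y) (hm : Measurable X') (h : TangentStep C₀ 8 ε τ U X Y X' η ζ) :
    UpdateBound (C₀ + B + B ^ 2 * (2 + σ ^ 2)) 8 ε U X Y ((τ / n) • (1 : Mat d d)) X'
      (fun ξ => η ξ - τ / n) ζ := by
  have hn' : (1 : ℝ) ≤ n := by exact_mod_cast hn
  have hn0 : (0 : ℝ) < n := by linarith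
  have hB : 0 ≤ B := hτ.trans hτB
  have hB2 : 0 ≤ B ^ 2 * (2 + σ ^ 2) := by positivity
  refine ⟨hm, ?_, h.fail, fun ξ hξ => ?_, fun ξ hξ => ?_, fun ξ hξ => ?_⟩
  · rw [norm_smul, norm_eq_abs, abs_of_nonneg (by positivity)]
    refine (mul_le_of_le_one_right (by positivity) norm_one_le_one).trans ?_
    exact div_le_div_of_nonneg_right (by linarith) hn0.le
  · rw [h.pass ξ hξ]
    simp only [smul_mulVec, one_mulVec, vecMulVec_smul, add_vecMulVec,
      smul_vecMulVec]
    module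
  · have hY := hE.one_le ξ
    refine (h.along_le ξ hξ).trans (mul_le_mul_of_nonneg_right
      (div_le_div_of_nonneg_right (by linarith) (by positivity)) (by positivity))
  · have hY := hE.one_le ξ
    have hR := hE.vnorm_resid_sq_le hε hα hn hξ
    have h1 := h.fit_le ξ hξ
    have h2 : Y ξ ^ 2 ≤ Y ξ ^ 8 := hE.pow_le_pow ξ (by norm_num)
    have h3 : (τ / n) ^ 2 * vnorm r[X, U, ξ] ^ 2 / 2 ≤ B ^ 2 * (2 + σ ^ 2) / n * Y ξ ^ 8 := by
      have e1 : (τ / n) ^ 2 * vnorm r[X, U, ξ] ^ 2 / 2 =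
          τ ^ 2 / 2 / n * (vnorm r[X, U, ξ] ^ 2 / n) := by field_simp
      rw [e1]
      calc _ ≤ B ^ 2 / n * ((2 + σ ^ 2) * Y ξ ^ 8) := by
            refine mul_le_mul (div_le_div_of_nonneg_right ?_ hn0.le)
              (hR.trans (mul_le_mul_of_nonneg_left h2 (by positivity))) (by positivity) (by positivity)
            have := pow_le_pow_left₀ hτ hτB 2
            linarith [sq_nonneg τ]
        _ = _ := by ring
    have h0 : 0 ≤ (τ / n) ^ 2 * vnorm r[X, U, ξ] ^ 2 / 2 := by positivity
    have h4 : C₀ / n ^ 2 * Y ξ ^ 8 ≤ C₀ / n * Y ξ ^ 8 := by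
      refine mul_le_mul_of_nonneg_right (div_le_div_of_nonneg_left hC₀ hn0 ?_) (by positivity)
      nlinarith
    have h5 : |ζ ξ| ≤ C₀ / n * Y ξ ^ 8 + B ^ 2 * (2 + σ ^ 2) / n * Y ξ ^ 8 := by
      rw [abs_le] at h1 ⊢
      constructor <;> linarith [h1.1, h1.2]
    refine h5.trans ?_
    rw [← add_mul, ← add_div]
    refine mul_le_mul_of_nonneg_right (div_le_div_of_nonneg_right (by linarith) hn0.le) (by positivity)

theorem one_div_sq_le {n : ℕ} (hn : 1 ≤ n) {h : ℝ} (hh : 0 ≤ h) :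
    1 / (n : ℝ) ^ 2 ≤ 1 / n * √(h + 1 / n) := by
  have hn' : (1 : ℝ) ≤ n := by exact_mod_cast hn
  have hn0 : (0 : ℝ) < n := by linarith
  have h1 : 1 / (n : ℝ) ≤ √(h + 1 / n) := by
    refine le_sqrt_of_sq_le ?_
    have : (1 / (n : ℝ)) ^ 2 ≤ 1 / n := by
      rw [div_pow, one_pow]
      exact one_div_le_one_div_of_le hn0 (by nlinarith)
    linarith
  calc 1 / (n : ℝ) ^ 2 = 1 / n * (1 / n) := by ring
    _ ≤ _ := mul_le_mul_of_nonneg_left h1 (by positivity)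

theorem vecMulVec_resid_coeff_le (hE : Envelope α σ ε U X Y) (hε : 0 < ε) (hU : Uᵀ * U = 1)
    {ξ : Draw n d} (hξ : ξ ∈ passSet ε X) :
    ‖vecMulVec (Uᵀ *ᵥ r[X, U, ξ]) ŵ[X, U, ξ]‖ ≤ 2 * Y ξ ^ 2 := by
  refine (norm_vecMulVec_le _ _).trans ?_
  have h1 := hE.vnorm_transpose_mulVec_resid_le hε hU hξ
  have h2 := hE.coeff_le ξ hξ
  have hY := hE.one_le ξ
  calc _ ≤ (2 * Y ξ) * Y ξ := mul_le_mul h1 h2 (vnorm_nonneg _) (by positivity)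
    _ = _ := by ring

theorem vecMulVec_coeff_coeff_le (hE : Envelope α σ ε U X Y) {ξ : Draw n d} (hξ : ξ ∈ passSet ε X) :
    ‖vecMulVec ŵ[X, U, ξ] ŵ[X, U, ξ]‖ ≤ Y ξ ^ 2 := by
  refine (norm_vecMulVec_le _ _).trans ?_
  have h2 := hE.coeff_le ξ hξ
  rw [pow_two]
  exact mul_le_mul h2 h2 (vnorm_nonneg _) ((vnorm_nonneg _).trans h2)

theorem energy_smul_le (hE : Envelope α σ ε U X Y) (hε : 0 < ε) (hα : α ∈ Ioo (0 : ℝ) 1) (hn : 1 ≤ n)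
    {ξ : Draw n d} (hξ : ξ ∈ passSet ε X) :
    ‖(vnorm r[X, U, ξ] ^ 2 / n) •
      vecMulVec ŵ[X, U, ξ] ŵ[X, U, ξ]‖ ≤ (2 + σ ^ 2) * Y ξ ^ 4 := by
  have hR := hE.vnorm_resid_sq_le hε hα hn hξ
  have h1 := vecMulVec_coeff_coeff_le hE hξ
  rw [norm_smul, norm_eq_abs, abs_of_nonneg (by positivity)]
  calc _ ≤ ((2 + σ ^ 2) * Y ξ ^ 2) * Y ξ ^ 2 := mul_le_mul hR h1 (norm_nonneg _) (by positivity)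
    _ = _ := by ring

set_option maxHeartbeats 1000000 in
theorem exists_orthonormal_driftBounds (hν : IsNoiseLaw ν σ) (hκ : IsCoefLaw κ lam)
    (hα : α ∈ Ioo (0 : ℝ) 1) (hε : 0 < ε) (hεα : ε < α) (CU : ℝ) {B C₀ : ℝ} (hB : 0 ≤ B) (hC₀ : 0 ≤ C₀) :
    ∃ C : ℝ, 0 ≤ C ∧ ∀ {n : ℕ} {U X : Mat n d} {τ : ℝ}
      {φ : Mat n d → Draw n d → Mat n d}
      {f : Mat d d → Mat d d}, 1 ≤ n → Uᵀ * U = 1 →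
      fourthSum U ≤ CU / n → Xᵀ * X = 1 → 0 ≤ τ → τ ≤ B → Measurable (φ X) →
      (∀ Y, Envelope α σ ε U X Y → ∃ η ζ, TangentStep C₀ 8 ε τ U X Y (φ X) η ζ) →
      f (Uᵀ * X) = drift α σ lam (Uᵀ * X) (τ • (1 : Mat d d)) →
      DriftBounds C n (drawLaw n κ ν α) (fun X => Uᵀ * X) fourthSum φ f X := by
  have := hν.isProb
  have := hκ.isProb
  have := isProbabilityMeasure_maskLaw hα
  obtain ⟨M, hM⟩ := exists_envelope hν hκ hα hε CU
  obtain ⟨CS, hCS, hstep⟩ := exists_stepMeans hν hκ hα hε (c := 1) one_pos (by linarith) M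
  set C₁ := C₀ + B + B ^ 2 * (2 + σ ^ 2)
  obtain ⟨CF, hCF, hfour⟩ := exists_fourthSum_step (ε := ε) hν hκ hα M C₁ CU hCS 8
  set A : ℝ := 2 * B + B ^ 2 * (2 + σ ^ 2) + 3 * C₀ with hA
  have hA0 : 0 ≤ A := by positivity
  set D : ℝ := B * CS + B ^ 2 * CS + 3 * C₀ * |M 10| with hD
  have hD0 : 0 ≤ D := by positivity
  refine ⟨A ^ 2 * |M 20| + D ^ 2 + CF, by positivity, ?_⟩
  intro n U X τ φ f hn hU hUf hX hτ hτB hφ htan hf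
  obtain ⟨Y, hE, hYM⟩ := hM hn hU hUf X
  obtain ⟨η, ζ, ht⟩ := htan Y hE
  have hS := hstep hn hU (by rw [atLeast_iff, hX, one_smul, sub_self]; exact Matrix.PosSemidef.zero) hE hYM
  have hupd := ht.updateBound hn hC₀ hε hα hτ hτB hE hφ
  obtain ⟨hi, hle⟩ := hfour hn hUf hε hE hYM hS hupd
  have hn' : (1 : ℝ) ≤ n := by exact_mod_cast hn
  have hn0 : (0 : ℝ) < n := by linarith
  set μ := drawLaw n κ ν α
  set Q := Uᵀ * X with hQ
  have hQ1 : ‖Q‖ ≤ 1 := by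
    refine (norm_mul_le_mul _ _).trans ?_
    rw [norm_transpose]
    exact mul_le_one₀ (norm_le_one_of_isometry hU) (norm_nonneg _) (norm_le_one_of_isometry hX)
  have hh0 := fourthSum_nonneg X
  have hwm := measurable_coeff_const U X
  have hrm := measurable_resid_const U X
  set Dl : Draw n d → Mat d d := fun ξ => Uᵀ * φ X ξ - Q with hDl
  have hDm : Measurable Dl := (measurable_matrix_mul measurable_const hφ).sub_const _
  set fc : Draw n d → Mat d d := (passSet ε X).indicator
    (fun ξ => vecMulVec (Uᵀ *ᵥ r[X, U, ξ]) ŵ[X, U, ξ]) with hfc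
  set fe : Draw n d → Mat d d := (passSet ε X).indicator
    (fun ξ => (vnorm r[X, U, ξ] ^ 2 / n) •
      vecMulVec ŵ[X, U, ξ] ŵ[X, U, ξ]) with hfe
  have hfci : Integrable fc μ := hE.integrable_indicator hYM
    (measurable_matrix_vecMulVec (measurable_matrix_mulVec measurable_const hrm) hwm) (by norm_num) 2
    fun ξ hξ => vecMulVec_resid_coeff_le hE hε hU hξ
  have hfei : Integrable fe μ := hE.integrable_indicator hYM
    ((((measurable_vnorm.comp hrm).pow_const 2).div_const _).smul (measurable_matrix_vecMulVec hwm hwm))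
    (by positivity) 4 fun ξ hξ => energy_smul_le hE hε hα hn hξ
  set e : Draw n d → Mat d d :=
    fun ξ => Dl ξ - ((τ / n) • fc ξ - (τ ^ 2 / (2 * n)) • (Q * fe ξ)) with he
  have hele : ∀ ξ, ‖e ξ‖ ≤ 3 * C₀ / n ^ 2 * |Y ξ| ^ 10 := fun ξ => by
    rw [hE.abs_eq]
    have hY := hE.one_le ξ
    by_cases hξ : ξ ∈ passSet ε X
    · have e1 : e ξ = (η ξ - τ / n) •
          vecMulVec (Uᵀ *ᵥ r[X, U, ξ]) ŵ[X, U, ξ] +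
          (ζ ξ + (τ / n) ^ 2 * vnorm r[X, U, ξ] ^ 2 / 2) •
            (Q * vecMulVec ŵ[X, U, ξ] ŵ[X, U, ξ]) := by
        simp only [he, hDl, hfc, hfe]
        rw [ht.pass ξ hξ, indicator_of_mem hξ, indicator_of_mem hξ, mmul_add, mul_vecMulVec',
          mulVec_add, mulVec_smul, mulVec_smul, mulVec_mulVec, ← hQ,
          add_vecMulVec, smul_vecMulVec, smul_vecMulVec, ← mul_vecMulVec' Q,
          mmul_smul, smul_smul]
        have e2 : τ ^ 2 / (2 * n) * (vnorm r[X, U, ξ] ^ 2 / n) =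
          (τ / n) ^ 2 * vnorm r[X, U, ξ] ^ 2 / 2 := by field_simp
        rw [e2]
        module
      rw [e1]
      have h1 := ht.along_le ξ hξ
      have h2 := ht.fit_le ξ hξ
      have h3 := vecMulVec_resid_coeff_le hE hε hU hξ
      have h4 : ‖Q * vecMulVec ŵ[X, U, ξ] ŵ[X, U, ξ]‖ ≤ Y ξ ^ 2 :=
        (norm_mul_le_mul _ _).trans ((mul_le_of_le_one_left (norm_nonneg _) hQ1).trans
          (vecMulVec_coeff_coeff_le hE hξ))
      refine (norm_add_le _ _).trans ?_
      rw [norm_smul, norm_smul, norm_eq_abs, norm_eq_abs]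
      calc _ ≤ C₀ / n ^ 2 * Y ξ ^ 8 * (2 * Y ξ ^ 2) + C₀ / n ^ 2 * Y ξ ^ 8 * Y ξ ^ 2 :=
            add_le_add (mul_le_mul h1 h3 (norm_nonneg _) (by positivity))
              (mul_le_mul h2 h4 (norm_nonneg _) (by positivity))
        _ = _ := by ring
    · have e1 : e ξ = 0 := by
        simp only [he, hDl, hfc, hfe]
        rw [ht.fail ξ hξ, indicator_of_notMem hξ, indicator_of_notMem hξ]
        simp [hQ]
      rw [e1, norm_zero]; positivity
  have hDle : ∀ ξ, ‖Dl ξ‖ ≤ A / n * |Y ξ| ^ 10 := fun ξ => by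
    have hY := hE.one_le ξ
    have h1 := hele ξ
    rw [hE.abs_eq] at h1 ⊢
    have h2 : ‖fc ξ‖ ≤ 2 * Y ξ ^ 10 := by
      rw [hfc]
      by_cases hξ : ξ ∈ passSet ε X
      · rw [indicator_of_mem hξ]
        exact (vecMulVec_resid_coeff_le hE hε hU hξ).trans
          (mul_le_mul_of_nonneg_left (hE.pow_le_pow ξ (by norm_num)) (by norm_num))
      · rw [indicator_of_notMem hξ, norm_zero]; positivity
    have h3 : ‖Q * fe ξ‖ ≤ (2 + σ ^ 2) * Y ξ ^ 10 := by
      refine (norm_mul_le_mul _ _).trans ((mul_le_of_le_one_left (norm_nonneg _) hQ1).trans ?_)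
      rw [hfe]
      by_cases hξ : ξ ∈ passSet ε X
      · rw [indicator_of_mem hξ]
        exact (energy_smul_le hE hε hα hn hξ).trans
          (mul_le_mul_of_nonneg_left (hE.pow_le_pow ξ (by norm_num)) (by positivity))
      · rw [indicator_of_notMem hξ, norm_zero]; positivity
    have e1 : Dl ξ = e ξ + ((τ / n) • fc ξ - (τ ^ 2 / (2 * n)) • (Q * fe ξ)) := by
      simp only [he]; abel
    have h4 : ‖(τ / n) • fc ξ‖ ≤ B / n * (2 * Y ξ ^ 10) := by
      rw [norm_smul, norm_eq_abs, abs_of_nonneg (by positivity)]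
      exact mul_le_mul (div_le_div_of_nonneg_right hτB hn0.le) h2 (norm_nonneg _) (by positivity)
    have h5 : ‖(τ ^ 2 / (2 * n)) • (Q * fe ξ)‖ ≤ B ^ 2 / n * ((2 + σ ^ 2) * Y ξ ^ 10) := by
      rw [norm_smul, norm_eq_abs, abs_of_nonneg (by positivity)]
      refine mul_le_mul ?_ h3 (norm_nonneg _) (by positivity)
      exact div_le_div₀ (by positivity) (pow_le_pow_left₀ hτ hτB 2) hn0 (by linarith)
    have h6 : 3 * C₀ / (n : ℝ) ^ 2 * Y ξ ^ 10 ≤ 3 * C₀ / n * Y ξ ^ 10 := by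
      refine mul_le_mul_of_nonneg_right (div_le_div_of_nonneg_left (by positivity) hn0 ?_) (by positivity)
      nlinarith
    rw [e1]
    refine (norm_add_le _ _).trans ((add_le_add (h1.trans h6)
      ((norm_sub_le _ _).trans (add_le_add h4 h5))).trans_eq ?_)
    rw [hA]; ring
  have hDi : Integrable Dl μ := hYM.integrable_of_le hDm.aestronglyMeasurable hDle
  have hQfe : Integrable (fun ξ => Q * fe ξ) μ := hfei.const_mul Q
  have i1 : Integrable (fun ξ => (τ / n) • fc ξ) μ := hfci.smul (τ / n)
  have i2 : Integrable (fun ξ => (τ ^ 2 / (2 * n)) • (Q * fe ξ)) μ := hQfe.smul (τ ^ 2 / (2 * n))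
  have i3 : Integrable (fun ξ => (τ / n) • fc ξ - (τ ^ 2 / (2 * n)) • (Q * fe ξ)) μ := i1.sub i2
  have hei : Integrable e μ := hDi.sub i3
  have hsq : ∀ ξ, ‖Dl ξ‖ ^ 2 ≤ A ^ 2 / n ^ 2 * |Y ξ| ^ 20 := fun ξ => by
    calc ‖Dl ξ‖ ^ 2 ≤ (A / n * |Y ξ| ^ 10) ^ 2 := pow_le_pow_left₀ (norm_nonneg _) (hDle ξ) 2
      _ = _ := by ring
  have hsqi : Integrable (fun ξ => ‖Dl ξ‖ ^ 2) μ :=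
    hYM.integrable_of_le (hDm.norm.pow_const 2).aestronglyMeasurable fun ξ => by
      rw [norm_eq_abs, abs_of_nonneg (sq_nonneg _)]; exact hsq ξ
  refine ⟨hsqi, ?_, ?_, hi, ?_⟩
  · refine (hYM.integral_le (by positivity) hsqi hsq).trans ?_
    have h1 : A ^ 2 / (n : ℝ) ^ 2 * M 20 ≤ (A ^ 2 * |M 20| + D ^ 2 + CF) / n ^ 2 := by
      rw [div_mul_eq_mul_div]
      refine div_le_div_of_nonneg_right ?_ (by positivity)
      have := mul_le_mul_of_nonneg_left (le_abs_self (M 20)) (sq_nonneg A)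
      linarith [sq_nonneg D]
    refine h1.trans (le_mul_of_one_le_right (by positivity) ?_)
    linarith [sq_nonneg ‖Q‖]
  · have hmean : ∫ ξ, Dl ξ ∂μ - (1 / (n : ℝ)) • f Q =
        (τ / n) • (∫ ξ, fc ξ ∂μ - crossLimit α lam U X) -
          (τ ^ 2 / (2 * n)) • (Q * (∫ ξ, fe ξ ∂μ - (α * σ ^ 2) • coefLimit α σ lam U X)) +
          ∫ ξ, e ξ ∂μ := by
      have e1 : ∫ ξ, e ξ ∂μ = ∫ ξ, Dl ξ ∂μ -
          ((τ / n) • ∫ ξ, fc ξ ∂μ - (τ ^ 2 / (2 * n)) • (Q * ∫ ξ, fe ξ ∂μ)) := by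
        rw [he, integral_sub hDi i3, integral_sub i1 i2, integral_smul, integral_smul,
          integral_const_mul_of_integrable hfei]
      rw [e1, hf, drift_smul_one, crossLimit_of_orthonormal U hX, mmul_sub,
        ← mul_coefLimit_of_orthonormal hα.1.ne' U hX]
      module
    have hs0 := sqrt_nonneg (fourthSum X + 1 / n)
    have b1 : ‖(τ / n) • (∫ ξ, fc ξ ∂μ - crossLimit α lam U X)‖ ≤
        B / n * (CS * √(fourthSum X + 1 / n)) := by
      rw [norm_smul, norm_eq_abs, abs_of_nonneg (by positivity)]
      exact mul_le_mul (div_le_div_of_nonneg_right hτB hn0.le) hS.cross_le (norm_nonneg _) (by positivity)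
    have b2 : ‖(τ ^ 2 / (2 * n)) • (Q * (∫ ξ, fe ξ ∂μ - (α * σ ^ 2) • coefLimit α σ lam U X))‖ ≤
        B ^ 2 / n * (CS * √(fourthSum X + 1 / n)) := by
      rw [norm_smul, norm_eq_abs, abs_of_nonneg (by positivity)]
      refine mul_le_mul (div_le_div₀ (by positivity) (pow_le_pow_left₀ hτ hτB 2) hn0 (by linarith)) ?_
        (norm_nonneg _) (by positivity)
      exact (norm_mul_le_mul _ _).trans ((mul_le_of_le_one_left (norm_nonneg _) hQ1).trans hS.energy_le)
    have b3 : ‖∫ ξ, e ξ ∂μ‖ ≤ 3 * C₀ * |M 10| * (1 / n * √(fourthSum X + 1 / n)) := by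
      refine (hYM.norm_integral_le (by positivity) hei hele).trans ?_
      calc 3 * C₀ / (n : ℝ) ^ 2 * M 10 ≤ 3 * C₀ / n ^ 2 * |M 10| :=
            mul_le_mul_of_nonneg_left (le_abs_self _) (by positivity)
        _ = 3 * C₀ * |M 10| * (1 / n ^ 2) := by ring
        _ ≤ _ := mul_le_mul_of_nonneg_left (one_div_sq_le hn hh0) (by positivity)
    have hb : ‖∫ ξ, Dl ξ ∂μ - (1 / (n : ℝ)) • f Q‖ ≤ D / n * √(fourthSum X + 1 / n) := by
      rw [hmean]
      refine (norm_add_le _ _).trans ((add_le_add ((norm_sub_le _ _).trans (add_le_add b1 b2)) b3).trans_eq ?_)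
      rw [hD]; ring
    have hsqrt : √(fourthSum X + 1 / (n : ℝ)) ^ 2 = fourthSum X + 1 / n := sq_sqrt (by positivity)
    calc _ ≤ (D / n * √(fourthSum X + 1 / n)) ^ 2 := pow_le_pow_left₀ (norm_nonneg _) hb 2
      _ = D ^ 2 / n ^ 2 * (fourthSum X + 1 / n) := by rw [mul_pow, hsqrt]; ring
      _ ≤ _ := by
        refine mul_le_mul (div_le_div_of_nonneg_right ?_ (by positivity)) ?_ (by positivity) (by positivity)
        · linarith [show 0 ≤ A ^ 2 * |M 20| by positivity]
        · have : 0 ≤ ‖Q‖ ^ 2 * min 1 (fourthSum X) := mul_nonneg (sq_nonneg _) (le_min zero_le_one hh0)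
          linarith
  · have hCC : CF ≤ A ^ 2 * |M 20| + D ^ 2 + CF := by
      linarith [sq_nonneg D, show 0 ≤ A ^ 2 * |M 20| by positivity]
    refine hle.trans (add_le_add (mul_le_mul_of_nonneg_right (add_le_add le_rfl ?_) hh0) ?_)
    · exact div_le_div_of_nonneg_right hCC hn0.le
    · exact div_le_div_of_nonneg_right hCC (by positivity)

end OrthonormalDrift

/-! ### Convergence of the orthonormalized methods -/

section General

theorem exists_lipschitz_extension_of_lipschitzOnWith {E F : Type*} [NormedAddCommGroup E]
    [NormedAddCommGroup F] [NormedSpace ℝ F] [FiniteDimensional ℝ F] {f : E → F} {s : Set E} {K : NNReal}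
    (hf : LipschitzOnWith K f s) :
    ∃ L : ℝ, 0 ≤ L ∧ ∃ g : E → F, (∀ x y, ‖g x - g y‖ ≤ L * ‖x - y‖) ∧ EqOn g f s := by
  obtain ⟨g, hg, hfg⟩ := hf.extend_finite_dimension
  exact ⟨_, NNReal.coe_nonneg _, g, fun x y => by simpa only [dist_eq_norm] using hg.dist_le_mul x y,
    hfg.symm⟩

theorem exists_lipschitz_extension {E : Type*} [NormedAddCommGroup E] [NormedSpace ℝ E]
    [FiniteDimensional ℝ E] {f : E → E} (hf : ContDiff ℝ 1 f) (R : ℝ) :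
    ∃ L : ℝ, 0 ≤ L ∧ ∃ g : E → E, (∀ x y, ‖g x - g y‖ ≤ L * ‖x - y‖) ∧ ∀ x, ‖x‖ ≤ R → g x = f x := by
  have := FiniteDimensional.proper_real E
  obtain ⟨K, hK⟩ := (hf.locallyLipschitz.locallyLipschitzOn
    (s := Metric.closedBall 0 R)).exists_lipschitzOnWith_of_compact (isCompact_closedBall 0 R)
  obtain ⟨L, hL, g, hg, hgf⟩ := exists_lipschitz_extension_of_lipschitzOnWith hK
  exact ⟨L, hL, g, hg, fun x hx => hgf (by simpa using hx)⟩

theorem intervalIntegrable_stepSize {E : Type*} [NormedAddCommGroup E] [NormedSpace ℝ E] {τ : ℝ → ℝ}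
    {T B : ℝ} (hT : 0 ≤ T) (hB : ∀ t, 0 ≤ t → |τ t| ≤ B) (hbv : LocallyBoundedVariationOn τ (Ici 0))
    {a b : ℝ → E} (ha : ContinuousOn a (Icc 0 T)) (hb : ContinuousOn b (Icc 0 T)) :
    IntervalIntegrable (fun s => τ s • a s - τ s ^ 2 • b s) volume 0 T := by
  obtain ⟨p, q, hp, hq, hpq⟩ := hbv.exists_monotoneOn_sub_monotoneOn
  have hsub : uIcc 0 T ⊆ Ici 0 := by rw [uIcc_of_le hT]; exact Icc_subset_Ici_self
  have hτ : IntervalIntegrable τ volume 0 T := by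
    rw [hpq]
    exact ((hp.mono hsub).intervalIntegrable).sub ((hq.mono hsub).intervalIntegrable)
  have hτ2 : IntervalIntegrable (fun s => τ s ^ 2) volume 0 T := by
    rw [intervalIntegrable_iff_integrableOn_Ioc_of_le hT] at hτ ⊢
    have := hτ.bdd_mul (c := B) hτ.aestronglyMeasurable
      ((ae_restrict_mem measurableSet_Ioc).mono fun s hs => by
        rw [norm_eq_abs]; exact hB s hs.1.le)
    simpa only [pow_two, IntegrableOn] using this
  rw [← uIcc_of_le hT] at ha hb
  exact (hτ.smul_continuousOn ha).sub (hτ2.smul_continuousOn hb)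

theorem integral_le_of_lintegral_le {Ω : Type*} [MeasurableSpace Ω] {P : Measure Ω} {f : Ω → ℝ}
    (hf : AEStronglyMeasurable f P) (h0 : ∀ ω, 0 ≤ f ω) {c : ℝ} (hc : 0 ≤ c)
    (h : ∫⁻ ω, ofReal (f ω) ∂P ≤ ofReal c) : ∫ ω, f ω ∂P ≤ c := by
  rw [integral_eq_lintegral_of_nonneg_ae (Filter.Eventually.of_forall h0) hf]
  exact ENNReal.toReal_le_of_le_ofReal hc h

theorem norm_stepSize_sub_le {E : Type*} [NormedAddCommGroup E] [NormedSpace ℝ E] {t B La Lb D : ℝ}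
    (hB : 0 ≤ B) (ht : |t| ≤ B) {x x' y y' : E} (hx : ‖x - x'‖ ≤ La * D)
    (hy : ‖y - y'‖ ≤ Lb * D) :
    ‖(t • x - t ^ 2 • y) - (t • x' - t ^ 2 • y')‖ ≤ (B * La + B ^ 2 * Lb) * D := by
  have e : (t • x - t ^ 2 • y) - (t • x' - t ^ 2 • y') = t • (x - x') - t ^ 2 • (y - y') := by
    rw [smul_sub, smul_sub]; abel
  have ht2 : |t ^ 2| ≤ B ^ 2 := by
    rw [abs_pow]; exact pow_le_pow_left₀ (abs_nonneg _) ht 2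
  rw [e]
  refine (norm_sub_le _ _).trans ?_
  rw [norm_smul, norm_smul, norm_eq_abs, norm_eq_abs]
  calc _ ≤ B * (La * D) + B ^ 2 * (Lb * D) :=
        add_le_add (mul_le_mul ht hx (norm_nonneg _) hB)
          (mul_le_mul ht2 hy (norm_nonneg _) (by positivity))
    _ = _ := by ring

theorem mem_of_forall_lintegral_le {E : Type*} [NormedAddCommGroup E] {F : Set E} (hF : IsClosed F)
    {Ω : ℕ → Type*} [∀ n, MeasurableSpace (Ω n)] {P : ∀ n, Measure (Ω n)} [∀ n, IsProbabilityMeasure (P n)]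
    {S : ∀ n, Ω n → E} {q : E} {N : ℕ} {C : ℝ} (hC : 0 ≤ C) (h : ∀ n ≥ N, ∃ A : Set (Ω n), MeasurableSet A ∧
      (P n).real Aᶜ ≤ C / √n ∧ (∀ ω ∈ A, S n ω ∈ F) ∧
      ∫⁻ ω in A, ofReal ‖S n ω - q‖ ∂P n ≤ ofReal (C / √n)) : q ∈ F := by
  by_contra hq
  obtain ⟨r, hr, hball⟩ := Metric.isOpen_iff.1 hF.isOpen_compl q hq
  have hlim : Filter.Tendsto (fun n : ℕ => (1 + r) * C / √n) Filter.atTop (nhds 0) :=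
    tendsto_const_nhds.div_atTop (Real.tendsto_sqrt_atTop.comp tendsto_natCast_atTop_atTop)
  refine absurd (ge_of_tendsto hlim (Filter.eventually_atTop.2 ⟨N, fun n hn => ?_⟩)) (not_le.2 hr)
  obtain ⟨A, hA, h1, h2, h3⟩ := h n hn
  have h4 : ofReal r * P n A ≤ ofReal (C / √n) := by
    rw [← setLIntegral_const]
    refine (setLIntegral_mono' hA fun ω hω => ofReal_le_ofReal ?_).trans h3
    by_contra h5
    exact hball (by rw [Metric.mem_ball, dist_eq_norm]; exact not_le.1 h5) (h2 ω hω)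
  rw [← ofReal_measureReal, ← ofReal_mul hr.le] at h4
  have h5 := (ENNReal.ofReal_le_ofReal_iff (by positivity)).1 h4
  rw [probReal_compl_eq_one_sub hA] at h1
  have h6 := mul_le_mul_of_nonneg_left h1 hr.le
  have e : (1 + r) * C / √n = C / √n + r * (C / √n) := by ring
  rw [e]
  linarith

end General

section OrthonormalLimit
variable {d : ℕ} {κ : Measure (Fin d → ℝ)} {ν : Measure ℝ} {α σ ε : ℝ} {lam : Fin d → ℝ} {τ : ℝ → ℝ}
  {Q₀ : Mat d d} {T : ℝ}

theorem contDiff_matrix_transpose : ContDiff ℝ 1 fun Q : Mat d d => Qᵀ :=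
  (LinearMap.toContinuousLinearMap
    (Matrix.transposeLinearEquiv (Fin d) (Fin d) ℝ ℝ).toLinearMap).contDiff

theorem contDiff_driftLin (α : ℝ) (lam : Fin d → ℝ) : ContDiff ℝ 1 (driftLin α lam) := by
  have := contDiff_matrix_transpose (d := d)
  unfold driftLin
  fun_prop

theorem contDiff_driftQuad (α σ : ℝ) (lam : Fin d → ℝ) : ContDiff ℝ 1 (driftQuad α σ lam) := by
  have := contDiff_matrix_transpose (d := d)
  unfold driftQuad
  fun_prop

theorem IsOjaSolution.eqOn {B : ℝ} (hT : 0 ≤ T) (hB : ∀ t, 0 ≤ t → |τ t| ≤ B)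
    (hbv : LocallyBoundedVariationOn τ (Ici 0)) {u v : ℝ → Mat d d}
    (hu : IsOjaSolution α σ lam τ Q₀ T u) (hv : IsOjaSolution α σ lam τ Q₀ T v) : EqOn u v (Icc 0 T) := by
  have hB0 : 0 ≤ B := (abs_nonneg _).trans (hB 0 le_rfl)
  obtain ⟨R₁, hR₁⟩ := isCompact_Icc.exists_bound_of_continuousOn hu.cont
  obtain ⟨R₂, hR₂⟩ := isCompact_Icc.exists_bound_of_continuousOn hv.cont
  obtain ⟨La, hLa, a, ha, haf⟩ := exists_lipschitz_extension (contDiff_driftLin α lam) (max R₁ R₂)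
  obtain ⟨Lb, hLb, b, hb, hbf⟩ := exists_lipschitz_extension (contDiff_driftQuad α σ lam) (max R₁ R₂)
  have hi : ∀ {w : ℝ → Mat d d}, ContinuousOn w (Icc 0 T) →
      IntervalIntegrable (fun s => τ s • driftLin α lam (w s) - τ s ^ 2 • driftQuad α σ lam (w s))
        volume 0 T := fun hw =>
    intervalIntegrable_stepSize hT hB hbv ((contDiff_driftLin α lam).continuous.comp_continuousOn hw)
      ((contDiff_driftQuad α σ lam).continuous.comp_continuousOn hw)
  refine eqOn_of_sub_eq_integral hT (L := B * La + B ^ 2 * Lb) (by positivity) hu.cont hv.cont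
    (φ := fun s => (τ s • driftLin α lam (u s) - τ s ^ 2 • driftQuad α σ lam (u s)) -
      (τ s • driftLin α lam (v s) - τ s ^ 2 • driftQuad α σ lam (v s))) ?_ ?_
  · intro t ht
    have hsub : uIcc 0 t ⊆ uIcc 0 T := by
      rw [uIcc_of_le ht.1, uIcc_of_le hT]; exact Icc_subset_Icc_right ht.2
    rw [intervalIntegral.integral_sub ((hi hu.cont).mono_set hsub) ((hi hv.cont).mono_set hsub),
      hu.eq t ht, hv.eq t ht]
    simp only [drift_smul_one]
    abel
  · intro s hs
    have h1 := (hR₁ s hs).trans (le_max_left R₁ R₂)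
    have h2 := (hR₂ s hs).trans (le_max_right R₁ R₂)
    rw [← haf _ h1, ← haf _ h2, ← hbf _ h1, ← hbf _ h2]
    exact norm_stepSize_sub_le hB0 (hB s hs.1) (ha _ _) (hb _ _)

/-- What the analysis needs to know about a method that keeps its iterates orthonormal. -/
structure OrthonormalMethod (α ε σ : ℝ)
    (step : ∀ {n : ℕ}, ℝ → Mat n d → Obs n → Mat n d) : Prop where
  meas : ∀ {n : ℕ} (U : Mat n d) (t : ℝ),
    Measurable fun p : Mat n d × Draw n d => step t p.1 (observe U p.2)
  gram : ∀ {n : ℕ} {U X : Mat n d} {t : ℝ} (ξ : Draw n d), 0 ≤ t → Xᵀ * X = 1 →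
    (step t X (observe U ξ))ᵀ * step t X (observe U ξ) = 1
  tangent : ∀ B : ℝ, 0 ≤ B → ∃ C₀ : ℝ, 0 ≤ C₀ ∧ ∀ {n : ℕ} {U X : Mat n d}
    {Y : Draw n d → ℝ} {t : ℝ}, 1 ≤ n → 0 ≤ t → t ≤ B → Xᵀ * X = 1 → Envelope α σ ε U X Y →
    ∃ η ζ, TangentStep C₀ 8 ε t U X Y (fun ξ => step t X (observe U ξ)) η ζ

theorem orthonormalMethod_ojaStep (hε : 0 < ε) (hα : α ∈ Ioo (0 : ℝ) 1) :
    OrthonormalMethod (d := d) α ε σ fun t X o => ojaStep ε t X o where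
  meas U t := measurable_ojaStep measurable_fst measurable_snd U ε t
  gram ξ ht hX := transpose_ojaStep_mul_self hε ht hX ξ
  tangent B hB := ⟨_, by positivity, fun hn ht htB hX hE => exists_tangentStep_ojaStep hε hα hn ht htB hX hE⟩

theorem orthonormalMethod_grouseStep (hε : 0 < ε) (hα : α ∈ Ioo (0 : ℝ) 1) :
    OrthonormalMethod (d := d) α ε σ fun t X o => grouseStep ε t X o where
  meas U t := measurable_grouseStep measurable_fst measurable_snd U ε t
  gram ξ ht hX := transpose_grouseStep_mul_self hε hX ξ
  tangent B hB := ⟨_, by positivity, fun hn ht htB hX hE => exists_tangentStep_grouseStep hε hα hn ht htB hX hE⟩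

theorem integrable_norm_cosSim_sub {Ω : Type*} [MeasurableSpace Ω] {P : Measure Ω} [IsFiniteMeasure P]
    {n : ℕ} {U : Mat n d} (hU : Uᵀ * U = 1) {X : Ω → Mat n d}
    (hX : Measurable X) (Q : Mat d d) : Integrable (fun ω => ‖cosSim U (X ω) - Q‖) P := by
  refine Integrable.mono' (integrable_const (1 + ‖Q‖))
    ((measurable_cosSim U hX).sub_const Q).norm.aestronglyMeasurable (ae_of_all _ fun ω => ?_)
  rw [norm_norm]
  exact (norm_sub_le _ _).trans (add_le_add (norm_cosSim_le_one hU _) le_rfl)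

theorem norm_sub_le_of_floor {E : Type*} [NormedAddCommGroup E] {Q : ℝ → E} {M t : ℝ} {n : ℕ}
    (hn : 1 ≤ n) (hM : 0 ≤ M) (ht : t ∈ Icc 0 T)
    (h : ∀ s ∈ Icc 0 T, ‖Q t - Q s‖ ≤ M * |t - s|) :
    (⌊(n : ℝ) * t⌋₊ : ℝ) ≤ n * T ∧ ‖Q (⌊(n : ℝ) * t⌋₊ / n) - Q t‖ ≤ M / √n := by
  have hn' : (1 : ℝ) ≤ n := by exact_mod_cast hn
  have hn0 : (0 : ℝ) < n := by linarith
  have h1 : (⌊(n : ℝ) * t⌋₊ : ℝ) ≤ n * t := Nat.floor_le (mul_nonneg hn0.le ht.1)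
  have h2 : (n : ℝ) * t < ⌊(n : ℝ) * t⌋₊ + 1 := Nat.lt_floor_add_one _
  have h3 : (⌊(n : ℝ) * t⌋₊ : ℝ) / n ≤ t := by rw [div_le_iff₀ hn0]; linarith
  have h4 : |t - ⌊(n : ℝ) * t⌋₊ / n| ≤ 1 / n := by
    rw [abs_of_nonneg (by linarith)]
    have : t - ⌊(n : ℝ) * t⌋₊ / n = (n * t - ⌊(n : ℝ) * t⌋₊) / n := by field_simp
    rw [this]
    exact div_le_div_of_nonneg_right (by linarith) hn0.le
  refine ⟨h1.trans (mul_le_mul_of_nonneg_left ht.2 hn0.le), ?_⟩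
  rw [norm_sub_rev]
  refine (h _ ⟨by positivity, h3.trans ht.2⟩).trans ?_
  have h5 : 1 / (n : ℝ) ≤ 1 / √n :=
    one_div_le_one_div_of_le (sqrt_pos.2 hn0) (Real.sqrt_le_left hn0.le |>.2 (by nlinarith))
  calc M * |t - ⌊(n : ℝ) * t⌋₊ / n| ≤ M * (1 / √n) := mul_le_mul_of_nonneg_left (h4.trans h5) hM
    _ = _ := by ring

/-- A stream with incoherent data whose initial similarity is close to `Q₀`. -/
structure IsIncoherentStream {Ω : Type*} [MeasurableSpace Ω] (P : Measure Ω) (κ : Measure (Fin d → ℝ))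
    (ν : Measure ℝ) (α CI CQ : ℝ) (Q₀ : Mat d d) {n : ℕ} (U : Mat n d) (X₀ : Ω → Mat n d)
    (ξ : ℕ → Ω → Draw n d) : Prop where
  isom : Uᵀ * U = 1
  stream : IsStream P κ ν α X₀ ξ
  inc : fourthSum U ≤ CI / n
  inc_init : ∀ᵐ ω ∂P, fourthSum (X₀ ω) ≤ CI / n
  init : ∫ ω, ‖cosSim U (X₀ ω) - Q₀‖ ∂P ≤ CQ / √n

variable {Ω : ℕ → Type*} [∀ n, MeasurableSpace (Ω n)] {P : ∀ n, Measure (Ω n)} [∀ n, IsProbabilityMeasure (P n)]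
  {U : ∀ n, Mat n d} {X₀ : ∀ n, Ω n → Mat n d} {ξ : ∀ n, ℕ → Ω n → Draw n d} {CI CQ : ℝ}

set_option maxHeartbeats 1000000 in
theorem OrthonormalMethod.exists_limit_bound
    {step : ∀ {n : ℕ}, ℝ → Mat n d → Obs n → Mat n d}
    (hstep : OrthonormalMethod α ε σ step) (hν : IsNoiseLaw ν σ) (hκ : IsCoefLaw κ lam)
    (hα : α ∈ Ioo (0 : ℝ) 1) (hε : 0 < ε) (hεα : ε < α) (hT : 0 ≤ T)
    (hU : ∀ n, 1 ≤ n → d ≤ n → IsIncoherentStream (P n) κ ν α CI CQ Q₀ (U n) (X₀ n) (ξ n))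
    {B : ℝ} (hτ0 : ∀ t, 0 ≤ t → 0 ≤ τ t) (hB : ∀ t, 0 ≤ t → |τ t| ≤ B)
    (hbv : LocallyBoundedVariationOn τ (Ici 0))
    (horth : ∀ n, 1 ≤ n → d ≤ n → ∀ᵐ ω ∂P n, (X₀ n ω)ᵀ * X₀ n ω = 1)
    {a b : Mat d d → Mat d d} {La Lb : ℝ} (hLa : 0 ≤ La) (hLb : 0 ≤ Lb)
    (ha : ∀ x y, ‖a x - a y‖ ≤ La * ‖x - y‖) (hb : ∀ x y, ‖b x - b y‖ ≤ Lb * ‖x - y‖)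
    (haf : ∀ x, ‖x‖ ≤ 1 → a x = driftLin α lam x) (hbf : ∀ x, ‖x‖ ≤ 1 → b x = driftQuad α σ lam x)
    {Q : ℝ → Mat d d} (hQc : Continuous Q)
    (hQ : ∀ t ∈ Icc 0 T, Q t = Q₀ + ∫ s in (0 : ℝ)..t, (τ s • a (Q s) - τ s ^ 2 • b (Q s)))
    {X : ∀ n, Ω n → ℕ → Mat n d} (hX0 : ∀ n ω, X n ω 0 = X₀ n ω)
    (hX : ∀ n ω k, X n ω (k + 1) = step (τ (k / n)) (X n ω k) (observe (U n) (ξ n k ω))) :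
    ∃ C : ℝ, ∀ t ∈ Icc 0 T, ∀ n : ℕ, 1 ≤ n → d ≤ n →
      Integrable (fun ω => ‖cosSim (U n) (X n ω ⌊n * t⌋₊) - Q t‖) (P n) ∧
      ∫ ω, ‖cosSim (U n) (X n ω ⌊n * t⌋₊) - Q t‖ ∂P n ≤ C / √n := by
  have hB0 : 0 ≤ B := (abs_nonneg _).trans (hB 0 le_rfl)
  obtain ⟨C₀, hC₀, htan⟩ := hstep.tangent B hB0
  obtain ⟨C₁, hC₁, hdrift⟩ := exists_orthonormal_driftBounds hν hκ hα hε hεα CI hB0 hC₀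
  have hac : Continuous a := continuous_of_norm_sub_le hLa ha
  have hbc : Continuous b := continuous_of_norm_sub_le hLb hb
  set g : ℝ → Mat d d → Mat d d :=
    fun s x => τ s • a x - τ s ^ 2 • b x with hg
  have hint : IntervalIntegrable (fun s => g s (Q s)) volume 0 T :=
    intervalIntegrable_stepSize hT hB hbv (hac.comp hQc).continuousOn (hbc.comp hQc).continuousOn
  obtain ⟨Ma, hMa⟩ := isCompact_Icc.exists_bound_of_continuousOn (s := Icc 0 T) (hac.comp hQc).continuousOn
  obtain ⟨Mb, hMb⟩ := isCompact_Icc.exists_bound_of_continuousOn (s := Icc 0 T) (hbc.comp hQc).continuousOn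
  have hMa0 : 0 ≤ Ma := (norm_nonneg _).trans (hMa 0 ⟨le_rfl, hT⟩)
  have hMb0 : 0 ≤ Mb := (norm_nonneg _).trans (hMb 0 ⟨le_rfl, hT⟩)
  have hbd : ∀ s ∈ Icc 0 T, ‖g s (Q s)‖ ≤ B * Ma + B ^ 2 * Mb := fun s hs => by
    refine (norm_sub_le _ _).trans ?_
    rw [norm_smul, norm_smul, norm_eq_abs, norm_eq_abs, abs_pow]
    exact add_le_add (mul_le_mul (hB s hs.1) (hMa s hs) (norm_nonneg _) hB0)
      (mul_le_mul (pow_le_pow_left₀ (abs_nonneg _) (hB s hs.1) 2) (hMb s hs) (norm_nonneg _) (by positivity))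
  obtain ⟨p, q, hp, hq, hpq⟩ := hbv.exists_monotoneOn_sub_monotoneOn
  have hV : ∀ r s, 0 ≤ r → r ≤ s → s ≤ T → ‖g s (Q r) - g r (Q r)‖ ≤
      (Ma + 2 * B * Mb) * (p s + q s) - (Ma + 2 * B * Mb) * (p r + q r) := fun r s hr hrs hs => by
    have e : g s (Q r) - g r (Q r) = (τ s - τ r) • (a (Q r) - (τ s + τ r) • b (Q r)) := by
      simp only [hg]; module
    have hr' : r ∈ Icc 0 T := ⟨hr, hrs.trans hs⟩
    have h1 : |τ s - τ r| ≤ (p s - p r) + (q s - q r) := by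
      have hps := hp (mem_Ici.2 hr) (mem_Ici.2 (hr.trans hrs)) hrs
      have hqs := hq (mem_Ici.2 hr) (mem_Ici.2 (hr.trans hrs)) hrs
      rw [hpq, abs_le]
      simp only [Pi.sub_apply]
      constructor <;> linarith
    have h2 : ‖a (Q r) - (τ s + τ r) • b (Q r)‖ ≤ Ma + 2 * B * Mb := by
      refine (norm_sub_le _ _).trans (add_le_add (hMa r hr') ?_)
      rw [norm_smul, norm_eq_abs]
      refine mul_le_mul ?_ (hMb r hr') (norm_nonneg _) (by positivity)
      refine (abs_add_le _ _).trans ?_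
      linarith [hB s (hr.trans hrs), hB r hr]
    rw [e, norm_smul, norm_eq_abs]
    calc _ ≤ ((p s - p r) + (q s - q r)) * (Ma + 2 * B * Mb) :=
          mul_le_mul h1 h2 (norm_nonneg _) ((abs_nonneg _).trans h1)
      _ = _ := by ring
  obtain ⟨C, hC, hest⟩ := exists_chain_estimate (g := g) (Q := Q) (B₀ := 1) (C₁ := C₁) (C₂ := CI)
    (V := fun s => (Ma + 2 * B * Mb) * (p s + q s)) (x₀ := Q₀) (M := B * Ma + B ^ 2 * Mb) hT
    (L := B * La + B ^ 2 * Lb) (by positivity) hC₁ hQ hint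
    (fun s hs x y => norm_stepSize_sub_le hB0 (hB s hs.1) (ha x y) (hb x y)) hbd hV
  have hCQ : 0 ≤ |CQ| := abs_nonneg _
  refine ⟨C + C * |CQ| + (B * Ma + B ^ 2 * Mb), fun t ht n hn hdn => ?_⟩
  have hn' : (1 : ℝ) ≤ n := by exact_mod_cast hn
  have hn0 : (0 : ℝ) < n := by linarith
  obtain ⟨hUn, hst, hUf, hXf, hinit⟩ := hU n hn hdn
  have hmeas0 : Measurable (X₀ n) := hst.measurable_init
  have hchainm : ∀ k, Measurable fun ω => X n ω k := fun k =>
    measurable_chain (Φ := fun k x z => step (τ (k / n)) x (observe (U n) z)) hmeas0 hst.measurable_draw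
      (fun k => hstep.meas (U n) _) (hX0 n) (hX n) k
  refine ⟨integrable_norm_cosSim_sub hUn (hchainm _) _, ?_⟩
  set G : Set (Mat n d) := {x | xᵀ * x = 1 ∧ fourthSum x ≤ CI / n}
  have hGm : MeasurableSet G :=
    (measurableSet_eq_fun (measurable_gram measurable_id) measurable_const).inter
      (measurableSet_le measurable_fourthSum measurable_const)
  have hGae : ∀ᵐ ω ∂P n, ω ∈ X₀ n ⁻¹' G := by
    filter_upwards [hXf, horth n hn hdn] with ω h1 h2 using ⟨h2, h1⟩
  have hinv : ∀ ω, X₀ n ω ∈ G → ∀ k, (X n ω k)ᵀ * X n ω k = 1 := fun ω hω k => by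
    induction k with
    | zero => rw [hX0]; exact hω.1
    | succ k ih => rw [hX]; exact hstep.gram _ (hτ0 _ (by positivity)) ih
  have hball : ∀ x : Mat n d, xᵀ * x = 1 → ‖(U n)ᵀ * x‖ ≤ 1 := fun x hx => by
    rw [← cosSim_of_orthonormal _ hx]; exact norm_cosSim_le_one hUn x
  obtain ⟨hkT, hfloor⟩ := norm_sub_le_of_floor (Q := Q) hn (M := B * Ma + B ^ 2 * Mb) (by positivity) ht
    fun s hs => norm_sub_le_of_integral hQ hint hbd hs ht
  set k := ⌊(n : ℝ) * t⌋₊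
  have hbound := hest (Φ := fun k x z => step (τ (k / n)) x (observe (U n) z)) (X := X n)
    (S := fun x => (U n)ᵀ * x) (h := fourthSum) (G := G) hn hmeas0 hst.measurable_draw hst.indep
    hst.indep_init (fun k => hstep.meas (U n) _) (hX0 n) (hX n) hst.law hGm
    (measurable_matrix_mul measurable_const measurable_id) measurable_fourthSum fourthSum_nonneg
    (fun x hx => hball x hx.1) (fun x hx => hx.2)
    (fun k _ ω hω => by
      have hτk : 0 ≤ τ (k / n) := hτ0 _ (by positivity)
      have hτB : τ (k / n) ≤ B := (le_abs_self _).trans (hB _ (by positivity))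
      have hgram := hinv ω hω k
      refine hdrift (φ := fun x z => step (τ (k / n)) x (observe (U n) z)) hn hUn hUf hgram hτk hτB ?_ ?_ ?_
      · exact (hstep.meas (U n) (τ (k / n))).comp (measurable_const.prodMk measurable_id)
      · exact fun Y hY => htan hn hτk hτB hgram hY
      · have h1 := hball _ hgram
        simp only [hg]
        rw [drift_smul_one, haf _ h1, hbf _ h1]) k hkT
  rw [Measure.restrict_eq_self_of_ae_mem hGae] at hbound
  have hQ00 : Q 0 = Q₀ := by rw [hQ 0 ⟨le_rfl, hT⟩]; simp
  have hinit' : ∫⁻ ω, ofReal ‖(U n)ᵀ * X₀ n ω - Q 0‖ ∂P n ≤ ofReal (|CQ| / √n) := by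
    have e : ∫⁻ ω, ofReal ‖(U n)ᵀ * X₀ n ω - Q 0‖ ∂P n =
        ∫⁻ ω, ofReal ‖cosSim (U n) (X₀ n ω) - Q₀‖ ∂P n := by
      refine lintegral_congr_ae ?_
      filter_upwards [horth n hn hdn] with ω hω
      rw [cosSim_of_orthonormal _ hω, hQ00]
    rw [e, ← ofReal_integral_eq_lintegral_ofReal (integrable_norm_cosSim_sub hUn hmeas0 Q₀)
      (ae_of_all _ fun ω => norm_nonneg _)]
    exact ofReal_le_ofReal (hinit.trans
      (div_le_div_of_nonneg_right (le_abs_self _) (sqrt_nonneg _)))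
  have hfin : ∫ ω, ‖cosSim (U n) (X n ω k) - Q (k / n)‖ ∂P n ≤ (C + C * |CQ|) / √n := by
    refine integral_le_of_lintegral_le (integrable_norm_cosSim_sub hUn (hchainm k) _).aestronglyMeasurable
      (fun ω => norm_nonneg _) (by positivity) ?_
    have e : ∫⁻ ω, ofReal ‖cosSim (U n) (X n ω k) - Q (k / n)‖ ∂P n =
        ∫⁻ ω, ofReal ‖(U n)ᵀ * X n ω k - Q (k / n)‖ ∂P n := by
      refine lintegral_congr_ae ?_
      filter_upwards [hGae] with ω hω
      rw [cosSim_of_orthonormal _ (hinv ω hω k)]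
    rw [e]
    refine hbound.trans ((add_le_add le_rfl (mul_le_mul' le_rfl hinit')).trans_eq ?_)
    rw [← ofReal_mul hC, ← ofReal_add (by positivity) (by positivity)]
    congr 1
    ring
  have hi := integrable_norm_cosSim_sub (P := P n) hUn (hchainm k) (Q (k / n))
  calc ∫ ω, ‖cosSim (U n) (X n ω k) - Q t‖ ∂P n
      ≤ ∫ ω, (‖cosSim (U n) (X n ω k) - Q (k / n)‖ + (B * Ma + B ^ 2 * Mb) / √n) ∂P n := by
        refine integral_mono (integrable_norm_cosSim_sub hUn (hchainm k) _) (hi.add (integrable_const _))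
          fun ω => ?_
        exact (norm_sub_le_norm_sub_add_norm_sub _ _ _).trans (add_le_add le_rfl hfloor)
    _ = ∫ ω, ‖cosSim (U n) (X n ω k) - Q (k / n)‖ ∂P n + (B * Ma + B ^ 2 * Mb) / √n := by
        rw [integral_add hi (integrable_const _)]
        simp
    _ ≤ (C + C * |CQ|) / √n + (B * Ma + B ^ 2 * Mb) / √n := add_le_add hfin le_rfl
    _ = _ := by ring

theorem exists_ojaSolution_limit (hν : IsNoiseLaw ν σ) (hκ : IsCoefLaw κ lam)
    (hα : α ∈ Ioo (0 : ℝ) 1) (hε : 0 < ε) (hεα : ε < α) (hT : 0 ≤ T)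
    (hU : ∀ n, 1 ≤ n → d ≤ n → IsIncoherentStream (P n) κ ν α CI CQ Q₀ (U n) (X₀ n) (ξ n))
    {B : ℝ} (hτ0 : ∀ t, 0 ≤ t → 0 ≤ τ t) (hB : ∀ t, 0 ≤ t → |τ t| ≤ B)
    (hbv : LocallyBoundedVariationOn τ (Ici 0))
    (horth : ∀ n, 1 ≤ n → d ≤ n → ∀ᵐ ω ∂P n, (X₀ n ω)ᵀ * X₀ n ω = 1) :
    ∃ Q : ℝ → Mat d d, IsOjaSolution α σ lam τ Q₀ T Q ∧
      ∀ (step : ∀ {n : ℕ}, ℝ → Mat n d → Obs n → Mat n d),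
        OrthonormalMethod α ε σ step → ∀ X : ∀ n, Ω n → ℕ → Mat n d,
        (∀ n ω, X n ω 0 = X₀ n ω) →
        (∀ n ω k, X n ω (k + 1) = step (τ (k / n)) (X n ω k) (observe (U n) (ξ n k ω))) →
        ∃ C : ℝ, ∀ t ∈ Icc 0 T, ∀ n : ℕ, 1 ≤ n → d ≤ n →
          Integrable (fun ω => ‖cosSim (U n) (X n ω ⌊n * t⌋₊) - Q t‖) (P n) ∧
          ∫ ω, ‖cosSim (U n) (X n ω ⌊n * t⌋₊) - Q t‖ ∂P n ≤ C / √n := by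
  have hB0 : 0 ≤ B := (abs_nonneg _).trans (hB 0 le_rfl)
  obtain ⟨La, hLa, a, ha, haf⟩ := exists_lipschitz_extension (contDiff_driftLin α lam) 1
  obtain ⟨Lb, hLb, b, hb, hbf⟩ := exists_lipschitz_extension (contDiff_driftQuad α σ lam) 1
  have hac : Continuous a := continuous_of_norm_sub_le hLa ha
  have hbc : Continuous b := continuous_of_norm_sub_le hLb hb
  obtain ⟨Q, hQc, hQ⟩ := exists_integral_solution
    (g := fun s x => τ s • a x - τ s ^ 2 • b x) hT (L := B * La + B ^ 2 * Lb) (by positivity)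
    (fun s hs x y => norm_stepSize_sub_le hB0 (hB s hs.1) (ha x y) (hb x y))
    (fun u hu => intervalIntegrable_stepSize hT hB hbv (hac.comp hu).continuousOn (hbc.comp hu).continuousOn)
    Q₀
  have key := fun (step : ∀ {n : ℕ}, ℝ → Mat n d → Obs n → Mat n d)
    (hs : OrthonormalMethod α ε σ step) (X : ∀ n, Ω n → ℕ → Mat n d)
    (hX0 : ∀ n ω, X n ω 0 = X₀ n ω)
    (hX : ∀ n ω k, X n ω (k + 1) = step (τ (k / n)) (X n ω k) (observe (U n) (ξ n k ω))) =>
    hs.exists_limit_bound hν hκ hα hε hεα hT hU hτ0 hB hbv horth hLa hLb ha hb haf hbf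
      hQc hQ hX0 hX
  refine ⟨Q, ⟨hQc.continuousOn, fun t ht => ?_⟩, key⟩
  obtain ⟨C, hC⟩ := key (fun t X o => ojaStep ε t X o) (orthonormalMethod_ojaStep hε hα)
    (fun n ω => ojaIter ε τ (X₀ n ω) fun k => observe (U n) (ξ n k ω)) (fun n ω => rfl) (fun n ω k => rfl)
  have hball : ∀ s ∈ Icc 0 T, ‖Q s‖ ≤ 1 := fun s hs =>
    mem_closedBall_zero_iff.1 <| mem_of_forall_lintegral_le Metric.isClosed_closedBall (P := P) (N := max 1 d)
      (abs_nonneg C) (S := fun n ω => cosSim (U n)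
        (ojaIter ε τ (X₀ n ω) (fun k => observe (U n) (ξ n k ω)) ⌊n * s⌋₊)) fun n hn => by
        have h1 := (le_max_left _ _).trans hn
        have h2 := (le_max_right _ _).trans hn
        obtain ⟨h3, h4⟩ := hC s hs n h1 h2
        refine ⟨univ, .univ, by simp; positivity,
          fun ω _ => mem_closedBall_zero_iff.2 (norm_cosSim_le_one (hU n h1 h2).isom _), ?_⟩
        rw [Measure.restrict_univ, ← ofReal_integral_eq_lintegral_ofReal h3 (ae_of_all _ fun ω => norm_nonneg _)]
        exact ofReal_le_ofReal (h4.trans (by gcongr; exact le_abs_self C))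
  rw [hQ t ht]
  congr 1
  refine intervalIntegral.integral_congr fun s hs => ?_
  rw [uIcc_of_le ht.1] at hs
  have h1 := hball s ⟨hs.1, hs.2.trans ht.2⟩
  rw [drift_smul_one, haf _ h1, hbf _ h1]

end OrthonormalLimit

/-! ### One step of PETRELS -/

section PetrelsStep
variable {n d : ℕ} {α σ ε μ γ a c : ℝ} {lam : Fin d → ℝ} {U X : Mat n d}
  {R : Mat d d}

/-- The triples `(A, K, W)` on which the limiting system lives. -/
abbrev Triple (d : ℕ) : Type :=
  Mat d d × Mat d d × Mat d d

/-- The triple `((n R)⁻¹, Uᵀ X, Xᵀ X)` of a state `(X, R)`. -/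
noncomputable def petrelsState (U : Mat n d)
    (p : Mat n d × Mat d d) : Triple d :=
  ((n : ℝ)⁻¹ • p.2⁻¹, Uᵀ * p.1, p.1ᵀ * p.1)

theorem rankOne_update_eq_inv (hR : R.PosDef) (hα : 0 ≤ α) (hγ : 0 < γ) (w : Fin d → ℝ) :
    γ⁻¹ • R - (α / (1 + α * (w ⬝ᵥ (γ⁻¹ • (R *ᵥ w))))) •
      vecMulVec (γ⁻¹ • (R *ᵥ w)) (γ⁻¹ • (R *ᵥ w)) = (γ • R⁻¹ + α • vecMulVec w w)⁻¹ := by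
  have hRt : Rᵀ = R := isHermitian_iff'.1 hR.isHermitian
  have hdet : IsUnit R.det := (isUnit_iff_isUnit_det _).mp hR.isUnit
  have hq : 0 ≤ w ⬝ᵥ (R *ᵥ w) := (posSemidef_iff'.1 hR.posSemidef).2 w
  set u := γ⁻¹ • (R *ᵥ w) with hu
  set β := 1 + α * (w ⬝ᵥ u) with hβ
  have hβ0 : 0 < β := by
    have : 0 ≤ w ⬝ᵥ u := by rw [hu, dotProduct_smul]; exact mul_nonneg (by positivity) hq
    positivity
  have hRw : R *ᵥ w = γ • u := by rw [hu, smul_smul, mul_inv_cancel₀ hγ.ne', one_smul]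
  have hiu : R⁻¹ *ᵥ u = γ⁻¹ • w := by
    rw [hu, mulVec_smul, mulVec_mulVec, nonsing_inv_mul _ hdet, one_mulVec]
  clear_value u β
  symm
  apply inv_eq_right_inv
  rw [madd_mul, mmul_sub, mmul_sub, msmul_mul, msmul_mul, msmul_mul,
    msmul_mul, mmul_smul, mmul_smul, mmul_smul, mmul_smul,
    nonsing_inv_mul _ hdet, mul_vecMulVec', hiu, vecMulVec_mul', hRt, hRw, vecMulVec_mul_vecMulVec',
    vecMulVec_smul, smul_vecMulVec, smul_smul, smul_smul, smul_smul, smul_smul, smul_smul,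
    smul_smul, mul_inv_cancel₀ hγ.ne', one_smul]
  have e : α * (γ⁻¹ * γ) - γ * (α / β * γ⁻¹) - α * (α / β * (w ⬝ᵥ u)) = 0 := by
    field_simp
    rw [hβ]; ring
  have e2 : (1 : Mat d d) + (α * (γ⁻¹ * γ) - γ * (α / β * γ⁻¹) - α * (α / β * (w ⬝ᵥ u))) •
      vecMulVec w u = 1 := by rw [e, zero_smul, add_zero]
  refine Eq.trans ?_ e2
  module

theorem petrelsStep_of_enough {ξ : Draw n d} (h : Enough ε X ξ.2.2) (hR : R.PosDef) (hα : 0 ≤ α)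
    (hγ : 0 < γ) : petrelsStep ε α γ (X, R) (observe U ξ) =
      (X + vecMulVec r[X, U, ξ] (R *ᵥ ŵ[X, U, ξ]),
        (γ • R⁻¹ + α • vecMulVec ŵ[X, U, ξ] ŵ[X, U, ξ])⁻¹) := by
  have h' : Enough ε X (observe U ξ).2 := h
  have hRt : Rᵀ = R := isHermitian_iff'.1 hR.isHermitian
  have hr : mask (observe U ξ).2 *ᵥ ((observe U ξ).1 - X *ᵥ ŵ[X, U, ξ]) =
      r[X, U, ξ] := by
    rw [resid, mulVec_sub]
    congr 1
    simp only [observe, mulVec_mulVec, mask_mul_mask]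
  rw [petrelsStep, if_pos h']
  simp only [hr]
  rw [rankOne_update_eq_inv hR hα hγ, vecMulVec_mul', hRt]

theorem petrelsStep_of_not_enough {ξ : Draw n d} (h : ¬ Enough ε X ξ.2.2) :
    petrelsStep ε α γ (X, R) (observe U ξ) = (X, R) := by
  have h' : ¬ Enough ε X (observe U ξ).2 := h
  rw [petrelsStep, if_neg h']

/-- The states that PETRELS can reach from a good initial state. -/
structure PetrelsDomain (a c : ℝ) (p : Mat n d × Mat d d) : Prop where
  posDef : p.2.PosDef
  atLeast_inv : AtLeast a ((n : ℝ)⁻¹ • p.2⁻¹)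
  atLeast_gram : AtLeast c (p.1ᵀ * p.1)

theorem gram_add_vecMulVec_of_orthogonal {r : Fin n → ℝ} (hr : Xᵀ *ᵥ r = 0) (b : Fin d → ℝ) :
    (X + vecMulVec r b)ᵀ * (X + vecMulVec r b) =
      Xᵀ * X + vnorm r ^ 2 • vecMulVec b b := by
  have z : ∀ b : Fin d → ℝ, vecMulVec b (0 : Fin d → ℝ) = 0 := fun b => by
    ext i j; simp [vecMulVec_apply]
  have z' : vecMulVec (0 : Fin d → ℝ) b = 0 := by ext i j; simp [vecMulVec_apply]
  rw [transpose_add, transpose_vecMulVec, madd_mul, mmul_add, mmul_add,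
    mul_vecMulVec', hr, vecMulVec_mul_vecMulVec', vecMulVec_mul', hr, z, z', ← vnorm_sq]
  abel

theorem isUnit_det_of_posDef (hR : R.PosDef) : IsUnit R.det :=
  (isUnit_iff_isUnit_det _).mp hR.isUnit

theorem inv_inv_smul (hn : 1 ≤ n) (hR : R.PosDef) : ((n : ℝ)⁻¹ • R⁻¹)⁻¹ = (n : ℝ) • R := by
  have hn0 : (n : ℝ) ≠ 0 := by positivity
  apply inv_eq_right_inv
  rw [msmul_mul, mmul_smul, nonsing_inv_mul _ (isUnit_det_of_posDef hR), smul_smul,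
    inv_mul_cancel₀ hn0, one_smul]

theorem PetrelsDomain.step (hε : 0 < ε) (hα : 0 ≤ α) (hγ : 0 < γ) (hγ1 : γ ≤ 1) (ha : 0 ≤ a) {ξ : Draw n d}
    (h : PetrelsDomain a c (X, R)) : PetrelsDomain (γ * a) c (petrelsStep ε α γ (X, R) (observe U ξ)) := by
  by_cases hξ : Enough ε X ξ.2.2
  · rw [petrelsStep_of_enough hξ h.posDef hα hγ]
    have hpd : (γ • R⁻¹ + α • vecMulVec ŵ[X, U, ξ] ŵ[X, U, ξ]).PosDef :=
      (h.posDef.inv.smul hγ).add_posSemidef ((posSemidef_vecMulVec_self _).smul hα)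
    refine ⟨hpd.inv, ?_, ?_⟩
    · simp only
      rw [Matrix.nonsing_inv_nonsing_inv _ (isUnit_det_of_posDef hpd), smul_add, smul_comm _ γ]
      exact (h.atLeast_inv.smul hγ.le).add_posSemidef
        (((posSemidef_vecMulVec_self _).smul hα).smul (by positivity))
    · simp only
      rw [gram_add_vecMulVec_of_orthogonal (transpose_mulVec_resid_observe hε hξ)]
      exact h.atLeast_gram.add_posSemidef ((posSemidef_vecMulVec_self _).smul (sq_nonneg _))
  · rw [petrelsStep_of_not_enough hξ]
    exact ⟨h.posDef, h.atLeast_inv.mono (mul_le_of_le_one_left ha hγ1), h.atLeast_gram⟩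

theorem petrelsState_step_sub (hn : 1 ≤ n) (hε : 0 < ε) (hα : 0 ≤ α) (hμ : μ < n) (hR : R.PosDef)
    {ξ : Draw n d} (hξ : Enough ε X ξ.2.2) :
    petrelsState U (petrelsStep ε α (1 - μ / n) (X, R) (observe U ξ)) - petrelsState U (X, R) =
      ((n : ℝ)⁻¹ • (α • vecMulVec ŵ[X, U, ξ] ŵ[X, U, ξ] -
          μ • ((n : ℝ)⁻¹ • R⁻¹)),
        (n : ℝ)⁻¹ • (vecMulVec (Uᵀ *ᵥ r[X, U, ξ]) ŵ[X, U, ξ] *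
          ((n : ℝ)⁻¹ • R⁻¹)⁻¹),
        (n : ℝ)⁻¹ • (((n : ℝ)⁻¹ • R⁻¹)⁻¹ * ((vnorm r[X, U, ξ] ^ 2 / n) •
          vecMulVec ŵ[X, U, ξ] ŵ[X, U, ξ]) * ((n : ℝ)⁻¹ • R⁻¹)⁻¹)) := by
  have hn0 : (0 : ℝ) < n := by positivity
  have hRt : Rᵀ = R := isHermitian_iff'.1 hR.isHermitian
  have hγ : 0 < 1 - μ / n := by rw [sub_pos, div_lt_one hn0]; exact hμ
  have hpd : ((1 - μ / n) • R⁻¹ + α • vecMulVec ŵ[X, U, ξ]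
      ŵ[X, U, ξ]).PosDef :=
    (hR.inv.smul hγ).add_posSemidef ((posSemidef_vecMulVec_self _).smul hα)
  rw [petrelsStep_of_enough hξ hR hα hγ, inv_inv_smul hn hR]
  simp only [petrelsState]
  rw [Matrix.nonsing_inv_nonsing_inv _ (isUnit_det_of_posDef hpd),
    gram_add_vecMulVec_of_orthogonal (transpose_mulVec_resid_observe hε hξ)]
  generalize ŵ[X, U, ξ] = w at *
  generalize r[X, U, ξ] = r at *
  refine Prod.ext ?_ (Prod.ext ?_ ?_)
  · simp only [Prod.fst_sub, smul_sub, smul_smul, smul_add]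
    module
  · simp only [Prod.snd_sub, Prod.fst_sub]
    rw [mmul_add, mul_vecMulVec', mmul_smul, smul_smul, inv_mul_cancel₀ hn0.ne', one_smul,
      vecMulVec_mul', hRt]
    abel
  · simp only [Prod.snd_sub]
    simp only [msmul_mul, mmul_smul, smul_smul, mul_vecMulVec', vecMulVec_mul', hRt]
    have e : (n : ℝ)⁻¹ * (n * (vnorm r ^ 2 / n * n)) = vnorm r ^ 2 := by field_simp
    rw [e]
    abel

end PetrelsStep

/-! ### Regularity of the PETRELS system -/

section PetrelsDrift
variable {n d : ℕ} {α σ μ a c : ℝ} {lam : Fin d → ℝ}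

/-- The vector field of the PETRELS system. -/
noncomputable def petrelsField (α σ μ : ℝ) (lam : Fin d → ℝ) (x : Triple d) : Triple d :=
  (petrelsJ₁ α σ μ lam x.1 x.2.1 x.2.2, petrelsJ₂ α σ lam x.1 x.2.1 x.2.2,
    petrelsJ₃ α σ lam x.1 x.2.1 x.2.2)

/-- A closed set of triples on which the vector field is Lipschitz. -/
def petrelsRegion (d : ℕ) (a c : ℝ) : Set (Triple d) :=
  {x | AtLeast a x.1 ∧ AtLeast c x.2.2 ∧ ‖x.2.1 * x.2.2⁻¹‖ ^ 2 ≤ c⁻¹ ∧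
    ‖x.2.1 * (x.2.1 * x.2.2⁻¹)ᵀ‖ ≤ 1}

theorem petrelsField_eq {x : Triple d} (hc : 0 < c) (hx : AtLeast c x.2.2) :
    petrelsField α σ μ lam x =
      ((x.2.1 * x.2.2⁻¹)ᵀ * (α • lamSq lam) * (x.2.1 * x.2.2⁻¹) + σ ^ 2 • x.2.2⁻¹ - μ • x.1,
        (1 - x.2.1 * (x.2.1 * x.2.2⁻¹)ᵀ) * (α • lamSq lam) * (x.2.1 * x.2.2⁻¹) * x.1⁻¹,
        σ ^ 2 • (x.1⁻¹ * ((x.2.1 * x.2.2⁻¹)ᵀ * (α • lamSq lam) * (x.2.1 * x.2.2⁻¹) + σ ^ 2 • x.2.2⁻¹) *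
          x.1⁻¹)) := by
  obtain ⟨A, K, W⟩ := x
  have hdet : IsUnit W.det := hx.isUnit_det hc
  have hWt : (W⁻¹)ᵀ = W⁻¹ := hx.transpose_inv
  have key : W⁻¹ * (Kᵀ * (α • lamSq lam) * K + σ ^ 2 • W) * W⁻¹ =
      (K * W⁻¹)ᵀ * (α • lamSq lam) * (K * W⁻¹) + σ ^ 2 • W⁻¹ := by
    rw [mmul_add, madd_mul, mmul_smul W⁻¹ (σ ^ 2) W, nonsing_inv_mul _ hdet,
      msmul_mul (σ ^ 2), mone_mul, transpose_mul, hWt]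
    simp only [mmul_assoc]
  simp only [petrelsField, petrelsJ₁, petrelsJ₂, petrelsJ₃]
  have e2 : K * W⁻¹ * (Kᵀ * (α • lamSq lam) * K + σ ^ 2 • W) * W⁻¹ * A⁻¹ =
      K * ((K * W⁻¹)ᵀ * (α • lamSq lam) * (K * W⁻¹) + σ ^ 2 • W⁻¹) * A⁻¹ := by
    rw [← key]; simp only [mmul_assoc]
  have e3 : A⁻¹ * W⁻¹ * (Kᵀ * (α • lamSq lam) * K + σ ^ 2 • W) * W⁻¹ * A⁻¹ =
      A⁻¹ * ((K * W⁻¹)ᵀ * (α • lamSq lam) * (K * W⁻¹) + σ ^ 2 • W⁻¹) * A⁻¹ := by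
    rw [← key]; simp only [mmul_assoc]
  rw [key, e2, e3]
  refine Prod.ext rfl (Prod.ext ?_ rfl)
  simp only [madd_mul, mmul_add, msub_mul, mone_mul, msmul_mul,
    mmul_smul, mmul_assoc, smul_sub]
  abel

theorem petrelsField_petrelsState (hα : α ≠ 0) (hc : 0 < c) (U : Mat n d)
    {p : Mat n d × Mat d d} (hp : AtLeast c (p.1ᵀ * p.1)) :
    petrelsField α σ μ lam (petrelsState U p) =
      (α • coefLimit α σ lam U p.1 - μ • ((n : ℝ)⁻¹ • p.2⁻¹),
        crossLimit α lam U p.1 * ((n : ℝ)⁻¹ • p.2⁻¹)⁻¹,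
        ((n : ℝ)⁻¹ • p.2⁻¹)⁻¹ * ((α * σ ^ 2) • coefLimit α σ lam U p.1) * ((n : ℝ)⁻¹ • p.2⁻¹)⁻¹) := by
  have hL : (regMat U p.1)ᵀ * (α • lamSq lam) * regMat U p.1 + σ ^ 2 • (p.1ᵀ * p.1)⁻¹ =
      α • coefLimit α σ lam U p.1 := by
    rw [coefLimit, smul_add, mmul_smul, msmul_mul, smul_smul, smul_smul]
    congr 2
    field_simp
  have hC : (1 - Uᵀ * p.1 * (regMat U p.1)ᵀ) * (α • lamSq lam) * regMat U p.1 =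
      crossLimit α lam U p.1 := by rw [crossLimit, mmul_smul, msmul_mul]
  rw [petrelsField_eq hc (x := petrelsState U p) hp]
  change ((regMat U p.1)ᵀ * (α • lamSq lam) * regMat U p.1 + σ ^ 2 • (p.1ᵀ * p.1)⁻¹ - _,
    (1 - Uᵀ * p.1 * (regMat U p.1)ᵀ) * (α • lamSq lam) * regMat U p.1 * _,
    σ ^ 2 • (_ * ((regMat U p.1)ᵀ * (α • lamSq lam) * regMat U p.1 + σ ^ 2 • (p.1ᵀ * p.1)⁻¹) * _)) = _
  rw [hL, hC]
  refine Prod.ext rfl (Prod.ext rfl ?_)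
  simp only [petrelsState, mmul_smul, msmul_mul, smul_smul]
  rw [mul_comm]

/-- Bounded and Lipschitz on a set. -/
def BddLipOn {E F : Type*} [NormedAddCommGroup E] [NormedAddCommGroup F] (f : E → F) (s : Set E) : Prop :=
  ∃ M L : ℝ, 0 ≤ M ∧ 0 ≤ L ∧ (∀ x ∈ s, ‖f x‖ ≤ M) ∧ ∀ x ∈ s, ∀ y ∈ s, ‖f x - f y‖ ≤ L * ‖x - y‖

namespace BddLipOn
variable {E : Type*} [NormedAddCommGroup E] {f g : E → Mat d d} {s : Set E}

theorem const (B : Mat d d) : BddLipOn (fun _ : E => B) s :=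
  ⟨‖B‖, 0, norm_nonneg _, le_rfl, fun _ _ => le_rfl, fun x _ y _ => by simp⟩

theorem add (hf : BddLipOn f s) (hg : BddLipOn g s) : BddLipOn (fun x => f x + g x) s := by
  obtain ⟨M, L, hM, hL, h1, h2⟩ := hf
  obtain ⟨M', L', hM', hL', h1', h2'⟩ := hg
  refine ⟨M + M', L + L', by positivity, by positivity,
    fun x hx => (norm_add_le _ _).trans (add_le_add (h1 x hx) (h1' x hx)), fun x hx y hy => ?_⟩
  rw [add_sub_add_comm, add_mul]
  exact (norm_add_le _ _).trans (add_le_add (h2 x hx y hy) (h2' x hx y hy))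

theorem mul (hf : BddLipOn f s) (hg : BddLipOn g s) : BddLipOn (fun x => f x * g x) s := by
  obtain ⟨M, L, hM, hL, h1, h2⟩ := hf
  obtain ⟨M', L', hM', hL', h1', h2'⟩ := hg
  refine ⟨M * M', M * L' + L * M', by positivity, by positivity, fun x hx => (norm_mul_le_mul _ _).trans
    (mul_le_mul (h1 x hx) (h1' x hx) (norm_nonneg _) hM), fun x hx y hy => ?_⟩
  have e : f x * g x - f y * g y = f x * (g x - g y) + (f x - f y) * g y := by noncomm_ring
  rw [e]
  calc _ ≤ M * (L' * ‖x - y‖) + L * ‖x - y‖ * M' :=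
        (norm_add_le _ _).trans (add_le_add
          ((norm_mul_le_mul _ _).trans (mul_le_mul (h1 x hx) (h2' x hx y hy) (norm_nonneg _) hM))
          ((norm_mul_le_mul _ _).trans (mul_le_mul (h2 x hx y hy) (h1' y hy) (norm_nonneg _) (by positivity))))
    _ = _ := by ring

theorem smul (hf : BddLipOn f s) (r : ℝ) : BddLipOn (fun x => r • f x) s := by
  simpa only [msmul_mul, mone_mul] using (const (r • (1 : Mat d d))).mul hf

theorem transpose (hf : BddLipOn f s) : BddLipOn (fun x => (f x)ᵀ) s := by
  obtain ⟨M, L, hM, hL, h1, h2⟩ := hf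
  refine ⟨M, L, hM, hL, fun x hx => by rw [norm_transpose]; exact h1 x hx, fun x hx y hy => ?_⟩
  rw [← transpose_sub, norm_transpose]
  exact h2 x hx y hy

theorem inv {f : E → Mat d d} {b : ℝ} (hb : 0 < b) (hf : ∀ x ∈ s, AtLeast b (f x))
    (hl : ∀ x y, ‖f x - f y‖ ≤ ‖x - y‖) : BddLipOn (fun x => (f x)⁻¹) s := by
  refine ⟨b⁻¹, b⁻¹ * b⁻¹, by positivity, by positivity, fun x hx => (hf x hx).norm_inv_le hb,
    fun x hx y hy => ?_⟩
  have e : (f x)⁻¹ - (f y)⁻¹ = (f x)⁻¹ * (f y - f x) * (f y)⁻¹ := by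
    rw [mmul_sub, msub_mul, nonsing_inv_mul _ ((hf x hx).isUnit_det hb), mone_mul,
      mmul_assoc, mul_nonsing_inv _ ((hf y hy).isUnit_det hb), mmul_one]
  rw [e]
  calc _ ≤ b⁻¹ * ‖x - y‖ * b⁻¹ := (norm_mul_le_mul _ _).trans (mul_le_mul ((norm_mul_le_mul _ _).trans
        (mul_le_mul ((hf x hx).norm_inv_le hb) (by rw [norm_sub_rev]; exact hl x y) (norm_nonneg _)
          (by positivity))) ((hf y hy).norm_inv_le hb) (norm_nonneg _) (by positivity))
    _ = _ := by ring

end BddLipOn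

theorem bddLipOn_regression (hc : 0 < c) :
    BddLipOn (fun x : Triple d => x.2.1 * x.2.2⁻¹) (petrelsRegion d a c) := by
  have hb : ∀ x ∈ petrelsRegion d a c, ‖x.2.1 * x.2.2⁻¹‖ ≤ 1 + c⁻¹ := fun x hx => by
    have h1 := hx.2.2.1
    by_contra! h
    nlinarith [inv_pos.2 hc]
  have hc' : 0 < c⁻¹ := inv_pos.2 hc
  refine ⟨1 + c⁻¹, c⁻¹ + (1 + c⁻¹) * c⁻¹, by positivity, by positivity, hb, fun x hx y hy => ?_⟩
  obtain ⟨A, K, W⟩ := x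
  obtain ⟨A', K', W'⟩ := y
  have hW := hx.2.1.isUnit_det hc
  have hW' := hy.2.1.isUnit_det hc
  have hi := hy.2.1.norm_inv_le hc
  have hbx := hb _ hx
  simp only at *
  have e : K * W⁻¹ - K' * W'⁻¹ = (K - K') * W'⁻¹ + K * W⁻¹ * (W' - W) * W'⁻¹ := by
    have h1 : K * W⁻¹ * W' * W'⁻¹ = K * W⁻¹ := by
      rw [mmul_assoc, mul_nonsing_inv _ hW', mmul_one]
    have h2 : K * W⁻¹ * W = K := by rw [mmul_assoc, nonsing_inv_mul _ hW, mmul_one]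
    rw [mmul_sub, msub_mul, msub_mul, h1, h2]
    abel
  set D := ‖((A, K, W) : Triple d) - (A', K', W')‖
  have h1 : ‖K - K'‖ ≤ D := (norm_fst_le (K - K', W - W')).trans (norm_snd_le (A - A', K - K', W - W'))
  have h2 : ‖W' - W‖ ≤ D := by
    rw [norm_sub_rev]
    exact (norm_snd_le (K - K', W - W')).trans (norm_snd_le (A - A', K - K', W - W'))
  rw [e]
  calc _ ≤ D * c⁻¹ + (1 + c⁻¹) * D * c⁻¹ := (norm_add_le _ _).trans (add_le_add
        ((norm_mul_le_mul _ _).trans (mul_le_mul h1 hi (norm_nonneg _) (norm_nonneg _)))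
        ((norm_mul_le_mul _ _).trans (mul_le_mul ((norm_mul_le_mul _ _).trans
          (mul_le_mul hbx h2 (norm_nonneg _) (by positivity))) hi (norm_nonneg _) (by positivity))))
    _ = _ := by ring

theorem bddLipOn_explained (hc : 0 < c) :
    BddLipOn (fun x : Triple d => x.2.1 * (x.2.1 * x.2.2⁻¹)ᵀ) (petrelsRegion d a c) := by
  obtain ⟨M, -, hM, -, hb, -⟩ := bddLipOn_regression (d := d) (a := a) hc
  refine ⟨1, M + M + M * M, by positivity, by positivity, fun x hx => hx.2.2.2, fun x hx y hy => ?_⟩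
  obtain ⟨A, K, W⟩ := x
  obtain ⟨A', K', W'⟩ := y
  have hW := hx.2.1.isUnit_det hc
  have hW' := hy.2.1.isUnit_det hc
  have hWt := hx.2.1.transpose_inv
  have hWt' := hy.2.1.transpose_inv
  have hbx := hb _ hx
  have hby := hb _ hy
  simp only at *
  have e : K * (K * W⁻¹)ᵀ - K' * (K' * W'⁻¹)ᵀ = K * W⁻¹ * (K - K')ᵀ + (K - K') * (K' * W'⁻¹)ᵀ +
      K * W⁻¹ * (W' - W) * (K' * W'⁻¹)ᵀ := by
    rw [transpose_mul, transpose_mul, hWt, hWt', transpose_sub]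
    have h1 : K * W⁻¹ * W' * (W'⁻¹ * K'ᵀ) = K * W⁻¹ * K'ᵀ := by
      rw [mmul_assoc, ← mmul_assoc W', mul_nonsing_inv _ hW', mone_mul]
    have h2 : K * W⁻¹ * W * (W'⁻¹ * K'ᵀ) = K * (W'⁻¹ * K'ᵀ) := by
      rw [mmul_assoc K, nonsing_inv_mul _ hW, mmul_one]
    rw [mmul_sub, mmul_sub, msub_mul, msub_mul, h1, h2]
    simp only [mmul_assoc]
    abel
  set D := ‖((A, K, W) : Triple d) - (A', K', W')‖
  have h1 : ‖K - K'‖ ≤ D := (norm_fst_le (K - K', W - W')).trans (norm_snd_le (A - A', K - K', W - W'))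
  have h1' : ‖(K - K')ᵀ‖ ≤ D := by rwa [norm_transpose]
  have h2 : ‖W' - W‖ ≤ D := by
    rw [norm_sub_rev]
    exact (norm_snd_le (K - K', W - W')).trans (norm_snd_le (A - A', K - K', W - W'))
  have hby' : ‖(K' * W'⁻¹)ᵀ‖ ≤ M := by rwa [norm_transpose]
  have hD0 : 0 ≤ D := norm_nonneg _
  rw [e]
  calc _ ≤ M * D + D * M + M * D * M := (norm_add_le _ _).trans (add_le_add ((norm_add_le _ _).trans (add_le_add
        ((norm_mul_le_mul _ _).trans (mul_le_mul hbx h1' (norm_nonneg _) hM))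
        ((norm_mul_le_mul _ _).trans (mul_le_mul h1 hby' (norm_nonneg _) hD0))))
        ((norm_mul_le_mul _ _).trans (mul_le_mul ((norm_mul_le_mul _ _).trans
          (mul_le_mul hbx h2 (norm_nonneg _) hM)) hby' (norm_nonneg _) (by positivity))))
    _ = _ := by ring

theorem exists_lipschitzOnWith_petrelsField (ha : 0 < a) (hc : 0 < c) (α σ μ : ℝ) (lam : Fin d → ℝ) :
    ∃ K : NNReal, LipschitzOnWith K (petrelsField α σ μ lam) (petrelsRegion d a c) := by
  have hV := bddLipOn_regression (d := d) (a := a) hc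
  have hP := bddLipOn_explained (d := d) (a := a) hc
  have hA : BddLipOn (fun x : Triple d => x.1⁻¹) (petrelsRegion d a c) :=
    BddLipOn.inv ha (fun x hx => hx.1) fun x y => norm_fst_le (x - y)
  have hW : BddLipOn (fun x : Triple d => x.2.2⁻¹) (petrelsRegion d a c) :=
    BddLipOn.inv hc (fun x hx => hx.2.1) fun x y => (norm_snd_le (x - y).2).trans (norm_snd_le (x - y))
  have hL := BddLipOn.const (s := petrelsRegion d a c) (α • lamSq lam)
  have h1 := ((hV.transpose.mul hL).mul hV).add (hW.smul (σ ^ 2))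
  have h2 := ((((BddLipOn.const 1).add (hP.smul (-1))).mul hL).mul hV).mul hA
  have h3 := ((hA.mul h1).mul hA).smul (σ ^ 2)
  obtain ⟨-, L₁, -, hL₁, -, h1⟩ := h1
  obtain ⟨-, L₂, -, hL₂, -, h2⟩ := h2
  obtain ⟨-, L₃, -, hL₃, -, h3⟩ := h3
  refine ⟨⟨(L₁ + |μ|) + L₂ + L₃, by positivity⟩, LipschitzOnWith.of_dist_le_mul fun x hx y hy => ?_⟩
  rw [dist_eq_norm, dist_eq_norm, petrelsField_eq hc hx.2.1, petrelsField_eq hc hy.2.1]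
  change _ ≤ (L₁ + |μ| + L₂ + L₃) * _
  have hD : 0 ≤ ‖x - y‖ := norm_nonneg _
  have m1 := mul_nonneg hL₁ hD
  have m2 := mul_nonneg hL₂ hD
  have m3 := mul_nonneg hL₃ hD
  have m4 := mul_nonneg (abs_nonneg μ) hD
  refine norm_prod_le_iff.2 ⟨?_, norm_prod_le_iff.2 ⟨?_, ?_⟩⟩
  · simp only [Prod.fst_sub]
    rw [sub_sub_sub_comm, ← smul_sub]
    have q1 := h1 x hx y hy
    have q2 : ‖μ • (x.1 - y.1)‖ ≤ |μ| * ‖x - y‖ := by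
      rw [norm_smul, norm_eq_abs]
      exact mul_le_mul_of_nonneg_left (norm_fst_le (x - y)) (abs_nonneg _)
    exact (norm_sub_le _ _).trans ((add_le_add q1 q2).trans (by linarith))
  · simp only [Prod.snd_sub, Prod.fst_sub]
    have := h2 x hx y hy
    simp only [neg_smul, one_smul, ← sub_eq_add_neg] at this
    exact this.trans (by linarith)
  · simp only [Prod.snd_sub]
    exact (h3 x hx y hy).trans (by linarith)

theorem isClosed_petrelsRegion (hc : 0 < c) : IsClosed (petrelsRegion d a c) := by
  set s : Set (Triple d) := {x | AtLeast a x.1 ∧ AtLeast c x.2.2} with hs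
  have hcl : IsClosed s := ((isClosed_atLeast a).preimage continuous_fst).inter
    ((isClosed_atLeast c).preimage continuous_snd.snd)
  have hinv : ContinuousOn (fun x : Triple d => x.2.2⁻¹) s := by
    obtain ⟨-, L, -, hL, -, h⟩ := BddLipOn.inv (s := s) (f := fun x : Triple d => x.2.2) hc (fun x hx => hx.2)
      fun x y => (norm_snd_le (x - y).2).trans (norm_snd_le (x - y))
    exact (LipschitzOnWith.of_dist_le_mul (K := ⟨L, hL⟩) fun x hx y hy => by
      rw [dist_eq_norm, dist_eq_norm]; exact h x hx y hy).continuousOn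
  have hV : ContinuousOn (fun x : Triple d => x.2.1 * x.2.2⁻¹) s := continuous_snd.fst.continuousOn.mul hinv
  have hVt : ContinuousOn (fun x : Triple d => (x.2.1 * x.2.2⁻¹)ᵀ) s :=
    contDiff_matrix_transpose.continuous.comp_continuousOn hV
  have h1 : ContinuousOn (fun x : Triple d => ‖x.2.1 * x.2.2⁻¹‖ ^ 2) s := hV.norm.pow 2
  have h2 : ContinuousOn (fun x : Triple d => ‖x.2.1 * (x.2.1 * x.2.2⁻¹)ᵀ‖) s :=
    (continuous_snd.fst.continuousOn.mul hVt).norm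
  have := (h1.preimage_isClosed_of_isClosed hcl (isClosed_Iic (a := c⁻¹))).inter
    (h2.preimage_isClosed_of_isClosed hcl (isClosed_Iic (a := 1)))
  convert this using 1
  ext x
  simp only [petrelsRegion, hs, mem_setOf_eq, mem_inter_iff, mem_preimage, mem_Iic]
  tauto

theorem contDiffAt_petrelsField {x : Triple d} (hA : x.1.PosDef) (hW : x.2.2.PosDef) :
    ContDiffAt ℝ 1 (petrelsField α σ μ lam) x := by
  have hinv : ∀ {B : Mat d d}, B.PosDef →
      ContDiffAt ℝ 1 (fun B : Mat d d => B⁻¹) B := fun {B} hB => by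
    have h := contDiffAt_ringInverse ℝ (n := 1) hB.isUnit.unit
    rw [IsUnit.unit_spec] at h
    have e : (fun B : Mat d d => B⁻¹) = Ring.inverse :=
      funext fun B => Matrix.nonsing_inv_eq_ringInverse B
    rw [e]
    exact h
  have h1 : ContDiffAt ℝ 1 (fun x : Triple d => x.1⁻¹) x := (hinv hA).comp x contDiffAt_fst
  have h2 : ContDiffAt ℝ 1 (fun x : Triple d => x.2.2⁻¹) x :=
    (hinv hW).comp x contDiff_snd.snd.contDiffAt
  have h3 : ContDiffAt ℝ 1 (fun x : Triple d => (x.2.1)ᵀ) x :=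
    contDiff_matrix_transpose.contDiffAt.comp x contDiff_snd.fst.contDiffAt
  unfold petrelsField petrelsJ₁ petrelsJ₂ petrelsJ₃
  fun_prop

theorem petrelsState_mem_region {U : Mat n d} (hU : Uᵀ * U = 1) (hc : 0 < c)
    {p : Mat n d × Mat d d} (hp : PetrelsDomain a c p) :
    petrelsState U p ∈ petrelsRegion d a c :=
  ⟨hp.atLeast_inv, hp.atLeast_gram, norm_regMat_sq_le hU hc hp.atLeast_gram,
    norm_mul_regMat_transpose_le hU hc hp.atLeast_gram⟩

end PetrelsDrift

/-! ### Drift of PETRELS -/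

section PetrelsDriftBounds
variable {n d : ℕ} {κ : Measure (Fin d → ℝ)} {ν : Measure ℝ} {α σ ε μ a c : ℝ} {lam : Fin d → ℝ}
  {U X : Mat n d} {R : Mat d d} {Y : Draw n d → ℝ}

theorem measurable_petrelsState (U : Mat n d) : Measurable (petrelsState U) := by
  have h : Measurable fun p : Mat n d × Mat d d => (n : ℝ)⁻¹ • p.2⁻¹ :=
    (measurable_matrix_inv measurable_snd).const_smul (n : ℝ)⁻¹
  exact h.prodMk ((measurable_matrix_mul measurable_const measurable_fst).prodMk (measurable_gram measurable_fst))

theorem measurable_petrelsStep' (U : Mat n d) (ε α γ : ℝ) :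
    Measurable fun p : (Mat n d × Mat d d) × Draw n d =>
      petrelsStep ε α γ p.1 (observe U p.2) :=
  measurable_petrelsStep measurable_fst.fst measurable_snd U ε measurable_fst.snd α γ

theorem petrelsStep_updateBound (hn : 1 ≤ n) (hα : 0 ≤ α) (hμ : μ < n) (ha : 0 < a)
    (h : PetrelsDomain a c (X, R)) (hE : Envelope α σ ε U X Y) :
    UpdateBound a⁻¹ 0 ε U X Y R (fun ξ => (petrelsStep ε α (1 - μ / n) (X, R) (observe U ξ)).1)
      (fun _ => 0) fun _ => 0 := by
  have hn0 : (0 : ℝ) < n := by positivity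
  have hγ : 0 < 1 - μ / n := by rw [sub_pos, div_lt_one hn0]; exact hμ
  have ha' : 0 < a⁻¹ := inv_pos.2 ha
  refine ⟨((measurable_petrelsStep' U ε α _).comp (measurable_const.prodMk measurable_id)).fst, ?_,
    fun ξ hξ => by rw [petrelsStep_of_not_enough hξ], fun ξ hξ => ?_, fun ξ hξ => ?_, fun ξ hξ => ?_⟩
  · have h1 := h.atLeast_inv.norm_inv_le ha
    rw [inv_inv_smul hn h.posDef, norm_smul, Real.norm_natCast] at h1
    rwa [le_div_iff₀' hn0]
  · rw [petrelsStep_of_enough hξ h.posDef hα hγ]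
    simp
  all_goals
    have := hE.one_le ξ
    rw [abs_zero]
    positivity

set_option maxHeartbeats 1000000 in
theorem exists_petrels_driftBounds (hν : IsNoiseLaw ν σ) (hκ : IsCoefLaw κ lam)
    (hα : α ∈ Ioo (0 : ℝ) 1) (hε : 0 < ε) (ha : 0 < a) (hc : 0 < c) (hεc : ε < α * c) (hμ0 : 0 ≤ μ) (CU : ℝ) :
    ∃ C : ℝ, 0 ≤ C ∧ ∀ {n : ℕ} {U : Mat n d}
      {p : Mat n d × Mat d d} {f : Triple d → Triple d}, 1 ≤ n →
      Uᵀ * U = 1 → fourthSum U ≤ CU / n → μ < n → PetrelsDomain a c p →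
      f (petrelsState U p) = petrelsField α σ μ lam (petrelsState U p) →
      DriftBounds C n (drawLaw n κ ν α) (petrelsState U) (fun p => fourthSum p.1)
        (fun p ξ => petrelsStep ε α (1 - μ / n) p (observe U ξ)) f p := by
  have := hν.isProb
  have := hκ.isProb
  have := isProbabilityMeasure_maskLaw hα
  obtain ⟨M, hM⟩ := exists_envelope hν hκ hα hε CU
  obtain ⟨CS, hCS, hstep⟩ := exists_stepMeans hν hκ hα hε hc hεc M
  obtain ⟨CF, hCF, hfour⟩ := exists_fourthSum_step (ε := ε) hν hκ hα M a⁻¹ CU hCS 0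
  have hα0 := hα.1
  have ha' : 0 < a⁻¹ := inv_pos.2 ha
  set B : ℝ := α + 2 * a⁻¹ + a⁻¹ * (2 + σ ^ 2) * a⁻¹ with hB
  have hB0 : 0 ≤ B := by positivity
  set G : ℝ := α * CS + CS * a⁻¹ + a⁻¹ * CS * a⁻¹ with hG
  have hG0 : 0 ≤ G := by positivity
  refine ⟨(2 * B ^ 2 + 2 * μ ^ 2) * |M 8| + (2 * G ^ 2 + 2 * (μ * CS) ^ 2) + CF, by positivity, ?_⟩
  rintro n U ⟨X, R⟩ f hn hU hUf hμ hp hf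
  obtain ⟨Y, hE, hYM⟩ := hM hn hU hUf X
  have hS := hstep hn hU hp.atLeast_gram hE hYM
  obtain ⟨hi, hle⟩ := hfour hn hUf hε hE hYM hS (petrelsStep_updateBound hn hα0.le hμ ha hp hE)
  have hn' : (1 : ℝ) ≤ n := by exact_mod_cast hn
  have hn0 : (0 : ℝ) < n := by linarith
  set ρ := drawLaw n κ ν α
  set A : Mat d d := (n : ℝ)⁻¹ • R⁻¹ with hA
  have hAi : ‖A⁻¹‖ ≤ a⁻¹ := hp.atLeast_inv.norm_inv_le ha
  set S := petrelsState U (X, R) with hSdef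
  have hAS : ‖A‖ ≤ ‖S‖ := norm_fst_le S
  have hh0 := fourthSum_nonneg X
  have hwm := measurable_coeff_const U X
  have hrm := measurable_resid_const U X
  set Dl : Draw n d → Triple d := fun ξ =>
    petrelsState U (petrelsStep ε α (1 - μ / n) (X, R) (observe U ξ)) - S with hDl
  set fw : Draw n d → Mat d d := (passSet ε X).indicator
    (fun ξ => vecMulVec ŵ[X, U, ξ] ŵ[X, U, ξ]) with hfw
  set fA : Draw n d → Mat d d := (passSet ε X).indicator (fun _ => A) with hfA
  set fc : Draw n d → Mat d d := (passSet ε X).indicator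
    (fun ξ => vecMulVec (Uᵀ *ᵥ r[X, U, ξ]) ŵ[X, U, ξ]) with hfc
  set fe : Draw n d → Mat d d := (passSet ε X).indicator
    (fun ξ => (vnorm r[X, U, ξ] ^ 2 / n) •
      vecMulVec ŵ[X, U, ξ] ŵ[X, U, ξ]) with hfe
  have hfwi : Integrable fw ρ := hE.integrable_indicator hYM (measurable_matrix_vecMulVec hwm hwm)
    zero_le_one 2 fun ξ hξ => by rw [one_mul]; exact vecMulVec_coeff_coeff_le hE hξ
  have hfAi : Integrable fA ρ := (integrable_const A).indicator (measurableSet_passSet ε X)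
  have hfci : Integrable fc ρ := hE.integrable_indicator hYM
    (measurable_matrix_vecMulVec (measurable_matrix_mulVec measurable_const hrm) hwm) (by norm_num) 2
    fun ξ hξ => vecMulVec_resid_coeff_le hE hε hU hξ
  have hfei : Integrable fe ρ := hE.integrable_indicator hYM
    ((((measurable_vnorm.comp hrm).pow_const 2).div_const _).smul (measurable_matrix_vecMulVec hwm hwm))
    (by positivity) 4 fun ξ hξ => energy_smul_le hE hε hα hn hξ
  have hDeq : Dl = fun ξ => ((n : ℝ)⁻¹ • (α • fw ξ - μ • fA ξ), (n : ℝ)⁻¹ • (fc ξ * A⁻¹),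
      (n : ℝ)⁻¹ • (A⁻¹ * fe ξ * A⁻¹)) := funext fun ξ => by
    by_cases hξ : ξ ∈ passSet ε X
    · simp only [hDl, hfw, hfA, hfc, hfe, indicator_of_mem hξ]
      exact petrelsState_step_sub hn hε hα0.le hμ hp.posDef hξ
    · simp only [hDl, hfw, hfA, hfc, hfe, indicator_of_notMem hξ, petrelsStep_of_not_enough hξ, hSdef]
      simp
      rfl
  have i1 : Integrable (fun ξ => α • fw ξ - μ • fA ξ) ρ := (hfwi.smul α).sub (hfAi.smul μ)
  have i2 : Integrable (fun ξ => fc ξ * A⁻¹) ρ := hfci.mul_const _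
  have i3 : Integrable (fun ξ => A⁻¹ * fe ξ * A⁻¹) ρ := (hfei.const_mul A⁻¹).mul_const _
  have hDle : ∀ ξ, ‖Dl ξ‖ ≤ (B * Y ξ ^ 4 + μ * ‖S‖) / n := fun ξ => by
    have hY := hE.one_le ξ
    have hB0' : 0 ≤ (B * Y ξ ^ 4 + μ * ‖S‖) / n := by positivity
    by_cases hξ : ξ ∈ passSet ε X
    swap
    · have e : Dl ξ = 0 := by simp only [hDl, petrelsStep_of_not_enough hξ, hSdef, sub_self]
      rw [e, norm_zero]; exact hB0'
    rw [hDeq]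
    simp only [hfw, hfA, hfc, hfe, indicator_of_mem hξ]
    have h24 : Y ξ ^ 2 ≤ Y ξ ^ 4 := hE.pow_le_pow ξ (by norm_num)
    have h1 := (vecMulVec_coeff_coeff_le hE hξ).trans h24
    have h2 := (vecMulVec_resid_coeff_le hE hε hU hξ).trans (mul_le_mul_of_nonneg_left h24 (by norm_num))
    have h3 := energy_smul_le hE hε hα hn hξ
    have hP : 0 ≤ Y ξ ^ 4 := by positivity
    have hμS : 0 ≤ μ * ‖S‖ := by positivity
    have hsm : ∀ {x : Mat d d}, ‖x‖ ≤ B * Y ξ ^ 4 + μ * ‖S‖ →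
        ‖(n : ℝ)⁻¹ • x‖ ≤ (B * Y ξ ^ 4 + μ * ‖S‖) / n := fun hx => by
      rw [norm_smul, norm_eq_abs, abs_of_nonneg (by positivity), inv_mul_eq_div]
      gcongr
    have q1 : 0 ≤ 2 * a⁻¹ * Y ξ ^ 4 := by positivity
    have q2 : 0 ≤ a⁻¹ * (2 + σ ^ 2) * a⁻¹ * Y ξ ^ 4 := by positivity
    have q3 : 0 ≤ α * Y ξ ^ 4 := by positivity
    have eB : B * Y ξ ^ 4 = α * Y ξ ^ 4 + 2 * a⁻¹ * Y ξ ^ 4 + a⁻¹ * (2 + σ ^ 2) * a⁻¹ * Y ξ ^ 4 := by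
      rw [hB]; ring
    refine norm_prod_le_iff.2 ⟨hsm ?_, norm_prod_le_iff.2 ⟨hsm ?_, hsm ?_⟩⟩
    · refine (norm_sub_le _ _).trans ?_
      rw [norm_smul, norm_smul, norm_eq_abs, norm_eq_abs, abs_of_nonneg hα0.le, abs_of_nonneg hμ0]
      have := mul_le_mul_of_nonneg_left h1 hα0.le
      have := mul_le_mul_of_nonneg_left hAS hμ0
      linarith
    · refine (norm_mul_le_mul _ _).trans ((mul_le_mul h2 hAi (norm_nonneg _) (by positivity)).trans ?_)
      linarith
    · refine (norm_mul_le_mul _ _).trans ((mul_le_mul ((norm_mul_le_mul _ _).trans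
        (mul_le_mul hAi h3 (norm_nonneg _) ha'.le)) hAi (norm_nonneg _) (by positivity)).trans ?_)
      linarith
  have hDm : Measurable Dl := ((measurable_petrelsState U).comp ((measurable_petrelsStep' U ε α _).comp
    (measurable_const.prodMk measurable_id))).sub_const _
  have hsq : ∀ ξ, ‖Dl ξ‖ ^ 2 ≤ (2 * B ^ 2 + 2 * μ ^ 2 * ‖S‖ ^ 2) / n ^ 2 * |Y ξ| ^ 8 := fun ξ => by
    rw [hE.abs_eq]
    have hY8 : 1 ≤ Y ξ ^ 8 := one_le_pow₀ (hE.one_le ξ)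
    have h1 : (B * Y ξ ^ 4 + μ * ‖S‖) ^ 2 ≤ 2 * B ^ 2 * Y ξ ^ 8 + 2 * μ ^ 2 * ‖S‖ ^ 2 := by
      nlinarith [sq_nonneg (B * Y ξ ^ 4 - μ * ‖S‖)]
    have h2 : 2 * μ ^ 2 * ‖S‖ ^ 2 ≤ 2 * μ ^ 2 * ‖S‖ ^ 2 * Y ξ ^ 8 :=
      le_mul_of_one_le_right (by positivity) hY8
    calc ‖Dl ξ‖ ^ 2 ≤ ((B * Y ξ ^ 4 + μ * ‖S‖) / n) ^ 2 := pow_le_pow_left₀ (norm_nonneg _) (hDle ξ) 2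
      _ = (B * Y ξ ^ 4 + μ * ‖S‖) ^ 2 / n ^ 2 := div_pow _ _ _
      _ ≤ (2 * B ^ 2 * Y ξ ^ 8 + 2 * μ ^ 2 * ‖S‖ ^ 2 * Y ξ ^ 8) / n ^ 2 :=
        div_le_div_of_nonneg_right (h1.trans (add_le_add le_rfl h2)) (by positivity)
      _ = _ := by ring
  have hsqi : Integrable (fun ξ => ‖Dl ξ‖ ^ 2) ρ :=
    hYM.integrable_of_le (hDm.norm.pow_const 2).aestronglyMeasurable fun ξ => by
      rw [norm_eq_abs, abs_of_nonneg (sq_nonneg _)]; exact hsq ξ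
  refine ⟨hsqi, ?_, ?_, hi, ?_⟩
  · refine (hYM.integral_le (by positivity) hsqi hsq).trans ?_
    have h1 := le_abs_self (M 8)
    have h0 := abs_nonneg (M 8)
    rw [div_mul_eq_mul_div, div_mul_eq_mul_div]
    refine div_le_div_of_nonneg_right ?_ (by positivity)
    calc _ ≤ (2 * B ^ 2 + 2 * μ ^ 2 * ‖S‖ ^ 2) * |M 8| := by gcongr
      _ ≤ ((2 * B ^ 2 + 2 * μ ^ 2) * |M 8|) * (1 + ‖S‖ ^ 2) := by
        have : 0 ≤ (2 * B ^ 2 * ‖S‖ ^ 2 + 2 * μ ^ 2) * |M 8| := by positivity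
        linarith
      _ ≤ _ := mul_le_mul_of_nonneg_right
        (by linarith [show 0 ≤ 2 * G ^ 2 + 2 * (μ * CS) ^ 2 by positivity]) (by positivity)
  · have hmean : ∫ ξ, Dl ξ ∂ρ - (1 / (n : ℝ)) • f S =
        ((n : ℝ)⁻¹ • (α • (∫ ξ, fw ξ ∂ρ - coefLimit α σ lam U X) + μ • (ρ.real (passSet ε X)ᶜ • A)),
          (n : ℝ)⁻¹ • ((∫ ξ, fc ξ ∂ρ - crossLimit α lam U X) * A⁻¹),
          (n : ℝ)⁻¹ • (A⁻¹ * (∫ ξ, fe ξ ∂ρ - (α * σ ^ 2) • coefLimit α σ lam U X) * A⁻¹)) := by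
      have eA : ∫ ξ, fA ξ ∂ρ = A - ρ.real (passSet ε X)ᶜ • A := by
        rw [hfA, integral_indicator_const _ (measurableSet_passSet ε X),
          probReal_compl_eq_one_sub (measurableSet_passSet ε X)]
        module
      have e1 : ∫ ξ, (α • fw ξ - μ • fA ξ) ∂ρ = α • ∫ ξ, fw ξ ∂ρ - μ • ∫ ξ, fA ξ ∂ρ := by
        have iw : Integrable (fun ξ => α • fw ξ) ρ := hfwi.smul α
        have iA : Integrable (fun ξ => μ • fA ξ) ρ := hfAi.smul μ
        rw [integral_sub iw iA, integral_smul, integral_smul]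
      have e2 : ∫ ξ, fc ξ * A⁻¹ ∂ρ = (∫ ξ, fc ξ ∂ρ) * A⁻¹ := integral_mul_const_of_integrable hfci
      have e3 : ∫ ξ, A⁻¹ * fe ξ * A⁻¹ ∂ρ = A⁻¹ * (∫ ξ, fe ξ ∂ρ) * A⁻¹ := by
        rw [integral_mul_const_of_integrable (hfei.const_mul A⁻¹), integral_const_mul_of_integrable hfei]
      have k1 : Integrable (fun ξ => (n : ℝ)⁻¹ • (α • fw ξ - μ • fA ξ)) ρ := i1.smul (n : ℝ)⁻¹
      have k2 : Integrable (fun ξ => (n : ℝ)⁻¹ • (fc ξ * A⁻¹)) ρ := i2.smul (n : ℝ)⁻¹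
      have k3 : Integrable (fun ξ => (n : ℝ)⁻¹ • (A⁻¹ * fe ξ * A⁻¹)) ρ := i3.smul (n : ℝ)⁻¹
      rw [hDeq, integral_pair k1 (k2.prodMk k3), integral_pair k2 k3,
        integral_smul, integral_smul, integral_smul, e1, e2, e3, eA, hf,
        petrelsField_petrelsState hα0.ne' hc U (p := (X, R)) hp.atLeast_gram]
      refine Prod.ext ?_ (Prod.ext ?_ ?_)
      · simp only [Prod.fst_sub, Prod.smul_fst, one_div, ← hA]
        module
      · simp only [Prod.snd_sub, Prod.fst_sub, Prod.smul_fst, Prod.smul_snd, one_div, ← hA]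
        rw [msub_mul, smul_sub]
      · simp only [Prod.snd_sub, Prod.smul_snd, one_div, ← hA]
        rw [mmul_sub, msub_mul, smul_sub]
    set s := √(fourthSum X + 1 / n)
    have hs0 : 0 ≤ s := sqrt_nonneg _
    set m := min 1 (fourthSum X)
    have hm0 : 0 ≤ m := le_min zero_le_one hh0
    have hm1 : m ≤ 1 := min_le_left _ _
    have hb : ‖∫ ξ, Dl ξ ∂ρ - (1 / (n : ℝ)) • f S‖ ≤ (G * s + μ * CS * m * ‖S‖) / n := by
      have hsm : ∀ {x : Mat d d}, ‖x‖ ≤ G * s + μ * CS * m * ‖S‖ →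
          ‖(n : ℝ)⁻¹ • x‖ ≤ (G * s + μ * CS * m * ‖S‖) / n := fun hx => by
        rw [norm_smul, norm_eq_abs, abs_of_nonneg (by positivity), inv_mul_eq_div]
        gcongr
      have q0 : 0 ≤ μ * CS * m * ‖S‖ := by positivity
      have q1 : 0 ≤ α * CS * s := by positivity
      have q2 : 0 ≤ CS * a⁻¹ * s := by positivity
      have q3 : 0 ≤ a⁻¹ * CS * a⁻¹ * s := by positivity
      have eG : G * s = α * CS * s + CS * a⁻¹ * s + a⁻¹ * CS * a⁻¹ * s := by rw [hG]; ring
      rw [hmean]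
      refine norm_prod_le_iff.2 ⟨hsm ?_, norm_prod_le_iff.2 ⟨hsm ?_, hsm ?_⟩⟩
      · refine (norm_add_le _ _).trans ?_
        rw [norm_smul, norm_smul, norm_smul, norm_eq_abs, norm_eq_abs, norm_eq_abs,
          abs_of_nonneg hα0.le, abs_of_nonneg hμ0, abs_of_nonneg measureReal_nonneg]
        have h1 := mul_le_mul_of_nonneg_left hS.coef_le hα0.le
        have h2 := mul_le_mul_of_nonneg_left (mul_le_mul hS.fail_le hAS (norm_nonneg _) (by positivity)) hμ0
        linarith
      · refine (norm_mul_le_mul _ _).trans ((mul_le_mul hS.cross_le hAi (norm_nonneg _) (by positivity)).trans ?_)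
        linarith
      · refine (norm_mul_le_mul _ _).trans ((mul_le_mul ((norm_mul_le_mul _ _).trans
          (mul_le_mul hAi hS.energy_le (norm_nonneg _) ha'.le)) hAi (norm_nonneg _) (by positivity)).trans ?_)
        linarith
    have hsqrt : s ^ 2 = fourthSum X + 1 / n := sq_sqrt (by positivity)
    have hmm : m ^ 2 ≤ m := by nlinarith
    have h1 : (G * s + μ * CS * m * ‖S‖) ^ 2 ≤
        (2 * G ^ 2 + 2 * (μ * CS) ^ 2) * (fourthSum X + 1 / n + ‖S‖ ^ 2 * m) := by
      have h2 : (G * s + μ * CS * m * ‖S‖) ^ 2 ≤ 2 * G ^ 2 * s ^ 2 + 2 * (μ * CS) ^ 2 * (‖S‖ ^ 2 * m ^ 2) := by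
        nlinarith [sq_nonneg (G * s - μ * CS * m * ‖S‖)]
      have h3 : 2 * (μ * CS) ^ 2 * (‖S‖ ^ 2 * m ^ 2) ≤ 2 * (μ * CS) ^ 2 * (‖S‖ ^ 2 * m) := by gcongr
      have h4 : 0 ≤ 2 * G ^ 2 * (‖S‖ ^ 2 * m) := by positivity
      have h5 : 0 ≤ 2 * (μ * CS) ^ 2 * (fourthSum X + 1 / n) := by positivity
      rw [hsqrt] at h2
      linarith
    calc _ ≤ ((G * s + μ * CS * m * ‖S‖) / n) ^ 2 := by gcongr
      _ = (G * s + μ * CS * m * ‖S‖) ^ 2 / n ^ 2 := div_pow _ _ _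
      _ ≤ (2 * G ^ 2 + 2 * (μ * CS) ^ 2) * (fourthSum X + 1 / n + ‖S‖ ^ 2 * m) / n ^ 2 :=
        div_le_div_of_nonneg_right h1 (by positivity)
      _ = (2 * G ^ 2 + 2 * (μ * CS) ^ 2) / n ^ 2 * (fourthSum X + 1 / n + ‖S‖ ^ 2 * m) := by ring
      _ ≤ _ := mul_le_mul_of_nonneg_right (div_le_div_of_nonneg_right
          (by linarith [show 0 ≤ (2 * B ^ 2 + 2 * μ ^ 2) * |M 8| by positivity]) (by positivity)) (by positivity)
  · have hCC : CF ≤ (2 * B ^ 2 + 2 * μ ^ 2) * |M 8| + (2 * G ^ 2 + 2 * (μ * CS) ^ 2) + CF := by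
      linarith [show 0 ≤ (2 * B ^ 2 + 2 * μ ^ 2) * |M 8| + (2 * G ^ 2 + 2 * (μ * CS) ^ 2) by positivity]
    refine hle.trans (add_le_add (mul_le_mul_of_nonneg_right (add_le_add le_rfl ?_) hh0) ?_)
    · gcongr
    · gcongr

end PetrelsDriftBounds

/-! ### Convergence of PETRELS -/

section PetrelsEstimate
variable {n d : ℕ} {κ : Measure (Fin d → ℝ)} {ν : Measure ℝ} {α σ ε μ δ c r T : ℝ} {lam : Fin d → ℝ}
  {Q₀ W₀ : Mat d d}

theorem exp_neg_le_one_sub_pow {k : ℕ} (hn : 1 ≤ n) (hμ : 0 ≤ μ) (hμn : 2 * μ ≤ n)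
    (hk : (k : ℝ) ≤ n * T) : exp (-(2 * μ * T)) ≤ (1 - μ / n) ^ k := by
  have hn0 : (0 : ℝ) < n := by positivity
  have hx0 : 0 ≤ μ / n := by positivity
  have hx1 : μ / n ≤ 1 / 2 := by rw [div_le_iff₀ hn0]; linarith
  have hkx : k * (μ / n) ≤ μ * T := by
    rw [mul_div_assoc', div_le_iff₀ hn0]
    have := mul_le_mul_of_nonneg_left hk hμ
    linarith
  generalize μ / n = x at *
  have h1 : exp (-(2 * x)) ≤ 1 - x := by
    rw [Real.exp_neg, inv_le_iff_one_le_mul₀' (exp_pos _)]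
    have h2 := mul_le_mul_of_nonneg_right (Real.add_one_le_exp (2 * x)) (by linarith : (0 : ℝ) ≤ 1 - x)
    nlinarith
  calc exp (-(2 * μ * T)) ≤ exp (k * -(2 * x)) := Real.exp_le_exp.2 (by linarith)
    _ = exp (-(2 * x)) ^ k := Real.exp_nat_mul _ _
    _ ≤ _ := by gcongr

theorem cosSim_mul_matSqrt {U X : Mat n d} (hX : (Xᵀ * X).PosDef) :
    cosSim U X * matSqrt (Xᵀ * X) = Uᵀ * X := by
  rw [cosSim, mmul_assoc, invSqrt_mul_matSqrt hX, mmul_one]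

/-- The cosine similarity is a Lipschitz function of `(Uᵀ X, Xᵀ X)`. -/
theorem norm_cosSim_sub_le {U X : Mat n d} (hU : Uᵀ * U = 1) (hc : 0 < c)
    (hX : AtLeast c (Xᵀ * X)) (K : Mat d d) {W : Mat d d}
    (hW : AtLeast c W) : ‖cosSim U X - K * invSqrt W‖ ≤
      (‖Uᵀ * X - K‖ + √d / (2 * √c) * ‖Xᵀ * X - W‖) * √c⁻¹ := by
  have e : cosSim U X - K * invSqrt W =
      ((Uᵀ * X - K) + cosSim U X * (matSqrt W - matSqrt (Xᵀ * X))) * invSqrt W := by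
    rw [mmul_sub, cosSim_mul_matSqrt (hX.posDef hc), madd_mul, msub_mul, msub_mul,
      mmul_assoc (cosSim U X), matSqrt_mul_invSqrt (hW.posDef hc), mmul_one]
    abel
  have h1 : ‖matSqrt W - matSqrt (Xᵀ * X)‖ ≤ √d / (2 * √c) * ‖Xᵀ * X - W‖ := by
    rw [norm_sub_rev]; exact norm_matSqrt_sub_le hc hX hW
  rw [e]
  refine (norm_mul_le_mul _ _).trans (mul_le_mul ((norm_add_le _ _).trans (add_le_add le_rfl ?_))
    (le_sqrt_of_sq_le (norm_invSqrt_sq_le hc hW)) (norm_nonneg _) (by positivity))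
  refine (norm_mul_le_mul _ _).trans ((mul_le_mul (norm_cosSim_le_one hU X) h1 (norm_nonneg _)
    zero_le_one).trans_eq (one_mul _))

theorem norm_transpose_mul_sub_le {U X : Mat n d} (hU : Uᵀ * U = 1) (hc : 0 < c)
    (hX : AtLeast c (Xᵀ * X)) (Q : Mat d d) {W : Mat d d}
    (hW : AtLeast c W) : ‖Uᵀ * X - Q * matSqrt W‖ ≤
      √d / (2 * √c) * ‖Xᵀ * X - W‖ + ‖matSqrt W‖ * ‖cosSim U X - Q‖ := by
  have e : Uᵀ * X - Q * matSqrt W =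
      cosSim U X * (matSqrt (Xᵀ * X) - matSqrt W) + (cosSim U X - Q) * matSqrt W := by
    rw [mmul_sub, cosSim_mul_matSqrt (hX.posDef hc), msub_mul]
    abel
  rw [e]
  refine (norm_add_le _ _).trans (add_le_add ?_ ?_)
  · refine (norm_mul_le_mul _ _).trans ((mul_le_mul (norm_cosSim_le_one hU X)
      (norm_matSqrt_sub_le hc hX hW) (norm_nonneg _) zero_le_one).trans_eq (one_mul _))
  · rw [mul_comm]; exact norm_mul_le_mul _ _

theorem sq_norm_le_fourthSum (X : Mat n d) : ‖X‖ ^ 2 ≤ n * d + fourthSum X := by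
  refine (sq_norm_le_sum X).trans ?_
  have e : (n : ℝ) * d + fourthSum X = ∑ i, ∑ j, (1 + X i j ^ 4) := by
    simp [fourthSum, sum_add_distrib]
  rw [e]
  refine sum_le_sum fun i _ => sum_le_sum fun j _ => ?_
  nlinarith [sq_nonneg (X i j ^ 2 - 1), sq_nonneg (X i j)]

theorem petrelsDomain_init (hn : 1 ≤ n) (hδ : 0 < δ) {X : Mat n d}
    (hX : AtLeast c (Xᵀ * X)) :
    (n : ℝ)⁻¹ • ((δ / n) • (1 : Mat d d))⁻¹ = δ⁻¹ • 1 ∧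
      PetrelsDomain δ⁻¹ c (X, (δ / n) • (1 : Mat d d)) := by
  have hn0 : (0 : ℝ) < n := by positivity
  have e : (n : ℝ)⁻¹ • ((δ / n) • (1 : Mat d d))⁻¹ = δ⁻¹ • 1 := by
    have : ((δ / n) • (1 : Mat d d))⁻¹ = (n / δ) • 1 := by
      apply inv_eq_right_inv
      rw [msmul_mul, mmul_smul, mone_mul, smul_smul]
      field_simp
      exact one_smul _ _
    rw [this, smul_smul]
    congr 1
    field_simp
  refine ⟨e, Matrix.PosDef.one.smul (by positivity), ?_, hX⟩
  rw [e]
  exact ⟨by rw [transpose_smul, Matrix.transpose_one], fun x => by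
    rw [smul_mulVec, one_mulVec, dotProduct_smul, smul_eq_mul]⟩

theorem PetrelsDomain.iterate (hn : 1 ≤ n) (hε : 0 < ε) (hα : 0 ≤ α) (hμ : 0 ≤ μ) (hμn : 2 * μ ≤ n)
    (hδ : 0 < δ) {U X : Mat n d} (hX : AtLeast c (Xᵀ * X)) (ξ : ℕ → Draw n d) {k : ℕ}
    (hk : (k : ℝ) ≤ n * T) : PetrelsDomain (exp (-(2 * μ * T)) * δ⁻¹) c
      (petrelsIter ε α μ δ X (fun k => observe U (ξ k)) k) := by
  have hn0 : (0 : ℝ) < n := by positivity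
  have hγ : 0 < 1 - μ / n := by
    rw [sub_pos, div_lt_one hn0]
    rcases hμ.eq_or_lt with h | h <;> linarith
  have hγ1 : 1 - μ / n ≤ 1 := by linarith [div_nonneg hμ hn0.le]
  have hδ' : 0 < δ⁻¹ := inv_pos.2 hδ
  have h : ∀ k, PetrelsDomain ((1 - μ / n) ^ k * δ⁻¹) c
      (petrelsIter ε α μ δ X (fun k => observe U (ξ k)) k) := fun k => by
    induction k with
    | zero => rw [pow_zero, one_mul]; exact (petrelsDomain_init hn hδ hX).2
    | succ k ih =>
      rw [pow_succ', mul_assoc]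
      exact ih.step hε hα hγ hγ1 (by positivity)
  exact ⟨(h k).posDef, (h k).atLeast_inv.mono
    (mul_le_mul_of_nonneg_right (exp_neg_le_one_sub_pow hn hμ hμn hk) hδ'.le), (h k).atLeast_gram⟩

theorem measureReal_compl_le_of_integral_norm_le {Ω : Type*} [MeasurableSpace Ω] {P : Measure Ω}
    [IsFiniteMeasure P] {f : Ω → ℝ} {p : Ω → Prop} (hf : Integrable f P) (hf0 : ∀ ω, 0 ≤ f ω)
    (hp : ∀ᵐ ω ∂P, p ω) (hr : 0 < r) {C : ℝ} (hC : ∫ ω, f ω ∂P ≤ C) :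
    P.real {ω | f ω ≤ r ∧ p ω}ᶜ ≤ r⁻¹ * C := by
  have h1 := mul_meas_ge_le_integral_of_nonneg (Filter.Eventually.of_forall hf0) hf r
  have h2 : P.real {ω | f ω ≤ r ∧ p ω}ᶜ ≤ P.real {ω | r ≤ f ω} :=
    ENNReal.toReal_mono (measure_ne_top _ _) (measure_mono_ae (by
      filter_upwards [hp] with ω hω h
      by_contra h'
      exact h ⟨(not_le.1 h').le, hω⟩))
  rw [inv_mul_eq_div, le_div_iff₀ hr]
  have := mul_le_mul_of_nonneg_left h2 hr.le
  linarith

end PetrelsEstimate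

section PetrelsLimit
variable {d : ℕ} {κ : Measure (Fin d → ℝ)} {ν : Measure ℝ} {α σ ε μ δ c r T : ℝ} {lam : Fin d → ℝ}
  {Q₀ W₀ : Mat d d}

set_option maxHeartbeats 1000000 in
/-- On an event of probability `1 - O(n ^ (-1/2))` the PETRELS triple follows the solution of the
extended equation. -/
theorem exists_petrels_estimate (hν : IsNoiseLaw ν σ) (hκ : IsCoefLaw κ lam) (hα : α ∈ Ioo (0 : ℝ) 1)
    (hε : 0 < ε) (hμ : 0 ≤ μ) (hδ : 0 < δ) (hc : 0 < c) (hεc : ε < α * c) (hr : 0 < r)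
    (hW₀ : AtLeast (c + r) W₀) (hT : 0 ≤ T) (CI CQ CW : ℝ) {g : Triple d → Triple d} {L : ℝ} (hL : 0 ≤ L)
    (hg : ∀ x y, ‖g x - g y‖ ≤ L * ‖x - y‖)
    (hgf : EqOn g (petrelsField α σ μ lam) (petrelsRegion d (exp (-(2 * μ * T)) * δ⁻¹) c))
    {s : ℝ → Triple d} (hsc : Continuous s)
    (hs : ∀ t ∈ Icc 0 T, s t = (δ⁻¹ • 1, Q₀ * matSqrt W₀, W₀) + ∫ u in (0 : ℝ)..t, g (s u)) :
    ∃ C : ℝ, 0 ≤ C ∧ ∀ {Ω : Type*} [MeasurableSpace Ω] {P : Measure Ω} [IsProbabilityMeasure P] {n : ℕ}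
      {U : Mat n d} {X₀ : Ω → Mat n d} {ξ : ℕ → Ω → Draw n d},
      1 ≤ n → 2 * μ ≤ n → μ < n → IsIncoherentStream P κ ν α CI CQ Q₀ U X₀ ξ →
      ∫ ω, ‖(X₀ ω)ᵀ * X₀ ω - W₀‖ ∂P ≤ CW / √n → ∀ t ∈ Icc 0 T,
      ∃ E : Set Ω, MeasurableSet E ∧ P.real Eᶜ ≤ C / √n ∧
        (∀ ω ∈ E, PetrelsDomain (exp (-(2 * μ * T)) * δ⁻¹) c
          (petrelsIter ε α μ δ (X₀ ω) (fun k => observe U (ξ k ω)) ⌊n * t⌋₊)) ∧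
        ∫⁻ ω in E, ofReal ‖petrelsState U (petrelsIter ε α μ δ (X₀ ω)
          (fun k => observe U (ξ k ω)) ⌊n * t⌋₊) - s t‖ ∂P ≤ ofReal (C / √n) := by
  have hδ' : 0 < δ⁻¹ := inv_pos.2 hδ
  have ha : 0 < exp (-(2 * μ * T)) * δ⁻¹ := mul_pos (exp_pos _) hδ'
  obtain ⟨C₁, hC₁, hdrift⟩ := exists_petrels_driftBounds hν hκ hα hε ha hc hεc hμ CI
  have hgc : Continuous g := continuous_of_norm_sub_le hL hg
  have hint : IntervalIntegrable (fun u => g (s u)) volume 0 T := (hgc.comp hsc).intervalIntegrable _ _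
  obtain ⟨M, hM⟩ := isCompact_Icc.exists_bound_of_continuousOn (s := Icc 0 T) (hgc.comp hsc).continuousOn
  have hM0 : 0 ≤ M := (norm_nonneg _).trans (hM 0 ⟨le_rfl, hT⟩)
  obtain ⟨C, hC, hest⟩ := exists_chain_estimate (g := fun _ => g) (Q := s)
    (B₀ := δ⁻¹ + (1 + ‖W₀‖ + r)) (C₁ := C₁) (C₂ := CI) (V := fun _ => 0)
    (x₀ := (δ⁻¹ • 1, Q₀ * matSqrt W₀, W₀)) (M := M) hT hL hC₁ hs hint (fun _ _ => hg) hM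
    (fun _ _ _ _ _ => by simp)
  have hs0 : s 0 = (δ⁻¹ • 1, Q₀ * matSqrt W₀, W₀) := by rw [hs 0 ⟨le_rfl, hT⟩]; simp
  set l := √d / (2 * √c)
  have hl0 : 0 ≤ l := by positivity
  set C' : ℝ := (1 + l) * |CW| + ‖matSqrt W₀‖ * |CQ| with hC'
  have hC'0 : 0 ≤ C' := by positivity
  refine ⟨(C + C * C' + M) + r⁻¹ * |CW|, by positivity, ?_⟩
  intro Ω _ P _ n U X₀ ξ hn hμn hμn' ⟨hU, hst, hUf, hXf, hQ⟩ hW t ht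
  have hn0 : (0 : ℝ) < n := by positivity
  have hsn : 0 < √(n : ℝ) := sqrt_pos.2 hn0
  have hmeas0 : Measurable X₀ := hst.measurable_init
  have hWm : Measurable fun ω => ‖(X₀ ω)ᵀ * X₀ ω - W₀‖ := ((measurable_gram hmeas0).sub_const W₀).norm
  have hWi : Integrable (fun ω => ‖(X₀ ω)ᵀ * X₀ ω - W₀‖) P := by
    refine Integrable.mono' (integrable_const (n * d + CI / n + ‖W₀‖)) hWm.aestronglyMeasurable ?_
    filter_upwards [hXf] with ω hω
    rw [norm_norm]
    refine (norm_sub_le _ _).trans (add_le_add ?_ le_rfl)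
    rw [norm_transpose_mul_self]
    exact (sq_norm_le_fourthSum _).trans (add_le_add le_rfl hω)
  have hQi := integrable_norm_cosSim_sub (P := P) hU hmeas0 Q₀
  have hgram : ∀ {x : Mat n d}, ‖xᵀ * x - W₀‖ ≤ r → AtLeast c (xᵀ * x) := fun hx => by
    rw [norm_sub_rev] at hx
    have h := hW₀.of_norm_sub_le (by rw [transpose_mul, transpose_transpose]) hx
    rwa [add_sub_cancel_right] at h
  set p₀ : Mat n d → Mat n d × Mat d d :=
    fun x => (x, (δ / n) • 1) with hp₀
  have hp₀m : Measurable p₀ := measurable_id.prodMk measurable_const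
  set G : Set (Mat n d × Mat d d) :=
    {p | (‖p.1ᵀ * p.1 - W₀‖ ≤ r ∧ fourthSum p.1 ≤ CI / n) ∧ p.2 = (δ / n) • 1} with hG
  have hGm : MeasurableSet G :=
    ((measurableSet_le ((measurable_gram measurable_fst).sub_const W₀).norm measurable_const).inter
      (measurableSet_le (measurable_fourthSum.comp measurable_fst) measurable_const)).inter
      (measurableSet_eq_fun measurable_snd measurable_const)
  set E : Set Ω := (fun ω => p₀ (X₀ ω)) ⁻¹' G with hE
  have hEm : MeasurableSet E := (hp₀m.comp hmeas0) hGm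
  have hEG : E = {ω | ‖(X₀ ω)ᵀ * X₀ ω - W₀‖ ≤ r ∧ fourthSum (X₀ ω) ≤ CI / n} := by
    ext ω; simp [hE, hG, hp₀]
  have hdom : ∀ ω ∈ E, ∀ k : ℕ, (k : ℝ) ≤ n * T → PetrelsDomain (exp (-(2 * μ * T)) * δ⁻¹) c
      (petrelsIter ε α μ δ (X₀ ω) (fun k => observe U (ξ k ω)) k) := fun ω hω k hk =>
    PetrelsDomain.iterate hn hε hα.1.le hμ hμn hδ (hgram hω.1.1) (fun k => ξ k ω) hk
  obtain ⟨hkT, hfloor⟩ := norm_sub_le_of_floor (Q := s) hn hM0 ht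
    fun u hu => norm_sub_le_of_integral (g := fun _ => g) hs hint hM hu ht
  have hbound := hest (Φ := fun _ p z => petrelsStep ε α (1 - μ / n) p (observe U z))
    (X₀ := fun ω => p₀ (X₀ ω)) (ξ := ξ)
    (X := fun ω k => petrelsIter ε α μ δ (X₀ ω) (fun k => observe U (ξ k ω)) k)
    (S := petrelsState U) (h := fun p => fourthSum p.1) (G := G) hn (hp₀m.comp hmeas0) hst.measurable_draw
    hst.indep (hst.indep_init.comp hp₀m measurable_id) (fun _ => measurable_petrelsStep' U ε α _)
    (fun _ => rfl) (fun _ _ => rfl) hst.law hGm (measurable_petrelsState U)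
    (measurable_fourthSum.comp measurable_fst) (fun _ => fourthSum_nonneg _)
    (fun p hp => by
      have hgr : ‖p.1ᵀ * p.1‖ ≤ ‖W₀‖ + r := by
        have := norm_add_le W₀ (p.1ᵀ * p.1 - W₀)
        rw [add_sub_cancel] at this
        linarith [hp.1.1]
      have hnn := norm_nonneg W₀
      have e := (petrelsDomain_init hn hδ (hgram hp.1.1)).1
      refine norm_prod_le_iff.2 ⟨?_, norm_prod_le_iff.2 ⟨?_, ?_⟩⟩
      · simp only [petrelsState]
        rw [hp.2, e, norm_smul, norm_eq_abs, abs_of_pos hδ']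
        have := mul_le_of_le_one_right hδ'.le (norm_one_le_one (d := d))
        linarith
      · simp only [petrelsState]
        refine (norm_mul_le_mul _ _).trans ((mul_le_of_le_one_left (norm_nonneg _)
          (by rw [norm_transpose]; exact norm_le_one_of_isometry hU)).trans ?_)
        rw [norm_transpose_mul_self] at hgr
        nlinarith [sq_nonneg (‖p.1‖ - 1)]
      · simp only [petrelsState]
        linarith)
    (fun p hp => hp.1.2)
    (fun k hk ω hω => by
      have hp := hdom ω hω k (le_trans (by push_cast; linarith) hk)
      exact hdrift hn hU hUf hμn' hp (hgf (petrelsState_mem_region hU hc hp))) _ hkT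
  refine ⟨E, hEm, ?_, fun ω hω => hdom ω hω _ hkT, ?_⟩
  · rw [hEG]
    refine (measureReal_compl_le_of_integral_norm_le hWi (fun ω => norm_nonneg _) hXf hr hW).trans ?_
    rw [← mul_div_assoc]
    refine div_le_div_of_nonneg_right ?_ hsn.le
    have := mul_le_mul_of_nonneg_left (le_abs_self CW) (inv_nonneg.2 hr.le)
    have : 0 ≤ C + C * C' + M := by positivity
    linarith
  have hinit : ∫⁻ ω in E, ofReal ‖petrelsState U (p₀ (X₀ ω)) - s 0‖ ∂P ≤
      ofReal (C' / √n) := by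
    have hfi : Integrable (fun ω => (1 + l) * ‖(X₀ ω)ᵀ * X₀ ω - W₀‖ +
        ‖matSqrt W₀‖ * ‖cosSim U (X₀ ω) - Q₀‖) P := (hWi.const_mul _).add (hQi.const_mul _)
    calc _ ≤ ∫⁻ ω in E, ofReal ((1 + l) * ‖(X₀ ω)ᵀ * X₀ ω - W₀‖ +
          ‖matSqrt W₀‖ * ‖cosSim U (X₀ ω) - Q₀‖) ∂P := by
          refine setLIntegral_mono' hEm fun ω hω => ofReal_le_ofReal ?_
          have hX := hgram hω.1.1
          have h1 := norm_transpose_mul_sub_le hU hc hX Q₀ (hW₀.mono (by linarith))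
          have h2 := norm_nonneg ((X₀ ω)ᵀ * X₀ ω - W₀)
          have h3 : 0 ≤ ‖matSqrt W₀‖ * ‖cosSim U (X₀ ω) - Q₀‖ := by positivity
          have h4 : 0 ≤ l * ‖(X₀ ω)ᵀ * X₀ ω - W₀‖ := by positivity
          have e := (petrelsDomain_init hn hδ hX).1
          rw [hs0]
          refine norm_prod_le_iff.2 ⟨?_, norm_prod_le_iff.2 ⟨?_, ?_⟩⟩
          · simp only [petrelsState, hp₀, Prod.fst_sub, e, sub_self, norm_zero]
            linarith
          · simp only [petrelsState, hp₀, Prod.snd_sub, Prod.fst_sub]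
            linarith
          · simp only [petrelsState, hp₀, Prod.snd_sub]
            linarith
      _ ≤ _ := by
          refine (setLIntegral_le_lintegral _ _).trans ?_
          rw [← ofReal_integral_eq_lintegral_ofReal hfi (ae_of_all _ fun ω => by positivity),
            integral_add (hWi.const_mul _) (hQi.const_mul _), integral_const_mul, integral_const_mul]
          refine ofReal_le_ofReal ?_
          have h1 : CW / √n ≤ |CW| / √n := div_le_div_of_nonneg_right (le_abs_self _) hsn.le
          have h2 : CQ / √n ≤ |CQ| / √n := div_le_div_of_nonneg_right (le_abs_self _) hsn.le
          rw [hC', add_div, mul_div_assoc, mul_div_assoc]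
          exact add_le_add (mul_le_mul_of_nonneg_left (hW.trans h1) (by positivity))
            (mul_le_mul_of_nonneg_left (hQ.trans h2) (norm_nonneg _))
  set k := ⌊(n : ℝ) * t⌋₊ with hk
  calc _ ≤ ∫⁻ ω in E, (ofReal ‖petrelsState U (petrelsIter ε α μ δ (X₀ ω)
          (fun k => observe U (ξ k ω)) k) - s (k / n)‖ + ofReal (M / √n)) ∂P := by
        refine lintegral_mono fun ω => ?_
        rw [← ofReal_add (norm_nonneg _) (by positivity)]
        exact ofReal_le_ofReal
          ((norm_sub_le_norm_sub_add_norm_sub _ _ _).trans (add_le_add le_rfl hfloor))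
    _ ≤ (ofReal (C / √n) + ofReal C * ofReal (C' / √n)) +
          ofReal (M / √n) := by
        rw [lintegral_add_right _ measurable_const, setLIntegral_const]
        exact add_le_add (hbound.trans (add_le_add le_rfl (mul_le_mul' le_rfl hinit)))
          (mul_le_of_le_one_right (by positivity) prob_le_one)
    _ ≤ _ := by
        rw [← ofReal_mul hC, ← ofReal_add (by positivity) (by positivity),
          ← ofReal_add (by positivity) (by positivity)]
        refine ofReal_le_ofReal ?_
        have e : C / √n + C * (C' / √n) + M / √n = (C + C * C' + M) / √n := by ring
        rw [e]
        refine div_le_div_of_nonneg_right ?_ hsn.le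
        have : 0 ≤ r⁻¹ * |CW| := by positivity
        linarith

end PetrelsLimit

section PetrelsSolution
variable {d : ℕ} {κ : Measure (Fin d → ℝ)} {ν : Measure ℝ} {α σ ε μ δ c r T : ℝ} {lam : Fin d → ℝ}
  {Q₀ W₀ A₀ K₀ : Mat d d} {A K W A' K' W' : ℝ → Mat d d}

theorem IsPetrelsSolution.hasDerivWithinAt (h : IsPetrelsSolution α σ μ lam A₀ K₀ W₀ T A K W) {t : ℝ}
    (ht : t ∈ Icc 0 T) : HasDerivWithinAt (fun t => ((A t, K t, W t) : Triple d))
      (petrelsField α σ μ lam (A t, K t, W t)) (Icc 0 T) t :=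
  (h.deriv_A t ht).prodMk ((h.deriv_K t ht).prodMk (h.deriv_W t ht))

theorem IsPetrelsSolution.eqOn (hu : IsPetrelsSolution α σ μ lam A₀ K₀ W₀ T A' K' W')
    (hv : IsPetrelsSolution α σ μ lam A₀ K₀ W₀ T A K W) (hpos : ∀ t ∈ Icc 0 T, (A t).PosDef ∧ (W t).PosDef) :
    EqOn A' A (Icc 0 T) ∧ EqOn K' K (Icc 0 T) ∧ EqOn W' W (Icc 0 T) := by
  have h := eqOn_of_hasDerivWithinAt (f := petrelsField α σ μ lam) (fun t => hu.hasDerivWithinAt)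
    (fun t => hv.hasDerivWithinAt)
    (by rw [hu.init_A, hu.init_K, hu.init_W, hv.init_A, hv.init_K, hv.init_W])
    fun t ht => (contDiffAt_petrelsField (x := (A t, K t, W t)) (hpos t ht).1 (hpos t ht).2).exists_lipschitzOnWith
  exact ⟨fun t ht => congrArg Prod.fst (h ht), fun t ht => congrArg (fun x => x.2.1) (h ht),
    fun t ht => congrArg (fun x => x.2.2) (h ht)⟩

theorem isPetrelsSolution_of_integral {g : Triple d → Triple d} (hg : Continuous g) {s : ℝ → Triple d}
    (hsc : Continuous s) (hs : ∀ t ∈ Icc 0 T, s t = (A₀, K₀, W₀) + ∫ u in (0 : ℝ)..t, g (s u)) (hT : 0 ≤ T)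
    (hgf : ∀ t ∈ Icc 0 T, g (s t) = petrelsField α σ μ lam (s t)) :
    IsPetrelsSolution α σ μ lam A₀ K₀ W₀ T (fun t => (s t).1) (fun t => (s t).2.1) fun t => (s t).2.2 := by
  have hs0 : s 0 = (A₀, K₀, W₀) := by rw [hs 0 ⟨le_rfl, hT⟩]; simp
  have hd : ∀ t ∈ Icc 0 T, HasDerivWithinAt s (petrelsField α σ μ lam (s t)) (Icc 0 T) t := fun t ht => by
    have h1 := (((hg.comp hsc).integral_hasStrictDerivAt 0 t).hasDerivAt.const_add
      ((A₀, K₀, W₀) : Triple d)).hasDerivWithinAt (s := Icc 0 T)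
    rw [← hgf t ht]
    exact h1.congr (fun u hu => hs u hu) (hs t ht)
  refine ⟨congrArg Prod.fst hs0, congrArg (fun x => x.2.1) hs0, congrArg (fun x => x.2.2) hs0,
    fun t ht => ?_, fun t ht => ?_, fun t ht => ?_⟩
  · exact (ContinuousLinearMap.fst ℝ _ _).hasFDerivAt.comp_hasDerivWithinAt t (hd t ht)
  · exact ((ContinuousLinearMap.fst ℝ _ _).comp
      (ContinuousLinearMap.snd ℝ _ _)).hasFDerivAt.comp_hasDerivWithinAt t (hd t ht)
  · exact ((ContinuousLinearMap.snd ℝ _ _).comp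
      (ContinuousLinearMap.snd ℝ _ _)).hasFDerivAt.comp_hasDerivWithinAt t (hd t ht)

theorem integral_norm_sub_le_of_event {E : Type*} [NormedAddCommGroup E] {Ω : Type*} [MeasurableSpace Ω]
    {P : Measure Ω} [IsProbabilityMeasure P] {S : Ω → ℝ} {Y : Ω → E} {A : Set Ω} {a b p C : ℝ}
    (hS : AEStronglyMeasurable S P) (hS0 : ∀ ω, 0 ≤ S ω) (hb : 0 ≤ b) (ha : 0 ≤ a) (hC : 0 ≤ C)
    (hA : MeasurableSet A) (hSb : ∀ ω, S ω ≤ b) (hSY : ∀ ω ∈ A, S ω ≤ a * ‖Y ω‖) (hp : P.real Aᶜ ≤ p)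
    (hY : ∫⁻ ω in A, ofReal ‖Y ω‖ ∂P ≤ ofReal C) : ∫ ω, S ω ∂P ≤ a * C + b * p := by
  have hp0 : 0 ≤ p := measureReal_nonneg.trans hp
  refine integral_le_of_lintegral_le hS hS0 (by positivity) ?_
  rw [← lintegral_add_compl _ hA, ofReal_add (by positivity) (by positivity), ofReal_mul ha,
    ofReal_mul hb]
  refine add_le_add ?_ ?_
  · calc _ ≤ ∫⁻ ω in A, ofReal a * ofReal ‖Y ω‖ ∂P := by
          refine setLIntegral_mono' hA fun ω hω => ?_
          rw [← ofReal_mul ha]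
          exact ofReal_le_ofReal (hSY ω hω)
      _ = ofReal a * ∫⁻ ω in A, ofReal ‖Y ω‖ ∂P :=
          lintegral_const_mul' _ _ ENNReal.ofReal_ne_top
      _ ≤ _ := mul_le_mul' le_rfl hY
  · calc _ ≤ ∫⁻ _ω in Aᶜ, ofReal b ∂P :=
          lintegral_mono fun ω => ofReal_le_ofReal (hSb ω)
      _ = ofReal b * P Aᶜ := setLIntegral_const _ _
      _ ≤ _ := by
          rw [← ofReal_measureReal (s := Aᶜ)]
          exact mul_le_mul' le_rfl (ofReal_le_ofReal hp)

variable {Ω : ℕ → Type*} [∀ n, MeasurableSpace (Ω n)] {P : ∀ n, Measure (Ω n)} [∀ n, IsProbabilityMeasure (P n)]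
  {U : ∀ n, Mat n d} {X₀ : ∀ n, Ω n → Mat n d} {ξ : ∀ n, ℕ → Ω n → Draw n d} {CI CQ : ℝ}

set_option maxHeartbeats 1000000 in
theorem exists_petrelsSolution_limit (hν : IsNoiseLaw ν σ) (hκ : IsCoefLaw κ lam) (hα : α ∈ Ioo (0 : ℝ) 1)
    (hε : 0 < ε) (hμ : 0 < μ) (hδ : 0 < δ) (hW₀ : (α • W₀ - ε • (1 : Mat d d)).PosDef)
    (hT : 0 ≤ T)
    (hU : ∀ n, 1 ≤ n → d ≤ n → IsIncoherentStream (P n) κ ν α CI CQ Q₀ (U n) (X₀ n) (ξ n))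
    {CW : ℝ} (hgram : ∀ n : ℕ, 1 ≤ n → d ≤ n → ∫ ω, ‖(X₀ n ω)ᵀ * X₀ n ω - W₀‖ ∂P n ≤ CW / √n) :
    ∃ A K W : ℝ → Mat d d,
      IsPetrelsSolution α σ μ lam (δ⁻¹ • 1) (Q₀ * matSqrt W₀) W₀ T A K W ∧
      (∀ t ∈ Icc 0 T, (A t).PosDef ∧ (W t).PosDef) ∧
      ∃ C : ℝ, ∀ t ∈ Icc 0 T, ∀ n : ℕ, 1 ≤ n → d ≤ n → μ < n →
        Integrable (fun ω => ‖cosSim (U n)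
          (petrelsIter ε α μ δ (X₀ n ω) (fun k => observe (U n) (ξ n k ω)) ⌊n * t⌋₊).1
            - K t * invSqrt (W t)‖) (P n) ∧
        ∫ ω, ‖cosSim (U n)
          (petrelsIter ε α μ δ (X₀ n ω) (fun k => observe (U n) (ξ n k ω)) ⌊n * t⌋₊).1
            - K t * invSqrt (W t)‖ ∂P n ≤ C / √n := by
  have hα0 := hα.1
  obtain ⟨η, hη, hηW⟩ := exists_atLeast_of_posDef hW₀
  set c : ℝ := (ε + η / 2) / α with hcdef
  set r : ℝ := η / (2 * α) with hrdef
  have hr : 0 < r := by positivity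
  have hc : 0 < c := by positivity
  have hεc : ε < α * c := by rw [hcdef, mul_div_cancel₀ _ hα0.ne']; linarith
  have hcr : AtLeast (c + r) W₀ := by
    have h1 := hηW.add_posSemidef (B := ε • 1) (Matrix.PosSemidef.one.smul hε.le)
    rw [sub_add_cancel] at h1
    have h2 : AtLeast (η + ε) (α • W₀) := by
      refine ⟨h1.1, fun x => ?_⟩
      have h3 := hηW.2 x
      rw [sub_mulVec, dotProduct_sub, smul_mulVec ε, one_mulVec, dotProduct_smul,
        smul_eq_mul] at h3
      linarith
    have h3 := h2.smul (inv_nonneg.2 hα0.le)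
    rw [smul_smul, inv_mul_cancel₀ hα0.ne', one_smul] at h3
    exact h3.mono (by rw [hcdef, hrdef]; field_simp; linarith)
  clear_value c r
  set a : ℝ := exp (-(2 * μ * T)) * δ⁻¹
  have ha : 0 < a := by positivity
  obtain ⟨Kf, hKf⟩ := exists_lipschitzOnWith_petrelsField (d := d) ha hc α σ μ lam
  obtain ⟨L, hL, g, hg, hgf⟩ := exists_lipschitz_extension_of_lipschitzOnWith hKf
  have hgc : Continuous g := continuous_of_norm_sub_le hL hg
  obtain ⟨s, hsc, hs⟩ := exists_integral_solution (g := fun _ => g) hT hL (fun _ _ => hg)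
    (fun u hu => (hgc.comp hu).intervalIntegrable _ _) (δ⁻¹ • 1, Q₀ * matSqrt W₀, W₀)
  obtain ⟨C, hC, hest⟩ := exists_petrels_estimate hν hκ hα hε hμ.le hδ hc hεc hr hcr hT CI CQ CW hL hg hgf
    hsc hs
  have hmem : ∀ t ∈ Icc 0 T, s t ∈ petrelsRegion d a c := fun t ht => by
    refine mem_of_forall_lintegral_le (isClosed_petrelsRegion hc) (P := P) (N := max (max 1 d) (⌈2 * μ⌉₊))
      (C := C) hC (S := fun n ω => petrelsState (U n) (petrelsIter ε α μ δ (X₀ n ω)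
        (fun k => observe (U n) (ξ n k ω)) ⌊n * t⌋₊)) fun n hn => ?_
    have h1 : 1 ≤ n := ((le_max_left _ _).trans (le_max_left _ _)).trans hn
    have h2 : d ≤ n := ((le_max_right _ _).trans (le_max_left _ _)).trans hn
    have h3 : 2 * μ ≤ n := Nat.ceil_le.1 ((le_max_right _ _).trans hn)
    obtain ⟨E, hE, hPE, hdom, hint⟩ := hest (P := P n) h1 h3 (by linarith) (hU n h1 h2) (hgram n h1 h2) t ht
    exact ⟨E, hE, hPE, fun ω hω => petrelsState_mem_region (hU n h1 h2).isom hc (hdom ω hω), hint⟩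
  refine ⟨fun t => (s t).1, fun t => (s t).2.1, fun t => (s t).2.2,
    isPetrelsSolution_of_integral hgc hsc hs hT fun t ht => hgf (hmem t ht),
    fun t ht => ⟨(hmem t ht).1.posDef ha, (hmem t ht).2.1.posDef hc⟩, ?_⟩
  obtain ⟨MS, hMS⟩ := isCompact_Icc.exists_bound_of_continuousOn (s := Icc 0 T) hsc.continuousOn
  have hMS0 : 0 ≤ MS := (norm_nonneg _).trans (hMS 0 ⟨le_rfl, hT⟩)
  set l := √d / (2 * √c)
  have hl0 : 0 ≤ l := by positivity
  refine ⟨((1 + l) * √c⁻¹ * C + (1 + MS * √c⁻¹) * C) + (1 + MS * √c⁻¹) * √(2 * μ),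
    fun t ht n hn hdn hμn => ?_⟩
  have hn0 : (0 : ℝ) < n := by positivity
  have hsn : 0 < √(n : ℝ) := sqrt_pos.2 hn0
  obtain ⟨hUn, hst, -, -, -⟩ := hU n hn hdn
  have hWt := (hmem t ht).2.1
  have hQt : ‖(s t).2.1 * invSqrt (s t).2.2‖ ≤ MS * √c⁻¹ :=
    (norm_mul_le_mul _ _).trans (mul_le_mul ((norm_fst_le (s t).2).trans ((norm_snd_le _).trans (hMS t ht)))
      (le_sqrt_of_sq_le (norm_invSqrt_sq_le hc hWt)) (norm_nonneg _) hMS0)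
  have hXm : Measurable fun ω => petrelsIter ε α μ δ (X₀ n ω) (fun k => observe (U n) (ξ n k ω)) ⌊n * t⌋₊ :=
    measurable_chain (X₀ := fun ω => (X₀ n ω, (δ / n) • 1)) (ξ := ξ n)
      (Φ := fun _ p z => petrelsStep ε α (1 - μ / n) p (observe (U n) z))
      (X := fun ω k => petrelsIter ε α μ δ (X₀ n ω) (fun k => observe (U n) (ξ n k ω)) k)
      (Measurable.prodMk (show Measurable (X₀ n) from hst.measurable_init) measurable_const)
      hst.measurable_draw (fun _ => measurable_petrelsStep' (U n) ε α _) (fun _ => rfl) (fun _ _ => rfl) _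
  have hi := integrable_norm_cosSim_sub (P := P n) hUn hXm.fst ((s t).2.1 * invSqrt (s t).2.2)
  refine ⟨hi, ?_⟩
  have hbdd : ∀ ω, ‖cosSim (U n) (petrelsIter ε α μ δ (X₀ n ω) (fun k => observe (U n) (ξ n k ω)) ⌊n * t⌋₊).1
      - (s t).2.1 * invSqrt (s t).2.2‖ ≤ 1 + MS * √c⁻¹ := fun ω =>
    (norm_sub_le _ _).trans (add_le_add (norm_cosSim_le_one hUn _) hQt)
  rw [add_div]
  have hb0 : 0 ≤ 1 + MS * √c⁻¹ := by positivity
  rcases le_or_gt (2 * μ) n with h2 | h2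
  · obtain ⟨E, hE, hPE, hdom, hlint⟩ := hest (P := P n) hn h2 hμn (hU n hn hdn) (hgram n hn hdn) t ht
    have h3 := integral_norm_sub_le_of_event (a := (1 + l) * √c⁻¹) hi.aestronglyMeasurable
      (fun ω => norm_nonneg _) hb0 (by positivity) (by positivity) hE hbdd (fun ω hω => ?_) hPE hlint
    · refine h3.trans ?_
      have e : (1 + l) * √c⁻¹ * (C / √n) + (1 + MS * √c⁻¹) * (C / √n) =
          ((1 + l) * √c⁻¹ * C + (1 + MS * √c⁻¹) * C) / √n := by ring
      rw [e]
      have : 0 ≤ (1 + MS * √c⁻¹) * √(2 * μ) / √n := by positivity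
      linarith
    · refine (norm_cosSim_sub_le hUn hc (hdom ω hω).atLeast_gram _ hWt).trans ?_
      generalize petrelsIter ε α μ δ (X₀ n ω) (fun k => observe (U n) (ξ n k ω)) ⌊n * t⌋₊ = p
      have k1 : ‖(U n)ᵀ * p.1 - (s t).2.1‖ ≤ ‖petrelsState (U n) p - s t‖ :=
        (norm_fst_le (petrelsState (U n) p - s t).2).trans (norm_snd_le _)
      have k2 : ‖p.1ᵀ * p.1 - (s t).2.2‖ ≤ ‖petrelsState (U n) p - s t‖ :=
        (norm_snd_le (petrelsState (U n) p - s t).2).trans (norm_snd_le _)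
      have k3 := mul_le_mul_of_nonneg_left k2 hl0
      calc _ ≤ ((1 + l) * ‖petrelsState (U n) p - s t‖) * √c⁻¹ :=
            mul_le_mul_of_nonneg_right (by linarith) (sqrt_nonneg _)
        _ = _ := by ring
  · have h3 : ∫ ω, ‖cosSim (U n) (petrelsIter ε α μ δ (X₀ n ω)
        (fun k => observe (U n) (ξ n k ω)) ⌊n * t⌋₊).1 - (s t).2.1 * invSqrt (s t).2.2‖ ∂P n ≤
        1 + MS * √c⁻¹ := by
      refine (integral_mono hi (integrable_const _) hbdd).trans_eq ?_
      simp
    have h4 : 1 + MS * √c⁻¹ ≤ (1 + MS * √c⁻¹) * √(2 * μ) / √n := by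
      rw [le_div_iff₀ hsn]
      gcongr
    have : 0 ≤ ((1 + l) * √c⁻¹ * C + (1 + MS * √c⁻¹) * C) / √n := by positivity
    linarith

end PetrelsSolution

end SubspaceTracking

theorem theorem3 {d : ℕ}
    -- signal strengths, noise level, subsampling ratio, test threshold
    {lam : Fin d → ℝ} (hlam : ∀ i, 0 < lam i)
    {σ : ℝ} (hσ : 0 < σ) {α : ℝ} (hα : α ∈ Ioo (0 : ℝ) 1) {ε : ℝ} (hε : 0 < ε)
    -- laws of the noise entries and of the coefficient vectors
    {ν : Measure ℝ} (hν : IsNoiseLaw ν σ)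
    {κ : Measure (Fin d → ℝ)} (hκ : IsCoefLaw κ lam)
    -- for every ambient dimension n: a probability space, a subspace, an initial guess, a stream
    {Ω : ℕ → Type*} [∀ n, MeasurableSpace (Ω n)]
    (P : ∀ n, Measure (Ω n)) [∀ n, IsProbabilityMeasure (P n)]
    (U : ∀ n, Matrix (Fin n) (Fin d) ℝ) (X₀ : ∀ n, Ω n → Matrix (Fin n) (Fin d) ℝ)
    (ξ : ∀ n, ℕ → Ω n → Draw n d)
    (hU : ∀ n, 1 ≤ n → d ≤ n → (U n)ᵀ * U n = 1)
    (hstream : ∀ n, 1 ≤ n → d ≤ n → IsStream (P n) κ ν α (X₀ n) (ξ n))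
    -- incoherence
    (hinc : ∃ C : ℝ, ∀ n : ℕ, 1 ≤ n → d ≤ n →
      fourthSum (U n) ≤ C / n ∧ ∀ᵐ ω ∂P n, fourthSum (X₀ n ω) ≤ C / n)
    -- initial cosine similarity
    (Q₀ : Matrix (Fin d) (Fin d) ℝ)
    (hinit : ∃ C : ℝ, ∀ n : ℕ, 1 ≤ n → d ≤ n →
      ∫ ω, ‖cosSim (U n) (X₀ n ω) - Q₀‖ ∂P n ≤ C / √n)
    (T : ℝ) (hT : 0 < T) :
    -- Oja's method and GROUSE
    (∀ τ : ℝ → ℝ, ε < α → (∀ t, 0 ≤ t → 0 ≤ τ t) → (∃ C : ℝ, ∀ t, 0 ≤ t → |τ t| ≤ C) →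
      LocallyBoundedVariationOn τ (Ici 0) →
      (∀ n, 1 ≤ n → d ≤ n → ∀ᵐ ω ∂P n, (X₀ n ω)ᵀ * X₀ n ω = 1) →
      ∃ Q : ℝ → Matrix (Fin d) (Fin d) ℝ, IsOjaSolution α σ lam τ Q₀ T Q ∧
        (∀ Q', IsOjaSolution α σ lam τ Q₀ T Q' → EqOn Q' Q (Icc 0 T)) ∧
        (∃ C : ℝ, ∀ t ∈ Icc 0 T, ∀ n : ℕ, 1 ≤ n → d ≤ n →
          Integrable (fun ω => ‖cosSim (U n)
            (ojaIter ε τ (X₀ n ω) (fun k => observe (U n) (ξ n k ω)) ⌊n * t⌋₊) - Q t‖) (P n) ∧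
          ∫ ω, ‖cosSim (U n)
            (ojaIter ε τ (X₀ n ω) (fun k => observe (U n) (ξ n k ω)) ⌊n * t⌋₊) - Q t‖ ∂P n
              ≤ C / √n) ∧
        (∃ C : ℝ, ∀ t ∈ Icc 0 T, ∀ n : ℕ, 1 ≤ n → d ≤ n →
          Integrable (fun ω => ‖cosSim (U n)
            (grouseIter ε τ (X₀ n ω) (fun k => observe (U n) (ξ n k ω)) ⌊n * t⌋₊) - Q t‖) (P n) ∧
          ∫ ω, ‖cosSim (U n)
            (grouseIter ε τ (X₀ n ω) (fun k => observe (U n) (ξ n k ω)) ⌊n * t⌋₊) - Q t‖ ∂P n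
              ≤ C / √n)) ∧
    -- simplified PETRELS
    (∀ (μ δ : ℝ) (W₀ : Matrix (Fin d) (Fin d) ℝ), 0 < μ → 0 < δ →
      (α • W₀ - ε • (1 : Matrix (Fin d) (Fin d) ℝ)).PosDef →
      (∃ C : ℝ, ∀ n : ℕ, 1 ≤ n → d ≤ n →
        ∫ ω, ‖(X₀ n ω)ᵀ * X₀ n ω - W₀‖ ∂P n ≤ C / √n) →
      ∃ A K W : ℝ → Matrix (Fin d) (Fin d) ℝ,
        IsPetrelsSolution α σ μ lam (δ⁻¹ • 1) (Q₀ * matSqrt W₀) W₀ T A K W ∧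
        (∀ A' K' W', IsPetrelsSolution α σ μ lam (δ⁻¹ • 1) (Q₀ * matSqrt W₀) W₀ T A' K' W' →
          EqOn A' A (Icc 0 T) ∧ EqOn K' K (Icc 0 T) ∧ EqOn W' W (Icc 0 T)) ∧
        (∀ t ∈ Icc 0 T, (A t).PosDef ∧ (W t).PosDef) ∧
        ∃ C : ℝ, ∀ t ∈ Icc 0 T, ∀ n : ℕ, 1 ≤ n → d ≤ n → μ < n →
          Integrable (fun ω => ‖cosSim (U n)
            (petrelsIter ε α μ δ (X₀ n ω) (fun k => observe (U n) (ξ n k ω)) ⌊n * t⌋₊).1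
              - K t * invSqrt (W t)‖) (P n) ∧
          ∫ ω, ‖cosSim (U n)
            (petrelsIter ε α μ δ (X₀ n ω) (fun k => observe (U n) (ξ n k ω)) ⌊n * t⌋₊).1
              - K t * invSqrt (W t)‖ ∂P n ≤ C / √n) := by
  obtain ⟨CI, hinc⟩ := hinc
  obtain ⟨CQ, hinit⟩ := hinit
  have hU : ∀ n, 1 ≤ n → d ≤ n → IsIncoherentStream (P n) κ ν α CI CQ Q₀ (U n) (X₀ n) (ξ n) := fun n hn hdn =>
    ⟨hU n hn hdn, hstream n hn hdn, (hinc n hn hdn).1, (hinc n hn hdn).2, hinit n hn hdn⟩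
  refine ⟨fun τ hεα hτ0 hτB hbv horth => ?_, fun μ δ W₀ hμ hδ hW₀ hgram => ?_⟩
  · obtain ⟨B, hB⟩ := hτB
    obtain ⟨Q, hQ, hlim⟩ := exists_ojaSolution_limit hν hκ hα hε hεα hT.le hU hτ0 hB hbv horth
    exact ⟨Q, hQ, fun Q' hQ' => hQ'.eqOn hT.le hB hbv hQ,
      hlim (fun t X o => ojaStep ε t X o) (orthonormalMethod_ojaStep hε hα)
        (fun n ω => ojaIter ε τ (X₀ n ω) fun k => observe (U n) (ξ n k ω)) (fun _ _ => rfl) fun _ _ _ => rfl,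
      hlim (fun t X o => grouseStep ε t X o) (orthonormalMethod_grouseStep hε hα)
        (fun n ω => grouseIter ε τ (X₀ n ω) fun k => observe (U n) (ξ n k ω)) (fun _ _ => rfl)
        fun _ _ _ => rfl⟩
  · obtain ⟨CW, hgram⟩ := hgram
    obtain ⟨A, K, W, hsol, hpos, hlim⟩ := exists_petrelsSolution_limit hν hκ hα hε hμ hδ hW₀ hT.le hU hgram
    exact ⟨A, K, W, hsol, fun A' K' W' h => h.eqOn hsol hpos, hpos, hlim⟩
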